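/- Let $\epsilon\in\{-1,1\}$. All functions are real and smooth, $x$ ranges over an open interval $I$ and $t$ over an open interval $J$ (both nonempty, bounded or not). Consider the class $\mathcal F'^\epsilon$ of the equations $u_t=\epsilon u_{xx}+(B(x)u)_x$ with the arbitrary element $B$, and the class $\bar{\mathcal F}'$ of the equations $u_t=(A(x)u)_{xx}+(B(x)u)_x$ with the arbitrary elements $(A,B)$, where $A$ has no zeros. The essential Lie invariance algebra $\mathfrak g^{\rm ess}$ of an equation consists of its Lie symmetries of the form $\tau(t,x)\partial_t+\xi(t,x)\partial_x+\eta(t,x)u\partial_u$. The (essential) kernel algebra of a class is the intersection of the maximal (essential) Lie invariance algebras of its equations, for a given domain $J\times I$. An equation admits an essential Lie-symmetry extension if its algebra $\mathfrak g^{\rm ess}$ is wider than the essential kernel algebra. The equivalence group of a class consists of the (local) diffeomorphisms of the space of the variables $(t,x,u)$ and the arbitrary elements that are projectable to the space of $(t,x,u)$ and map, via the standard prolongation to derivatives of $u$, each equation of the class to an equation of the class. Then the following holds. (i) The kernel algebras and the essential kernel algebras of $\mathcal F'^\epsilon$ and of $\bar{\mathcal F}'$ all coincide with $\langle\partial_t,u\partial_u\rangle$.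 (ii) An equation from the class $\mathcal F'^\epsilon$ (resp. $\bar{\mathcal F}'$) admits an essential Lie-symmetry extension if and only if it is equivalent, with respect to the equivalence group of the class, to an equation with $A=\epsilon$ and $B=-2\epsilon W_x/W$, where $W$ is a real function without zeros on an open interval from the list below. For each equation of the list, $\mathfrak g^{\rm ess}$ has the basis consisting of $\partial_t$, $u\partial_u$ and the indicated vector fields. 1. $\sqrt{|x|}\cos(\alpha\ln|x|)$; $\sqrt{|x|}$; $\sqrt{|x|}\ln|x|$; $\sqrt{|x|}(a_1|x|^\alpha+a_2|x|^{-\alpha})$ with $\alpha\ne\frac12$: $D_{B,0}(t)$, $D_{B,0}(t^2)$. 1′. $\sqrt{|x|}\,(a_1\mathrm J_\beta(|x|)+a_2\mathrm Y_\beta(|x|))$; $\sqrt{|x|}\,(a_1\tilde{\mathrm H}^{(1)}_\gamma(|x|)+a_2\tilde{\mathrm H}^{(2)}_\gamma(|x|))$: $D_{B,1}(t)$, $D_{B,1}(t^2)$. 1″. $\sqrt{|x|}\,(a_1\mathrm I_\beta(|x|)+a_2\mathrm K_\beta(|x|))$; $\sqrt{|x|}\,(a_1\tilde{\mathrm I}_\gamma(|x|)+a_2\mathrm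 K_{{\rm i}\gamma}(|x|))$: $D_{B,-1}(t)$, $D_{B,-1}(t^2)$. 1a. $|x|^{-1/2}\operatorname{Re}\big((a_1-a_2{\rm i})\mathrm W_{-\frac14\kappa{\rm i},\frac12\nu}({\rm i}x^2)\big)$: $D_{B,\kappa}(\cos4t)$, $D_{B,\kappa}(\sin4t)$. 1b. $|x|^{-1/2}\big(a_1\mathrm W_{\frac14\kappa,\frac12\nu}(x^2)+a_2\mathrm W_{-\frac14\kappa,\frac12\nu}(-x^2)\big)$: $D_{B,\kappa}({\rm e}^{4t})$, $D_{B,\kappa}({\rm e}^{-4t})$. 2. $1$; $x$: $P_B(1)$, $P_B(t)$, $D_{B,0}(t)$, $D_{B,0}(t^2)$. 2′. $\cos x$: $P_B(1)$, $P_B(t)$, $D_{B,1}(t)$, $D_{B,1}(t^2)$. 2″. ${\rm e}^x$; $\cosh x$; $\sinh x$: $P_B(1)$, $P_B(t)$, $D_{B,-1}(t)$, $D_{B,-1}(t^2)$. 2a. The function of 1a with $\nu=\frac12$: $P_B(\sin2t)$, $P_B(\cos2t)$, $D_{B,\kappa}(\cos4t)$, $D_{B,\kappa}(\sin4t)$.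 2b. The function of 1b with $\nu=\frac12$: $P_B({\rm e}^{2t})$, $P_B({\rm e}^{-2t})$, $D_{B,\kappa}({\rm e}^{4t})$, $D_{B,\kappa}({\rm e}^{-4t})$. 2c. $a_1\operatorname{Ai}(x)+a_2\operatorname{Bi}(x)$: $\bar P_B(1)$, $\bar P_B(t)$, $D_{B,0}(t)+\frac32\bar P_B(t^2)$, $D_{B,0}(t^2)+\bar P_B(t^3)$. Here $\kappa\in\mathbb R$; $\nu\in\mathbb R_{\ge0}\cup{\rm i}\mathbb R_{>0}$ with $\nu\ne\frac12$ in 1a and 1b; $\alpha,\gamma>0$; $\beta\ge0$, $\beta\ne\frac12$; $(a_1,a_2)\ne(0,0)$, and $a_1,a_2$ are real, except that in 1b and 2b they are complex numbers for which $W$ is real-valued. The intervals of the cases with the number 1 do not contain $0$; in 2a and 2b, if the interval contains $0$, the formula gives $W$ for $x>0$, and $W$ is continued analytically to the whole interval. $\mathrm J$, $\mathrm Y$, $\mathrm H^{(1)}$, $\mathrm H^{(2)}$, $\mathrm I$, $\mathrm K$ are the Bessel, Hankel and modified Bessel functions, $\mathrm W_{k,m}$ is the Whittaker function (principal branch), $\operatorname{Ai}$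 and $\operatorname{Bi}$ are the Airy functions, $$\tilde{\mathrm H}^{(1)}_\gamma=\tfrac12\big({\rm e}^{-\gamma\pi/2}\mathrm H^{(1)}_{{\rm i}\gamma}+{\rm e}^{\gamma\pi/2}\mathrm H^{(2)}_{{\rm i}\gamma}\big),\quad \tilde{\mathrm H}^{(2)}_\gamma=\tfrac1{2{\rm i}}\big({\rm e}^{-\gamma\pi/2}\mathrm H^{(1)}_{{\rm i}\gamma}-{\rm e}^{\gamma\pi/2}\mathrm H^{(2)}_{{\rm i}\gamma}\big),\quad \tilde{\mathrm I}_\gamma=\frac{\pi{\rm i}}{2\sin({\rm i}\gamma\pi)}\big(\mathrm I_{{\rm i}\gamma}+\mathrm I_{-{\rm i}\gamma}\big),$$ and $$D_{B,\kappa}(f)=f\partial_t+\tfrac12f_tx\partial_x-\epsilon\big(\tfrac18f_{tt}x^2+\tfrac14\epsilon f_t-\kappa f+\tfrac14f_txB(x)\big)u\partial_u,\quad P_B(f)=f\partial_x-\tfrac12\epsilon\big(f_tx+fB(x)\big)u\partial_u,$$ $\bar P_B(f)=P_B(f)-\epsilon Fu\partial_u$ with the antiderivative $F$ of $f=f(t)$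 that vanishes at $t=0$. (iii) The list is irredundant with respect to either equivalence group: if two equations of the list are equivalent, then they belong to the same case with the same function form and the same values of $\alpha,\beta,\gamma,\kappa,\nu$, and the pairs $(a_1,a_2)$ coincide up to a nonzero real multiplier. The only exceptions are that the function $\sqrt{|x|}(a_1|x|^\alpha+a_2|x|^{-\alpha})$ is considered up to the replacement of $(a_1,a_2)$ by $(s^\alpha a_1,s^{-\alpha}a_2)$ with $s>0$, and that, in 2a and 2b on an interval containing $0$, the two equations may instead be related by the reflection $x\mapsto-x$ (with the same $\kappa$). -/

import Mathlib

open scoped ContDiff Topology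

noncomputable section

namespace FP

/-- A nonempty open interval of the real line, bounded or not. -/
def IsOpenInterval (I : Set ℝ) : Prop := IsOpen I ∧ I.OrdConnected ∧ I.Nonempty

/-! ### Jets, total derivatives, prolongations -/

/-- A point of the second-order jet space of functions `u = u(t,x)`. -/
structure Jet where
  t : ℝ
  x : ℝ
  u : ℝ
  ut : ℝ
  ux : ℝ
  utt : ℝ
  utx : ℝ
  uxx : ℝ

/-- Partial derivatives of a function of `(t,x,u)`. -/
def pt (F : ℝ → ℝ → ℝ → ℝ) : ℝ → ℝ → ℝ → ℝ := fun t x u => deriv (fun s => F s x u) t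
def px (F : ℝ → ℝ → ℝ → ℝ) : ℝ → ℝ → ℝ → ℝ := fun t x u => deriv (fun y => F t y u) x
def pu (F : ℝ → ℝ → ℝ → ℝ) : ℝ → ℝ → ℝ → ℝ := fun t x u => deriv (fun w => F t x w) u

/-- The value of a function of `(t,x,u)` at a jet. -/
def at₀ (F : ℝ → ℝ → ℝ → ℝ) (j : Jet) : ℝ := F j.t j.x j.u

/-- Total derivatives `D_t F`, `D_x F`, `D_t D_t F`, `D_t D_x F`, `D_x D_x F`
of a function `F` of `(t,x,u)`. -/
def Dt (F : ℝ → ℝ → ℝ → ℝ) (j : Jet) : ℝ := at₀ (pt F) j + j.ut * at₀ (pu F) j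
def Dx (F : ℝ → ℝ → ℝ → ℝ) (j : Jet) : ℝ := at₀ (px F) j + j.ux * at₀ (pu F) j
def Dtt (F : ℝ → ℝ → ℝ → ℝ) (j : Jet) : ℝ :=
  at₀ (pt (pt F)) j + 2 * j.ut * at₀ (pt (pu F)) j + j.ut ^ 2 * at₀ (pu (pu F)) j
    + j.utt * at₀ (pu F) j
def Dtx (F : ℝ → ℝ → ℝ → ℝ) (j : Jet) : ℝ :=
  at₀ (pt (px F)) j + j.ut * at₀ (px (pu F)) j + j.ux * at₀ (pt (pu F)) j
    + j.ut * j.ux * at₀ (pu (pu F)) j + j.utx * at₀ (pu F) j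
def Dxx (F : ℝ → ℝ → ℝ → ℝ) (j : Jet) : ℝ :=
  at₀ (px (px F)) j + 2 * j.ux * at₀ (px (pu F)) j + j.ux ^ 2 * at₀ (pu (pu F)) j
    + j.uxx * at₀ (pu F) j

/-- The expression `(A u)_{xx} + (B u)_x`, expanded as a function on the jet space. -/
def fpRhs (A B : ℝ → ℝ) (x u ux uxx : ℝ) : ℝ :=
  A x * uxx + (2 * deriv A x + B x) * ux + (deriv (deriv A) x + deriv B x) * u

/-- The Fokker--Planck equation `u_t = (A(x) u)_{xx} + (B(x) u)_x` in the jet space. -/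
def SatFP (A B : ℝ → ℝ) (j : Jet) : Prop := j.ut = fpRhs A B j.x j.u j.ux j.uxx

/-! ### Classes of Fokker--Planck equations with time-independent coefficients -/

/-- A class of Fokker--Planck equations `u_t = (A(x) u)_{xx} + (B(x) u)_x`. The arbitrary element
is a smooth function `θ` of `x` with values in `range ⊆ E`; the coefficients of the equation
are `A = diffusion ∘ θ` and `B = drift ∘ θ`. -/
structure FPClass (E : Type) where
  diffusion : E → ℝ
  drift : E → ℝ
  range : Set E

/-- The reduced class: `u_t = ε u_{xx} + (B(x) u)_x`, with the arbitrary element `B`. -/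
def reducedFP (ε : ℝ) : FPClass ℝ where
  diffusion := fun _ => ε
  drift := fun b => b
  range := Set.univ

/-- The full class: `u_t = (A(x) u)_{xx} + (B(x) u)_x` with `A ≠ 0`,
with the arbitrary elements `(A, B)`. -/
def fullFP : FPClass (ℝ × ℝ) where
  diffusion := Prod.fst
  drift := Prod.snd
  range := {θ | θ.1 ≠ 0}

section Classes

variable {E : Type} [NormedAddCommGroup E] [NormedSpace ℝ E]

/-- The admissible arbitrary elements on the interval `I` (only their values on `I` matter). -/
def FPClass.Adm (L : FPClass E) (I : Set ℝ) (θ : ℝ → E) : Prop :=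
  ContDiffOn ℝ ∞ θ I ∧ ∀ x ∈ I, θ x ∈ L.range

/-- The equation of the class with the arbitrary element `θ`. -/
def FPClass.Sat (L : FPClass E) (θ : ℝ → E) (j : Jet) : Prop :=
  SatFP (fun x => L.diffusion (θ x)) (fun x => L.drift (θ x)) j

end Classes

/-! ### Lie symmetries -/

/-- Vector fields `τ ∂_t + ξ ∂_x + η ∂_u` on the space with coordinates `(t,x,u)`,
written as `(t,x,u) ↦ (τ, ξ, η)`. -/
abbrev VField := ℝ → ℝ → ℝ → ℝ × ℝ × ℝ

def VField.τ (v : VField) : ℝ → ℝ → ℝ → ℝ := fun t x u => (v t x u).1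
def VField.ξ (v : VField) : ℝ → ℝ → ℝ → ℝ := fun t x u => (v t x u).2.1
def VField.η (v : VField) : ℝ → ℝ → ℝ → ℝ := fun t x u => (v t x u).2.2

/-- The coefficients of `∂_{u_t}`, `∂_{u_x}`, `∂_{u_{xx}}` in the second prolongation of `v`. -/
def VField.prolT (v : VField) (j : Jet) : ℝ :=
  Dt v.η j - j.ut * Dt v.τ j - j.ux * Dt v.ξ j
def VField.prolX (v : VField) (j : Jet) : ℝ :=
  Dx v.η j - j.ut * Dx v.τ j - j.ux * Dx v.ξ j
def VField.prolXX (v : VField) (j : Jet) : ℝ :=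
  Dxx v.η j - j.ut * Dxx v.τ j - j.ux * Dxx v.ξ j
    - 2 * j.utx * Dx v.τ j - 2 * j.uxx * Dx v.ξ j

/-- Infinitesimal invariance of `u_t = (A u)_{xx} + (B u)_x` over `J × I × ℝ`: the second
prolongation of `v`, applied to the difference of the two sides, vanishes on the equation. -/
def IsLieSymmetry (A B : ℝ → ℝ) (J I : Set ℝ) (v : VField) : Prop :=
  ContDiffOn ℝ ∞ (fun p : ℝ × ℝ × ℝ => v p.1 p.2.1 p.2.2) (J ×ˢ I ×ˢ Set.univ) ∧
  ∀ j : Jet, j.t ∈ J → j.x ∈ I → SatFP A B j →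
    v.prolT j = at₀ v.ξ j * deriv (fun y => fpRhs A B y j.u j.ux j.uxx) j.x
      + fpRhs A B j.x (at₀ v.η j) (v.prolX j) (v.prolXX j)

/-- Vector fields of the form `τ(t,x) ∂_t + ξ(t,x) ∂_x + η(t,x) u ∂_u` over `J × I × ℝ`. -/
def IsEssential (J I : Set ℝ) (v : VField) : Prop :=
  ∃ τ ξ η : ℝ → ℝ → ℝ, ∀ t ∈ J, ∀ x ∈ I, ∀ u, v t x u = (τ t x, ξ t x, η t x * u)

section Algebras

variable {E : Type} [NormedAddCommGroup E] [NormedSpace ℝ E]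

/-- The maximal Lie invariance algebra of an equation, over `J × I × ℝ`. -/
def FPClass.lieAlg (L : FPClass E) (J I : Set ℝ) (θ : ℝ → E) : Set VField :=
  {v | IsLieSymmetry (fun x => L.diffusion (θ x)) (fun x => L.drift (θ x)) J I v}

/-- The essential Lie invariance algebra of an equation. -/
def FPClass.essAlg (L : FPClass E) (J I : Set ℝ) (θ : ℝ → E) : Set VField :=
  {v | v ∈ L.lieAlg J I θ ∧ IsEssential J I v}

/-- The kernel algebra of a class. -/
def FPClass.kernel (L : FPClass E) (J I : Set ℝ) : Set VField :=
  {v | ∀ θ, L.Adm I θ → v ∈ L.lieAlg J I θ}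

/-- The essential kernel algebra of a class. -/
def FPClass.essKernel (L : FPClass E) (J I : Set ℝ) : Set VField :=
  {v | ∀ θ, L.Adm I θ → v ∈ L.essAlg J I θ}

/-- The equation admits an essential Lie-symmetry extension. -/
def FPClass.IsExtension (L : FPClass E) (J I : Set ℝ) (θ : ℝ → E) : Prop :=
  ∃ v ∈ L.essAlg J I θ, v ∉ L.essKernel J I

end Algebras

/-- The list `l` is a basis of the space `S` of vector fields over `J × I × ℝ`
(vector fields are identified if they coincide there). -/
def IsBasisOn (J I : Set ℝ) (S : Set VField) (l : List VField) : Prop :=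
  (∀ v : VField, v ∈ S ↔ ∃ c : Fin l.length → ℝ, ∀ t ∈ J, ∀ x ∈ I, ∀ u,
      v t x u = ∑ i, c i • l.get i t x u) ∧
  ∀ c : Fin l.length → ℝ, (∀ t ∈ J, ∀ x ∈ I, ∀ u, ∑ i, c i • l.get i t x u = 0) → c = 0

/-! ### Equivalence transformations -/

/-- `j'` is the image of the jet `j` under the second prolongation of the point transformation
`t' = T(t,x,u)`, `x' = X(t,x,u)`, `u' = U(t,x,u)`: the transversality condition
and the chain rule for the first and second derivatives. -/
structure IsProlonged (T X U : ℝ → ℝ → ℝ → ℝ) (j j' : Jet) : Prop where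
  transversal : Dt T j * Dx X j - Dx T j * Dt X j ≠ 0
  t_eq : j'.t = at₀ T j
  x_eq : j'.x = at₀ X j
  u_eq : j'.u = at₀ U j
  dt_eq : Dt U j = j'.ut * Dt T j + j'.ux * Dt X j
  dx_eq : Dx U j = j'.ut * Dx T j + j'.ux * Dx X j
  dtt_eq : Dtt U j = j'.utt * Dt T j ^ 2 + 2 * j'.utx * (Dt T j * Dt X j) + j'.uxx * Dt X j ^ 2
    + j'.ut * Dtt T j + j'.ux * Dtt X j
  dtx_eq : Dtx U j = j'.utt * (Dt T j * Dx T j) + j'.utx * (Dt T j * Dx X j + Dx T j * Dt X j)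
    + j'.uxx * (Dt X j * Dx X j) + j'.ut * Dtx T j + j'.ux * Dtx X j
  dxx_eq : Dxx U j = j'.utt * Dx T j ^ 2 + 2 * j'.utx * (Dx T j * Dx X j) + j'.uxx * Dx X j ^ 2
    + j'.ut * Dxx T j + j'.ux * Dxx X j

section Equivalence

variable {E : Type} [NormedAddCommGroup E] [NormedSpace ℝ E]

/-- The transformation `(t,x,u,θ) ↦ (T, X, U, Θ)` of the space of the variables and the
arbitrary element. -/
def totalMap (T X U : ℝ → ℝ → ℝ → ℝ) (Θ : ℝ → ℝ → ℝ → E → E) :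
    (ℝ × ℝ × ℝ) × E → (ℝ × ℝ × ℝ) × E :=
  fun p => ((T p.1.1 p.1.2.1 p.1.2.2, X p.1.1 p.1.2.1 p.1.2.2, U p.1.1 p.1.2.1 p.1.2.2),
    Θ p.1.1 p.1.2.1 p.1.2.2 p.2)

/-- `θ'` is the image of the arbitrary element `θ`: one has `θ' = Θ(t,x,u,θ(x))`
at `x' = X(t,x,u)`. -/
def MapsElement (J I K : Set ℝ) (X : ℝ → ℝ → ℝ → ℝ) (Θ : ℝ → ℝ → ℝ → E → E)
    (θ θ' : ℝ → E) : Prop :=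
  ∀ t ∈ J, ∀ x ∈ I, ∀ u ∈ K, θ' (X t x u) = Θ t x u (θ x)

/-- The point transformation `(T, X, U)` of `J × I × K` maps the equation with the arbitrary
element `θ` to the one with `θ'`. -/
def FPClass.MapsEquation (L : FPClass E) (J I K : Set ℝ) (T X U : ℝ → ℝ → ℝ → ℝ)
    (θ θ' : ℝ → E) : Prop :=
  ∀ j j' : Jet, j.t ∈ J → j.x ∈ I → j.u ∈ K → L.Sat θ j → IsProlonged T X U j j' → L.Sat θ' j'

/-- The set of values of `X` on `J × I × K`. -/
def imageX (J I K : Set ℝ) (X : ℝ → ℝ → ℝ → ℝ) : Set ℝ :=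
  {y | ∃ t ∈ J, ∃ x ∈ I, ∃ u ∈ K, X t x u = y}

/-- (Usual) equivalence transformations of the class: diffeomorphisms of the space with
coordinates `(t,x,u,θ)`, projectable to the space with coordinates `(t,x,u)`, whose standard
prolongation maps every equation of the class to an equation of the class.
They are defined over a box `J × I × K`, where `I` is the domain of the arbitrary elements. -/
structure FPClass.IsEquivTransf (L : FPClass E) (J I K : Set ℝ)
    (T X U : ℝ → ℝ → ℝ → ℝ) (Θ : ℝ → ℝ → ℝ → E → E) : Prop where
  smooth : ContDiffOn ℝ ∞ (totalMap T X U Θ) ((J ×ˢ I ×ˢ K) ×ˢ L.range)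
  injective : Set.InjOn (totalMap T X U Θ) ((J ×ˢ I ×ˢ K) ×ˢ L.range)
  regular : ∀ p ∈ (J ×ˢ I ×ˢ K) ×ˢ L.range,
    Function.Bijective (fderiv ℝ (totalMap T X U Θ) p)
  preserves : ∀ θ, L.Adm I θ → ∃ θ', L.Adm (imageX J I K X) θ' ∧
    MapsElement J I K X Θ θ θ' ∧ L.MapsEquation J I K T X U θ θ'

/-- Equivalence, with respect to the equivalence group of the class, of the equation
with the arbitrary element `θ` on `I` and the equation with `θ'` on `I'`. -/
def FPClass.Equivalent (L : FPClass E) (I : Set ℝ) (θ : ℝ → E) (I' : Set ℝ) (θ' : ℝ → E) : Prop :=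
  ∃ J K : Set ℝ, IsOpenInterval J ∧ IsOpenInterval K ∧
    ∃ (T X U : ℝ → ℝ → ℝ → ℝ) (Θ : ℝ → ℝ → ℝ → E → E),
      L.IsEquivTransf J I K T X U Θ ∧ imageX J I K X = I' ∧ MapsElement J I K X Θ θ θ'

end Equivalence

/-! ### Special functions -/

/-- The Bessel function `J_ν`, at `x > 0`. -/
def besselJ (ν : ℂ) (x : ℝ) : ℂ :=
  ((x / 2 : ℝ) : ℂ) ^ ν * Complex.regularizedHGFun 0 {ν + 1} (-(x : ℂ) ^ 2 / 4)

/-- The modified Bessel function `I_ν`, at `x > 0`. -/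
def besselI (ν : ℂ) (x : ℝ) : ℂ :=
  ((x / 2 : ℝ) : ℂ) ^ ν * Complex.regularizedHGFun 0 {ν + 1} ((x : ℂ) ^ 2 / 4)

open Classical in
/-- The value of `F` at `m` if `d m ≠ 0`, and the limit of `F` at `m` otherwise. Used for formulas
with the denominator `d`. -/
def valueOrLimit (d F : ℂ → ℂ) (m : ℂ) : ℂ :=
  if d m ≠ 0 then F m else Filter.limUnder (𝓝[≠] m) F

/-- The Bessel function `Y_ν` of the second kind. -/
def besselY (ν : ℂ) (x : ℝ) : ℂ :=
  valueOrLimit (fun μ => Complex.sin (μ * Real.pi))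
    (fun μ => (besselJ μ x * Complex.cos (μ * Real.pi) - besselJ (-μ) x)
      / Complex.sin (μ * Real.pi)) ν

/-- The modified Bessel function `K_ν` of the second kind. -/
def besselK (ν : ℂ) (x : ℝ) : ℂ :=
  valueOrLimit (fun μ => Complex.sin (μ * Real.pi))
    (fun μ => Real.pi / 2 * (besselI (-μ) x - besselI μ x) / Complex.sin (μ * Real.pi)) ν

/-- The Hankel functions. -/
def hankel₁ (ν : ℂ) (x : ℝ) : ℂ := besselJ ν x + Complex.I * besselY ν x
def hankel₂ (ν : ℂ) (x : ℝ) : ℂ := besselJ ν x - Complex.I * besselY ν x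

/-- The real modifications of the Hankel functions of the imaginary order `i γ`. -/
def hankelMod₁ (γ x : ℝ) : ℂ :=
  1 / 2 * (Real.exp (-(γ * Real.pi) / 2) * hankel₁ (Complex.I * γ) x
    + Real.exp (γ * Real.pi / 2) * hankel₂ (Complex.I * γ) x)
def hankelMod₂ (γ x : ℝ) : ℂ :=
  1 / (2 * Complex.I) * (Real.exp (-(γ * Real.pi) / 2) * hankel₁ (Complex.I * γ) x
    - Real.exp (γ * Real.pi / 2) * hankel₂ (Complex.I * γ) x)

/-- The real modification of `I_ν` for the imaginary order `ν = i γ`. -/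
def besselIMod (γ x : ℝ) : ℂ :=
  Real.pi * Complex.I / (2 * Complex.sin (Complex.I * γ * Real.pi))
    * (besselI (Complex.I * γ) x + besselI (-(Complex.I * γ)) x)

/-- The Whittaker function `M_{k,m}`, for `2m ≠ -1, -2, …`
(principal values of powers; `₁F₁(a;b;z)` is `Γ(b)` times the regularized one). -/
def whittakerM (k m z : ℂ) : ℂ :=
  Complex.exp (-z / 2) * z ^ (1 / 2 + m) *
    (Complex.Gamma (1 + 2 * m) * Complex.regularizedHGFun {1 / 2 + m - k} {1 + 2 * m} z)

/-- The Whittaker function `W_{k,m}` (principal branch; the limit in `m` if `2m` is an integer). -/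
def whittakerW (k m z : ℂ) : ℂ :=
  valueOrLimit (fun n => Complex.sin (2 * n * Real.pi))
    (fun n => Complex.Gamma (-2 * n) / Complex.Gamma (1 / 2 - n - k) * whittakerM k n z
      + Complex.Gamma (2 * n) / Complex.Gamma (1 / 2 + n - k) * whittakerM k (-n) z) m

/-- The Airy functions. -/
def airyAi (x : ℝ) : ℂ :=
  ((3 : ℝ) ^ (-2 / 3 : ℝ) : ℝ) * Complex.regularizedHGFun 0 {2 / 3} ((x : ℂ) ^ 3 / 9)
    - ((3 : ℝ) ^ (-4 / 3 : ℝ) : ℝ) * x * Complex.regularizedHGFun 0 {4 / 3} ((x : ℂ) ^ 3 / 9)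
def airyBi (x : ℝ) : ℂ :=
  ((3 : ℝ) ^ (-1 / 6 : ℝ) : ℝ) * Complex.regularizedHGFun 0 {2 / 3} ((x : ℂ) ^ 3 / 9)
    + ((3 : ℝ) ^ (-5 / 6 : ℝ) : ℝ) * x * Complex.regularizedHGFun 0 {4 / 3} ((x : ℂ) ^ 3 / 9)

/-! ### The classification list -/

/-- The cases of the classification list, with their parameters. -/
inductive TableCase where
  | cosLog (α : ℝ)
  | sqrtAbs
  | sqrtLog
  | power (α a₁ a₂ : ℝ)
  | bessel (β a₁ a₂ : ℝ)
  | besselImag (γ a₁ a₂ : ℝ)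
  | modBessel (β a₁ a₂ : ℝ)
  | modBesselImag (γ a₁ a₂ : ℝ)
  | whittakerOsc (κ : ℝ) (ν : ℂ) (a₁ a₂ : ℝ)
  | whittakerExp (κ : ℝ) (ν : ℂ) (a₁ a₂ : ℂ)
  | one
  | ident
  | cosine
  | expo
  | hypCos
  | hypSin
  | quarterOsc (κ a₁ a₂ : ℝ)
  | quarterExp (κ : ℝ) (a₁ a₂ : ℂ)
  | airy (a₁ a₂ : ℝ)

/-- `ν ≥ 0` or `ν ∈ i ℝ_{>0}`, and `ν ≠ 1/2`. -/
def AdmOrder (ν : ℂ) : Prop :=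
  ((∃ r : ℝ, 0 ≤ r ∧ ν = r) ∨ ∃ r : ℝ, 0 < r ∧ ν = Complex.I * r) ∧ ν ≠ 1 / 2

/-- The constraints on the parameters. -/
def TableCase.Admissible : TableCase → Prop
  | .cosLog α => 0 < α
  | .power α a₁ a₂ => 0 < α ∧ α ≠ 1 / 2 ∧ (a₁, a₂) ≠ 0
  | .bessel β a₁ a₂ => 0 ≤ β ∧ β ≠ 1 / 2 ∧ (a₁, a₂) ≠ 0
  | .besselImag γ a₁ a₂ => 0 < γ ∧ (a₁, a₂) ≠ 0
  | .modBessel β a₁ a₂ => 0 ≤ β ∧ β ≠ 1 / 2 ∧ (a₁, a₂) ≠ 0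
  | .modBesselImag γ a₁ a₂ => 0 < γ ∧ (a₁, a₂) ≠ 0
  | .whittakerOsc _ ν a₁ a₂ => AdmOrder ν ∧ (a₁, a₂) ≠ 0
  | .whittakerExp _ ν a₁ a₂ => AdmOrder ν ∧ (a₁, a₂) ≠ 0
  | .quarterOsc _ a₁ a₂ => (a₁, a₂) ≠ 0
  | .quarterExp _ a₁ a₂ => (a₁, a₂) ≠ 0
  | .airy a₁ a₂ => (a₁, a₂) ≠ 0
  | _ => True

/-- `|x|^{-1/2} Re((a₁ - a₂ i) W_{-κ i/4, ν/2}(i x²))` -/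
def oscW (κ : ℝ) (ν : ℂ) (a₁ a₂ x : ℝ) : ℝ :=
  |x| ^ (-1 / 2 : ℝ) *
    (((a₁ : ℂ) - a₂ * Complex.I) *
      whittakerW (-(κ / 4) * Complex.I) (ν / 2) (Complex.I * (x : ℂ) ^ 2)).re

/-- `|x|^{-1/2} (a₁ W_{κ/4, ν/2}(x²) + a₂ W_{-κ/4, ν/2}(-x²))` -/
def expW (κ : ℝ) (ν a₁ a₂ : ℂ) (x : ℝ) : ℂ :=
  (|x| ^ (-1 / 2 : ℝ) : ℝ) *
    (a₁ * whittakerW (κ / 4) (ν / 2) ((x : ℂ) ^ 2)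
      + a₂ * whittakerW (-(κ / 4)) (ν / 2) (-(x : ℂ) ^ 2))

/-- The function `W` of each case (for real-valued `W`, see `Realizes`). -/
def TableCase.W : TableCase → ℝ → ℂ
  | .cosLog α, x => (√|x| * Real.cos (α * Real.log |x|) : ℝ)
  | .sqrtAbs, x => (√|x| : ℝ)
  | .sqrtLog, x => (√|x| * Real.log |x| : ℝ)
  | .power α a₁ a₂, x => (√|x| * (a₁ * |x| ^ α + a₂ * |x| ^ (-α)) : ℝ)
  | .bessel β a₁ a₂, x => √|x| * (a₁ * besselJ β |x| + a₂ * besselY β |x|)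
  | .besselImag γ a₁ a₂, x => √|x| * (a₁ * hankelMod₁ γ |x| + a₂ * hankelMod₂ γ |x|)
  | .modBessel β a₁ a₂, x => √|x| * (a₁ * besselI β |x| + a₂ * besselK β |x|)
  | .modBesselImag γ a₁ a₂, x =>
      √|x| * (a₁ * besselIMod γ |x| + a₂ * besselK (Complex.I * γ) |x|)
  | .whittakerOsc κ ν a₁ a₂, x => oscW κ ν a₁ a₂ x
  | .whittakerExp κ ν a₁ a₂, x => expW κ ν a₁ a₂ x
  | .one, _ => 1
  | .ident, x => x
  | .cosine, x => Real.cos x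
  | .expo, x => Real.exp x
  | .hypCos, x => Real.cosh x
  | .hypSin, x => Real.sinh x
  | .quarterOsc κ a₁ a₂, x => oscW κ (1 / 2) a₁ a₂ x
  | .quarterExp κ a₁ a₂, x => expW κ (1 / 2) a₁ a₂ x
  | .airy a₁ a₂, x => a₁ * airyAi x + a₂ * airyBi x

/-- The cases where `W` is singular at `x = 0`, so that the interval avoids this point. -/
def TableCase.IsSingular : TableCase → Prop
  | .cosLog _ | .sqrtAbs | .sqrtLog | .power _ _ _ | .bessel _ _ _ | .besselImag _ _ _
  | .modBessel _ _ _ | .modBesselImag _ _ _ | .whittakerOsc _ _ _ _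
  | .whittakerExp _ _ _ _ => True
  | _ => False

/-- The cases where `W` is given by the formula in `|x|` on either side of `x = 0` but
both sides are joined by an analytic function. -/
def TableCase.IsQuarter : TableCase → Prop
  | .quarterOsc _ _ _ | .quarterExp _ _ _ => True
  | _ => False

/-- The real function `W` on the interval `I`, without zeros, is the one of the case `p`.
In the cases with Whittaker functions of order `1/4`, an interval that contains `x = 0` is allowed;
then the formula defines `W` for `x > 0`, and `W` is continued analytically to the rest of the interval. -/
def Realizes (p : TableCase) (I : Set ℝ) (W : ℝ → ℝ) : Prop :=
  AnalyticOnNhd ℝ W I ∧ (∀ x ∈ I, W x ≠ 0) ∧ (p.IsSingular → (0 : ℝ) ∉ I) ∧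
  (p.IsQuarter ∧ (0 : ℝ) ∈ I → ∀ x ∈ I, 0 < x → (W x : ℂ) = p.W x) ∧
  (¬ (p.IsQuarter ∧ (0 : ℝ) ∈ I) → ∀ x ∈ I, (W x : ℂ) = p.W x)

/-- `B = -2 ε W_x / W` on the open interval `I`, where `W` is the function of the case `p`. -/
def IsTableDrift (ε : ℝ) (p : TableCase) (I : Set ℝ) (B : ℝ → ℝ) : Prop :=
  IsOpenInterval I ∧ p.Admissible ∧
    ∃ W : ℝ → ℝ, Realizes p I W ∧ ∀ x ∈ I, B x = -2 * ε * deriv W x / W x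

/-- `∂_t` and `u ∂_u`. -/
def fieldT : VField := fun _ _ _ => (1, 0, 0)
def fieldU : VField := fun _ _ u => (0, 0, u)

/-- `D_{B,κ}(f)` -/
def fieldD (ε : ℝ) (B : ℝ → ℝ) (κ : ℝ) (f : ℝ → ℝ) : VField := fun t x u =>
  (f t, 1 / 2 * deriv f t * x,
    -ε * (1 / 8 * deriv (deriv f) t * x ^ 2 + 1 / 4 * ε * deriv f t - κ * f t
      + 1 / 4 * deriv f t * x * B x) * u)

/-- `P_B(f)` -/
def fieldP (ε : ℝ) (B : ℝ → ℝ) (f : ℝ → ℝ) : VField := fun t x u =>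
  (0, f t, -(1 / 2) * ε * (deriv f t * x + f t * B x) * u)

/-- `P_B(f) - ε F u ∂_u`, where `F` is an antiderivative of `f`. -/
def fieldPbar (ε : ℝ) (B : ℝ → ℝ) (F : ℝ → ℝ) : VField := fun t x u =>
  fieldP ε B (deriv F) t x u + (0, 0, -ε * F t * u)

/-- The basis elements of the essential Lie invariance algebra besides `∂_t` and `u ∂_u`. -/
def TableCase.basis (ε : ℝ) (B : ℝ → ℝ) : TableCase → List VField
  | .cosLog _ | .sqrtAbs | .sqrtLog | .power _ _ _ =>
      [fieldD ε B 0 (fun t => t), fieldD ε B 0 (fun t => t ^ 2)]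
  | .bessel _ _ _ | .besselImag _ _ _ =>
      [fieldD ε B 1 (fun t => t), fieldD ε B 1 (fun t => t ^ 2)]
  | .modBessel _ _ _ | .modBesselImag _ _ _ =>
      [fieldD ε B (-1) (fun t => t), fieldD ε B (-1) (fun t => t ^ 2)]
  | .whittakerOsc κ _ _ _ =>
      [fieldD ε B κ (fun t => Real.cos (4 * t)), fieldD ε B κ (fun t => Real.sin (4 * t))]
  | .whittakerExp κ _ _ _ =>
      [fieldD ε B κ (fun t => Real.exp (4 * t)), fieldD ε B κ (fun t => Real.exp (-4 * t))]
  | .one | .ident =>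
      [fieldP ε B (fun _ => 1), fieldP ε B (fun t => t),
        fieldD ε B 0 (fun t => t), fieldD ε B 0 (fun t => t ^ 2)]
  | .cosine =>
      [fieldP ε B (fun _ => 1), fieldP ε B (fun t => t),
        fieldD ε B 1 (fun t => t), fieldD ε B 1 (fun t => t ^ 2)]
  | .expo | .hypCos | .hypSin =>
      [fieldP ε B (fun _ => 1), fieldP ε B (fun t => t),
        fieldD ε B (-1) (fun t => t), fieldD ε B (-1) (fun t => t ^ 2)]
  | .quarterOsc κ _ _ =>
      [fieldP ε B (fun t => Real.sin (2 * t)), fieldP ε B (fun t => Real.cos (2 * t)),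
        fieldD ε B κ (fun t => Real.cos (4 * t)), fieldD ε B κ (fun t => Real.sin (4 * t))]
  | .quarterExp κ _ _ =>
      [fieldP ε B (fun t => Real.exp (2 * t)), fieldP ε B (fun t => Real.exp (-2 * t)),
        fieldD ε B κ (fun t => Real.exp (4 * t)), fieldD ε B κ (fun t => Real.exp (-4 * t))]
  | .airy _ _ =>
      [fieldPbar ε B (fun t => t), fieldPbar ε B (fun t => t ^ 2 / 2),
        fieldD ε B 0 (fun t => t) + (3 / 2 : ℝ) • fieldPbar ε B (fun t => t ^ 3 / 3),
        fieldD ε B 0 (fun t => t ^ 2) + fieldPbar ε B (fun t => t ^ 4 / 4)]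

/-- The two cases are the same, up to a nonzero common multiplier of `(a₁, a₂)` and, in the case of
a combination of two powers, up to the change of `(a₁, a₂)` that a scaling of `x` induces. -/
def TableCase.Same : TableCase → TableCase → Prop
  | .cosLog α, .cosLog α' => α = α'
  | .sqrtAbs, .sqrtAbs => True
  | .sqrtLog, .sqrtLog => True
  | .power α a₁ a₂, .power α' b₁ b₂ =>
      α = α' ∧ ∃ c s : ℝ, c ≠ 0 ∧ 0 < s ∧ b₁ = c * s ^ α * a₁ ∧ b₂ = c * s ^ (-α) * a₂
  | .bessel β a₁ a₂, .bessel β' b₁ b₂ => β = β' ∧ ∃ c : ℝ, c ≠ 0 ∧ b₁ = c * a₁ ∧ b₂ = c * a₂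
  | .besselImag γ a₁ a₂, .besselImag γ' b₁ b₂ =>
      γ = γ' ∧ ∃ c : ℝ, c ≠ 0 ∧ b₁ = c * a₁ ∧ b₂ = c * a₂
  | .modBessel β a₁ a₂, .modBessel β' b₁ b₂ =>
      β = β' ∧ ∃ c : ℝ, c ≠ 0 ∧ b₁ = c * a₁ ∧ b₂ = c * a₂
  | .modBesselImag γ a₁ a₂, .modBesselImag γ' b₁ b₂ =>
      γ = γ' ∧ ∃ c : ℝ, c ≠ 0 ∧ b₁ = c * a₁ ∧ b₂ = c * a₂
  | .whittakerOsc κ ν a₁ a₂, .whittakerOsc κ' ν' b₁ b₂ =>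
      κ = κ' ∧ ν = ν' ∧ ∃ c : ℝ, c ≠ 0 ∧ b₁ = c * a₁ ∧ b₂ = c * a₂
  | .whittakerExp κ ν a₁ a₂, .whittakerExp κ' ν' b₁ b₂ =>
      κ = κ' ∧ ν = ν' ∧ ∃ c : ℝ, c ≠ 0 ∧ b₁ = c * a₁ ∧ b₂ = c * a₂
  | .one, .one => True
  | .ident, .ident => True
  | .cosine, .cosine => True
  | .expo, .expo => True
  | .hypCos, .hypCos => True
  | .hypSin, .hypSin => True
  | .quarterOsc κ a₁ a₂, .quarterOsc κ' b₁ b₂ =>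
      κ = κ' ∧ ∃ c : ℝ, c ≠ 0 ∧ b₁ = c * a₁ ∧ b₂ = c * a₂
  | .quarterExp κ a₁ a₂, .quarterExp κ' b₁ b₂ =>
      κ = κ' ∧ ∃ c : ℝ, c ≠ 0 ∧ b₁ = c * a₁ ∧ b₂ = c * a₂
  | .airy a₁ a₂, .airy b₁ b₂ => ∃ c : ℝ, c ≠ 0 ∧ b₁ = c * a₁ ∧ b₂ = c * a₂
  | _, _ => False

/-- Both cases are `quarterOsc` or both are `quarterExp`, with the same `κ`. -/
def TableCase.SameQuarter : TableCase → TableCase → Prop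
  | .quarterOsc κ _ _, .quarterOsc κ' _ _ => κ = κ'
  | .quarterExp κ _ _, .quarterExp κ' _ _ => κ = κ'
  | _, _ => False

/-- The conclusion that two drifts of the list, of the cases `p` on `I` and `p'`, are one entry of
the list. In the cases with Whittaker functions of order `1/4` on an interval around `x = 0`, where
`W` is not even in general, the reflection of `x` remains as a residual equivalence. -/
def SameEntry (p p' : TableCase) (I : Set ℝ) (B B' : ℝ → ℝ) : Prop :=
  p.Same p' ∨ (p.SameQuarter p' ∧ (0 : ℝ) ∈ I ∧ ∀ x ∈ I, B' (-x) = -B x)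

end FP

end

open FP

open scoped ContDiff Topology

noncomputable section

namespace FP

/-! ### Calculus on boxes -/

theorem IsOpenInterval.isOpen {I : Set ℝ} (h : IsOpenInterval I) : IsOpen I := h.1

theorem IsOpenInterval.isPreconnected {I : Set ℝ} (h : IsOpenInterval I) : IsPreconnected I :=
  h.2.1.isPreconnected

theorem IsOpenInterval.nonempty {I : Set ℝ} (h : IsOpenInterval I) : I.Nonempty := h.2.2

theorem isOpenInterval_univ : IsOpenInterval Set.univ :=
  ⟨isOpen_univ, Set.ordConnected_univ, Set.univ_nonempty⟩

theorem IsOpenInterval.infinite {I : Set ℝ} (h : IsOpenInterval I) : I.Infinite := by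
  obtain ⟨x, hx⟩ := h.nonempty
  exact infinite_of_mem_nhds x (h.isOpen.mem_nhds hx)

/-- A function with zero derivative on an open interval is constant there. -/
theorem IsOpenInterval.eq_of_hasDerivAt_zero {E : Type*} [NormedAddCommGroup E] [NormedSpace ℝ E]
    {I : Set ℝ} (hI : IsOpenInterval I) {f : ℝ → E} (hf : ∀ x ∈ I, HasDerivAt f 0 x)
    {x y : ℝ} (hx : x ∈ I) (hy : y ∈ I) : f x = f y :=
  hI.isOpen.is_const_of_deriv_eq_zero hI.isPreconnected
    (fun x hx => (hf x hx).differentiableAt.differentiableWithinAt)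
    (fun x hx => (hf x hx).deriv) hx hy

/-- Every continuous function on an open interval has an antiderivative. -/
theorem IsOpenInterval.exists_antideriv {I : Set ℝ} (hI : IsOpenInterval I) {f : ℝ → ℝ}
    (hf : ContinuousOn f I) : ∃ F : ℝ → ℝ, ∀ x ∈ I, HasDerivAt F (f x) x := by
  obtain ⟨x₀, hx₀⟩ := hI.nonempty
  refine ⟨fun x => ∫ y in x₀..x, f y, fun x hx => ?_⟩
  have hsub : Set.uIcc x₀ x ⊆ I := hI.2.1.uIcc_subset hx₀ hx
  refine intervalIntegral.integral_hasDerivAt_right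
    ((hf.mono hsub).intervalIntegrable) ?_ (hf.continuousAt (hI.isOpen.mem_nhds hx))
  exact hf.stronglyMeasurableAtFilter hI.isOpen x hx

/-- Smoothness in `(t,x,u)` on a box. -/
def SmoothOnBox (J I K : Set ℝ) (F : ℝ → ℝ → ℝ → ℝ) : Prop :=
  ContDiffOn ℝ ∞ (fun p : ℝ × ℝ × ℝ => F p.1 p.2.1 p.2.2) (J ×ˢ I ×ˢ K)

/-- Equality on a box. -/
def EqOnBox (J I K : Set ℝ) (F G : ℝ → ℝ → ℝ → ℝ) : Prop :=
  ∀ t ∈ J, ∀ x ∈ I, ∀ u ∈ K, F t x u = G t x u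

section Box

variable {J I K : Set ℝ} {F G : ℝ → ℝ → ℝ → ℝ} {t x u : ℝ}

theorem EqOnBox.pt (h : EqOnBox J I K F G) (hJ : IsOpen J) : EqOnBox J I K (pt F) (pt G) := by
  intro t ht x hx u hu
  apply Filter.EventuallyEq.deriv_eq
  filter_upwards [hJ.mem_nhds ht] with s hs using h s hs x hx u hu

theorem EqOnBox.px (h : EqOnBox J I K F G) (hI : IsOpen I) : EqOnBox J I K (px F) (px G) := by
  intro t ht x hx u hu
  apply Filter.EventuallyEq.deriv_eq
  filter_upwards [hI.mem_nhds hx] with s hs using h t ht s hs u hu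

theorem EqOnBox.pu (h : EqOnBox J I K F G) (hK : IsOpen K) : EqOnBox J I K (pu F) (pu G) := by
  intro t ht x hx u hu
  apply Filter.EventuallyEq.deriv_eq
  filter_upwards [hK.mem_nhds hu] with s hs using h t ht x hx s hs

variable (hJ : IsOpen J) (hI : IsOpen I) (hK : IsOpen K)

include hJ hI hK

theorem SmoothOnBox.hasFDerivAt (h : SmoothOnBox J I K F) (ht : t ∈ J) (hx : x ∈ I) (hu : u ∈ K) :
    HasFDerivAt (fun p : ℝ × ℝ × ℝ => F p.1 p.2.1 p.2.2)
      (fderiv ℝ (fun p : ℝ × ℝ × ℝ => F p.1 p.2.1 p.2.2) (t, x, u)) (t, x, u) :=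
  ((ContDiffOn.differentiableOn h (by simp)).differentiableAt
    ((hJ.prod (hI.prod hK)).mem_nhds ⟨ht, hx, hu⟩)).hasFDerivAt

theorem SmoothOnBox.hasDerivAt_t' (h : SmoothOnBox J I K F) (ht : t ∈ J) (hx : x ∈ I)
    (hu : u ∈ K) : HasDerivAt (fun s => F s x u)
      (fderiv ℝ (fun p : ℝ × ℝ × ℝ => F p.1 p.2.1 p.2.2) (t, x, u) (1, 0, 0)) t := by
  have h1 := h.hasFDerivAt hJ hI hK ht hx hu
  have h2 : HasDerivAt (fun s : ℝ => (s, x, u)) (1, 0, 0) t :=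
    (hasDerivAt_id t).prodMk (hasDerivAt_const t (x, u))
  exact h1.comp_hasDerivAt t h2

theorem SmoothOnBox.hasDerivAt_x' (h : SmoothOnBox J I K F) (ht : t ∈ J) (hx : x ∈ I)
    (hu : u ∈ K) : HasDerivAt (fun y => F t y u)
      (fderiv ℝ (fun p : ℝ × ℝ × ℝ => F p.1 p.2.1 p.2.2) (t, x, u) (0, 1, 0)) x := by
  have h1 := h.hasFDerivAt hJ hI hK ht hx hu
  have h2 : HasDerivAt (fun y : ℝ => (t, y, u)) (0, 1, 0) x :=
    (hasDerivAt_const x t).prodMk ((hasDerivAt_id x).prodMk (hasDerivAt_const x u))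
  exact h1.comp_hasDerivAt x h2

theorem SmoothOnBox.hasDerivAt_u' (h : SmoothOnBox J I K F) (ht : t ∈ J) (hx : x ∈ I)
    (hu : u ∈ K) : HasDerivAt (fun w => F t x w)
      (fderiv ℝ (fun p : ℝ × ℝ × ℝ => F p.1 p.2.1 p.2.2) (t, x, u) (0, 0, 1)) u := by
  have h1 := h.hasFDerivAt hJ hI hK ht hx hu
  have h2 : HasDerivAt (fun w : ℝ => (t, x, w)) (0, 0, 1) u :=
    (hasDerivAt_const u t).prodMk ((hasDerivAt_const u x).prodMk (hasDerivAt_id u))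
  exact h1.comp_hasDerivAt u h2

theorem SmoothOnBox.hasDerivAt_t (h : SmoothOnBox J I K F) (ht : t ∈ J) (hx : x ∈ I)
    (hu : u ∈ K) : HasDerivAt (fun s => F s x u) (pt F t x u) t :=
  (h.hasDerivAt_t' hJ hI hK ht hx hu).differentiableAt.hasDerivAt

theorem SmoothOnBox.hasDerivAt_x (h : SmoothOnBox J I K F) (ht : t ∈ J) (hx : x ∈ I)
    (hu : u ∈ K) : HasDerivAt (fun y => F t y u) (px F t x u) x :=
  (h.hasDerivAt_x' hJ hI hK ht hx hu).differentiableAt.hasDerivAt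

theorem SmoothOnBox.hasDerivAt_u (h : SmoothOnBox J I K F) (ht : t ∈ J) (hx : x ∈ I)
    (hu : u ∈ K) : HasDerivAt (fun w => F t x w) (pu F t x u) u :=
  (h.hasDerivAt_u' hJ hI hK ht hx hu).differentiableAt.hasDerivAt

theorem SmoothOnBox.fderiv_apply (h : SmoothOnBox J I K F) (v : ℝ × ℝ × ℝ) :
    ContDiffOn ℝ ∞ (fun p => fderiv ℝ (fun p : ℝ × ℝ × ℝ => F p.1 p.2.1 p.2.2) p v)
      (J ×ˢ I ×ˢ K) :=
  (ContDiffOn.fderiv_of_isOpen h (hJ.prod (hI.prod hK)) (m := ∞) (by simp)).clm_apply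
    contDiffOn_const

theorem SmoothOnBox.px (h : SmoothOnBox J I K F) : SmoothOnBox J I K (px F) :=
  (h.fderiv_apply hJ hI hK (0, 1, 0)).congr
    (fun _ hp => (h.hasDerivAt_x' hJ hI hK hp.1 hp.2.1 hp.2.2).deriv)

theorem SmoothOnBox.pu (h : SmoothOnBox J I K F) : SmoothOnBox J I K (pu F) :=
  (h.fderiv_apply hJ hI hK (0, 0, 1)).congr
    (fun _ hp => (h.hasDerivAt_u' hJ hI hK hp.1 hp.2.1 hp.2.2).deriv)

end Box

theorem px_zero : px (fun _ _ _ => 0) = fun _ _ _ => 0 := by simp [funext_iff, px]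
theorem pu_zero : pu (fun _ _ _ => 0) = fun _ _ _ => 0 := by simp [funext_iff, pu]

/-- Smooth functions of one variable on an open set. -/
theorem hasDerivAt_on {I : Set ℝ} {f : ℝ → ℝ} (hf : ContDiffOn ℝ ∞ f I)
    (hI : IsOpen I) {x : ℝ} (hx : x ∈ I) : HasDerivAt f (deriv f x) x :=
  ((hf.differentiableOn (by simp)).differentiableAt (hI.mem_nhds hx)).hasDerivAt

theorem deriv_smooth {I : Set ℝ} {f : ℝ → ℝ} (hf : ContDiffOn ℝ ∞ f I)
    (hI : IsOpen I) : ContDiffOn ℝ ∞ (deriv f) I :=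
  hf.deriv_of_isOpen hI (by simp)

/-- If a function has derivative `g` on an open set and `g` is smooth, then it is smooth. -/
theorem contDiffOn_infty_of_hasDerivAt {I : Set ℝ} (hI : IsOpen I) {f g : ℝ → ℝ}
    (hf : ∀ x ∈ I, HasDerivAt f (g x) x) (hg : ContDiffOn ℝ ∞ g I) : ContDiffOn ℝ ∞ f I := by
  rw [contDiffOn_infty_iff_deriv_of_isOpen hI]
  exact ⟨fun x hx => (hf x hx).differentiableAt.differentiableWithinAt,
    hg.congr fun x hx => (hf x hx).deriv⟩

theorem deriv_fpRhs {A B : ℝ → ℝ} {I : Set ℝ} (hI : IsOpen I) (hA : ContDiffOn ℝ ∞ A I)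
    (hB : ContDiffOn ℝ ∞ B I) {x : ℝ} (hx : x ∈ I) (u ux uxx : ℝ) :
    deriv (fun y => A y * uxx + (2 * deriv A y + B y) * ux + (deriv (deriv A) y + deriv B y) * u) x
      = deriv A x * uxx
      + (2 * deriv (deriv A) x + deriv B x) * ux
      + (deriv (deriv (deriv A)) x + deriv (deriv B) x) * u := by
  have hA1 := deriv_smooth hA hI
  have hA2 := deriv_smooth hA1 hI
  have hB1 := deriv_smooth hB hI
  have a0 := hasDerivAt_on hA hI hx
  have a1 := hasDerivAt_on hA1 hI hx
  have a2 := hasDerivAt_on hA2 hI hx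
  have b0 := hasDerivAt_on hB hI hx
  have b1 := hasDerivAt_on hB1 hI hx
  exact (((a0.mul_const uxx).add (((a1.const_mul 2).add b0).mul_const ux)).add
    ((a2.add b1).mul_const u)).deriv

/-! ### Determining equations of Lie symmetries -/

/-- The determining equations for Lie symmetries of `u_t = (A u)_{xx} + (B u)_x`. -/
structure Determining (A B : ℝ → ℝ) (J I : Set ℝ) (v : VField) : Prop where
  px_τ : EqOnBox J I Set.univ (px v.τ) (fun _ _ _ => 0)
  pu_τ : EqOnBox J I Set.univ (pu v.τ) (fun _ _ _ => 0)
  pu_ξ : EqOnBox J I Set.univ (pu v.ξ) (fun _ _ _ => 0)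
  pu_pu_η : EqOnBox J I Set.univ (pu (pu v.η)) (fun _ _ _ => 0)
  second : ∀ t ∈ J, ∀ x ∈ I, ∀ u,
    -(pt v.τ t x u * A x) = v.ξ t x u * deriv A x - 2 * A x * px v.ξ t x u
  first : ∀ t ∈ J, ∀ x ∈ I, ∀ u,
    -(pt v.τ t x u * (2 * deriv A x + B x)) - pt v.ξ t x u
      = v.ξ t x u * (2 * deriv (deriv A) x + deriv B x) + 2 * A x * px (pu v.η) t x u
        - A x * px (px v.ξ) t x u - (2 * deriv A x + B x) * px v.ξ t x u
  zeroth : ∀ t ∈ J, ∀ x ∈ I, ∀ u,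
    pt v.η t x u + (deriv (deriv A) x + deriv B x) * u * (pu v.η t x u - pt v.τ t x u)
      = v.ξ t x u * (deriv (deriv (deriv A)) x + deriv (deriv B) x) * u
        + A x * px (px v.η) t x u + (2 * deriv A x + B x) * px v.η t x u
        + (deriv (deriv A) x + deriv B x) * v.η t x u

section

variable {A B : ℝ → ℝ} {J I : Set ℝ} {v : VField}

/-- The jet of a solution with prescribed free coordinates. -/
def jetOf (A B : ℝ → ℝ) (t x u ux utx uxx : ℝ) : Jet :=
  ⟨t, x, u, fpRhs A B x u ux uxx, ux, 0, utx, uxx⟩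

theorem isLieSymmetry_determining (hI : IsOpen I) (hA : ContDiffOn ℝ ∞ A I)
    (hB : ContDiffOn ℝ ∞ B I) (hA0 : ∀ x ∈ I, A x ≠ 0) (hv : IsLieSymmetry A B J I v) :
    Determining A B J I v := by
  have inv : ∀ t ∈ J, ∀ x ∈ I, ∀ u ux utx uxx, _ := fun t ht x hx u ux utx uxx =>
    hv.2 (jetOf A B t x u ux utx uxx) ht hx rfl
  have Tx : ∀ t ∈ J, ∀ x ∈ I, ∀ u ux, px v.τ t x u + ux * pu v.τ t x u = 0 := by
    intro t ht x hx u ux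
    have h0 := inv t ht x hx u ux 0 0
    have h1 := inv t ht x hx u ux 1 0
    simp only [VField.prolT, VField.prolX, VField.prolXX, Dt, Dx, Dxx, at₀, jetOf, fpRhs] at h0 h1
    have : 2 * A x * (px v.τ t x u + ux * pu v.τ t x u) = 0 := by linear_combination h1 - h0
    simpa [hA0 x hx] using this
  have pxτ : EqOnBox J I Set.univ (px v.τ) (fun _ _ _ => 0) := fun t ht x hx u _ => by
    simpa using Tx t ht x hx u 0
  have puτ : EqOnBox J I Set.univ (pu v.τ) (fun _ _ _ => 0) := fun t ht x hx u hu => by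
    simpa [pxτ t ht x hx u hu] using Tx t ht x hx u 1
  have pxpxτ := pxτ.px hI
  have pxpuτ := puτ.px hI
  have pupuτ := puτ.pu isOpen_univ
  simp only [px_zero, pu_zero] at pxpxτ pxpuτ pupuτ
  have Xx : ∀ t ∈ J, ∀ x ∈ I, ∀ u ux, -(pt v.τ t x u * A x) = v.ξ t x u * deriv A x
      - 2 * A x * px v.ξ t x u - 2 * A x * ux * pu v.ξ t x u := by
    intro t ht x hx u ux
    have h0 := inv t ht x hx u ux 0 0
    have h1 := inv t ht x hx u ux 0 1
    simp only [VField.prolT, VField.prolX, VField.prolXX, Dt, Dx, Dxx, at₀, jetOf,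
      deriv_fpRhs hI hA hB hx, fpRhs, pxτ t ht x hx u trivial, puτ t ht x hx u trivial,
      pxpxτ t ht x hx u trivial, pxpuτ t ht x hx u trivial, pupuτ t ht x hx u trivial] at h0 h1
    linear_combination h1 - h0
  have puξ : EqOnBox J I Set.univ (pu v.ξ) (fun _ _ _ => 0) := fun t ht x hx u _ => by
    have : 2 * A x * pu v.ξ t x u = 0 := by
      linear_combination Xx t ht x hx u 1 - Xx t ht x hx u 0
    simpa [hA0 x hx] using this
  have pxpuξ := puξ.px hI
  have pupuξ := puξ.pu isOpen_univ
  simp only [px_zero, pu_zero] at pxpuξ pupuξ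
  have sec : ∀ t ∈ J, ∀ x ∈ I, ∀ u,
      -(pt v.τ t x u * A x) = v.ξ t x u * deriv A x - 2 * A x * px v.ξ t x u :=
    fun t ht x hx u => by simpa using Xx t ht x hx u 0
  have red : ∀ t ∈ J, ∀ x ∈ I, ∀ u ux, _ := fun t ht x hx u ux => by
    have h0 := inv t ht x hx u ux 0 0
    simp only [VField.prolT, VField.prolX, VField.prolXX, Dt, Dx, Dxx, at₀, jetOf,
      deriv_fpRhs hI hA hB hx, fpRhs, pxτ t ht x hx u trivial, puτ t ht x hx u trivial,
      pxpxτ t ht x hx u trivial, pxpuτ t ht x hx u trivial, pupuτ t ht x hx u trivial,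
      puξ t ht x hx u trivial, pxpuξ t ht x hx u trivial, pupuξ t ht x hx u trivial] at h0
    exact h0
  refine ⟨pxτ, puτ, puξ, fun t ht x hx u _ => ?_, sec, fun t ht x hx u => ?_,
    fun t ht x hx u => ?_⟩
  · have : 2 * A x * pu (pu v.η) t x u = 0 := by
      linear_combination 2 * red t ht x hx u 0 - red t ht x hx u 1 - red t ht x hx u (-1)
    simpa [hA0 x hx] using this
  · linear_combination (1 / 2) * red t ht x hx u 1 - (1 / 2) * red t ht x hx u (-1)
  · linear_combination red t ht x hx u 0

theorem determining_isLieSymmetry (hI : IsOpen I) (hA : ContDiffOn ℝ ∞ A I)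
    (hB : ContDiffOn ℝ ∞ B I)
    (hs : ContDiffOn ℝ ∞ (fun p : ℝ × ℝ × ℝ => v p.1 p.2.1 p.2.2) (J ×ˢ I ×ˢ Set.univ))
    (h : Determining A B J I v) : IsLieSymmetry A B J I v := by
  refine ⟨hs, fun j ht hx hsat => ?_⟩
  obtain ⟨pxτ, puτ, puξ, pupuη, sec, fst, zth⟩ := h
  have pxpxτ := pxτ.px hI
  have pxpuτ := puτ.px hI
  have pupuτ := puτ.pu isOpen_univ
  have pxpuξ := puξ.px hI
  have pupuξ := puξ.pu isOpen_univ
  simp only [px_zero, pu_zero] at pxpxτ pxpuτ pupuτ pxpuξ pupuξ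
  obtain ⟨t, x, u, ut, ux, utt, utx, uxx⟩ := j
  simp only [SatFP, fpRhs] at ht hx hsat
  simp only [VField.prolT, VField.prolX, VField.prolXX, Dt, Dx, Dxx, at₀,
      deriv_fpRhs hI hA hB hx, fpRhs, pxτ t ht x hx u trivial, puτ t ht x hx u trivial,
      pxpxτ t ht x hx u trivial, pxpuτ t ht x hx u trivial, pupuτ t ht x hx u trivial,
      puξ t ht x hx u trivial, pxpuξ t ht x hx u trivial, pupuξ t ht x hx u trivial,
      pupuη t ht x hx u trivial]
  linear_combination uxx * sec t ht x hx u + ux * fst t ht x hx u + zth t ht x hx u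
    + (pu v.η t x u - pt v.τ t x u) * hsat

theorem VField.smooth_iff :
    ContDiffOn ℝ ∞ (fun p : ℝ × ℝ × ℝ => v p.1 p.2.1 p.2.2) (J ×ˢ I ×ˢ Set.univ) ↔
      SmoothOnBox J I Set.univ v.τ ∧ SmoothOnBox J I Set.univ v.ξ ∧
        SmoothOnBox J I Set.univ v.η := by
  constructor
  · intro h
    exact ⟨h.fst, h.snd.fst, h.snd.snd⟩
  · rintro ⟨h1, h2, h3⟩
    exact ContDiffOn.prodMk h1 (ContDiffOn.prodMk h2 h3)

end

/-! ### Essential Lie symmetries in terms of functions of `t` -/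

theorem _root_.HasDerivAt.congr_on {E : Type*} [NormedAddCommGroup E] [NormedSpace ℝ E]
    {I : Set ℝ} (hI : IsOpen I) {f g : ℝ → E} {g' : E} {x : ℝ} (hg : HasDerivAt g g' x)
    (h : ∀ y ∈ I, f y = g y) (hx : x ∈ I) : HasDerivAt f g' x :=
  hg.congr_of_eventuallyEq (by filter_upwards [hI.mem_nhds hx] with y hy using h y hy)

theorem determining_essential_iff {A B : ℝ → ℝ} {J I : Set ℝ} (hJ : IsOpen J) (hI : IsOpen I)
    {v : VField} {τ τ₁ : ℝ → ℝ} {ξ ξt ξx ξxx H Ht Hx Hxx : ℝ → ℝ → ℝ}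
    (hv : ∀ t ∈ J, ∀ x ∈ I, ∀ u, v t x u = (τ t, ξ t x, H t x * u))
    (hτ : ∀ t ∈ J, HasDerivAt τ (τ₁ t) t)
    (hξt : ∀ t ∈ J, ∀ x ∈ I, HasDerivAt (fun s => ξ s x) (ξt t x) t)
    (hξx : ∀ t ∈ J, ∀ x ∈ I, HasDerivAt (ξ t) (ξx t x) x)
    (hξxx : ∀ t ∈ J, ∀ x ∈ I, HasDerivAt (ξx t) (ξxx t x) x)
    (hHt : ∀ t ∈ J, ∀ x ∈ I, HasDerivAt (fun s => H s x) (Ht t x) t)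
    (hHx : ∀ t ∈ J, ∀ x ∈ I, HasDerivAt (H t) (Hx t x) x)
    (hHxx : ∀ t ∈ J, ∀ x ∈ I, HasDerivAt (Hx t) (Hxx t x) x) :
    Determining A B J I v ↔ ∀ t ∈ J, ∀ x ∈ I,
      (-(τ₁ t * A x) = ξ t x * deriv A x - 2 * A x * ξx t x) ∧
      (-(τ₁ t * (2 * deriv A x + B x)) - ξt t x
        = ξ t x * (2 * deriv (deriv A) x + deriv B x) + 2 * A x * Hx t x
          - A x * ξxx t x - (2 * deriv A x + B x) * ξx t x) ∧
      (Ht t x - (deriv (deriv A) x + deriv B x) * τ₁ t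
        = ξ t x * (deriv (deriv (deriv A)) x + deriv (deriv B) x)
          + A x * Hxx t x + (2 * deriv A x + B x) * Hx t x) := by
  have vτ : EqOnBox J I Set.univ v.τ (fun t _ _ => τ t) := fun t ht x hx u _ => by
    simp [VField.τ, hv t ht x hx u]
  have vξ : EqOnBox J I Set.univ v.ξ (fun t x _ => ξ t x) := fun t ht x hx u _ => by
    simp [VField.ξ, hv t ht x hx u]
  have vη : EqOnBox J I Set.univ v.η (fun t x u => H t x * u) := fun t ht x hx u _ => by
    simp [VField.η, hv t ht x hx u]
  have pxτ := vτ.px hI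
  have puτ := vτ.pu isOpen_univ
  have ptτ : EqOnBox J I Set.univ (pt v.τ) (fun t _ _ => τ₁ t) := fun t ht x hx u hu => by
    rw [vτ.pt hJ t ht x hx u hu]; exact (hτ t ht).deriv
  have ptξ : EqOnBox J I Set.univ (pt v.ξ) (fun t x _ => ξt t x) := fun t ht x hx u hu => by
    rw [vξ.pt hJ t ht x hx u hu]; exact (hξt t ht x hx).deriv
  have pxξ : EqOnBox J I Set.univ (px v.ξ) (fun t x _ => ξx t x) := fun t ht x hx u hu => by
    rw [vξ.px hI t ht x hx u hu]; exact (hξx t ht x hx).deriv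
  have pxpxξ : EqOnBox J I Set.univ (px (px v.ξ)) (fun t x _ => ξxx t x) :=
    fun t ht x hx u hu => by
      rw [pxξ.px hI t ht x hx u hu]; exact (hξxx t ht x hx).deriv
  have puξ := vξ.pu isOpen_univ
  have ptη : EqOnBox J I Set.univ (pt v.η) (fun t x u => Ht t x * u) := fun t ht x hx u hu => by
    rw [vη.pt hJ t ht x hx u hu]; exact ((hHt t ht x hx).mul_const u).deriv
  have pxη : EqOnBox J I Set.univ (px v.η) (fun t x u => Hx t x * u) := fun t ht x hx u hu => by
    rw [vη.px hI t ht x hx u hu]; exact ((hHx t ht x hx).mul_const u).deriv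
  have pxpxη : EqOnBox J I Set.univ (px (px v.η)) (fun t x u => Hxx t x * u) :=
    fun t ht x hx u hu => by
      rw [pxη.px hI t ht x hx u hu]; exact ((hHxx t ht x hx).mul_const u).deriv
  have puη : EqOnBox J I Set.univ (pu v.η) (fun t x _ => H t x) := fun t ht x hx u hu => by
    rw [vη.pu isOpen_univ t ht x hx u hu]; simp [pu]
  have pxpuη : EqOnBox J I Set.univ (px (pu v.η)) (fun t x _ => Hx t x) :=
    fun t ht x hx u hu => by
      rw [puη.px hI t ht x hx u hu]; exact (hHx t ht x hx).deriv
  have pupuη := puη.pu isOpen_univ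
  constructor
  · intro h t ht x hx
    refine ⟨?_, ?_, ?_⟩
    · simpa only [ptτ t ht x hx 1 trivial, pxξ t ht x hx 1 trivial, vξ t ht x hx 1 trivial]
        using h.second t ht x hx 1
    · simpa only [ptτ t ht x hx 1 trivial, pxξ t ht x hx 1 trivial, vξ t ht x hx 1 trivial,
        ptξ t ht x hx 1 trivial, pxpxξ t ht x hx 1 trivial, pxpuη t ht x hx 1 trivial]
        using h.first t ht x hx 1
    · have := h.zeroth t ht x hx 1
      simp only [ptτ t ht x hx 1 trivial, vξ t ht x hx 1 trivial, ptη t ht x hx 1 trivial,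
        puη t ht x hx 1 trivial, pxpxη t ht x hx 1 trivial, pxη t ht x hx 1 trivial,
        vη t ht x hx 1 trivial] at this
      linear_combination this
  · intro h
    refine ⟨?_, ?_, ?_, ?_, fun t ht x hx u => ?_, fun t ht x hx u => ?_, fun t ht x hx u => ?_⟩
    · intro t ht x hx u hu; rw [pxτ t ht x hx u hu]; simp [px]
    · intro t ht x hx u hu; rw [puτ t ht x hx u hu]; simp [pu]
    · intro t ht x hx u hu; rw [puξ t ht x hx u hu]; simp [pu]
    · intro t ht x hx u hu; rw [pupuη t ht x hx u hu]; simp [pu]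
    · simpa only [ptτ t ht x hx u trivial, pxξ t ht x hx u trivial, vξ t ht x hx u trivial]
        using (h t ht x hx).1
    · simpa only [ptτ t ht x hx u trivial, pxξ t ht x hx u trivial, vξ t ht x hx u trivial,
        ptξ t ht x hx u trivial, pxpxξ t ht x hx u trivial, pxpuη t ht x hx u trivial]
        using (h t ht x hx).2.1
    · simp only [ptτ t ht x hx u trivial, vξ t ht x hx u trivial, ptη t ht x hx u trivial,
        puη t ht x hx u trivial, pxpxη t ht x hx u trivial, pxη t ht x hx u trivial,
        vη t ht x hx u trivial]
      linear_combination u * (h t ht x hx).2.2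

/-- The vector field with `τ`, `σ`, `ρ` as the parameter functions of time, for the equation
`u_t = (A u)_{xx} + (B u)_x` with `A = ε a²`, `B = a b - ε a a'`, where `X' = 1/a`. -/
def symField (ε : ℝ) (a X b τ σ ρ : ℝ → ℝ) : VField := fun t x u =>
  (τ t, a x * (1 / 2 * deriv τ t * X x + σ t),
    (-(ε / 2) * (deriv (deriv τ) t * X x ^ 2 / 4 + deriv σ t * X x
        + (1 / 2 * deriv τ t * X x + σ t) * b x) + ρ t
      - deriv a x * (1 / 2 * deriv τ t * X x + σ t)) * u)

/-- The classifying condition that relates `τ`, `σ`, `ρ` to the potential `Q`, with `Q₁` the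
derivative of `Q` with respect to `X`. -/
def Classifying (ε : ℝ) (X Q Q₁ τ σ ρ : ℝ → ℝ) (t x : ℝ) : Prop :=
  deriv τ t * (Q x + 1 / 2 * X x * Q₁ x) + σ t * Q₁ x
    = deriv (deriv (deriv τ)) t * X x ^ 2 / 8 + deriv (deriv σ) t * X x / 2
      - ε * (deriv ρ t + deriv (deriv τ) t / 4)

/-- The data that bring `u_t = (A u)_{xx} + (B u)_x` to the reduced form. -/
structure Straightening (ε : ℝ) (I : Set ℝ) (A B a X b : ℝ → ℝ) : Prop where
  isOpen : IsOpen I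
  sq : ε * ε = 1
  smooth_a : ContDiffOn ℝ ∞ a I
  smooth_b : ContDiffOn ℝ ∞ b I
  ne_zero : ∀ x ∈ I, a x ≠ 0
  deriv_X : ∀ x ∈ I, HasDerivAt X (1 / a x) x
  A_eq : ∀ x ∈ I, A x = ε * a x ^ 2
  B_eq : ∀ x ∈ I, B x = a x * b x - ε * a x * deriv a x

/-- The potential of the equation. -/
def potential (ε : ℝ) (a b : ℝ → ℝ) (x : ℝ) : ℝ := -(ε / 2) * a x * deriv b x + b x ^ 2 / 4

namespace Straightening

variable {ε : ℝ} {I J : Set ℝ} {A B a X b : ℝ → ℝ} (s : Straightening ε I A B a X b)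

include s

theorem smooth_A : ContDiffOn ℝ ∞ A I :=
  (contDiffOn_const.mul (s.smooth_a.pow 2)).congr s.A_eq

theorem smooth_B : ContDiffOn ℝ ∞ B I :=
  ((s.smooth_a.mul s.smooth_b).sub ((contDiffOn_const.mul s.smooth_a).mul
    (deriv_smooth s.smooth_a s.isOpen))).congr s.B_eq

theorem smooth_X : ContDiffOn ℝ ∞ X I :=
  contDiffOn_infty_of_hasDerivAt s.isOpen s.deriv_X (contDiffOn_const.div s.smooth_a s.ne_zero)

theorem eps_ne : ε ≠ 0 := by rintro rfl; simpa using s.sq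

theorem A_ne {x : ℝ} (hx : x ∈ I) : A x ≠ 0 := by
  rw [s.A_eq x hx]; exact mul_ne_zero s.eps_ne (pow_ne_zero 2 (s.ne_zero x hx))

theorem a₀ {x : ℝ} (hx : x ∈ I) : HasDerivAt a (deriv a x) x :=
  hasDerivAt_on s.smooth_a s.isOpen hx

theorem a₁ {x : ℝ} (hx : x ∈ I) : HasDerivAt (deriv a) (deriv (deriv a) x) x :=
  hasDerivAt_on (deriv_smooth s.smooth_a s.isOpen) s.isOpen hx

theorem a₂ {x : ℝ} (hx : x ∈ I) :
    HasDerivAt (deriv (deriv a)) (deriv (deriv (deriv a)) x) x :=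
  hasDerivAt_on (deriv_smooth
    (deriv_smooth s.smooth_a s.isOpen) s.isOpen) s.isOpen hx

theorem b₀ {x : ℝ} (hx : x ∈ I) : HasDerivAt b (deriv b x) x :=
  hasDerivAt_on s.smooth_b s.isOpen hx

theorem b₁ {x : ℝ} (hx : x ∈ I) : HasDerivAt (deriv b) (deriv (deriv b) x) x :=
  hasDerivAt_on (deriv_smooth s.smooth_b s.isOpen) s.isOpen hx

theorem deriv_A {x : ℝ} (hx : x ∈ I) : deriv A x = 2 * ε * a x * deriv a x := by
  rw [((((s.a₀ hx).fun_pow 2).const_mul ε).congr_on s.isOpen s.A_eq hx).deriv]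
  simp only [Nat.cast_ofNat, Nat.reduceSub, pow_one]; ring

theorem deriv_deriv_A {x : ℝ} (hx : x ∈ I) :
    deriv (deriv A) x = 2 * ε * (deriv a x ^ 2 + a x * deriv (deriv a) x) := by
  rw [(((((s.a₀ hx).const_mul (2 * ε)).fun_mul (s.a₁ hx))).congr_on s.isOpen
    (fun y hy => s.deriv_A hy) hx).deriv]
  ring

theorem deriv_deriv_deriv_A {x : ℝ} (hx : x ∈ I) : deriv (deriv (deriv A)) x =
    2 * ε * (3 * deriv a x * deriv (deriv a) x + a x * deriv (deriv (deriv a)) x) := by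
  rw [(((((s.a₁ hx).fun_pow 2).add ((s.a₀ hx).fun_mul (s.a₂ hx))).const_mul (2 * ε)).congr_on s.isOpen
    (fun y hy => s.deriv_deriv_A hy) hx).deriv]
  simp only [Nat.cast_ofNat, Nat.reduceSub, pow_one]; ring

theorem deriv_B {x : ℝ} (hx : x ∈ I) : deriv B x = deriv a x * b x + a x * deriv b x
    - ε * (deriv a x ^ 2 + a x * deriv (deriv a) x) := by
  rw [((((s.a₀ hx).fun_mul (s.b₀ hx)).sub (((s.a₀ hx).const_mul ε).fun_mul (s.a₁ hx))).congr_on s.isOpen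
    s.B_eq hx).deriv]
  ring

theorem deriv_deriv_B {x : ℝ} (hx : x ∈ I) : deriv (deriv B) x = deriv (deriv a) x * b x
    + 2 * deriv a x * deriv b x + a x * deriv (deriv b) x
    - ε * (3 * deriv a x * deriv (deriv a) x + a x * deriv (deriv (deriv a)) x) := by
  rw [(((((s.a₁ hx).fun_mul (s.b₀ hx)).add ((s.a₀ hx).fun_mul (s.b₁ hx))).sub
    ((((s.a₁ hx).fun_pow 2).add ((s.a₀ hx).fun_mul (s.a₂ hx))).const_mul ε)).congr_on s.isOpen
    (fun y hy => s.deriv_B hy) hx).deriv]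
  simp only [Nat.cast_ofNat, Nat.reduceSub, pow_one]; ring

theorem hasDerivAt_potential {x : ℝ} (hx : x ∈ I) :
    HasDerivAt (potential ε a b) (-(ε / 2) * (deriv a x * deriv b x + a x * deriv (deriv b) x)
      + b x * deriv b x / 2) x := by
  have := (((s.a₀ hx).const_mul (-(ε / 2))).fun_mul (s.b₁ hx)).add
    (((s.b₀ hx).fun_pow 2).div_const 4)
  refine HasDerivAt.congr_deriv this ?_
  simp only [Nat.cast_ofNat, Nat.reduceSub, pow_one]; ring

theorem smooth_potential : ContDiffOn ℝ ∞ (potential ε a b) I :=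
  ((contDiffOn_const.mul s.smooth_a).mul (deriv_smooth s.smooth_b s.isOpen)).add
    ((s.smooth_b.pow 2).div_const 4)

end Straightening

namespace Straightening

variable {ε : ℝ} {I J : Set ℝ} {A B a X b : ℝ → ℝ} (s : Straightening ε I A B a X b)
  {τ σ ρ : ℝ → ℝ}

include s

/-- The determining equations in terms of the straightening data. -/
theorem determining_iff (hJ : IsOpen J)
    {v : VField} {τ τ₁ : ℝ → ℝ} {ξ ξt ξx ξxx H Ht Hx Hxx : ℝ → ℝ → ℝ}
    (hv : ∀ t ∈ J, ∀ x ∈ I, ∀ u, v t x u = (τ t, ξ t x, H t x * u))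
    (hτ : ∀ t ∈ J, HasDerivAt τ (τ₁ t) t)
    (hξt : ∀ t ∈ J, ∀ x ∈ I, HasDerivAt (fun s => ξ s x) (ξt t x) t)
    (hξx : ∀ t ∈ J, ∀ x ∈ I, HasDerivAt (ξ t) (ξx t x) x)
    (hξxx : ∀ t ∈ J, ∀ x ∈ I, HasDerivAt (ξx t) (ξxx t x) x)
    (hHt : ∀ t ∈ J, ∀ x ∈ I, HasDerivAt (fun s => H s x) (Ht t x) t)
    (hHx : ∀ t ∈ J, ∀ x ∈ I, HasDerivAt (H t) (Hx t x) x)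
    (hHxx : ∀ t ∈ J, ∀ x ∈ I, HasDerivAt (Hx t) (Hxx t x) x) :
    Determining A B J I v ↔ ∀ t ∈ J, ∀ x ∈ I,
      (a x * τ₁ t = 2 * a x * ξx t x - 2 * deriv a x * ξ t x) ∧
      (-(τ₁ t * (3 * ε * a x * deriv a x + a x * b x)) - ξt t x
        = ξ t x * (3 * ε * (deriv a x ^ 2 + a x * deriv (deriv a) x) + deriv a x * b x
            + a x * deriv b x) + 2 * ε * a x ^ 2 * Hx t x
          - ε * a x ^ 2 * ξxx t x - (3 * ε * a x * deriv a x + a x * b x) * ξx t x) ∧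
      (Ht t x - (ε * (deriv a x ^ 2 + a x * deriv (deriv a) x) + deriv a x * b x
            + a x * deriv b x) * τ₁ t
        = ξ t x * (ε * (3 * deriv a x * deriv (deriv a) x + a x * deriv (deriv (deriv a)) x)
            + deriv (deriv a) x * b x + 2 * deriv a x * deriv b x + a x * deriv (deriv b) x)
          + ε * a x ^ 2 * Hxx t x + (3 * ε * a x * deriv a x + a x * b x) * Hx t x) := by
  rw [determining_essential_iff hJ s.isOpen hv hτ hξt hξx hξxx hHt hHx hHxx]
  refine forall₂_congr fun t _ => forall₂_congr fun x hx => ?_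
  rw [s.deriv_A hx, s.deriv_deriv_A hx, s.deriv_deriv_deriv_A hx, s.deriv_B hx,
    s.deriv_deriv_B hx, s.A_eq x hx, s.B_eq x hx]
  refine and_congr ⟨fun h => ?_, fun h => ?_⟩ (and_congr ⟨fun h => ?_, fun h => ?_⟩
    ⟨fun h => ?_, fun h => ?_⟩)
  · refine mul_left_cancel₀ (mul_ne_zero s.eps_ne (s.ne_zero x hx)) ?_
    linear_combination -h
  · linear_combination -ε * a x * h
  all_goals linear_combination h

theorem determining_symField_iff (hJ : IsOpen J) (hτ : ContDiffOn ℝ ∞ τ J)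
    (hσ : ContDiffOn ℝ ∞ σ J) (hρ : ContDiffOn ℝ ∞ ρ J) :
    Determining A B J I (symField ε a X b τ σ ρ) ↔ ∀ t ∈ J, ∀ x ∈ I,
      Classifying ε X (potential ε a b) (fun x => a x * deriv (potential ε a b) x) τ σ ρ t x := by
  have hτ1 := deriv_smooth hτ hJ
  have hτ2 := deriv_smooth hτ1 hJ
  have hσ1 := deriv_smooth hσ hJ
  have T0 := fun t ht => hasDerivAt_on hτ hJ (x := t) ht
  have T1 := fun t ht => hasDerivAt_on hτ1 hJ (x := t) ht
  have T2 := fun t ht => hasDerivAt_on hτ2 hJ (x := t) ht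
  have S0 := fun t ht => hasDerivAt_on hσ hJ (x := t) ht
  have S1 := fun t ht => hasDerivAt_on hσ1 hJ (x := t) ht
  have R0 := fun t ht => hasDerivAt_on hρ hJ (x := t) ht
  have hζx : ∀ t, ∀ x ∈ I, HasDerivAt (fun x => 1 / 2 * deriv τ t * X x + σ t)
      (1 / 2 * deriv τ t * (1 / a x)) x := fun t x hx =>
    ((s.deriv_X x hx).const_mul _).add_const _
  have hinv : ∀ x ∈ I, HasDerivAt (fun x => 1 / a x) (-deriv a x / a x ^ 2) x := fun x hx => by
    simpa [one_div] using (s.a₀ hx).fun_inv (s.ne_zero x hx)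
  rw [s.determining_iff hJ (v := symField ε a X b τ σ ρ) (fun t _ x _ u => rfl) T0
    (ξt := fun t x => a x * (1 / 2 * deriv (deriv τ) t * X x + deriv σ t))
    (ξx := fun t x => deriv a x * (1 / 2 * deriv τ t * X x + σ t)
      + a x * (1 / 2 * deriv τ t * (1 / a x)))
    (ξxx := fun t x => (deriv (deriv a) x * (1 / 2 * deriv τ t * X x + σ t)
      + deriv a x * (1 / 2 * deriv τ t * (1 / a x))) + (deriv a x * (1 / 2 * deriv τ t * (1 / a x))
      + a x * (1 / 2 * deriv τ t * (-deriv a x / a x ^ 2))))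
    (Ht := fun t x => -(ε / 2) * (deriv (deriv (deriv τ)) t * X x ^ 2 / 4 + deriv (deriv σ) t * X x
        + (1 / 2 * deriv (deriv τ) t * X x + deriv σ t) * b x) + deriv ρ t
      - deriv a x * (1 / 2 * deriv (deriv τ) t * X x + deriv σ t))
    (Hx := fun t x => -(ε / 2) * (deriv (deriv τ) t * (2 * X x * (1 / a x)) / 4
        + deriv σ t * (1 / a x)
        + (1 / 2 * deriv τ t * (1 / a x) * b x + (1 / 2 * deriv τ t * X x + σ t) * deriv b x))
      - (deriv (deriv a) x * (1 / 2 * deriv τ t * X x + σ t)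
        + deriv a x * (1 / 2 * deriv τ t * (1 / a x))))
    (Hxx := fun t x => -(ε / 2) * (deriv (deriv τ) t * (2 * (1 / a x) * (1 / a x)
          + 2 * X x * (-deriv a x / a x ^ 2)) / 4
        + deriv σ t * (-deriv a x / a x ^ 2)
        + ((1 / 2 * deriv τ t * (-deriv a x / a x ^ 2) * b x
            + 1 / 2 * deriv τ t * (1 / a x) * deriv b x)
          + (1 / 2 * deriv τ t * (1 / a x) * deriv b x
            + (1 / 2 * deriv τ t * X x + σ t) * deriv (deriv b) x)))
      - ((deriv (deriv (deriv a)) x * (1 / 2 * deriv τ t * X x + σ t)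
          + deriv (deriv a) x * (1 / 2 * deriv τ t * (1 / a x)))
        + (deriv (deriv a) x * (1 / 2 * deriv τ t * (1 / a x))
          + deriv a x * (1 / 2 * deriv τ t * (-deriv a x / a x ^ 2)))))
    (fun t ht x _ => ((((T1 t ht).const_mul _).mul_const _).add (S0 t ht)).const_mul _)
    (fun t _ x hx => (s.a₀ hx).mul (hζx t x hx))
    (fun t _ x hx => ((s.a₁ hx).mul (hζx t x hx)).add
      ((s.a₀ hx).mul ((hinv x hx).const_mul _)))
    (fun t ht x _ => (((((((T2 t ht).mul_const _).div_const 4).add ((S1 t ht).mul_const _)).add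
      (((((T1 t ht).const_mul _).mul_const _).add (S0 t ht)).mul_const _)).const_mul _).add
      (R0 t ht)).sub (((((T1 t ht).const_mul _).mul_const _).add (S0 t ht)).const_mul _))
    (fun t _ x hx => by
      have := ((((((((s.deriv_X x hx).fun_pow 2).const_mul (deriv (deriv τ) t)).div_const 4).add
        ((s.deriv_X x hx).const_mul (deriv σ t))).add ((hζx t x hx).mul (s.b₀ hx))).const_mul
        (-(ε / 2))).add_const (ρ t)).sub ((s.a₁ hx).mul (hζx t x hx))
      refine HasDerivAt.congr_deriv this ?_
      simp only [Nat.cast_ofNat, Nat.reduceSub, pow_one])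
    (fun t _ x hx => ((((((((s.deriv_X x hx).const_mul 2).mul (hinv x hx)).const_mul _).div_const
        4).add ((hinv x hx).const_mul _)).add ((((hinv x hx).const_mul _).mul (s.b₀ hx)).add
        ((hζx t x hx).mul (s.b₁ hx)))).const_mul _).sub
        (((s.a₂ hx).mul (hζx t x hx)).add ((s.a₁ hx).mul ((hinv x hx).const_mul _))))]
  refine forall₂_congr fun t ht => forall₂_congr fun x hx => ?_
  have ha := s.ne_zero x hx
  simp only [Classifying, (s.hasDerivAt_potential hx).deriv, potential]
  rcases mul_self_eq_one_iff.mp s.sq with rfl | rfl <;> constructor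
  · rintro ⟨-, -, h⟩
    refine sub_eq_zero.mp (Eq.trans ?_ (mul_eq_zero_of_right 1 (sub_eq_zero.mpr h)))
    field_simp; ring
  · refine fun h => ⟨by field_simp; ring, by field_simp; ring, ?_⟩
    refine sub_eq_zero.mp (Eq.trans ?_ (mul_eq_zero_of_right 1 (sub_eq_zero.mpr h)))
    field_simp; ring
  · rintro ⟨-, -, h⟩
    refine sub_eq_zero.mp (Eq.trans ?_ (mul_eq_zero_of_right (-1) (sub_eq_zero.mpr h)))
    field_simp; ring
  · refine fun h => ⟨by field_simp; ring, by field_simp; ring, ?_⟩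
    refine sub_eq_zero.mp (Eq.trans ?_ (mul_eq_zero_of_right (-1) (sub_eq_zero.mpr h)))
    field_simp; ring

end Straightening

theorem SmoothOnBox.slice_t {J I K : Set ℝ} {F : ℝ → ℝ → ℝ → ℝ} (h : SmoothOnBox J I K F)
    {x u : ℝ} (hx : x ∈ I) (hu : u ∈ K) : ContDiffOn ℝ ∞ (fun t => F t x u) J := by
  have h2 : ContDiffOn ℝ ∞ (fun t : ℝ => (t, x, u)) J := by fun_prop
  exact ContDiffOn.comp h h2 (fun t ht => ⟨ht, hx, hu⟩)

theorem VField.smooth_congr {J I : Set ℝ} {v w : VField}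
    (h : ∀ t ∈ J, ∀ x ∈ I, ∀ u, v t x u = w t x u)
    (hw : ContDiffOn ℝ ∞ (fun p : ℝ × ℝ × ℝ => w p.1 p.2.1 p.2.2) (J ×ˢ I ×ˢ Set.univ)) :
    ContDiffOn ℝ ∞ (fun p : ℝ × ℝ × ℝ => v p.1 p.2.1 p.2.2) (J ×ˢ I ×ˢ Set.univ) :=
  hw.congr fun p hp => h p.1 hp.1 p.2.1 hp.2.1 p.2.2

theorem Determining.congr {A B : ℝ → ℝ} {J I : Set ℝ} (hJ : IsOpen J) (hI : IsOpen I)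
    {v w : VField} (h : ∀ t ∈ J, ∀ x ∈ I, ∀ u, v t x u = w t x u)
    (hw : Determining A B J I w) : Determining A B J I v := by
  have eτ : EqOnBox J I Set.univ v.τ w.τ := fun t ht x hx u _ => by
    simp [VField.τ, h t ht x hx u]
  have eξ : EqOnBox J I Set.univ v.ξ w.ξ := fun t ht x hx u _ => by
    simp [VField.ξ, h t ht x hx u]
  have eη : EqOnBox J I Set.univ v.η w.η := fun t ht x hx u _ => by
    simp [VField.η, h t ht x hx u]
  have o := isOpen_univ (X := ℝ)
  refine ⟨fun t ht x hx u hu => ?_, fun t ht x hx u hu => ?_, fun t ht x hx u hu => ?_,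
    fun t ht x hx u hu => ?_, fun t ht x hx u => ?_, fun t ht x hx u => ?_,
    fun t ht x hx u => ?_⟩
  · rw [eτ.px hI t ht x hx u hu, hw.px_τ t ht x hx u hu]
  · rw [eτ.pu o t ht x hx u hu, hw.pu_τ t ht x hx u hu]
  · rw [eξ.pu o t ht x hx u hu, hw.pu_ξ t ht x hx u hu]
  · rw [(eη.pu o).pu o t ht x hx u hu, hw.pu_pu_η t ht x hx u hu]
  · rw [eτ.pt hJ t ht x hx u trivial, eξ t ht x hx u trivial, eξ.px hI t ht x hx u trivial]
    exact hw.second t ht x hx u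
  · rw [eτ.pt hJ t ht x hx u trivial, eξ t ht x hx u trivial, eξ.px hI t ht x hx u trivial,
      eξ.pt hJ t ht x hx u trivial, (eη.pu o).px hI t ht x hx u trivial,
      (eξ.px hI).px hI t ht x hx u trivial]
    exact hw.first t ht x hx u
  · rw [eτ.pt hJ t ht x hx u trivial, eξ t ht x hx u trivial, eη.pt hJ t ht x hx u trivial,
      eη.pu o t ht x hx u trivial, (eη.px hI).px hI t ht x hx u trivial,
      eη.px hI t ht x hx u trivial, eη t ht x hx u trivial]
    exact hw.zeroth t ht x hx u

namespace Straightening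

variable {ε : ℝ} {I J : Set ℝ} {A B a X b : ℝ → ℝ} (s : Straightening ε I A B a X b)

include s

theorem smooth_symField (hJ : IsOpen J) {τ σ ρ : ℝ → ℝ} (hτ : ContDiffOn ℝ ∞ τ J)
    (hσ : ContDiffOn ℝ ∞ σ J) (hρ : ContDiffOn ℝ ∞ ρ J) :
    ContDiffOn ℝ ∞ (fun p : ℝ × ℝ × ℝ => symField ε a X b τ σ ρ p.1 p.2.1 p.2.2)
      (J ×ˢ I ×ˢ Set.univ) := by
  have m1 : Set.MapsTo (fun p : ℝ × ℝ × ℝ => p.1) (J ×ˢ I ×ˢ Set.univ) J := fun p hp => hp.1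
  have m2 : Set.MapsTo (fun p : ℝ × ℝ × ℝ => p.2.1) (J ×ˢ I ×ˢ Set.univ) I := fun p hp => hp.2.1
  have d1 : ContDiffOn ℝ ∞ (fun p : ℝ × ℝ × ℝ => p.1) (J ×ˢ I ×ˢ Set.univ) :=
    contDiff_fst.contDiffOn
  have d2 : ContDiffOn ℝ ∞ (fun p : ℝ × ℝ × ℝ => p.2.1) (J ×ˢ I ×ˢ Set.univ) :=
    contDiff_snd.fst.contDiffOn
  have d3 : ContDiffOn ℝ ∞ (fun p : ℝ × ℝ × ℝ => p.2.2) (J ×ˢ I ×ˢ Set.univ) :=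
    contDiff_snd.snd.contDiffOn
  have c0 := hτ.comp d1 m1
  have hτ1 := deriv_smooth hτ hJ
  have c1 := hτ1.comp d1 m1
  have c2 := (deriv_smooth hτ1 hJ).comp d1 m1
  have c3 := hσ.comp d1 m1
  have c4 := (deriv_smooth hσ hJ).comp d1 m1
  have c5 := hρ.comp d1 m1
  have e0 := s.smooth_a.comp d2 m2
  have e1 := (deriv_smooth s.smooth_a s.isOpen).comp d2 m2
  have e2 := s.smooth_X.comp d2 m2
  have e3 := s.smooth_b.comp d2 m2
  have z := (((contDiffOn_const (c := (1 / 2 : ℝ))).mul c1).mul e2).add c3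
  refine c0.prodMk ((e0.mul z).prodMk ((((contDiffOn_const.mul (((((c2.mul (e2.pow 2)).div_const
    4)).add (c4.mul e2)).add (z.mul e3))).add c5).sub (e1.mul z)).mul d3))

theorem essential_iff (hJ : IsOpenInterval J) (hI : IsOpenInterval I) {v : VField} :
    (IsLieSymmetry A B J I v ∧ IsEssential J I v) ↔
      ∃ τ σ ρ : ℝ → ℝ, ContDiffOn ℝ ∞ τ J ∧ ContDiffOn ℝ ∞ σ J ∧ ContDiffOn ℝ ∞ ρ J ∧
        (∀ t ∈ J, ∀ x ∈ I, ∀ u, v t x u = symField ε a X b τ σ ρ t x u) ∧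
        ∀ t ∈ J, ∀ x ∈ I, Classifying ε X (potential ε a b)
          (fun x => a x * deriv (potential ε a b) x) τ σ ρ t x := by
  have oJ := hJ.isOpen
  have oI := hI.isOpen
  constructor
  swap
  · rintro ⟨τ, σ, ρ, hτ, hσ, hρ, hv, hc⟩
    refine ⟨determining_isLieSymmetry oI s.smooth_A s.smooth_B
      (VField.smooth_congr hv (s.smooth_symField oJ hτ hσ hρ))
      (Determining.congr oJ oI hv ((s.determining_symField_iff oJ hτ hσ hρ).mpr hc)),
      fun t _ => τ t, _, _, hv⟩
  rintro ⟨hsym, τ', ξ', η', hess⟩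
  have D := isLieSymmetry_determining oI s.smooth_A s.smooth_B (fun x hx => s.A_ne hx) hsym
  obtain ⟨sτ, sξ, sη⟩ := VField.smooth_iff.mp hsym.1
  obtain ⟨x₀, hx₀⟩ := hI.nonempty
  have o := isOpen_univ (X := ℝ)
  set τ : ℝ → ℝ := fun t => v.τ t x₀ 0 with hτdef
  have hτ : ContDiffOn ℝ ∞ τ J := sτ.slice_t hx₀ trivial
  have hτ1 := deriv_smooth hτ oJ
  have T0 := fun t ht => hasDerivAt_on hτ oJ (x := t) ht
  have T1 := fun t ht => hasDerivAt_on hτ1 oJ (x := t) ht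
  have vτ : ∀ t ∈ J, ∀ x ∈ I, ∀ u, v.τ t x u = τ t := fun t ht x hx u => by
    have h1 : v.τ t x u = v.τ t x 0 := by simp [VField.τ, hess t ht x hx]
    rw [h1]
    refine hI.eq_of_hasDerivAt_zero (f := fun y => v.τ t y 0) (fun y hy => ?_) hx hx₀
    have := sτ.hasDerivAt_x oJ oI o ht hy (Set.mem_univ (0 : ℝ))
    rwa [D.px_τ t ht y hy 0 trivial] at this
  have hv : ∀ t ∈ J, ∀ x ∈ I, ∀ u, v t x u = (τ t, v.ξ t x 0, v.η t x 1 * u) :=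
    fun t ht x hx u => by
      refine Prod.ext (vτ t ht x hx u) (Prod.ext ?_ ?_)
      · simp [VField.ξ, hess t ht x hx]
      · simp [VField.η, hess t ht x hx]
  have tr : ∀ y : ℝ, y ∈ Set.univ := fun _ => trivial
  have E := (s.determining_iff oJ (ξ := fun t x => v.ξ t x 0) (H := fun t x => v.η t x 1) hv T0
    (fun t ht x hx => sξ.hasDerivAt_t oJ oI o ht hx (tr 0))
    (fun t ht x hx => sξ.hasDerivAt_x oJ oI o ht hx (tr 0))
    (fun t ht x hx => (sξ.px oJ oI o).hasDerivAt_x oJ oI o ht hx (tr 0))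
    (fun t ht x hx => sη.hasDerivAt_t oJ oI o ht hx (tr 1))
    (fun t ht x hx => sη.hasDerivAt_x oJ oI o ht hx (tr 1))
    (fun t ht x hx => (sη.px oJ oI o).hasDerivAt_x oJ oI o ht hx (tr 1))).mp D
  set σ : ℝ → ℝ := fun t => v.ξ t x₀ 0 / a x₀ - 1 / 2 * deriv τ t * X x₀ with hσdef
  have hσ : ContDiffOn ℝ ∞ σ J :=
    ((sξ.slice_t hx₀ (tr 0)).div_const _).sub ((contDiffOn_const.mul hτ1).mul contDiffOn_const)
  have S0 := fun t ht => hasDerivAt_on hσ oJ (x := t) ht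
  have ξeq : ∀ t ∈ J, ∀ x ∈ I, v.ξ t x 0 = a x * (1 / 2 * deriv τ t * X x + σ t) :=
    fun t ht x hx => by
      have hc := hI.eq_of_hasDerivAt_zero
        (f := fun y => v.ξ t y 0 / a y - 1 / 2 * deriv τ t * X y) (fun y hy => by
          have ha := s.ne_zero y hy
          refine HasDerivAt.congr_deriv (((sξ.hasDerivAt_x oJ oI o ht hy (tr 0)).fun_div (s.a₀ hy)
            ha).sub ((s.deriv_X y hy).const_mul _)) ?_
          have := (E t ht y hy).1
          field_simp
          linear_combination -this) hx hx₀
      have ha := s.ne_zero x hx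
      have : v.ξ t x 0 / a x = 1 / 2 * deriv τ t * X x + σ t := by
        simp only [hσdef]; linear_combination hc
      rw [← this]; field_simp
  have ξt : ∀ t ∈ J, ∀ x ∈ I, pt v.ξ t x 0
      = a x * (1 / 2 * deriv (deriv τ) t * X x + deriv σ t) := fun t ht x hx =>
    (((((((T1 t ht).const_mul (1 / 2)).mul_const (X x)).add (S0 t ht)).const_mul (a x)).congr_on oJ
      (fun r hr => ξeq r hr x hx) ht)).deriv
  have ζx : ∀ t, ∀ x ∈ I, HasDerivAt (fun x => 1 / 2 * deriv τ t * X x + σ t)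
      (1 / 2 * deriv τ t * (1 / a x)) x := fun t x hx =>
    ((s.deriv_X x hx).const_mul _).add_const _
  have ξx : ∀ t ∈ J, ∀ x ∈ I, px v.ξ t x 0
      = deriv a x * (1 / 2 * deriv τ t * X x + σ t) + 1 / 2 * deriv τ t := fun t ht x hx => by
    have ha := s.ne_zero x hx
    have := (((s.a₀ hx).fun_mul (ζx t x hx)).congr_on oI (fun y hy => ξeq t ht y hy) hx).deriv
    refine this.trans ?_
    field_simp
  have ξxx : ∀ t ∈ J, ∀ x ∈ I, px (px v.ξ) t x 0
      = deriv (deriv a) x * (1 / 2 * deriv τ t * X x + σ t)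
        + deriv a x * (1 / 2 * deriv τ t * (1 / a x)) := fun t ht x hx =>
    ((((s.a₁ hx).fun_mul (ζx t x hx)).add_const (1 / 2 * deriv τ t)).congr_on oI
      (fun y hy => ξx t ht y hy) hx).deriv
  set G : ℝ → ℝ → ℝ := fun t x => v.η t x 1 + deriv a x * (1 / 2 * deriv τ t * X x + σ t)
    + (ε / 2) * (deriv (deriv τ) t * X x ^ 2 / 4 + deriv σ t * X x
        + (1 / 2 * deriv τ t * X x + σ t) * b x) with hG
  have hρ : ContDiffOn ℝ ∞ (fun t => G t x₀) J := by
    have z := (((contDiffOn_const (c := (1 / 2 : ℝ))).mul hτ1).mul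
      (contDiffOn_const (c := X x₀))).add hσ
    exact ((sη.slice_t hx₀ (tr 1)).add (contDiffOn_const.mul z)).add (contDiffOn_const.mul
      (((((deriv_smooth hτ1 oJ).mul contDiffOn_const).div_const 4).add
        ((deriv_smooth hσ oJ).mul contDiffOn_const)).add (z.mul contDiffOn_const)))
  have Geq : ∀ t ∈ J, ∀ x ∈ I, G t x = G t x₀ := fun t ht x hx => by
    refine hI.eq_of_hasDerivAt_zero (f := G t) (fun y hy => ?_) hx hx₀
    have ha := s.ne_zero y hy
    have e := (E t ht y hy).2.1
    simp only [ξt t ht y hy, ξx t ht y hy, ξxx t ht y hy, ξeq t ht y hy] at e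
    have := ((sη.hasDerivAt_x oJ oI o ht hy (tr 1)).add ((s.a₁ hy).fun_mul (ζx t y hy))).add
      ((((((s.deriv_X y hy).fun_pow 2).const_mul (deriv (deriv τ) t)).div_const 4).add
        ((s.deriv_X y hy).const_mul (deriv σ t))).add ((ζx t y hy).fun_mul (s.b₀ hy))|>.const_mul
        (ε / 2))
    refine HasDerivAt.congr_deriv this ?_
    simp only [Nat.cast_ofNat, Nat.reduceSub, pow_one]
    rcases mul_self_eq_one_iff.mp s.sq with rfl | rfl
    · field_simp at e ⊢
      linear_combination -4 * e
    · field_simp at e ⊢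
      linear_combination 4 * e
  have hsymf : ∀ t ∈ J, ∀ x ∈ I, ∀ u,
      v t x u = symField ε a X b τ σ (fun t => G t x₀) t x u := fun t ht x hx u => by
    rw [hv t ht x hx u, ξeq t ht x hx]
    refine Prod.ext rfl (Prod.ext rfl ?_)
    have := Geq t ht x hx
    simp only [symField]
    rw [← this]
    simp only [hG]
    ring
  refine ⟨τ, σ, _, hτ, hσ, hρ, hsymf, ?_⟩
  exact (s.determining_symField_iff oJ hτ hσ hρ).mp
    (Determining.congr oJ oI (fun t ht x hx u => (hsymf t ht x hx u).symm) D)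

end Straightening

/-! ### Bases of spaces of vector fields -/

section Bases

variable {J I : Set ℝ} {S : Set VField}

theorem isBasisOn_two {f₀ f₁ : VField}
    (hS : ∀ v : VField, v ∈ S ↔ ∃ c₀ c₁ : ℝ, ∀ t ∈ J, ∀ x ∈ I, ∀ u,
      v t x u = c₀ • f₀ t x u + c₁ • f₁ t x u)
    (hl : ∀ c₀ c₁ : ℝ, (∀ t ∈ J, ∀ x ∈ I, ∀ u, c₀ • f₀ t x u + c₁ • f₁ t x u = 0) →
      c₀ = 0 ∧ c₁ = 0) : IsBasisOn J I S [f₀, f₁] := by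
  refine ⟨fun v => (hS v).trans ?_, ?_⟩
  · simp [Fin.exists_fin_succ_pi, Fin.sum_univ_succ]
  · simpa [Fin.forall_fin_succ_pi, Fin.sum_univ_succ, Matrix.cons_eq_zero_iff] using hl

theorem isBasisOn_four {f₀ f₁ f₂ f₃ : VField}
    (hS : ∀ v : VField, v ∈ S ↔ ∃ c₀ c₁ c₂ c₃ : ℝ, ∀ t ∈ J, ∀ x ∈ I, ∀ u,
      v t x u = c₀ • f₀ t x u + c₁ • f₁ t x u + c₂ • f₂ t x u + c₃ • f₃ t x u)
    (hl : ∀ c₀ c₁ c₂ c₃ : ℝ, (∀ t ∈ J, ∀ x ∈ I, ∀ u,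
      c₀ • f₀ t x u + c₁ • f₁ t x u + c₂ • f₂ t x u + c₃ • f₃ t x u = 0) →
      c₀ = 0 ∧ c₁ = 0 ∧ c₂ = 0 ∧ c₃ = 0) : IsBasisOn J I S [f₀, f₁, f₂, f₃] := by
  simp only [add_assoc] at hS hl
  refine ⟨fun v => (hS v).trans ?_, ?_⟩
  · simp [Fin.exists_fin_succ_pi, Fin.sum_univ_succ]
  · simpa [Fin.forall_fin_succ_pi, Fin.sum_univ_succ, Matrix.cons_eq_zero_iff] using hl

theorem isBasisOn_six {f₀ f₁ f₂ f₃ f₄ f₅ : VField}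
    (hS : ∀ v : VField, v ∈ S ↔ ∃ c₀ c₁ c₂ c₃ c₄ c₅ : ℝ, ∀ t ∈ J, ∀ x ∈ I, ∀ u,
      v t x u = c₀ • f₀ t x u + c₁ • f₁ t x u + c₂ • f₂ t x u + c₃ • f₃ t x u + c₄ • f₄ t x u
        + c₅ • f₅ t x u)
    (hl : ∀ c₀ c₁ c₂ c₃ c₄ c₅ : ℝ, (∀ t ∈ J, ∀ x ∈ I, ∀ u,
      c₀ • f₀ t x u + c₁ • f₁ t x u + c₂ • f₂ t x u + c₃ • f₃ t x u + c₄ • f₄ t x u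
        + c₅ • f₅ t x u = 0) →
      c₀ = 0 ∧ c₁ = 0 ∧ c₂ = 0 ∧ c₃ = 0 ∧ c₄ = 0 ∧ c₅ = 0) :
    IsBasisOn J I S [f₀, f₁, f₂, f₃, f₄, f₅] := by
  simp only [add_assoc] at hS hl
  refine ⟨fun v => (hS v).trans ?_, ?_⟩
  · simp [Fin.exists_fin_succ_pi, Fin.sum_univ_succ]
  · simpa [Fin.forall_fin_succ_pi, Fin.sum_univ_succ, Matrix.cons_eq_zero_iff] using hl

end Bases

/-! ### Kernel algebras -/

section Kernel

variable {J I : Set ℝ} {ε : ℝ} {v : VField}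

theorem SmoothOnBox.eq_of_pt_px_zero {F : ℝ → ℝ → ℝ → ℝ} (hJ : IsOpenInterval J)
    (hI : IsOpenInterval I) (hF : SmoothOnBox J I Set.univ F)
    (h1 : EqOnBox J I Set.univ (FP.pt F) (fun _ _ _ => 0))
    (h2 : EqOnBox J I Set.univ (FP.px F) (fun _ _ _ => 0)) {t t₀ x x₀ u : ℝ} (ht : t ∈ J)
    (ht₀ : t₀ ∈ J) (hx : x ∈ I) (hx₀ : x₀ ∈ I) : F t x u = F t₀ x₀ u := by
  have e1 : F t x u = F t₀ x u := hJ.eq_of_hasDerivAt_zero (f := fun s => F s x u)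
    (fun s hs => by
      have := hF.hasDerivAt_t hJ.isOpen hI.isOpen isOpen_univ hs hx (Set.mem_univ u)
      rwa [h1 s hs x hx u trivial] at this) ht ht₀
  have e2 : F t₀ x u = F t₀ x₀ u := hI.eq_of_hasDerivAt_zero (f := fun y => F t₀ y u)
    (fun y hy => by
      have := hF.hasDerivAt_x hJ.isOpen hI.isOpen isOpen_univ ht₀ hy (Set.mem_univ u)
      rwa [h2 t₀ ht₀ y hy u trivial] at this) hx hx₀
  exact e1.trans e2

theorem kernel_subset (hε : ε ≠ 0) (hJ : IsOpenInterval J) (hI : IsOpenInterval I)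
    (hv : ∀ B : ℝ → ℝ, ContDiffOn ℝ ∞ B I → IsLieSymmetry (fun _ => ε) B J I v) :
    ∃ c₀ c₁ : ℝ, ∀ t ∈ J, ∀ x ∈ I, ∀ u, v t x u = (c₀, 0, c₁ * u) := by
  have oJ := hJ.isOpen
  have oI := hI.isOpen
  have o := isOpen_univ (X := ℝ)
  obtain ⟨sτ, sξ, sη⟩ := VField.smooth_iff.mp (hv 0 contDiffOn_const).1
  have D := fun (B : ℝ → ℝ) (hB : ContDiffOn ℝ ∞ B I) =>
    isLieSymmetry_determining oI contDiffOn_const hB (fun _ _ => hε) (hv B hB)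
  have D0 := D (fun _ => 0) contDiffOn_const
  have D1 := D (fun _ => 1) contDiffOn_const
  have Dx := D (fun x => x) contDiffOn_id
  have h1 : ∀ t ∈ J, ∀ x ∈ I, ∀ u, pt v.τ t x u = 0 ∧ px v.ξ t x u = 0 ∧ v.ξ t x u = 0 := by
    intro t ht x hx u
    have s := D0.second t ht x hx u
    have f0 := D0.first t ht x hx u
    have f1 := D1.first t ht x hx u
    have fx := Dx.first t ht x hx u
    simp at s f0 f1 fx
    have s' : pt v.τ t x u = 2 * px v.ξ t x u :=
      mul_left_cancel₀ hε (by linear_combination s)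
    have e : px v.ξ t x u = 0 := by linear_combination f0 - f1 - s'
    have e' : pt v.τ t x u = 0 := by rw [s', e, mul_zero]
    refine ⟨e', e, ?_⟩
    rw [e, e'] at fx
    linear_combination f0 - fx
  have ptτ : EqOnBox J I Set.univ (pt v.τ) (fun _ _ _ => 0) :=
    fun t ht x hx u _ => (h1 t ht x hx u).1
  have pxη : EqOnBox J I Set.univ (px v.η) (fun _ _ _ => 0) := fun t ht x hx u _ => by
    have z0 := D0.zeroth t ht x hx u
    have z1 := D1.zeroth t ht x hx u
    simp at z0 z1
    linear_combination z0 - z1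
  have pxpxη := pxη.px oI
  rw [px_zero] at pxpxη
  have ptη : EqOnBox J I Set.univ (pt v.η) (fun _ _ _ => 0) := fun t ht x hx u _ => by
    have z0 := D0.zeroth t ht x hx u
    simp [pxpxη t ht x hx u trivial] at z0
    exact z0
  have hη : ∀ t ∈ J, ∀ x ∈ I, ∀ u, v.η t x u = u * pu v.η t x u := fun t ht x hx u => by
    have z := Dx.zeroth t ht x hx u
    simp [pxpxη t ht x hx u trivial, pxη t ht x hx u trivial, ptη t ht x hx u trivial,
      ptτ t ht x hx u trivial] at z
    exact z.symm
  obtain ⟨t₀, ht₀⟩ := hJ.nonempty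
  obtain ⟨x₀, hx₀⟩ := hI.nonempty
  refine ⟨v.τ t₀ x₀ 0, pu v.η t₀ x₀ 0, fun t ht x hx u => ?_⟩
  refine Prod.ext ?_ (Prod.ext (h1 t ht x hx u).2.2 ?_)
  · have e1 : v.τ t x u = v.τ t₀ x₀ u := sτ.eq_of_pt_px_zero hJ hI ptτ D0.px_τ ht ht₀ hx hx₀
    refine e1.trans (isOpenInterval_univ.eq_of_hasDerivAt_zero (f := fun w => v.τ t₀ x₀ w)
      (fun w _ => ?_) trivial trivial)
    have := sτ.hasDerivAt_u oJ oI o ht₀ hx₀ (Set.mem_univ w)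
    rwa [D0.pu_τ t₀ ht₀ x₀ hx₀ w trivial] at this
  · have e1 : v.η t x u = v.η t₀ x₀ u := sη.eq_of_pt_px_zero hJ hI ptη pxη ht ht₀ hx hx₀
    have e2 : pu v.η t₀ x₀ u = pu v.η t₀ x₀ 0 :=
      isOpenInterval_univ.eq_of_hasDerivAt_zero (f := fun w => pu v.η t₀ x₀ w)
      (fun w _ => by
        have := (sη.pu oJ oI o).hasDerivAt_u oJ oI o ht₀ hx₀ (Set.mem_univ w)
        rwa [D0.pu_pu_η t₀ ht₀ x₀ hx₀ w trivial] at this) trivial trivial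
    refine e1.trans ?_
    rw [hη t₀ ht₀ x₀ hx₀ u, e2, mul_comm]

theorem isLieSymmetry_trivial (hJ : IsOpenInterval J) (hI : IsOpenInterval I) {A B : ℝ → ℝ}
    (hA : ContDiffOn ℝ ∞ A I) (hB : ContDiffOn ℝ ∞ B I) {c₀ c₁ : ℝ}
    (hv : ∀ t ∈ J, ∀ x ∈ I, ∀ u, v t x u = (c₀, 0, c₁ * u)) :
    IsLieSymmetry A B J I v := by
  refine determining_isLieSymmetry hI.isOpen hA hB ?_ ?_
  · refine VField.smooth_congr (w := fun _ _ u => (c₀, 0, c₁ * u)) hv ?_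
    fun_prop
  · rw [determining_essential_iff hJ.isOpen hI.isOpen (τ := fun _ => c₀) (ξ := fun _ _ => 0)
      (H := fun _ _ => c₁) hv (fun t _ => hasDerivAt_const t c₀)
      (fun t _ x _ => hasDerivAt_const t 0) (fun t _ x _ => hasDerivAt_const x 0)
      (fun t _ x _ => hasDerivAt_const x 0) (fun t _ x _ => hasDerivAt_const t c₁)
      (fun t _ x _ => hasDerivAt_const x c₁) (fun t _ x _ => hasDerivAt_const x 0)]
    intro t _ x _
    simp

theorem isBasisOn_trivial (hJ : IsOpenInterval J) (hI : IsOpenInterval I) {S : Set VField}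
    (hS : ∀ v, v ∈ S ↔ ∃ c₀ c₁ : ℝ, ∀ t ∈ J, ∀ x ∈ I, ∀ u, v t x u = (c₀, 0, c₁ * u)) :
    IsBasisOn J I S [fieldT, fieldU] := by
  refine isBasisOn_two (fun v => (hS v).trans ?_) fun c₀ c₁ h => ?_
  · simp [fieldT, fieldU]
  · obtain ⟨t₀, ht₀⟩ := hJ.nonempty
    obtain ⟨x₀, hx₀⟩ := hI.nonempty
    simpa [fieldT, fieldU] using h t₀ ht₀ x₀ hx₀ 1

theorem isEssential_trivial {c₀ c₁ : ℝ}
    (hv : ∀ t ∈ J, ∀ x ∈ I, ∀ u, v t x u = (c₀, 0, c₁ * u)) : IsEssential J I v :=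
  ⟨fun _ _ => c₀, fun _ _ => 0, fun _ _ => c₁, hv⟩

theorem adm_reduced_iff {B : ℝ → ℝ} : (reducedFP ε).Adm I B ↔ ContDiffOn ℝ ∞ B I := by
  simp [FPClass.Adm, reducedFP]

theorem adm_full_iff {θ : ℝ → ℝ × ℝ} : fullFP.Adm I θ ↔
    ContDiffOn ℝ ∞ (fun x => (θ x).1) I ∧ ContDiffOn ℝ ∞ (fun x => (θ x).2) I ∧
      ∀ x ∈ I, (θ x).1 ≠ 0 :=
  ⟨fun h => ⟨h.1.fst, h.1.snd, h.2⟩, fun h => ⟨h.1.prodMk h.2.1, h.2.2⟩⟩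

theorem adm_full_const (hε : ε ≠ 0) {B : ℝ → ℝ} (hB : ContDiffOn ℝ ∞ B I) :
    fullFP.Adm I (fun x => (ε, B x)) :=
  adm_full_iff.mpr ⟨contDiffOn_const, hB, fun _ _ => hε⟩

theorem mem_kernel_reduced (hε : ε ≠ 0) (hJ : IsOpenInterval J) (hI : IsOpenInterval I) :
    v ∈ (reducedFP ε).kernel J I ↔
      ∃ c₀ c₁ : ℝ, ∀ t ∈ J, ∀ x ∈ I, ∀ u, v t x u = (c₀, 0, c₁ * u) :=
  ⟨fun h => kernel_subset hε hJ hI fun B hB => h B (adm_reduced_iff.mpr hB),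
    fun ⟨_, _, h⟩ _ hB => isLieSymmetry_trivial hJ hI contDiffOn_const (adm_reduced_iff.mp hB) h⟩

theorem mem_essKernel_reduced (hε : ε ≠ 0) (hJ : IsOpenInterval J) (hI : IsOpenInterval I) :
    v ∈ (reducedFP ε).essKernel J I ↔
      ∃ c₀ c₁ : ℝ, ∀ t ∈ J, ∀ x ∈ I, ∀ u, v t x u = (c₀, 0, c₁ * u) :=
  ⟨fun h => kernel_subset hε hJ hI fun B hB => (h B (adm_reduced_iff.mpr hB)).1,
    fun ⟨_, _, h⟩ _ hB => ⟨isLieSymmetry_trivial hJ hI contDiffOn_const (adm_reduced_iff.mp hB) h,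
      isEssential_trivial h⟩⟩

theorem mem_kernel_full (hJ : IsOpenInterval J) (hI : IsOpenInterval I) :
    v ∈ fullFP.kernel J I ↔
      ∃ c₀ c₁ : ℝ, ∀ t ∈ J, ∀ x ∈ I, ∀ u, v t x u = (c₀, 0, c₁ * u) :=
  ⟨fun h => kernel_subset one_ne_zero hJ hI fun _ hB => h _ (adm_full_const one_ne_zero hB),
    fun ⟨_, _, h⟩ _ hB => isLieSymmetry_trivial hJ hI (adm_full_iff.mp hB).1
      (adm_full_iff.mp hB).2.1 h⟩

theorem mem_essKernel_full (hJ : IsOpenInterval J) (hI : IsOpenInterval I) :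
    v ∈ fullFP.essKernel J I ↔
      ∃ c₀ c₁ : ℝ, ∀ t ∈ J, ∀ x ∈ I, ∀ u, v t x u = (c₀, 0, c₁ * u) :=
  ⟨fun h => kernel_subset one_ne_zero hJ hI fun _ hB => (h _ (adm_full_const one_ne_zero hB)).1,
    fun ⟨_, _, h⟩ _ hB => ⟨isLieSymmetry_trivial hJ hI (adm_full_iff.mp hB).1
      (adm_full_iff.mp hB).2.1 h, isEssential_trivial h⟩⟩

end Kernel

/-! ### Equations with essential symmetry extensions -/

open Polynomial in
theorem coeff_eq_zero_of_infinite {S : Set ℝ} (hS : S.Infinite) {p₀ p₁ p₂ p₃ p₄ p₅ p₆ : ℝ}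
    (h : ∀ y ∈ S, p₀ + p₁ * y + p₂ * y ^ 2 + p₃ * y ^ 3 + p₄ * y ^ 4 + p₅ * y ^ 5 + p₆ * y ^ 6 = 0) :
    p₀ = 0 ∧ p₁ = 0 ∧ p₂ = 0 ∧ p₃ = 0 ∧ p₄ = 0 ∧ p₅ = 0 ∧ p₆ = 0 := by
  set P : ℝ[X] := C p₀ + C p₁ * X + C p₂ * X ^ 2 + C p₃ * X ^ 3 + C p₄ * X ^ 4 + C p₅ * X ^ 5
    + C p₆ * X ^ 6 with hP
  have hz : P = 0 := eq_zero_of_infinite_isRoot P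
    (hS.mono fun y hy => by simpa [IsRoot, hP] using h y hy)
  have hc : ∀ n, P.coeff n = 0 := fun n => by rw [hz]; simp
  have := And.intro (hc 0) <| And.intro (hc 1) <| And.intro (hc 2) <| And.intro (hc 3) <|
    And.intro (hc 4) <| And.intro (hc 5) (hc 6)
  simpa [hP, coeff_X, coeff_C] using this

/-- The potentials that admit essential symmetry extensions, as functions of `X`. -/
def PotForm (I : Set ℝ) (X Q : ℝ → ℝ) : Prop :=
  ∃ c₀ c₁ c₂ μ x₀ : ℝ, (μ = 0 ∨ (c₁ = 0 ∧ ∀ x ∈ I, X x ≠ x₀)) ∧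
    ∀ x ∈ I, Q x = c₀ + c₁ * (X x - x₀) + c₂ * (X x - x₀) ^ 2 + μ / (X x - x₀) ^ 2

theorem exists_oscillator (k t₀ : ℝ) :
    ∃ y y₁ : ℝ → ℝ, (∀ t, HasDerivAt y (y₁ t) t) ∧ (∀ t, HasDerivAt y₁ (k * y t) t) ∧ y t₀ = 1 := by
  rcases le_total 0 k with hk | hk
  · refine ⟨fun t => Real.cosh (√k * (t - t₀)), fun t => Real.sinh (√k * (t - t₀)) * √k,
      fun t => ?_, fun t => ?_, by simp⟩
    · have : HasDerivAt (fun t => √k * (t - t₀)) (√k) t := by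
        simpa using ((hasDerivAt_id t).sub_const t₀).const_mul (√k)
      exact this.cosh
    · have : HasDerivAt (fun t => √k * (t - t₀)) (√k) t := by
        simpa using ((hasDerivAt_id t).sub_const t₀).const_mul (√k)
      refine (this.sinh.mul_const (√k)).congr_deriv ?_
      linear_combination Real.cosh (√k * (t - t₀)) * Real.mul_self_sqrt hk
  · refine ⟨fun t => Real.cos (√(-k) * (t - t₀)), fun t => -Real.sin (√(-k) * (t - t₀)) * √(-k),
      fun t => ?_, fun t => ?_, by simp⟩
    · have : HasDerivAt (fun t => √(-k) * (t - t₀)) (√(-k)) t := by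
        simpa using ((hasDerivAt_id t).sub_const t₀).const_mul (√(-k))
      exact this.cos
    · have : HasDerivAt (fun t => √(-k) * (t - t₀)) (√(-k)) t := by
        simpa using ((hasDerivAt_id t).sub_const t₀).const_mul (√(-k))
      refine (this.sin.neg.mul_const (√(-k))).congr_deriv ?_
      linear_combination -Real.cos (√(-k) * (t - t₀)) *
        Real.mul_self_sqrt (neg_nonneg.mpr hk)

theorem contDiff_of_oscillator {k : ℝ} {y y₁ : ℝ → ℝ} (h : ∀ t, HasDerivAt y (y₁ t) t)
    (h₁ : ∀ t, HasDerivAt y₁ (k * y t) t) : ContDiff ℝ ∞ y := by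
  have key : ∀ n : ℕ, ContDiff ℝ n y ∧ ContDiff ℝ n y₁ := by
    intro n
    induction n with
    | zero => exact ⟨contDiff_zero.mpr (continuous_iff_continuousAt.mpr fun t => (h t).continuousAt),
        contDiff_zero.mpr (continuous_iff_continuousAt.mpr fun t => (h₁ t).continuousAt)⟩
    | succ n ih =>
      push_cast
      constructor
      · rw [contDiff_succ_iff_deriv]
        refine ⟨fun t => (h t).differentiableAt, by simp, ?_⟩
        rw [funext fun t => (h t).deriv]; exact ih.2
      · rw [contDiff_succ_iff_deriv]
        refine ⟨fun t => (h₁ t).differentiableAt, by simp, ?_⟩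
        rw [funext fun t => (h₁ t).deriv]; exact contDiff_const.mul ih.1
  exact contDiff_infty.mpr fun n => (key n).1

namespace Straightening

variable {ε : ℝ} {I J : Set ℝ} {A B a X b : ℝ → ℝ} (s : Straightening ε I A B a X b)

include s

theorem shift (x₀ : ℝ) : Straightening ε I A B a (fun x => X x - x₀) b :=
  { s with deriv_X := fun x hx => (s.deriv_X x hx).sub_const x₀ }

theorem infinite_image (hI : IsOpenInterval I) : (X '' I).Infinite := by
  obtain ⟨x, hx⟩ := hI.nonempty
  refine infinite_of_mem_nhds (X x) ?_
  have hs : HasStrictDerivAt X (1 / a x) x := by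
    have := (s.smooth_X.contDiffAt (s.isOpen.mem_nhds hx)).hasStrictDerivAt (by simp)
    rwa [(s.deriv_X x hx).deriv] at this
  have := hs.map_nhds_eq (one_div_ne_zero (s.ne_zero x hx))
  rw [← this]
  exact Filter.image_mem_map (s.isOpen.mem_nhds hx)

/-- Existence of an essential symmetry beyond the trivial ones. -/
theorem exists_extension (hJ : IsOpenInterval J) (hI : IsOpenInterval I)
    (h : PotForm I X (potential ε a b)) :
    ∃ v, (IsLieSymmetry A B J I v ∧ IsEssential J I v) ∧
      ¬ ∃ c₀ c₁ : ℝ, ∀ t ∈ J, ∀ x ∈ I, ∀ u, v t x u = (c₀, 0, c₁ * u) := by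
  obtain ⟨c₀, c₁, c₂, μ, x₀, hμ, hQ⟩ := h
  obtain ⟨t₀, ht₀⟩ := hJ.nonempty
  obtain ⟨x₁, hx₁⟩ := hI.nonempty
  have s' := s.shift x₀
  have cd : ∀ {f g : ℝ → ℝ}, (∀ t, HasDerivAt f (g t) t) → deriv f = g :=
    fun h => funext fun t => (h t).deriv
  rcases eq_or_ne μ 0 with rfl | hμ0
  · obtain ⟨y, y₁, hy, hy₁, hy0⟩ := exists_oscillator (4 * c₂) t₀
    have sy := contDiff_of_oscillator hy hy₁
    obtain ⟨r, hr⟩ := isOpenInterval_univ.exists_antideriv (f := fun t => -(ε * c₁ * y t))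
      (by have := sy.continuous; fun_prop)
    have hr' : ∀ t, HasDerivAt r (-(ε * c₁ * y t)) t := fun t => hr t trivial
    have sr : ContDiffOn ℝ ∞ r Set.univ := contDiffOn_infty_of_hasDerivAt isOpen_univ hr
      (by have := sy.contDiffOn (s := Set.univ); fun_prop)
    refine ⟨symField ε a (fun x => X x - x₀) b (fun _ => 0) y r,
      (s'.essential_iff hJ hI).mpr ⟨_, _, _, contDiffOn_const, sy.contDiffOn,
        sr.mono (Set.subset_univ _), fun _ _ _ _ _ => rfl, fun t _ x hx => ?_⟩, ?_⟩
    · have hd : deriv (potential ε a b) x = (c₁ + 2 * c₂ * (X x - x₀)) * (1 / a x) := by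
        have hX := (s'.deriv_X x hx)
        have := ((((hX.const_mul c₁).const_add c₀).add ((hX.fun_pow 2).const_mul c₂)).congr_on
          s.isOpen (f := potential ε a b) (fun z hz => by rw [hQ z hz]; simp) hx).deriv
        rw [this]; simp only [Nat.cast_ofNat, Nat.reduceSub, pow_one]; ring
      have ha := s.ne_zero x hx
      simp only [Classifying, cd hy, cd hy₁, cd hr', deriv_const', hd]
      field_simp
      linear_combination (-64 * c₁ * y t) * s.sq
    · rintro ⟨k₀, k₁, hk⟩
      have := congrArg (fun p => p.2.1) (hk t₀ ht₀ x₁ hx₁ 0)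
      simp [symField, hy0, s.ne_zero x₁ hx₁] at this
  · obtain ⟨rfl, hne⟩ := hμ.resolve_left hμ0
    obtain ⟨y, y₁, hy, hy₁, hy0⟩ := exists_oscillator (16 * c₂) t₀
    have sy := contDiff_of_oscillator hy hy₁
    obtain ⟨r, hr⟩ := isOpenInterval_univ.exists_antideriv (f := y) sy.continuous.continuousOn
    have hr' : ∀ t, HasDerivAt r (y t) t := fun t => hr t trivial
    have sr : ContDiffOn ℝ ∞ r Set.univ := contDiffOn_infty_of_hasDerivAt isOpen_univ hr
      sy.contDiffOn
    have hρ : ∀ t, HasDerivAt (fun t => -(ε * c₀ * r t) - y t / 4) (-(ε * c₀ * y t) - y₁ t / 4) t :=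
      fun t => ((hr' t).const_mul _).neg.sub ((hy t).div_const 4)
    refine ⟨symField ε a (fun x => X x - x₀) b r (fun _ => 0) (fun t => -(ε * c₀ * r t) - y t / 4),
      (s'.essential_iff hJ hI).mpr ⟨_, _, _, sr.mono (Set.subset_univ _), contDiffOn_const,
        ?_, fun _ _ _ _ _ => rfl, fun t _ x hx => ?_⟩, ?_⟩
    · have := sr.mono (Set.subset_univ J)
      have := sy.contDiffOn (s := J)
      fun_prop
    · have hX := (s'.deriv_X x hx)
      have hn : X x - x₀ ≠ 0 := sub_ne_zero.mpr (hne x hx)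
      have hd : deriv (potential ε a b) x =
          (2 * c₂ * (X x - x₀) - 2 * μ / (X x - x₀) ^ 3) * (1 / a x) := by
        have := (((((hX.fun_pow 2).const_mul c₂)).const_add c₀).add
          ((hasDerivAt_const x μ).fun_div (hX.fun_pow 2) (pow_ne_zero 2 hn))).congr_on
          s.isOpen (f := potential ε a b) (fun z hz => by rw [hQ z hz]; simp) hx |>.deriv
        rw [this]; simp only [Nat.cast_ofNat, Nat.reduceSub, pow_one]
        have ha := s.ne_zero x hx
        field_simp; ring
      have ha := s.ne_zero x hx
      simp only [Classifying, cd hy, cd hy₁, cd hr', cd hρ, deriv_const', hd, hQ x hx]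
      have e2 : ε ^ 2 = 1 := by rw [pow_two, s.sq]
      field_simp
      ring_nf
      rw [e2]
      ring
    · rintro ⟨k₀, k₁, hk⟩
      have : HasDerivAt r 0 t₀ := (hasDerivAt_const t₀ k₀).congr_on hJ.isOpen
        (fun t ht => congrArg (fun p => p.1) (hk t ht x₁ hx₁ 0)) ht₀
      have := this.unique (hr' t₀)
      rw [hy0] at this
      exact zero_ne_one this

end Straightening

namespace Straightening

variable {ε : ℝ} {I J : Set ℝ} {A B a X b : ℝ → ℝ} (s : Straightening ε I A B a X b)

include s

/-- Integration of the relation between the potential and its derivative given by a symmetry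
with `τ_t ≠ 0`. -/
theorem potForm_of_scaling (hI : IsOpenInterval I) {Q : ℝ → ℝ} (hQs : ContDiffOn ℝ ∞ Q I)
    {α k₀ k₁ k₂ : ℝ} (hα : α ≠ 0) (h : ∀ x ∈ I,
      α * (Q x + 1 / 2 * X x * (a x * deriv Q x)) = k₀ + k₁ * X x + k₂ * X x ^ 2) :
    ∃ c₀ c₁ c₂ μ : ℝ, (μ = 0 ∨ ∀ x ∈ I, X x ≠ 0) ∧
      ∀ x ∈ I, Q x = c₀ + c₁ * X x + c₂ * X x ^ 2 + μ / X x ^ 2 := by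
  obtain ⟨x₁, hx₁⟩ := hI.nonempty
  set F : ℝ → ℝ := fun x => X x ^ 2 * Q x
    - (k₀ / α * X x ^ 2 + 2 / 3 * (k₁ / α) * X x ^ 3 + 1 / 2 * (k₂ / α) * X x ^ 4) with hF
  have hFd : ∀ x ∈ I, HasDerivAt F 0 x := fun x hx => by
    have hX := s.deriv_X x hx
    have := ((hX.fun_pow 2).fun_mul (hasDerivAt_on hQs s.isOpen hx)).sub
      ((((hX.fun_pow 2).const_mul (k₀ / α)).add ((hX.fun_pow 3).const_mul (2 / 3 * (k₁ / α)))).add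
        ((hX.fun_pow 4).const_mul (1 / 2 * (k₂ / α))))
    refine this.congr_deriv ?_
    have ha := s.ne_zero x hx
    have := h x hx
    push_cast
    field_simp at this ⊢
    linear_combination (2 * X x) * this
  have hFc : ∀ x ∈ I, F x = F x₁ := fun x hx => hI.eq_of_hasDerivAt_zero hFd hx hx₁
  refine ⟨k₀ / α, 2 / 3 * (k₁ / α), 1 / 2 * (k₂ / α), F x₁, ?_, fun x hx => ?_⟩
  · by_contra! hcon
    obtain ⟨h0, x, hx, hX⟩ := hcon
    apply h0
    rw [← hFc x hx, hF]
    simp [hX]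
  · rw [← hFc x hx, hF]
    rcases eq_or_ne (X x) 0 with h0 | h0
    · have := h x hx
      rw [h0] at this
      simp [h0]
      field_simp
      linear_combination this
    · field_simp
      ring

theorem potForm_of_extension (hJ : IsOpenInterval J) (hI : IsOpenInterval I) {v : VField}
    (hv : IsLieSymmetry A B J I v ∧ IsEssential J I v)
    (hn : ¬ ∃ c₀ c₁ : ℝ, ∀ t ∈ J, ∀ x ∈ I, ∀ u, v t x u = (c₀, 0, c₁ * u)) :
    PotForm I X (potential ε a b) := by
  obtain ⟨τ, σ, ρ, hτ, hσ, hρ, hvs, hc⟩ := (s.essential_iff hJ hI).mp hv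
  have oJ := hJ.isOpen
  have T0 := fun t ht => hasDerivAt_on hτ oJ (x := t) ht
  have hinf := s.infinite_image hI
  set Q := potential ε a b with hQ
  have hQs : ContDiffOn ℝ ∞ Q I := s.smooth_potential
  have hex : ∃ t ∈ J, deriv τ t ≠ 0 ∨ σ t ≠ 0 := by
    by_contra! hcon
    obtain ⟨t₀, ht₀⟩ := hJ.nonempty
    obtain ⟨x₀, hx₀⟩ := hI.nonempty
    have e1 : ∀ t ∈ J, deriv (deriv τ) t = 0 := fun t ht =>
      ((hasDerivAt_const t (0 : ℝ)).congr_on oJ (fun r hr => (hcon r hr).1) ht).deriv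
    have e2 : ∀ t ∈ J, deriv (deriv (deriv τ)) t = 0 := fun t ht =>
      ((hasDerivAt_const t (0 : ℝ)).congr_on oJ e1 ht).deriv
    have f1 : ∀ t ∈ J, deriv σ t = 0 := fun t ht =>
      ((hasDerivAt_const t (0 : ℝ)).congr_on oJ (fun r hr => (hcon r hr).2) ht).deriv
    have f2 : ∀ t ∈ J, deriv (deriv σ) t = 0 := fun t ht =>
      ((hasDerivAt_const t (0 : ℝ)).congr_on oJ f1 ht).deriv
    have g1 : ∀ t ∈ J, deriv ρ t = 0 := fun t ht => by
      have := hc t ht x₀ hx₀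
      simp only [Classifying, (hcon t ht).1, (hcon t ht).2, e1 t ht, e2 t ht, f2 t ht] at this
      have h2 : ε * deriv ρ t = 0 := by linear_combination this
      exact (mul_eq_zero.mp h2).resolve_left s.eps_ne
    refine hn ⟨τ t₀, ρ t₀, fun t ht x hx u => ?_⟩
    have h1 : τ t = τ t₀ := hJ.eq_of_hasDerivAt_zero (f := τ)
      (fun r hr => by have := T0 r hr; rwa [(hcon r hr).1] at this) ht ht₀
    have h2 : ρ t = ρ t₀ := hJ.eq_of_hasDerivAt_zero (f := ρ)
      (fun r hr => by
        have := hasDerivAt_on hρ oJ hr; rwa [g1 r hr] at this) ht ht₀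
    rw [hvs t ht x hx u]
    simp [symField, (hcon t ht).1, (hcon t ht).2, e1 t ht, f1 t ht, h1, h2]
  obtain ⟨t₁, ht₁, hne⟩ := hex
  by_cases hα : deriv τ t₁ = 0
  · have hβ : σ t₁ ≠ 0 := hne.resolve_left (not_not.mpr hα)
    obtain ⟨x₁, hx₁⟩ := hI.nonempty
    set β := σ t₁
    set k₀ := -(ε * (deriv ρ t₁ + deriv (deriv τ) t₁ / 4)) with hk₀
    set k₁ := deriv (deriv σ) t₁ / 2 with hk₁
    set k₂ := deriv (deriv (deriv τ)) t₁ / 8 with hk₂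
    have hQ1 : ∀ x ∈ I, β * (a x * deriv Q x) = k₀ + k₁ * X x + k₂ * X x ^ 2 := fun x hx => by
      have := hc t₁ ht₁ x hx
      simp only [Classifying, hα] at this
      rw [hk₀, hk₁, hk₂]
      linear_combination this
    set F : ℝ → ℝ := fun x => Q x - (k₀ / β * X x + k₁ / (2 * β) * X x ^ 2
      + k₂ / (3 * β) * X x ^ 3) with hF
    have hFd : ∀ x ∈ I, HasDerivAt F 0 x := fun x hx => by
      have hX := s.deriv_X x hx
      have := (hasDerivAt_on hQs s.isOpen hx).sub
        (((hX.const_mul (k₀ / β)).add ((hX.fun_pow 2).const_mul (k₁ / (2 * β)))).add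
          ((hX.fun_pow 3).const_mul (k₂ / (3 * β))))
      refine this.congr_deriv ?_
      have ha := s.ne_zero x hx
      have := hQ1 x hx
      push_cast
      field_simp at this ⊢
      linear_combination this
    have hFc : ∀ x ∈ I, F x = F x₁ := fun x hx => hI.eq_of_hasDerivAt_zero hFd hx hx₁
    have hQe : ∀ x ∈ I, Q x = F x₁ + k₀ / β * X x + k₁ / (2 * β) * X x ^ 2
        + k₂ / (3 * β) * X x ^ 3 := fun x hx => by
      rw [← hFc x hx, hF]; ring
    have hk : k₂ = 0 := by
      by_contra hk
      have key : ∀ t ∈ J, deriv τ t = 0 ∧ (k₂ / β) * σ t + deriv τ t * (k₁ / β)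
          = deriv (deriv (deriv τ)) t / 8 := fun t ht => by
        have := coeff_eq_zero_of_infinite hinf
          (p₀ := deriv τ t * F x₁ + σ t * (k₀ / β) + ε * (deriv ρ t + deriv (deriv τ) t / 4))
          (p₁ := 3 / 2 * deriv τ t * (k₀ / β) + σ t * (k₁ / β) - deriv (deriv σ) t / 2)
          (p₂ := (k₂ / β) * σ t + deriv τ t * (k₁ / β) - deriv (deriv (deriv τ)) t / 8)
          (p₃ := 5 / 6 * deriv τ t * (k₂ / β)) (p₄ := 0) (p₅ := 0) (p₆ := 0) (by
            rintro _ ⟨x, hx, rfl⟩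
            have e := hc t ht x hx
            simp only [Classifying] at e
            have e1 : a x * deriv Q x = (k₀ + k₁ * X x + k₂ * X x ^ 2) / β := by
              rw [← hQ1 x hx]; field_simp
            rw [e1, hQe x hx] at e
            linear_combination e)
        obtain ⟨-, -, h2, h3, -⟩ := this
        refine ⟨?_, by linear_combination h2⟩
        have h4 : 5 / 6 * (k₂ / β) ≠ 0 := mul_ne_zero (by norm_num) (div_ne_zero hk hβ)
        exact (mul_eq_zero.mp (by linear_combination h3 : 5 / 6 * (k₂ / β) * deriv τ t = 0)).resolve_left h4
      have e1 : ∀ t ∈ J, deriv (deriv τ) t = 0 := fun t ht =>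
        ((hasDerivAt_const t (0 : ℝ)).congr_on oJ (fun r hr => (key r hr).1) ht).deriv
      have e2 : deriv (deriv (deriv τ)) t₁ = 0 :=
        ((hasDerivAt_const t₁ (0 : ℝ)).congr_on oJ e1 ht₁).deriv
      apply hk
      rw [hk₂, e2, zero_div]
    refine ⟨F x₁, k₀ / β, k₁ / (2 * β), 0, 0, Or.inl rfl, fun x hx => ?_⟩
    rw [hQe x hx, hk]; ring
  · set α := deriv τ t₁
    set d := σ t₁ / α with hd
    have s' := s.shift (-(2 * d))
    obtain ⟨c₀, c₁, c₂, μ, hμ, hQf⟩ := s'.potForm_of_scaling hI hQs hα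
      (k₀ := deriv (deriv (deriv τ)) t₁ / 8 * (2 * d) ^ 2 - deriv (deriv σ) t₁ / 2 * (2 * d)
        - ε * (deriv ρ t₁ + deriv (deriv τ) t₁ / 4))
      (k₁ := deriv (deriv σ) t₁ / 2 - deriv (deriv (deriv τ)) t₁ / 4 * (2 * d))
      (k₂ := deriv (deriv (deriv τ)) t₁ / 8) (fun x hx => by
        have e := hc t₁ ht₁ x hx
        simp only [Classifying] at e
        have : σ t₁ = α * d := by rw [hd]; field_simp
        rw [this] at e
        linear_combination e)
    refine ⟨c₀, c₁, c₂, μ, -(2 * d), ?_, hQf⟩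
    rcases hμ with hμ | hμ
    · exact Or.inl hμ
    rcases eq_or_ne μ 0 with hμ0 | hμ0
    · exact Or.inl hμ0
    refine Or.inr ⟨?_, fun x hx h0 => hμ x hx (by rw [h0, sub_self])⟩
    have hd1 : ∀ x ∈ I, a x * deriv Q x = c₁ + 2 * c₂ * (X x - -(2 * d))
        - 2 * μ / (X x - -(2 * d)) ^ 3 := fun x hx => by
      have hX := (s'.deriv_X x hx)
      have hne := hμ x hx
      have := ((((hX.const_mul c₁).const_add c₀).add ((hX.fun_pow 2).const_mul c₂)).add
        ((hasDerivAt_const x μ).fun_div (hX.fun_pow 2) (pow_ne_zero 2 hne))).congr_on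
        s.isOpen (f := Q) hQf hx |>.deriv
      rw [this]; simp only [Nat.cast_ofNat, Nat.reduceSub, pow_one]
      have ha := s.ne_zero x hx
      field_simp; ring
    have key : ∀ t ∈ J, σ t - d * deriv τ t = 0 ∧ 3 / 2 * c₁ * deriv τ t
        + 2 * c₂ * (σ t - d * deriv τ t) - (deriv (deriv σ) t / 2
          - d * deriv (deriv (deriv τ)) t / 2) = 0 := fun t ht => by
      have := coeff_eq_zero_of_infinite (s'.infinite_image hI)
        (p₀ := -(2 * μ) * (σ t - d * deriv τ t)) (p₁ := 0) (p₂ := 0)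
        (p₃ := c₀ * deriv τ t + c₁ * (σ t - d * deriv τ t)
          - (deriv (deriv (deriv τ)) t / 8 * (2 * d) ^ 2 - deriv (deriv σ) t / 2 * (2 * d)
            - ε * (deriv ρ t + deriv (deriv τ) t / 4)))
        (p₄ := 3 / 2 * c₁ * deriv τ t + 2 * c₂ * (σ t - d * deriv τ t) - (deriv (deriv σ) t / 2
          - d * deriv (deriv (deriv τ)) t / 2))
        (p₅ := 2 * c₂ * deriv τ t - deriv (deriv (deriv τ)) t / 8) (p₆ := 0) (by
          rintro _ ⟨x, hx, rfl⟩
          have e := hc t ht x hx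
          simp only [Classifying] at e
          have hne := hμ x hx
          have e1 : Q x + 1 / 2 * (X x - -(2 * d)) * (a x * deriv Q x)
              = c₀ + 3 / 2 * c₁ * (X x - -(2 * d)) + 2 * c₂ * (X x - -(2 * d)) ^ 2 := by
            rw [hd1 x hx, hQf x hx]; field_simp; ring
          have e2 : (X x - -(2 * d)) ^ 3 * (a x * deriv Q x)
              = c₁ * (X x - -(2 * d)) ^ 3 + 2 * c₂ * (X x - -(2 * d)) ^ 4 - 2 * μ := by
            rw [hd1 x hx]; field_simp
          linear_combination (X x - -(2 * d)) ^ 3 * e - (X x - -(2 * d)) ^ 3 * deriv τ t * e1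
            - (σ t - d * deriv τ t) * e2)
      obtain ⟨h0, -, -, -, h4, -⟩ := this
      refine ⟨?_, h4⟩
      exact (mul_eq_zero.mp h0).resolve_left (by simpa using hμ0)
    have hσ' : ∀ t ∈ J, σ t = d * deriv τ t := fun t ht => by linear_combination (key t ht).1
    have hτ1 := deriv_smooth hτ oJ
    have hτ2 := deriv_smooth hτ1 oJ
    have f1 : ∀ t ∈ J, deriv σ t = d * deriv (deriv τ) t := fun t ht =>
      (((hasDerivAt_on hτ1 oJ ht).const_mul d).congr_on oJ hσ' ht).deriv
    have f2 : deriv (deriv σ) t₁ = d * deriv (deriv (deriv τ)) t₁ :=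
      (((hasDerivAt_on hτ2 oJ ht₁).const_mul d).congr_on oJ f1 ht₁).deriv
    have h4 := (key t₁ ht₁).2
    rw [f2, (key t₁ ht₁).1] at h4
    have : c₁ * α = 0 := by linear_combination (2 / 3) * h4
    exact (mul_eq_zero.mp this).resolve_right hα

end Straightening

/-! ### Linear equations of second order -/

/-- `f` solves `f'' = q f` on `I`, and `f₁` is its derivative. -/
def IsSol {𝕜 : Type*} [NontriviallyNormedField 𝕜] [NormedAlgebra ℝ 𝕜] (q : ℝ → 𝕜) (I : Set ℝ)
    (f f₁ : ℝ → 𝕜) : Prop :=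
  ∀ x ∈ I, HasDerivAt f (f₁ x) x ∧ HasDerivAt f₁ (q x * f x) x

section Sol

variable {𝕜 : Type*} [NontriviallyNormedField 𝕜] [NormedAlgebra ℝ 𝕜] {q : ℝ → 𝕜} {I : Set ℝ}
  {f f₁ g g₁ y y₁ : ℝ → 𝕜}

theorem IsSol.mono {I' : Set ℝ} (hf : IsSol q I f f₁) (h : I' ⊆ I) : IsSol q I' f f₁ :=
  fun x hx => hf x (h hx)

theorem IsSol.wronskian_const (hI : IsOpenInterval I) (hf : IsSol q I f f₁) (hg : IsSol q I g g₁)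
    {x x₀ : ℝ} (hx : x ∈ I) (hx₀ : x₀ ∈ I) :
    f x * g₁ x - f₁ x * g x = f x₀ * g₁ x₀ - f₁ x₀ * g x₀ := by
  refine hI.eq_of_hasDerivAt_zero (f := fun x => f x * g₁ x - f₁ x * g x) (fun z hz => ?_) hx hx₀
  refine HasDerivAt.congr_deriv
    (((hf z hz).1.fun_mul (hg z hz).2).sub ((hf z hz).2.fun_mul (hg z hz).1)) ?_
  ring

theorem IsSol.exists_comb (hI : IsOpenInterval I) (hf : IsSol q I f f₁) (hg : IsSol q I g g₁)
    (hy : IsSol q I y y₁) {x₀ : ℝ} (hx₀ : x₀ ∈ I) (hW : f x₀ * g₁ x₀ - f₁ x₀ * g x₀ ≠ 0) :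
    ∃ A B : 𝕜, ∀ x ∈ I, y x = A * f x + B * g x ∧ y₁ x = A * f₁ x + B * g₁ x := by
  set w := f x₀ * g₁ x₀ - f₁ x₀ * g x₀ with hw
  refine ⟨(y x₀ * g₁ x₀ - y₁ x₀ * g x₀) / w, (f x₀ * y₁ x₀ - f₁ x₀ * y x₀) / w, fun x hx => ?_⟩
  have h0 := hf.wronskian_const hI hg hx hx₀
  have h1 := hy.wronskian_const hI hg hx hx₀
  have h2 := hf.wronskian_const hI hy hx hx₀
  rw [← h1, ← h2]
  constructor
  · field_simp
    rw [hw, ← h0]; ring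
  · field_simp
    rw [hw, ← h0]; ring

theorem IsSol.comb (hf : IsSol q I f f₁) (hg : IsSol q I g g₁) (A B : 𝕜) :
    IsSol q I (fun x => A * f x + B * g x) (fun x => A * f₁ x + B * g₁ x) := fun x hx =>
  ⟨((hf x hx).1.const_mul A).add ((hg x hx).1.const_mul B),
    (((hf x hx).2.const_mul A).add ((hg x hx).2.const_mul B)).congr_deriv (by ring)⟩

theorem IsSol.congr (hI : IsOpen I) (hf : IsSol q I f f₁) (h : ∀ x ∈ I, g x = f x) :
    IsSol q I g f₁ := fun x hx =>
  ⟨(hf x hx).1.congr_on hI h hx, by rw [h x hx]; exact (hf x hx).2⟩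

theorem IsSol.congr_coeff {q' : ℝ → 𝕜} (hf : IsSol q I f f₁) (h : ∀ x ∈ I, q x = q' x) :
    IsSol q' I f f₁ := fun x hx => ⟨(hf x hx).1, by rw [← h x hx]; exact (hf x hx).2⟩

/-- Coefficients with respect to a fundamental system are unique. -/
theorem IsSol.comb_unique (hI : IsOpen I) (hf : IsSol q I f f₁) (hg : IsSol q I g g₁)
    {x₀ : ℝ} (hx₀ : x₀ ∈ I) (hW : f x₀ * g₁ x₀ - f₁ x₀ * g x₀ ≠ 0) {A B A' B' : 𝕜}
    (h : ∀ x ∈ I, A * f x + B * g x = A' * f x + B' * g x) : A = A' ∧ B = B' := by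
  have h0 := h x₀ hx₀
  have h1 : A * f₁ x₀ + B * g₁ x₀ = A' * f₁ x₀ + B' * g₁ x₀ :=
    ((hf.comb hg A B) x₀ hx₀).1.unique
      (((hf.comb hg A' B') x₀ hx₀).1.congr_on hI h hx₀)
  have e1 : (A - A') * (f x₀ * g₁ x₀ - f₁ x₀ * g x₀) = 0 := by
    linear_combination g₁ x₀ * h0 - g x₀ * h1
  have e2 : (B - B') * (f x₀ * g₁ x₀ - f₁ x₀ * g x₀) = 0 := by
    linear_combination f x₀ * h1 - f₁ x₀ * h0
  exact ⟨sub_eq_zero.mp ((mul_eq_zero.mp e1).resolve_right hW),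
    sub_eq_zero.mp ((mul_eq_zero.mp e2).resolve_right hW)⟩

end Sol

/-! ### The essential algebras for the potentials of the list -/

section Reduced

variable {ε : ℝ} {I J : Set ℝ} {B : ℝ → ℝ}

theorem straightening_reduced (hε : ε * ε = 1) (hI : IsOpen I) (hB : ContDiffOn ℝ ∞ B I) :
    Straightening ε I (fun _ => ε) B (fun _ => 1) (fun x => x) B where
  isOpen := hI
  sq := hε
  smooth_a := contDiffOn_const
  smooth_b := hB
  ne_zero := fun _ _ => one_ne_zero
  deriv_X := fun x _ => by simpa using hasDerivAt_id' x
  A_eq := fun _ _ => by simp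
  B_eq := fun _ _ => by simp

/-- The vector field with parameter functions `τ`, `σ`, `ρ` for the reduced class. -/
def redField (ε : ℝ) (B τ σ ρ : ℝ → ℝ) : VField := fun t x u =>
  (τ t, 1 / 2 * deriv τ t * x + σ t,
    (-(ε / 2) * (deriv (deriv τ) t * x ^ 2 / 4 + deriv σ t * x
        + (1 / 2 * deriv τ t * x + σ t) * B x) + ρ t) * u)

/-- The potential of the equation with the drift `B`. -/
def redPot (ε : ℝ) (B : ℝ → ℝ) (x : ℝ) : ℝ := -(ε / 2) * deriv B x + B x ^ 2 / 4

theorem symField_one (τ σ ρ : ℝ → ℝ) :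
    symField ε (fun _ => 1) (fun x => x) B τ σ ρ = redField ε B τ σ ρ := by
  funext t x u
  simp [symField, redField]

theorem potential_one : potential ε (fun _ => 1) B = redPot ε B := by
  funext x; simp [potential, redPot]

theorem essential_reduced_iff (hε : ε * ε = 1) (hJ : IsOpenInterval J) (hI : IsOpenInterval I)
    (hB : ContDiffOn ℝ ∞ B I) {v : VField} :
    (IsLieSymmetry (fun _ => ε) B J I v ∧ IsEssential J I v) ↔
      ∃ τ σ ρ : ℝ → ℝ, ContDiffOn ℝ ∞ τ J ∧ ContDiffOn ℝ ∞ σ J ∧ ContDiffOn ℝ ∞ ρ J ∧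
        (∀ t ∈ J, ∀ x ∈ I, ∀ u, v t x u = redField ε B τ σ ρ t x u) ∧
        ∀ t ∈ J, ∀ x ∈ I,
          Classifying ε (fun x => x) (redPot ε B) (deriv (redPot ε B)) τ σ ρ t x := by
  have := (straightening_reduced hε hI.isOpen hB).essential_iff hJ hI (v := v)
  simpa only [symField_one, potential_one, one_mul] using this

theorem classifying_regular_iff (hI : IsOpenInterval I) {c₀ c₁ c₂ : ℝ} {Q τ σ ρ : ℝ → ℝ}
    (hQ : ∀ x ∈ I, Q x = c₀ + c₁ * x + c₂ * x ^ 2) {t : ℝ} :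
    (∀ x ∈ I, Classifying ε (fun x => x) Q (deriv Q) τ σ ρ t x) ↔
      deriv (deriv (deriv τ)) t = 16 * c₂ * deriv τ t ∧
      deriv (deriv σ) t = 4 * c₂ * σ t + 3 * c₁ * deriv τ t ∧
      c₀ * deriv τ t + c₁ * σ t + ε * (deriv ρ t + deriv (deriv τ) t / 4) = 0 := by
  have hd : ∀ x ∈ I, deriv Q x = c₁ + 2 * c₂ * x := fun x hx => by
    have := ((((hasDerivAt_id' x).const_mul c₁).const_add c₀).add
      (((hasDerivAt_id' x).fun_pow 2).const_mul c₂)).congr_on hI.isOpen hQ hx |>.deriv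
    rw [this]; simp only [Nat.cast_ofNat, Nat.reduceSub, pow_one]; ring
  constructor
  · intro h
    have := coeff_eq_zero_of_infinite hI.infinite
      (p₀ := c₀ * deriv τ t + c₁ * σ t + ε * (deriv ρ t + deriv (deriv τ) t / 4))
      (p₁ := 3 / 2 * c₁ * deriv τ t + 2 * c₂ * σ t - deriv (deriv σ) t / 2)
      (p₂ := 2 * c₂ * deriv τ t - deriv (deriv (deriv τ)) t / 8)
      (p₃ := 0) (p₄ := 0) (p₅ := 0) (p₆ := 0) (fun x hx => by
        have e := h x hx
        simp only [Classifying, hd x hx, hQ x hx] at e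
        linear_combination e)
    obtain ⟨h0, h1, h2, -⟩ := this
    exact ⟨by linear_combination -8 * h2, by linear_combination -2 * h1, h0⟩
  · rintro ⟨h2, h1, h0⟩ x hx
    simp only [Classifying, hd x hx, hQ x hx]
    linear_combination h0 - x / 2 * h1 - x ^ 2 / 8 * h2

theorem classifying_singular_iff (hI : IsOpenInterval I) {c₀ c₂ μ : ℝ} (hμ : μ ≠ 0)
    (h0 : (0 : ℝ) ∉ I) {Q τ σ ρ : ℝ → ℝ} (hJ : IsOpen J)
    (hQ : ∀ x ∈ I, Q x = c₀ + c₂ * x ^ 2 + μ / x ^ 2) :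
    (∀ t ∈ J, ∀ x ∈ I, Classifying ε (fun x => x) Q (deriv Q) τ σ ρ t x) ↔
      ∀ t ∈ J, σ t = 0 ∧ deriv (deriv (deriv τ)) t = 16 * c₂ * deriv τ t ∧
      c₀ * deriv τ t + ε * (deriv ρ t + deriv (deriv τ) t / 4) = 0 := by
  have hne : ∀ x ∈ I, x ≠ 0 := fun x hx h => h0 (h ▸ hx)
  have hd : ∀ x ∈ I, deriv Q x = 2 * c₂ * x - 2 * μ / x ^ 3 := fun x hx => by
    have hx0 := hne x hx
    have := ((((hasDerivAt_id' x).fun_pow 2).const_mul c₂).const_add c₀).add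
      ((hasDerivAt_const x μ).fun_div ((hasDerivAt_id' x).fun_pow 2) (pow_ne_zero 2 hx0))
      |>.congr_on hI.isOpen hQ hx |>.deriv
    rw [this]; simp only [Nat.cast_ofNat, Nat.reduceSub, pow_one]
    field_simp; ring
  constructor
  · intro h t ht
    have := coeff_eq_zero_of_infinite hI.infinite
      (p₀ := -(2 * μ) * σ t) (p₁ := 0) (p₂ := 0)
      (p₃ := c₀ * deriv τ t + ε * (deriv ρ t + deriv (deriv τ) t / 4))
      (p₄ := 2 * c₂ * σ t - deriv (deriv σ) t / 2)
      (p₅ := 2 * c₂ * deriv τ t - deriv (deriv (deriv τ)) t / 8) (p₆ := 0) (fun x hx => by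
        have e := h t ht x hx
        have hx0 := hne x hx
        have e1 : Q x + 1 / 2 * x * deriv Q x = c₀ + 2 * c₂ * x ^ 2 := by
          rw [hd x hx, hQ x hx]; field_simp; ring
        have e2 : x ^ 3 * deriv Q x = 2 * c₂ * x ^ 4 - 2 * μ := by
          rw [hd x hx]; field_simp
        simp only [Classifying] at e
        linear_combination x ^ 3 * e - x ^ 3 * deriv τ t * e1 - σ t * e2)
    obtain ⟨h0, -, -, h3, -, h5, -⟩ := this
    exact ⟨(mul_eq_zero.mp h0).resolve_left (by simpa using hμ), by linear_combination -8 * h5, h3⟩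
  · intro h t ht x hx
    obtain ⟨hσ, h5, h3⟩ := h t ht
    have f1 : ∀ t ∈ J, deriv σ t = 0 := fun t ht =>
      ((hasDerivAt_const t (0 : ℝ)).congr_on hJ (fun r hr => (h r hr).1) ht).deriv
    have f2 : deriv (deriv σ) t = 0 := ((hasDerivAt_const t (0 : ℝ)).congr_on hJ f1 ht).deriv
    have hx0 := hne x hx
    have e1 : Q x + 1 / 2 * x * deriv Q x = c₀ + 2 * c₂ * x ^ 2 := by
      rw [hd x hx, hQ x hx]; field_simp; ring
    simp only [Classifying, hσ, f2]
    linear_combination deriv τ t * e1 + h3 - x ^ 2 / 8 * h5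

end Reduced

section TimeFunctions

/-- `1`, `f₁`, `f₂` form a fundamental system of `τ''' = k τ'`. -/
structure TimePair (k : ℝ) (f₁ f₂ : ℝ → ℝ) : Prop where
  smooth₁ : ContDiff ℝ ∞ f₁
  smooth₂ : ContDiff ℝ ∞ f₂
  eq₁ : ∀ t, deriv (deriv (deriv f₁)) t = k * deriv f₁ t
  eq₂ : ∀ t, deriv (deriv (deriv f₂)) t = k * deriv f₂ t
  wronskian : ∀ t, deriv f₁ t * deriv (deriv f₂) t - deriv (deriv f₁) t * deriv f₂ t ≠ 0

/-- `g₁`, `g₂` form a fundamental system of `σ'' = k σ`. -/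
structure SpacePair (k : ℝ) (g₁ g₂ : ℝ → ℝ) : Prop where
  smooth₁ : ContDiff ℝ ∞ g₁
  smooth₂ : ContDiff ℝ ∞ g₂
  eq₁ : ∀ t, deriv (deriv g₁) t = k * g₁ t
  eq₂ : ∀ t, deriv (deriv g₂) t = k * g₂ t
  wronskian : ∀ t, g₁ t * deriv g₂ t - deriv g₁ t * g₂ t ≠ 0

theorem hasDerivAt_self {f : ℝ → ℝ} (hf : ContDiff ℝ ∞ f) (t : ℝ) :
    HasDerivAt f (deriv f t) t := (hf.differentiable (by simp) t).hasDerivAt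

theorem deriv_infty {f : ℝ → ℝ} (hf : ContDiff ℝ ∞ f) : ContDiff ℝ ∞ (deriv f) :=
  (contDiff_infty_iff_deriv.mp hf).2

variable {k : ℝ} {f₁ f₂ : ℝ → ℝ} {J : Set ℝ}

theorem SpacePair.isSol (h : SpacePair k f₁ f₂) (J : Set ℝ) :
    IsSol (fun _ => k) J f₁ (deriv f₁) ∧ IsSol (fun _ => k) J f₂ (deriv f₂) :=
  ⟨fun t _ => ⟨hasDerivAt_self h.smooth₁ t, h.eq₁ t ▸ hasDerivAt_self (deriv_infty h.smooth₁) t⟩,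
    fun t _ => ⟨hasDerivAt_self h.smooth₂ t, h.eq₂ t ▸ hasDerivAt_self (deriv_infty h.smooth₂) t⟩⟩

theorem SpacePair.comb (h : SpacePair k f₁ f₂) (hJ : IsOpenInterval J) {σ : ℝ → ℝ}
    (hσ : ContDiffOn ℝ ∞ σ J) (he : ∀ t ∈ J, deriv (deriv σ) t = k * σ t) :
    ∃ k₁ k₂ : ℝ, ∀ t ∈ J, σ t = k₁ * f₁ t + k₂ * f₂ t ∧
      deriv σ t = k₁ * deriv f₁ t + k₂ * deriv f₂ t := by
  obtain ⟨t₀, ht₀⟩ := hJ.nonempty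
  have hy : IsSol (fun _ => k) J σ (deriv σ) := fun t ht => ⟨hasDerivAt_on hσ hJ.isOpen ht,
    he t ht ▸ hasDerivAt_on (deriv_smooth hσ hJ.isOpen) hJ.isOpen ht⟩
  exact (h.isSol J).1.exists_comb hJ (h.isSol J).2 hy ht₀ (h.wronskian t₀)

theorem SpacePair.indep (h : SpacePair k f₁ f₂) (hJ : IsOpenInterval J) {k₁ k₂ : ℝ}
    (he : ∀ t ∈ J, k₁ * f₁ t + k₂ * f₂ t = 0) : k₁ = 0 ∧ k₂ = 0 := by
  obtain ⟨t₀, ht₀⟩ := hJ.nonempty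
  exact (h.isSol J).1.comb_unique hJ.isOpen (h.isSol J).2 ht₀ (h.wronskian t₀) (A' := 0) (B' := 0)
    (fun t ht => by simpa using he t ht)

theorem TimePair.toSpacePair (h : TimePair k f₁ f₂) : SpacePair k (deriv f₁) (deriv f₂) :=
  ⟨deriv_infty h.smooth₁, deriv_infty h.smooth₂, h.eq₁, h.eq₂, h.wronskian⟩

theorem TimePair.comb (h : TimePair k f₁ f₂) (hJ : IsOpenInterval J) {τ : ℝ → ℝ}
    (hτ : ContDiffOn ℝ ∞ τ J) (he : ∀ t ∈ J, deriv (deriv (deriv τ)) t = k * deriv τ t) :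
    ∃ k₀ k₁ k₂ : ℝ, ∀ t ∈ J, τ t = k₀ + k₁ * f₁ t + k₂ * f₂ t ∧
      deriv τ t = k₁ * deriv f₁ t + k₂ * deriv f₂ t ∧
      deriv (deriv τ) t = k₁ * deriv (deriv f₁) t + k₂ * deriv (deriv f₂) t := by
  obtain ⟨t₀, ht₀⟩ := hJ.nonempty
  obtain ⟨k₁, k₂, hk⟩ := h.toSpacePair.comb hJ (deriv_smooth hτ hJ.isOpen) he
  refine ⟨τ t₀ - (k₁ * f₁ t₀ + k₂ * f₂ t₀), k₁, k₂, fun t ht => ⟨?_, hk t ht⟩⟩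
  have := hJ.eq_of_hasDerivAt_zero (f := fun t => τ t - (k₁ * f₁ t + k₂ * f₂ t)) (fun r hr => by
    refine HasDerivAt.congr_deriv ((hasDerivAt_on hτ hJ.isOpen hr).sub
      (((hasDerivAt_self h.smooth₁ r).const_mul k₁).add
        ((hasDerivAt_self h.smooth₂ r).const_mul k₂))) ?_
    rw [(hk r hr).1]; ring) ht ht₀
  linear_combination this

theorem TimePair.indep (h : TimePair k f₁ f₂) (hJ : IsOpenInterval J) {k₀ k₁ k₂ : ℝ}
    (he : ∀ t ∈ J, k₀ + k₁ * f₁ t + k₂ * f₂ t = 0) : k₀ = 0 ∧ k₁ = 0 ∧ k₂ = 0 := by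
  obtain ⟨t₀, ht₀⟩ := hJ.nonempty
  have hd : ∀ t ∈ J, k₁ * deriv f₁ t + k₂ * deriv f₂ t = 0 := fun t ht => by
    have h1 := (((hasDerivAt_self h.smooth₁ t).const_mul k₁).const_add k₀).add
        ((hasDerivAt_self h.smooth₂ t).const_mul k₂)
    exact h1.unique ((hasDerivAt_const t (0 : ℝ)).congr_on hJ.isOpen he ht)
  obtain ⟨rfl, rfl⟩ := h.toSpacePair.indep hJ hd
  exact ⟨by simpa using he t₀ ht₀, rfl, rfl⟩

theorem TimePair.exists_params (h : TimePair k f₁ f₂) (hJ : IsOpenInterval J) {ε κ : ℝ}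
    (hε : ε * ε = 1) {τ ρ : ℝ → ℝ} (hτ : ContDiffOn ℝ ∞ τ J) (hρ : ContDiffOn ℝ ∞ ρ J)
    (he : ∀ t ∈ J, deriv (deriv (deriv τ)) t = k * deriv τ t)
    (hr : ∀ t ∈ J, -κ * deriv τ t + ε * (deriv ρ t + deriv (deriv τ) t / 4) = 0) :
    ∃ k₀ k₁ k₂ r : ℝ, ∀ t ∈ J, (τ t = k₀ + k₁ * f₁ t + k₂ * f₂ t ∧
      deriv τ t = k₁ * deriv f₁ t + k₂ * deriv f₂ t ∧
      deriv (deriv τ) t = k₁ * deriv (deriv f₁) t + k₂ * deriv (deriv f₂) t) ∧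
      ρ t = ε * κ * τ t - deriv τ t / 4 + r := by
  obtain ⟨k₀, k₁, k₂, hk⟩ := h.comb hJ hτ he
  obtain ⟨t₀, ht₀⟩ := hJ.nonempty
  refine ⟨k₀, k₁, k₂, ρ t₀ - (ε * κ * τ t₀ - deriv τ t₀ / 4), fun t ht => ⟨hk t ht, ?_⟩⟩
  have := hJ.eq_of_hasDerivAt_zero (f := fun t => ρ t - (ε * κ * τ t - deriv τ t / 4))
    (fun r hr' => ((hasDerivAt_on hρ hJ.isOpen hr').sub
      (((hasDerivAt_on hτ hJ.isOpen hr').const_mul (ε * κ)).sub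
        ((hasDerivAt_on (deriv_smooth hτ hJ.isOpen) hJ.isOpen hr').div_const 4))).congr_deriv (by
      linear_combination ε * hr r hr' - (deriv ρ r + deriv (deriv τ) r / 4) * hε)) ht ht₀
  linear_combination this

theorem TimePair.of_params (h : TimePair k f₁ f₂) {ε κ : ℝ} (hε : ε * ε = 1) (k₀ k₁ k₂ r : ℝ) :
    ∃ τ ρ : ℝ → ℝ, ContDiff ℝ ∞ τ ∧ ContDiff ℝ ∞ ρ ∧ (∀ t, τ t = k₀ + k₁ * f₁ t + k₂ * f₂ t ∧
      deriv τ t = k₁ * deriv f₁ t + k₂ * deriv f₂ t ∧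
      deriv (deriv τ) t = k₁ * deriv (deriv f₁) t + k₂ * deriv (deriv f₂) t ∧
      ρ t = ε * κ * (τ t - k₀) - deriv τ t / 4 + r ∧
      deriv (deriv (deriv τ)) t = k * deriv τ t ∧
      -κ * deriv τ t + ε * (deriv ρ t + deriv (deriv τ) t / 4) = 0) := by
  have comb : ∀ {f g : ℝ → ℝ}, ContDiff ℝ ∞ f → ContDiff ℝ ∞ g → deriv (fun t => k₁ * f t + k₂ * g t)
      = fun t => k₁ * deriv f t + k₂ * deriv g t := fun hf hg => funext fun t =>
    (((hasDerivAt_self hf t).const_mul k₁).add ((hasDerivAt_self hg t).const_mul k₂)).deriv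
  have dτ : deriv (fun t => k₀ + k₁ * f₁ t + k₂ * f₂ t) = fun t => k₁ * deriv f₁ t + k₂ * deriv f₂ t :=
    funext fun t => ((((hasDerivAt_self h.smooth₁ t).const_mul k₁).const_add k₀).add
      ((hasDerivAt_self h.smooth₂ t).const_mul k₂)).deriv
  have d1 := deriv_infty h.smooth₁
  have d2 := deriv_infty h.smooth₂
  have sτ : ContDiff ℝ ∞ (fun t => k₀ + k₁ * f₁ t + k₂ * f₂ t) :=
    (contDiff_const.add (contDiff_const.mul h.smooth₁)).add (contDiff_const.mul h.smooth₂)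
  refine ⟨fun t => k₀ + k₁ * f₁ t + k₂ * f₂ t, fun t => ε * κ * (k₀ + k₁ * f₁ t + k₂ * f₂ t - k₀)
    - deriv (fun t => k₀ + k₁ * f₁ t + k₂ * f₂ t) t / 4 + r, sτ,
    ((contDiff_const.mul (sτ.sub contDiff_const)).sub
      ((deriv_infty sτ).div_const 4)).add contDiff_const,
    fun t => ⟨rfl, by rw [dτ], by rw [dτ, comb d1 d2], rfl, ?_, ?_⟩⟩
  · rw [dτ, comb d1 d2, comb (deriv_infty d1) (deriv_infty d2)]
    simp only [h.eq₁ t, h.eq₂ t]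
    ring
  · rw [(((((hasDerivAt_self sτ t).sub_const k₀).const_mul (ε * κ)).fun_sub
      ((hasDerivAt_self (deriv_infty sτ) t).div_const 4)).add_const r).deriv]
    linear_combination κ * deriv (fun t => k₀ + k₁ * f₁ t + k₂ * f₂ t) t * hε

/-- Differentiation of polynomials of degree four. -/
theorem hasDerivAt_quartic (a b c d e t : ℝ) :
    HasDerivAt (fun t => a + b * t + c * t ^ 2 + d * t ^ 3 + e * t ^ 4)
      (b + 2 * c * t + 3 * d * t ^ 2 + 4 * e * t ^ 3) t := by
  refine ((((((hasDerivAt_id' t).const_mul b).const_add a).add ((hasDerivAt_pow 2 t).const_mul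
    c)).add ((hasDerivAt_pow 3 t).const_mul d)).add ((hasDerivAt_pow 4 t).const_mul e)).congr_deriv ?_
  push_cast
  ring

theorem deriv_of_quartic (a b c d e : ℝ) {f g : ℝ → ℝ}
    (hf : ∀ t, f t = a + b * t + c * t ^ 2 + d * t ^ 3 + e * t ^ 4)
    (hg : ∀ t, g t = b + 2 * c * t + 3 * d * t ^ 2 + 4 * e * t ^ 3) : deriv f = g := by
  rw [funext hf, funext hg]
  exact funext fun t => (hasDerivAt_quartic a b c d e t).deriv

theorem IsOpenInterval.exists_quartic (hJ : IsOpenInterval J) (b c d e : ℝ) {f f' : ℝ → ℝ}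
    (hf : ∀ t ∈ J, HasDerivAt f (f' t) t)
    (h : ∀ t ∈ J, f' t = b + 2 * c * t + 3 * d * t ^ 2 + 4 * e * t ^ 3) :
    ∃ a, ∀ t ∈ J, f t = a + b * t + c * t ^ 2 + d * t ^ 3 + e * t ^ 4 := by
  obtain ⟨t₀, ht₀⟩ := hJ.nonempty
  refine ⟨f t₀ - (0 + b * t₀ + c * t₀ ^ 2 + d * t₀ ^ 3 + e * t₀ ^ 4), fun t ht => ?_⟩
  have := hJ.eq_of_hasDerivAt_zero (f := fun t => f t - (0 + b * t + c * t ^ 2 + d * t ^ 3 + e * t ^ 4))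
    (fun r hr => ((hf r hr).sub (hasDerivAt_quartic 0 b c d e r)).congr_deriv (by
      rw [h r hr]; ring)) ht ht₀
  linear_combination this

theorem timePair_poly : TimePair (16 * 0) (fun t => t) (fun t => t ^ 2) := by
  have d1 : deriv (fun t : ℝ => t) = fun _ => 1 := by funext t; simp
  have d2 : deriv (fun t : ℝ => t ^ 2) = fun t => 2 * t := by funext t; simp
  have d3 : deriv (fun t : ℝ => 2 * t) = fun _ => 2 := by funext t; simp
  refine ⟨contDiff_id, contDiff_id.pow 2, fun t => ?_, fun t => ?_, fun t => ?_⟩ <;>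
  simp [d1, d2, d3]

theorem spacePair_poly : SpacePair (4 * 0) (fun _ => 1) (fun t => t) := by
  have d1 : deriv (fun t : ℝ => t) = fun _ => 1 := by funext t; simp
  refine ⟨contDiff_const, contDiff_id, fun t => ?_, fun t => ?_, fun t => ?_⟩ <;>
  simp [d1]

theorem deriv_cos_mul (w : ℝ) : deriv (fun t => Real.cos (w * t)) = fun t => -w * Real.sin (w * t) :=
  funext fun t => by
    rw [((hasDerivAt_id' t).const_mul w).cos.deriv]; ring

theorem deriv_sin_mul (w : ℝ) : deriv (fun t => Real.sin (w * t)) = fun t => w * Real.cos (w * t) :=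
  funext fun t => by
    rw [((hasDerivAt_id' t).const_mul w).sin.deriv]; ring

theorem deriv_exp_mul (w : ℝ) : deriv (fun t => Real.exp (w * t)) = fun t => w * Real.exp (w * t) :=
  funext fun t => by
    rw [((hasDerivAt_id' t).const_mul w).exp.deriv]; ring

theorem deriv_smul_fun {c : ℝ} {f f' : ℝ → ℝ} (h : deriv f = f') :
    deriv (fun t => c * f t) = fun t => c * f' t := by
  funext t; rw [deriv_const_mul_field', h]

theorem timePair_trig :
    TimePair (16 * (-1)) (fun t => Real.cos (4 * t)) (fun t => Real.sin (4 * t)) := by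
  refine ⟨by fun_prop, by fun_prop, fun t => ?_, fun t => ?_, fun t => ?_⟩
  · simp only [deriv_cos_mul, deriv_smul_fun (deriv_sin_mul 4),
      deriv_smul_fun (deriv_smul_fun (deriv_cos_mul 4))]; ring
  · simp only [deriv_sin_mul, deriv_smul_fun (deriv_cos_mul 4),
      deriv_smul_fun (deriv_smul_fun (deriv_sin_mul 4))]; ring
  · simp only [deriv_cos_mul, deriv_sin_mul, deriv_smul_fun (deriv_cos_mul 4),
      deriv_smul_fun (deriv_sin_mul 4)]
    have := Real.sin_sq_add_cos_sq (4 * t)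
    intro h
    nlinarith

theorem spacePair_trig :
    SpacePair (4 * (-1)) (fun t => Real.sin (2 * t)) (fun t => Real.cos (2 * t)) := by
  refine ⟨by fun_prop, by fun_prop, fun t => ?_, fun t => ?_, fun t => ?_⟩
  · simp only [deriv_sin_mul, deriv_smul_fun (deriv_cos_mul 2)]; ring
  · simp only [deriv_cos_mul, deriv_smul_fun (deriv_sin_mul 2)]; ring
  · simp only [deriv_cos_mul, deriv_sin_mul]
    have := Real.sin_sq_add_cos_sq (2 * t)
    intro h
    nlinarith

theorem timePair_exp :
    TimePair (16 * 1) (fun t => Real.exp (4 * t)) (fun t => Real.exp (-4 * t)) := by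
  refine ⟨by fun_prop, by fun_prop, fun t => ?_, fun t => ?_, fun t => ?_⟩
  · simp only [deriv_exp_mul, deriv_smul_fun (deriv_exp_mul 4),
      deriv_smul_fun (deriv_smul_fun (deriv_exp_mul 4))]; ring
  · simp only [deriv_exp_mul, deriv_smul_fun (deriv_exp_mul (-4)),
      deriv_smul_fun (deriv_smul_fun (deriv_exp_mul (-4)))]; ring
  · simp only [deriv_exp_mul, deriv_smul_fun (deriv_exp_mul 4),
      deriv_smul_fun (deriv_exp_mul (-4))]
    have := Real.exp_pos (4 * t)
    have := Real.exp_pos (-4 * t)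
    intro h; nlinarith [mul_pos (Real.exp_pos (4 * t)) (Real.exp_pos (-4 * t))]

theorem spacePair_exp :
    SpacePair (4 * 1) (fun t => Real.exp (2 * t)) (fun t => Real.exp (-2 * t)) := by
  refine ⟨by fun_prop, by fun_prop, fun t => ?_, fun t => ?_, fun t => ?_⟩
  · simp only [deriv_exp_mul, deriv_smul_fun (deriv_exp_mul 2)]; ring
  · simp only [deriv_exp_mul, deriv_smul_fun (deriv_exp_mul (-2))]; ring
  · simp only [deriv_exp_mul]
    have := mul_pos (Real.exp_pos (2 * t)) (Real.exp_pos (-2 * t))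
    intro h
    nlinarith

end TimeFunctions

section TableBases

variable {ε : ℝ} {I J : Set ℝ} {B : ℝ → ℝ} {κ c₂ μ : ℝ} {f₁ f₂ g₁ g₂ : ℝ → ℝ} {S : Set VField}

theorem isBasisOn_singular (hε : ε * ε = 1) (hJ : IsOpenInterval J) (hI : IsOpenInterval I)
    (hB : ContDiffOn ℝ ∞ B I) (hμ : μ ≠ 0) (h0 : (0 : ℝ) ∉ I)
    (hQ : ∀ x ∈ I, redPot ε B x = -κ + c₂ * x ^ 2 + μ / x ^ 2) (hf : TimePair (16 * c₂) f₁ f₂)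
    (hS : ∀ v, v ∈ S ↔ (IsLieSymmetry (fun _ => ε) B J I v ∧ IsEssential J I v)) :
    IsBasisOn J I S [fieldT, fieldU, fieldD ε B κ f₁, fieldD ε B κ f₂] := by
  obtain ⟨t₀, ht₀⟩ := hJ.nonempty
  obtain ⟨x₀, hx₀⟩ := hI.nonempty
  refine isBasisOn_four (fun v => (hS v).trans ((essential_reduced_iff hε hJ hI hB).trans ?_))
    fun c₀ c₁ c₂ c₃ h => ?_
  · constructor
    · rintro ⟨τ, σ, ρ, hτ, hσ, hρ, hv, hc⟩
      rw [classifying_singular_iff hI hμ h0 hJ.isOpen hQ] at hc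
      obtain ⟨k₀, k₁, k₂, r, hk⟩ := hf.exists_params hJ hε hτ hρ (fun t ht => (hc t ht).2.1)
        (fun t ht => (hc t ht).2.2)
      refine ⟨k₀, ε * κ * k₀ + r, k₁, k₂, fun t ht x hx u => ?_⟩
      have hσ1 : deriv σ t = 0 :=
        ((hasDerivAt_const t (0 : ℝ)).congr_on hJ.isOpen (fun r hr => (hc r hr).1) ht).deriv
      rw [hv t ht x hx u]
      simp only [redField, fieldT, fieldU, fieldD, (hc t ht).1, hσ1, (hk t ht).2]
      rw [(hk t ht).1.2.1, (hk t ht).1.2.2, (hk t ht).1.1]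
      simp only [Prod.smul_mk, Prod.mk_add_mk, smul_eq_mul, Prod.mk.injEq]
      refine ⟨by ring, by ring, ?_⟩
      linear_combination (1 / 4 * u * (k₁ * deriv f₁ t + k₂ * deriv f₂ t)) * hε
    · rintro ⟨k₀, k, k₁, k₂, hv⟩
      obtain ⟨τ, ρ, sτ, sρ, hk⟩ := hf.of_params (κ := κ) hε k₀ k₁ k₂ k
      refine ⟨τ, fun _ => 0, ρ, sτ.contDiffOn, contDiffOn_const, sρ.contDiffOn,
        fun t ht x hx u => ?_, ?_⟩
      · obtain ⟨e1, e2, e3, e4, -⟩ := hk t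
        rw [hv t ht x hx u]
        simp only [redField, fieldT, fieldU, fieldD, e4, e3, e2, e1, deriv_const']
        simp only [Prod.smul_mk, Prod.mk_add_mk, smul_eq_mul, Prod.mk.injEq]
        refine ⟨by ring, by ring, ?_⟩
        linear_combination -(1 / 4 * u * (k₁ * deriv f₁ t + k₂ * deriv f₂ t)) * hε
      · rw [classifying_singular_iff hI hμ h0 hJ.isOpen hQ]
        exact fun t ht => ⟨rfl, (hk t).2.2.2.2⟩
  · have h1 : ∀ t ∈ J, c₀ + c₂ * f₁ t + c₃ * f₂ t = 0 := fun t ht => by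
      have := congrArg (fun p => p.1) (h t ht x₀ hx₀ 0)
      simpa [fieldT, fieldU, fieldD] using this
    obtain ⟨rfl, rfl, rfl⟩ := hf.indep hJ h1
    have := congrArg (fun p => p.2.2) (h t₀ ht₀ x₀ hx₀ 1)
    refine ⟨rfl, ?_, rfl, rfl⟩
    simpa [fieldT, fieldU, fieldD] using this

theorem isBasisOn_regular (hε : ε * ε = 1) (hJ : IsOpenInterval J) (hI : IsOpenInterval I)
    (hB : ContDiffOn ℝ ∞ B I)
    (hQ : ∀ x ∈ I, redPot ε B x = -κ + 0 * x + c₂ * x ^ 2) (hf : TimePair (16 * c₂) f₁ f₂)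
    (hg : SpacePair (4 * c₂) g₁ g₂)
    (hS : ∀ v, v ∈ S ↔ (IsLieSymmetry (fun _ => ε) B J I v ∧ IsEssential J I v)) :
    IsBasisOn J I S [fieldT, fieldU, fieldP ε B g₁, fieldP ε B g₂,
      fieldD ε B κ f₁, fieldD ε B κ f₂] := by
  obtain ⟨t₀, ht₀⟩ := hJ.nonempty
  obtain ⟨x₀, hx₀⟩ := hI.nonempty
  refine isBasisOn_six (fun v => (hS v).trans ((essential_reduced_iff hε hJ hI hB).trans ?_))
    fun c₀ c₁ d₁ d₂ c₂ c₃ h => ?_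
  · constructor
    · rintro ⟨τ, σ, ρ, hτ, hσ, hρ, hv, hc⟩
      replace hc := fun t ht => (classifying_regular_iff hI hQ).mp (hc t ht)
      obtain ⟨k₀, k₁, k₂, r, hk⟩ := hf.exists_params (κ := κ) hJ hε hτ hρ
        (fun t ht => (hc t ht).1) (fun t ht => by linear_combination (hc t ht).2.2)
      obtain ⟨m₁, m₂, hm⟩ := hg.comb hJ hσ (fun t ht => by rw [(hc t ht).2.1]; ring)
      refine ⟨k₀, ε * κ * k₀ + r, m₁, m₂, k₁, k₂, fun t ht x hx u => ?_⟩
      rw [hv t ht x hx u]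
      simp only [redField, fieldT, fieldU, fieldD, fieldP, (hk t ht).2]
      rw [(hk t ht).1.2.1, (hk t ht).1.2.2, (hk t ht).1.1, (hm t ht).1, (hm t ht).2]
      simp only [Prod.smul_mk, Prod.mk_add_mk, smul_eq_mul, Prod.mk.injEq]
      refine ⟨by ring, by ring, ?_⟩
      linear_combination (1 / 4 * u * (k₁ * deriv f₁ t + k₂ * deriv f₂ t)) * hε
    · rintro ⟨k₀, k, m₁, m₂, k₁, k₂, hv⟩
      obtain ⟨τ, ρ, sτ, sρ, hk⟩ := hf.of_params (κ := κ) hε k₀ k₁ k₂ k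
      have hσ := (hg.isSol Set.univ).1.comb (hg.isSol Set.univ).2 m₁ m₂
      have dσ : deriv (fun t => m₁ * g₁ t + m₂ * g₂ t) = fun t => m₁ * deriv g₁ t + m₂ * deriv g₂ t :=
        funext fun t => (hσ t trivial).1.deriv
      refine ⟨τ, fun t => m₁ * g₁ t + m₂ * g₂ t, ρ, sτ.contDiffOn,
        ((contDiff_const.mul hg.smooth₁).add (contDiff_const.mul hg.smooth₂)).contDiffOn,
        sρ.contDiffOn, fun t ht x hx u => ?_, fun t ht => (classifying_regular_iff hI hQ).mpr
          ⟨(hk t).2.2.2.2.1, ?_, by linear_combination (hk t).2.2.2.2.2⟩⟩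
      · obtain ⟨e1, e2, e3, e4, -⟩ := hk t
        rw [hv t ht x hx u]
        simp only [redField, fieldT, fieldU, fieldD, fieldP, e4, e3, e2, e1, dσ]
        simp only [Prod.smul_mk, Prod.mk_add_mk, smul_eq_mul, Prod.mk.injEq]
        refine ⟨by ring, by ring, ?_⟩
        linear_combination -(1 / 4 * u * (k₁ * deriv f₁ t + k₂ * deriv f₂ t)) * hε
      · rw [dσ, (hσ t trivial).2.deriv]
        ring
  · have h1 : ∀ t ∈ J, c₀ + c₂ * f₁ t + c₃ * f₂ t = 0 := fun t ht => by
      have := congrArg (fun p => p.1) (h t ht x₀ hx₀ 0)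
      simpa [fieldT, fieldU, fieldD, fieldP] using this
    obtain ⟨rfl, rfl, rfl⟩ := hf.indep hJ h1
    have h2 : ∀ t ∈ J, d₁ * g₁ t + d₂ * g₂ t = 0 := fun t ht => by
      have := congrArg (fun p => p.2.1) (h t ht x₀ hx₀ 0)
      simpa [fieldT, fieldU, fieldD, fieldP] using this
    obtain ⟨rfl, rfl⟩ := hg.indep hJ h2
    have := congrArg (fun p => p.2.2) (h t₀ ht₀ x₀ hx₀ 1)
    refine ⟨rfl, ?_, rfl, rfl, rfl, rfl⟩
    simpa [fieldT, fieldU, fieldD, fieldP] using this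

theorem isBasisOn_airy (hε : ε * ε = 1) (hJ : IsOpenInterval J) (hI : IsOpenInterval I)
    (hB : ContDiffOn ℝ ∞ B I) (hQ : ∀ x ∈ I, redPot ε B x = 0 + 1 * x + 0 * x ^ 2)
    (hS : ∀ v, v ∈ S ↔ (IsLieSymmetry (fun _ => ε) B J I v ∧ IsEssential J I v)) :
    IsBasisOn J I S [fieldT, fieldU, fieldPbar ε B (fun t => t), fieldPbar ε B (fun t => t ^ 2 / 2),
        fieldD ε B 0 (fun t => t) + (3 / 2 : ℝ) • fieldPbar ε B (fun t => t ^ 3 / 3),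
        fieldD ε B 0 (fun t => t ^ 2) + fieldPbar ε B (fun t => t ^ 4 / 4)] := by
  have oJ := hJ.isOpen
  obtain ⟨t₀, ht₀⟩ := hJ.nonempty
  obtain ⟨x₀, hx₀⟩ := hI.nonempty
  have p1 : deriv (fun t : ℝ => t) = fun _ => 1 := by funext t; simp
  have p2 : deriv (fun t : ℝ => t ^ 2 / 2) = fun t => t :=
    deriv_of_quartic 0 0 (1 / 2) 0 0 (fun t => by ring) (fun t => by ring)
  have p3 : deriv (fun t : ℝ => t ^ 3 / 3) = fun t => t ^ 2 :=
    deriv_of_quartic 0 0 0 (1 / 3) 0 (fun t => by ring) (fun t => by ring)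
  have p4 : deriv (fun t : ℝ => t ^ 4 / 4) = fun t => t ^ 3 :=
    deriv_of_quartic 0 0 0 0 (1 / 4) (fun t => by ring) (fun t => by ring)
  have d2 : deriv (fun t : ℝ => t ^ 2) = fun t => 2 * t := by funext t; simp
  have d2' : deriv (fun t : ℝ => 2 * t) = fun _ => 2 := by funext t; simp
  have d3 : deriv (fun t : ℝ => t ^ 3) = fun t => 3 * t ^ 2 := by funext t; simp
  refine isBasisOn_six (fun v => (hS v).trans ((essential_reduced_iff hε hJ hI hB).trans ?_))
    fun c₀ c₁ c₂ c₃ c₄ c₅ h => ?_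
  · constructor
    · rintro ⟨τ, σ, ρ, hτ, hσ, hρ, hv, hc⟩
      replace hc := fun t ht => (classifying_regular_iff hI hQ).mp (hc t ht)
      obtain ⟨k₀, k₁, k₂, hk⟩ := timePair_poly.comb hJ hτ
        (fun t ht => by rw [(hc t ht).1])
      simp only [p1, d2, d2', deriv_const'] at hk
      obtain ⟨m₂, hσ1⟩ := hJ.exists_quartic (3 * k₁) (3 * k₂) 0 0
        (fun t ht => hasDerivAt_on (deriv_smooth hσ oJ) oJ ht)
        (fun t ht => by rw [(hc t ht).2.1, (hk t ht).2.1]; ring)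
      obtain ⟨m₁, hσe⟩ := hJ.exists_quartic m₂ (3 / 2 * k₁) k₂ 0
        (fun t ht => hasDerivAt_on hσ oJ ht) (fun t ht => by rw [hσ1 t ht]; ring)
      obtain ⟨r, hρe⟩ := hJ.exists_quartic (-ε * m₁ - k₂ / 2) (-ε * m₂ / 2) (-ε * k₁ / 2)
        (-ε * k₂ / 4) (fun t ht => hasDerivAt_on hρ oJ ht) (fun t ht => by
          have := (hc t ht).2.2
          rw [hσe t ht, (hk t ht).2.2] at this
          linear_combination ε * this - (deriv ρ t + k₂ / 2) * hε)
      refine ⟨k₀, k₁ / 4 + r, m₁, m₂, k₁, k₂, fun t ht x hx u => ?_⟩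
      rw [hv t ht x hx u]
      simp only [redField, fieldT, fieldU, fieldD, fieldPbar, fieldP, hρe t ht, Pi.add_apply,
        Pi.smul_apply, p1, p2, p3, p4, d2, d2', d3, deriv_const']
      rw [(hk t ht).2.1, (hk t ht).2.2, (hk t ht).1, hσe t ht, hσ1 t ht]
      simp only [Prod.smul_mk, Prod.mk_add_mk, smul_eq_mul, Prod.mk.injEq]
      refine ⟨by ring, by ring, ?_⟩
      linear_combination (1 / 4 * u * (k₁ + 2 * k₂ * t)) * hε
    · rintro ⟨k₀, k, m₁, m₂, k₁, k₂, hv⟩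
      have e1 : deriv (fun t : ℝ => k₀ + k₁ * t + k₂ * t ^ 2) = fun t => k₁ + k₂ * (2 * t) :=
        deriv_of_quartic k₀ k₁ k₂ 0 0 (fun t => by ring) (fun t => by ring)
      have e2 : deriv (fun t : ℝ => k₁ + k₂ * (2 * t)) = fun _ => k₂ * 2 :=
        deriv_of_quartic k₁ (2 * k₂) 0 0 0 (fun t => by ring) (fun t => by ring)
      have f1 : deriv (fun t : ℝ => m₁ + m₂ * t + k₁ * (3 / 2) * t ^ 2 + k₂ * t ^ 3)
          = fun t => m₂ + k₁ * 3 * t + k₂ * 3 * t ^ 2 :=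
        deriv_of_quartic m₁ m₂ (k₁ * (3 / 2)) k₂ 0 (fun t => by ring) (fun t => by ring)
      have f2 : deriv (fun t : ℝ => m₂ + k₁ * 3 * t + k₂ * 3 * t ^ 2)
          = fun t => k₁ * 3 + k₂ * 6 * t :=
        deriv_of_quartic m₂ (k₁ * 3) (k₂ * 3) 0 0 (fun t => by ring) (fun t => by ring)
      have g1 : deriv (fun t : ℝ => k - (k₁ + 2 * k₂ * t) / 4 - ε * (m₁ * t + m₂ * (t ^ 2 / 2)
            + k₁ * (3 / 2) * (t ^ 3 / 3) + k₂ * (t ^ 4 / 4))) = fun t => -(k₂ / 2)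
            - ε * (m₁ + m₂ * t + k₁ * (3 / 2) * t ^ 2 + k₂ * t ^ 3) :=
        deriv_of_quartic (k - k₁ / 4) (-(k₂ / 2) - ε * m₁) (-ε * m₂ / 2) (-ε * k₁ / 2) (-ε * k₂ / 4)
          (fun t => by ring) (fun t => by ring)
      refine ⟨fun t => k₀ + k₁ * t + k₂ * t ^ 2,
        fun t => m₁ + m₂ * t + k₁ * (3 / 2) * t ^ 2 + k₂ * t ^ 3,
        fun t => k - (k₁ + 2 * k₂ * t) / 4 - ε * (m₁ * t + m₂ * (t ^ 2 / 2)
            + k₁ * (3 / 2) * (t ^ 3 / 3) + k₂ * (t ^ 4 / 4)),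
        by fun_prop, by fun_prop, by fun_prop, fun t ht x hx u => ?_, fun t ht => ?_⟩
      · rw [hv t ht x hx u]
        simp only [redField, fieldT, fieldU, fieldD, fieldPbar, fieldP, Pi.add_apply,
          Pi.smul_apply, p1, p2, p3, p4, d2, d2', d3, deriv_const', e1, e2, f1]
        simp only [Prod.smul_mk, Prod.mk_add_mk, smul_eq_mul, Prod.mk.injEq]
        refine ⟨by ring, by ring, ?_⟩
        linear_combination -(1 / 4 * u * (k₁ + 2 * k₂ * t)) * hε
      · refine (classifying_regular_iff hI hQ).mpr ?_
        simp only [e1, e2, f1, f2, g1, deriv_const']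
        refine ⟨by ring, by ring, ?_⟩
        linear_combination -(m₁ + m₂ * t + k₁ * (3 / 2) * t ^ 2 + k₂ * t ^ 3) * hε
  · have h1 : ∀ t ∈ J, c₀ + c₄ * t + c₅ * t ^ 2 = 0 := fun t ht => by
      have := congrArg (fun p => p.1) (h t ht x₀ hx₀ 0)
      simpa [fieldT, fieldU, fieldD, fieldP, fieldPbar] using this
    obtain ⟨rfl, rfl, rfl⟩ := timePair_poly.indep hJ h1
    have h2 : ∀ t ∈ J, c₂ * 1 + c₃ * t = 0 := fun t ht => by
      have := congrArg (fun p => p.2.1) (h t ht x₀ hx₀ 0)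
      simpa [fieldT, fieldU, fieldD, fieldP, fieldPbar, p2] using this
    obtain ⟨rfl, rfl⟩ := spacePair_poly.indep hJ h2
    have := congrArg (fun p => p.2.2) (h t₀ ht₀ x₀ hx₀ 1)
    refine ⟨rfl, ?_, rfl, rfl, rfl, rfl⟩
    simpa [fieldT, fieldU, fieldD, fieldP, fieldPbar] using this

end TableBases

/-! ### Equivalence transformations: determination of the equivalence group -/

section Prolongation

variable {T X U : ℝ → ℝ → ℝ → ℝ}

theorem exists_isProlonged (j : Jet) (h : Dt T j * Dx X j - Dx T j * Dt X j ≠ 0) :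
    ∃ j' : Jet, IsProlonged T X U j j' := by
  set p := Dt T j with hp
  set q := Dx T j with hq
  set r := Dt X j with hr
  set s := Dx X j with hs
  set d := p * s - q * r with hd
  set vt := (Dt U j * s - Dx U j * r) / d with hvt
  set vx := (p * Dx U j - q * Dt U j) / d with hvx
  set m₁ := Dtt U j - vt * Dtt T j - vx * Dtt X j with hm₁
  set m₂ := Dtx U j - vt * Dtx T j - vx * Dtx X j with hm₂
  set m₃ := Dxx U j - vt * Dxx T j - vx * Dxx X j with hm₃
  refine ⟨⟨at₀ T j, at₀ X j, at₀ U j, vt, vx, (s ^ 2 * m₁ - 2 * s * r * m₂ + r ^ 2 * m₃) / d ^ 2,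
    (-(s * q) * m₁ + (s * p + r * q) * m₂ - p * r * m₃) / d ^ 2,
    (q ^ 2 * m₁ - 2 * q * p * m₂ + p ^ 2 * m₃) / d ^ 2⟩, ⟨h, rfl, rfl, rfl, ?_, ?_, ?_, ?_, ?_⟩⟩
  · rw [← hp, ← hr, hvt, hvx]; field_simp; rw [hd]; ring
  · rw [← hq, ← hs, hvt, hvx]; field_simp; rw [hd]; ring
  · have e : Dtt U j = m₁ + vt * Dtt T j + vx * Dtt X j := by rw [hm₁]; ring
    rw [e, ← hp, ← hr]
    clear_value m₁ m₂ m₃ vt vx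
    field_simp; rw [hd]; ring
  · have e : Dtx U j = m₂ + vt * Dtx T j + vx * Dtx X j := by rw [hm₂]; ring
    rw [e, ← hp, ← hr, ← hq, ← hs]
    clear_value m₁ m₂ m₃ vt vx
    field_simp; rw [hd]; ring
  · have e : Dxx U j = m₃ + vt * Dxx T j + vx * Dxx X j := by rw [hm₃]; ring
    rw [e, ← hq, ← hs]
    clear_value m₁ m₂ m₃ vt vx
    field_simp; rw [hd]; ring

/-- The first derivatives after a prolonged transformation. -/
theorem IsProlonged.first {j j' : Jet} (h : IsProlonged T X U j j') :
    j'.ut * (Dt T j * Dx X j - Dx T j * Dt X j) = Dt U j * Dx X j - Dx U j * Dt X j ∧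
    j'.ux * (Dt T j * Dx X j - Dx T j * Dt X j) = Dt T j * Dx U j - Dx T j * Dt U j := by
  have h1 := h.dt_eq
  have h2 := h.dx_eq
  exact ⟨by linear_combination Dt X j * h2 - Dx X j * h1,
    by linear_combination Dx T j * h1 - Dt T j * h2⟩

/-- The second `x`-derivative after a prolonged transformation. -/
theorem IsProlonged.uxx_eq {j j' : Jet} (h : IsProlonged T X U j j') :
    j'.uxx * (Dt T j * Dx X j - Dx T j * Dt X j) ^ 2
      = Dx T j ^ 2 * (Dtt U j - j'.ut * Dtt T j - j'.ux * Dtt X j)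
        - 2 * Dx T j * Dt T j * (Dtx U j - j'.ut * Dtx T j - j'.ux * Dtx X j)
        + Dt T j ^ 2 * (Dxx U j - j'.ut * Dxx T j - j'.ux * Dxx X j) := by
  rw [h.dtt_eq, h.dtx_eq, h.dxx_eq]; ring

/-- The gradients of `T`, `X`, `U` at the point are linearly independent. -/
def RegularAt (T X U : ℝ → ℝ → ℝ → ℝ) (t x u : ℝ) : Prop :=
  ∀ w₁ w₂ w₃ : ℝ, ∃ v₁ v₂ v₃ : ℝ,
    pt T t x u * v₁ + px T t x u * v₂ + pu T t x u * v₃ = w₁ ∧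
    pt X t x u * v₁ + px X t x u * v₂ + pu X t x u * v₃ = w₂ ∧
    pt U t x u * v₁ + px U t x u * v₂ + pu U t x u * v₃ = w₃

theorem RegularAt.exists_transversal {t x u : ℝ} (h : RegularAt T X U t x u) :
    ∃ ut ux : ℝ, (pt T t x u + ut * pu T t x u) * (px X t x u + ux * pu X t x u)
      - (px T t x u + ux * pu T t x u) * (pt X t x u + ut * pu X t x u) ≠ 0 := by
  by_contra! hcon
  obtain ⟨v₁, v₂, v₃, a1, a2, -⟩ := h 1 0 0
  obtain ⟨w₁, w₂, w₃, b1, b2, -⟩ := h 0 1 0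
  have h0 := hcon 0 0
  have h1 := hcon 1 0
  have h2 := hcon 0 1
  have m0 : pt T t x u * px X t x u - px T t x u * pt X t x u = 0 := by linear_combination h0
  have m1 : pu T t x u * px X t x u - px T t x u * pu X t x u = 0 := by
    linear_combination h1 - h0
  have m2 : pt T t x u * pu X t x u - pu T t x u * pt X t x u = 0 := by
    linear_combination h2 - h0
  have : (1 : ℝ) = 0 := by
    have e : (pt T t x u * v₁ + px T t x u * v₂ + pu T t x u * v₃)
        * (pt X t x u * w₁ + px X t x u * w₂ + pu X t x u * w₃)
        - (pt T t x u * w₁ + px T t x u * w₂ + pu T t x u * w₃)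
        * (pt X t x u * v₁ + px X t x u * v₂ + pu X t x u * v₃) = 0 := by
      linear_combination (v₁ * w₂ - v₂ * w₁) * m0 + (v₃ * w₂ - v₂ * w₃) * m1
        + (v₁ * w₃ - v₃ * w₁) * m2
    rw [a1, a2, b1, b2] at e
    linear_combination e
  exact one_ne_zero this

theorem RegularAt.multiplier_ne_zero {j j' : Jet} (h : RegularAt T X U j.t j.x j.u)
    (hp : IsProlonged T X U j j') :
    at₀ (pu U) j - j'.ut * at₀ (pu T) j - j'.ux * at₀ (pu X) j ≠ 0 := by
  intro h0
  obtain ⟨v₁, v₂, v₃, a1, a2, a3⟩ := h 0 0 1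
  have h1 := hp.dt_eq
  have h2 := hp.dx_eq
  simp only [Dt, Dx, at₀] at h0 h1 h2
  have : (1 : ℝ) = 0 := by
    linear_combination -a3 + (j'.ut * a1) + (j'.ux * a2) + v₁ * (h1 - j.ut * h0)
      + v₂ * (h2 - j.ux * h0) + v₃ * h0
  exact one_ne_zero this

end Prolongation

/-- The point transformation `(T, X, U)` of `J × I × K` maps the equation with the coefficients
`A`, `B` to the one with `A'`, `B'`. -/
def MapsFP (J I K : Set ℝ) (T X U : ℝ → ℝ → ℝ → ℝ) (A B A' B' : ℝ → ℝ) : Prop :=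
  ∀ j j' : Jet, j.t ∈ J → j.x ∈ I → j.u ∈ K → SatFP A B j → IsProlonged T X U j j' →
    SatFP A' B' j'

section Maps

variable {J I K : Set ℝ} {T X U : ℝ → ℝ → ℝ → ℝ} {A B A' B' : ℝ → ℝ} {t x u : ℝ}

/-- The jet on the equation with the given values of the parametric derivatives. -/
def jetOn (A B : ℝ → ℝ) (t x u ut ux utt : ℝ) : Jet :=
  ⟨t, x, u, ut, ux, utt, 0,
    (ut - (2 * deriv A x + B x) * ux - (deriv (deriv A) x + deriv B x) * u) / A x⟩

theorem satFP_jetOn (hA : A x ≠ 0) (ut ux utt : ℝ) : SatFP A B (jetOn A B t x u ut ux utt) := by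
  simp only [SatFP, jetOn, fpRhs]
  field_simp
  ring

theorem MapsFP.dx_time (h : MapsFP J I K T X U A B A' B') (ht : t ∈ J) (hx : x ∈ I) (hu : u ∈ K)
    (hA : A x ≠ 0) (hA' : A' (X t x u) ≠ 0) (hr : RegularAt T X U t x u) {ut ux : ℝ}
    (hΔ : (pt T t x u + ut * pu T t x u) * (px X t x u + ux * pu X t x u)
      - (px T t x u + ux * pu T t x u) * (pt X t x u + ut * pu X t x u) ≠ 0) :
    px T t x u + ux * pu T t x u = 0 := by
  obtain ⟨p, hp⟩ := exists_isProlonged (T := T) (X := X) (U := U) (jetOn A B t x u ut ux 0) hΔ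
  obtain ⟨q, hq⟩ := exists_isProlonged (T := T) (X := X) (U := U) (jetOn A B t x u ut ux 1) hΔ
  have sp := h _ _ ht hx hu (satFP_jetOn hA _ _ _) hp
  have sq := h _ _ ht hx hu (satFP_jetOn hA _ _ _) hq
  have mp := hr.multiplier_ne_zero hp
  have eut : q.ut = p.ut := mul_right_cancel₀ hΔ (hq.first.1.trans hp.first.1.symm)
  have eux : q.ux = p.ux := mul_right_cancel₀ hΔ (hq.first.2.trans hp.first.2.symm)
  have exx : q.uxx = p.uxx := by
    have ex : q.x = p.x := hq.x_eq.trans hp.x_eq.symm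
    have eu : q.u = p.u := hq.u_eq.trans hp.u_eq.symm
    have hpx : A' p.x ≠ 0 := by rw [hp.x_eq]; exact hA'
    simp only [SatFP, fpRhs, ex, eu, eut, eux] at sp sq
    exact mul_left_cancel₀ hpx (by linear_combination sp - sq)
  have e1 := hp.uxx_eq
  have e2 := hq.uxx_eq
  rw [exx, eut, eux] at e2
  simp only [Dt, Dx, Dtt, Dtx, Dxx, at₀, jetOn] at e1 e2 mp
  have : (px T t x u + ux * pu T t x u) ^ 2
      * (pu U t x u - p.ut * pu T t x u - p.ux * pu X t x u) = 0 := by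
    linear_combination e1 - e2
  exact pow_eq_zero_iff two_ne_zero |>.mp ((mul_eq_zero.mp this).resolve_right mp)

theorem MapsFP.time_projectable (h : MapsFP J I K T X U A B A' B') (ht : t ∈ J) (hx : x ∈ I)
    (hu : u ∈ K) (hA : A x ≠ 0) (hA' : A' (X t x u) ≠ 0) (hr : RegularAt T X U t x u) :
    px T t x u = 0 ∧ pu T t x u = 0 := by
  obtain ⟨ut, ux, hΔ⟩ := hr.exists_transversal
  have key := @MapsFP.dx_time J I K T X U A B A' B' t x u h ht hx hu hA hA' hr
  have h0 := key hΔ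
  by_cases h1 : (pt T t x u + ut * pu T t x u) * (px X t x u + (ux + 1) * pu X t x u)
      - (px T t x u + (ux + 1) * pu T t x u) * (pt X t x u + ut * pu X t x u) = 0
  · have h2 : (pt T t x u + ut * pu T t x u) * (px X t x u + (ux - 1) * pu X t x u)
      - (px T t x u + (ux - 1) * pu T t x u) * (pt X t x u + ut * pu X t x u) ≠ 0 := by
      intro h2; exact hΔ (by linear_combination (h1 + h2) / 2)
    have h3 := key h2
    have : pu T t x u = 0 := by linear_combination h0 - h3
    exact ⟨by rw [this] at h0; linear_combination h0, this⟩
  · have h3 := key h1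
    have : pu T t x u = 0 := by linear_combination h3 - h0
    exact ⟨by rw [this] at h0; linear_combination h0, this⟩

theorem RegularAt.pt_time_ne_zero (hr : RegularAt T X U t x u) (h1 : px T t x u = 0)
    (h2 : pu T t x u = 0) : pt T t x u ≠ 0 := by
  intro h0
  obtain ⟨v₁, v₂, v₃, e, -⟩ := hr 1 0 0
  rw [h0, h1, h2] at e
  simp at e

theorem RegularAt.pu_ne_zero (hr : RegularAt T X U t x u) (h1 : pu T t x u = 0)
    (h2 : pu X t x u = 0) : pu U t x u ≠ 0 := by
  intro h0
  obtain ⟨ut, ux, hΔ⟩ := hr.exists_transversal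
  obtain ⟨v₁, v₂, v₃, a1, a2, a3⟩ := hr 0 0 1
  simp only [h1, h2, mul_zero, zero_mul, add_zero] at hΔ a1 a2
  have e1 : v₁ = 0 := (mul_eq_zero.mp (by linear_combination px X t x u * a1 - px T t x u * a2 :
    (pt T t x u * px X t x u - px T t x u * pt X t x u) * v₁ = 0)).resolve_left hΔ
  have e2 : v₂ = 0 := (mul_eq_zero.mp (by linear_combination pt T t x u * a2 - pt X t x u * a1 :
    (pt T t x u * px X t x u - px T t x u * pt X t x u) * v₂ = 0)).resolve_left hΔ
  rw [h0, e1, e2] at a3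
  simp at a3

/-- The transformed equation at a jet, once `T = T(t)`. -/
theorem MapsFP.of_time (h : MapsFP J I K T X U A B A' B') (ht : t ∈ J) (hx : x ∈ I)
    (hu : u ∈ K) (hA : A x ≠ 0) (hIo : IsOpen I) (hKo : IsOpen K)
    (hTx : EqOnBox J I K (px T) (fun _ _ _ => 0)) (hTu : EqOnBox J I K (pu T) (fun _ _ _ => 0))
    (hTt : pt T t x u ≠ 0) (ut ux : ℝ) (hX : px X t x u + ux * pu X t x u ≠ 0) :
    ∃ vx : ℝ, vx * (px X t x u + ux * pu X t x u) = px U t x u + ux * pu U t x u ∧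
      (pt U t x u + ut * pu U t x u - vx * (pt X t x u + ut * pu X t x u)) / pt T t x u =
      A' (X t x u) * ((px (px U) t x u + 2 * ux * px (pu U) t x u + ux ^ 2 * pu (pu U) t x u
        + (ut - (2 * deriv A x + B x) * ux - (deriv (deriv A) x + deriv B x) * u) / A x
          * pu U t x u
        - vx * (px (px X) t x u + 2 * ux * px (pu X) t x u + ux ^ 2 * pu (pu X) t x u
        + (ut - (2 * deriv A x + B x) * ux - (deriv (deriv A) x + deriv B x) * u) / A x
          * pu X t x u)) / (px X t x u + ux * pu X t x u) ^ 2)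
      + (2 * deriv A' (X t x u) + B' (X t x u)) * vx
      + (deriv (deriv A') (X t x u) + deriv B' (X t x u)) * U t x u := by
  have e1 := hTx t ht x hx u hu
  have e2 := hTu t ht x hx u hu
  have e3 := hTx.px hIo t ht x hx u hu
  have e4 := hTu.px hIo t ht x hx u hu
  have e5 := hTu.pu hKo t ht x hx u hu
  rw [px_zero] at e3 e4
  rw [pu_zero] at e5
  simp only at e1 e2 e3 e4 e5
  have hΔ : Dt T (jetOn A B t x u ut ux 0) * Dx X (jetOn A B t x u ut ux 0)
      - Dx T (jetOn A B t x u ut ux 0) * Dt X (jetOn A B t x u ut ux 0) ≠ 0 := by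
    simp only [Dt, Dx, at₀, jetOn, e1, e2, mul_zero, add_zero, zero_mul, sub_zero]
    exact mul_ne_zero hTt hX
  obtain ⟨p, hp⟩ := exists_isProlonged (T := T) (X := X) (U := U) _ hΔ
  have s := h _ _ ht hx hu (satFP_jetOn hA _ _ _) hp
  have d1 := hp.dx_eq
  have d2 := hp.dt_eq
  have d3 := hp.dxx_eq
  have d4 := hp.x_eq
  have d5 := hp.u_eq
  simp only [Dt, Dx, Dxx, at₀, jetOn, e1, e2, e3, e4, e5, mul_zero, add_zero, zero_mul,
    zero_add, ne_eq, OfNat.ofNat_ne_zero, not_false_eq_true, zero_pow] at d1 d2 d3 d4 d5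
  refine ⟨p.ux, d1.symm, ?_⟩
  simp only [SatFP, fpRhs, d4, d5] at s
  have c1 : (pt U t x u + ut * pu U t x u - p.ux * (pt X t x u + ut * pu X t x u)) / pt T t x u
      = p.ut := by
    rw [div_eq_iff hTt]; linear_combination d2
  rw [c1, s]
  congr 3
  rw [eq_div_iff (pow_ne_zero 2 hX)]
  linear_combination -d3

theorem MapsFP.space (h : MapsFP J I K T X U A B A' B') (ht : t ∈ J) (hx : x ∈ I)
    (hu : u ∈ K) (hA : A x ≠ 0) (hIo : IsOpen I) (hKo : IsOpen K)
    (hTx : EqOnBox J I K (px T) (fun _ _ _ => 0)) (hTu : EqOnBox J I K (pu T) (fun _ _ _ => 0))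
    (hTt : pt T t x u ≠ 0) (hr : RegularAt T X U t x u) {ux : ℝ}
    (hX : px X t x u + ux * pu X t x u ≠ 0) :
    pt T t x u * A' (X t x u) = A x * (px X t x u + ux * pu X t x u) ^ 2 := by
  obtain ⟨v, hv, e⟩ := h.of_time ht hx hu hA hIo hKo hTx hTu hTt 0 ux hX
  obtain ⟨w, hw, f⟩ := h.of_time ht hx hu hA hIo hKo hTx hTu hTt (A x) ux hX
  have hvw : w = v := mul_right_cancel₀ hX (hw.trans hv.symm)
  rw [hvw] at f
  have m : pu U t x u - v * pu X t x u ≠ 0 := by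
    intro h0
    obtain ⟨v₁, v₂, v₃, a1, a2, a3⟩ := hr 0 0 1
    rw [hTx t ht x hx u hu, hTu t ht x hx u hu] at a1
    have hv1 : v₁ = 0 := (mul_eq_zero.mp (by linear_combination a1 :
      pt T t x u * v₁ = 0)).resolve_left hTt
    rw [hv1] at a2 a3
    exact one_ne_zero (α := ℝ)
      (by linear_combination -a3 + v * a2 - v₂ * hv + v₃ * h0 - v₂ * ux * h0)
  have key : A x * (pu U t x u - v * pu X t x u) / pt T t x u
      = A' (X t x u) * ((pu U t x u - v * pu X t x u) / (px X t x u + ux * pu X t x u) ^ 2) := by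
    have hAi : A x * (A x)⁻¹ = 1 := mul_inv_cancel₀ hA
    linear_combination f - e + A' (X t x u) * ((pu U t x u - v * pu X t x u)
      / (px X t x u + ux * pu X t x u) ^ 2) * hAi
  have key2 : (pt T t x u * A' (X t x u)) * (pu U t x u - v * pu X t x u)
      = (A x * (px X t x u + ux * pu X t x u) ^ 2) * (pu U t x u - v * pu X t x u) := by
    rw [mul_div_assoc', div_eq_div_iff hTt (pow_ne_zero 2 hX)] at key
    linear_combination -key
  exact mul_right_cancel₀ m key2

theorem MapsFP.space_projectable (h : MapsFP J I K T X U A B A' B') (ht : t ∈ J) (hx : x ∈ I)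
    (hu : u ∈ K) (hA : A x ≠ 0) (hIo : IsOpen I) (hKo : IsOpen K)
    (hTx : EqOnBox J I K (px T) (fun _ _ _ => 0)) (hTu : EqOnBox J I K (pu T) (fun _ _ _ => 0))
    (hTt : pt T t x u ≠ 0) (hr : RegularAt T X U t x u) :
    pu X t x u = 0 ∧ px X t x u ≠ 0 ∧ pt T t x u * A' (X t x u) = A x * px X t x u ^ 2 := by
  have key := fun ux => h.space ht hx hu hA hIo hKo hTx hTu hTt hr (ux := ux)
  have hXu : pu X t x u = 0 := by
    by_contra h0
    have k1 := key ((1 - px X t x u) / pu X t x u) (by field_simp; simp)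
    have k2 := key ((2 - px X t x u) / pu X t x u) (by field_simp; simp)
    rw [div_mul_cancel₀ _ h0] at k1 k2
    exact hA (by linear_combination (k1 - k2) / 3)
  have hXx : px X t x u ≠ 0 := by
    obtain ⟨ut, ux, hΔ⟩ := hr.exists_transversal
    rw [hTx t ht x hx u hu, hTu t ht x hx u hu, hXu] at hΔ
    intro h0; rw [h0] at hΔ; simp at hΔ
  refine ⟨hXu, hXx, ?_⟩
  have := key 0 (by simpa using hXx)
  simpa using this

/-- The transformed equation, split with respect to `u_x`. -/
theorem MapsFP.split (h : MapsFP J I K T X U A B A' B') (ht : t ∈ J) (hx : x ∈ I)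
    (hu : u ∈ K) (hA : A x ≠ 0) (hIo : IsOpen I) (hKo : IsOpen K)
    (hTx : EqOnBox J I K (px T) (fun _ _ _ => 0)) (hTu : EqOnBox J I K (pu T) (fun _ _ _ => 0))
    (hTt : pt T t x u ≠ 0) (hXu : EqOnBox J I K (pu X) (fun _ _ _ => 0)) (hXx : px X t x u ≠ 0)
    (hAA : pt T t x u * A' (X t x u) = A x * px X t x u ^ 2) :
    ((2 * deriv A x + B x) - pt X t x u / px X t x u) * pu U t x u
      = A x * (2 * px (pu U) t x u - pu U t x u * px (px X) t x u / px X t x u)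
        + pt T t x u * (2 * deriv A' (X t x u) + B' (X t x u)) * pu U t x u / px X t x u ∧
    pt U t x u + (deriv (deriv A) x + deriv B x) * u * pu U t x u
        - px U t x u * pt X t x u / px X t x u
      = A x * (px (px U) t x u - px U t x u * px (px X) t x u / px X t x u)
        + pt T t x u * (2 * deriv A' (X t x u) + B' (X t x u)) * px U t x u / px X t x u
        + pt T t x u * (deriv (deriv A') (X t x u) + deriv B' (X t x u)) * U t x u := by
  have e1 := hXu t ht x hx u hu
  have e2 := hXu.px hIo t ht x hx u hu
  have e3 := hXu.pu hKo t ht x hx u hu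
  rw [px_zero] at e2
  rw [pu_zero] at e3
  simp only at e1 e2 e3
  have key : ∀ ux : ℝ,
      pt U t x u + ((2 * deriv A x + B x) * ux + (deriv (deriv A) x + deriv B x) * u) * pu U t x u
        - (px U t x u + ux * pu U t x u) * pt X t x u / px X t x u
      = A x * (px (px U) t x u + 2 * ux * px (pu U) t x u + ux ^ 2 * pu (pu U) t x u
          - (px U t x u + ux * pu U t x u) * px (px X) t x u / px X t x u)
        + pt T t x u * (2 * deriv A' (X t x u) + B' (X t x u)) * (px U t x u + ux * pu U t x u)
          / px X t x u
        + pt T t x u * (deriv (deriv A') (X t x u) + deriv B' (X t x u)) * U t x u := by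
    intro ux
    obtain ⟨v, hv, e⟩ := h.of_time ht hx hu hA hIo hKo hTx hTu hTt
      ((2 * deriv A x + B x) * ux + (deriv (deriv A) x + deriv B x) * u) ux
      (by simpa [e1] using hXx)
    simp only [e1, e2, e3, mul_zero, add_zero] at e hv
    have hv' : v = (px U t x u + ux * pu U t x u) / px X t x u := by
      rw [eq_div_iff hXx, hv]
    have hA'' : A' (X t x u) = A x * px X t x u ^ 2 / pt T t x u := by
      rw [eq_div_iff hTt]; linear_combination hAA
    rw [div_eq_iff hTt, hA'', hv'] at e
    have z : (2 * deriv A x + B x) * ux + (deriv (deriv A) x + deriv B x) * u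
      - (2 * deriv A x + B x) * ux - (deriv (deriv A) x + deriv B x) * u = 0 := by ring
    rw [z] at e
    rw [zero_div, zero_mul, add_zero] at e
    field_simp at e ⊢
    linear_combination e
  have k0 := key 0
  have k1 := key 1
  have k2 := key (-1)
  constructor
  · field_simp at k1 k2 ⊢
    linear_combination (k1 - k2) / 2
  · field_simp at k0 ⊢
    linear_combination k0

end Maps

section Box

variable {J I K : Set ℝ} {F : ℝ → ℝ → ℝ → ℝ} {t x u : ℝ}

theorem SmoothOnBox.fderiv_eq (hJ : IsOpen J) (hI : IsOpen I) (hK : IsOpen K)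
    (h : SmoothOnBox J I K F) (ht : t ∈ J) (hx : x ∈ I) (hu : u ∈ K) (v₁ v₂ v₃ : ℝ) :
    fderiv ℝ (fun p : ℝ × ℝ × ℝ => F p.1 p.2.1 p.2.2) (t, x, u) (v₁, v₂, v₃)
      = pt F t x u * v₁ + FP.px F t x u * v₂ + FP.pu F t x u * v₃ := by
  have e : ((v₁, v₂, v₃) : ℝ × ℝ × ℝ)
      = v₁ • ((1, 0, 0) : ℝ × ℝ × ℝ) + v₂ • ((0, 1, 0) : ℝ × ℝ × ℝ)
        + v₃ • ((0, 0, 1) : ℝ × ℝ × ℝ) := by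
    simp
  rw [e, map_add, map_add, map_smul, map_smul, map_smul, pt, FP.px, FP.pu,
    (h.hasDerivAt_t' hJ hI hK ht hx hu).deriv, (h.hasDerivAt_x' hJ hI hK ht hx hu).deriv,
    (h.hasDerivAt_u' hJ hI hK ht hx hu).deriv]
  simp only [smul_eq_mul]
  ring

theorem SmoothOnBox.slice_x (h : SmoothOnBox J I K F) (ht : t ∈ J) (hu : u ∈ K) :
    ContDiffOn ℝ ∞ (fun y => F t y u) I :=
  ContDiffOn.comp (g := fun p : ℝ × ℝ × ℝ => F p.1 p.2.1 p.2.2) (f := fun y => (t, y, u)) h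
    (by fun_prop) (fun _ hy => ⟨ht, hy, hu⟩)

end Box

/-- The features of a class of equations that determine its equivalence group: every equation
`u_t = ε u_{xx} + (B u)_x` belongs to the class, with the arbitrary element `mk B`. -/
structure FPClass.Rich {E : Type} [NormedAddCommGroup E] [NormedSpace ℝ E] (L : FPClass E)
    (ε : ℝ) (mk : (ℝ → ℝ) → ℝ → E) : Prop where
  isOpen_range : IsOpen L.range
  smooth_diffusion : ContDiff ℝ ∞ L.diffusion
  smooth_drift : ContDiff ℝ ∞ L.drift
  diffusion_ne : ∀ r ∈ L.range, L.diffusion r ≠ 0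
  adm_mk : ∀ (I : Set ℝ) (B : ℝ → ℝ), ContDiffOn ℝ ∞ B I → L.Adm I (mk B)
  diffusion_mk : ∀ B x, L.diffusion (mk B x) = ε
  drift_mk : ∀ B x, L.drift (mk B x) = B x

theorem rich_reduced {ε : ℝ} (hε : ε ≠ 0) : (reducedFP ε).Rich ε (fun B => B) where
  isOpen_range := isOpen_univ
  smooth_diffusion := contDiff_const
  smooth_drift := contDiff_id
  diffusion_ne := fun _ _ => hε
  adm_mk := fun _ _ hB => adm_reduced_iff.2 hB
  diffusion_mk := fun _ _ => rfl
  drift_mk := fun _ _ => rfl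

theorem rich_full {ε : ℝ} (hε : ε ≠ 0) : fullFP.Rich ε (fun B x => (ε, B x)) where
  isOpen_range := isOpen_ne_fun continuous_fst continuous_const
  smooth_diffusion := contDiff_fst
  smooth_drift := contDiff_snd
  diffusion_ne := fun _ h => h
  adm_mk := fun _ _ hB => adm_full_const hε hB
  diffusion_mk := fun _ _ => rfl
  drift_mk := fun _ _ => rfl

namespace FPClass

section Equiv

variable {E : Type} [NormedAddCommGroup E] [NormedSpace ℝ E] {L : FPClass E} {ε : ℝ}
  {mk : (ℝ → ℝ) → ℝ → E} {J I K : Set ℝ} {T X U : ℝ → ℝ → ℝ → ℝ} {Θ : ℝ → ℝ → ℝ → E → E}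

theorem IsEquivTransf.smooth_fst (h : L.IsEquivTransf J I K T X U Θ) {r : E} (hr : r ∈ L.range) :
    ContDiffOn ℝ ∞ (fun p : ℝ × ℝ × ℝ =>
      (T p.1 p.2.1 p.2.2, X p.1 p.2.1 p.2.2, U p.1 p.2.1 p.2.2)) (J ×ˢ I ×ˢ K) := by
  have := h.smooth.comp (f := fun p : ℝ × ℝ × ℝ => (p, r)) (s := J ×ˢ I ×ˢ K) (by fun_prop)
    (fun p hp => ⟨hp, hr⟩)
  exact contDiff_fst.comp_contDiffOn this

theorem IsEquivTransf.smooth_T (h : L.IsEquivTransf J I K T X U Θ) {r : E} (hr : r ∈ L.range) :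
    SmoothOnBox J I K T := contDiff_fst.comp_contDiffOn (h.smooth_fst hr)

theorem IsEquivTransf.smooth_X (h : L.IsEquivTransf J I K T X U Θ) {r : E} (hr : r ∈ L.range) :
    SmoothOnBox J I K X :=
  contDiff_fst.comp_contDiffOn (contDiff_snd.comp_contDiffOn (h.smooth_fst hr))

theorem IsEquivTransf.smooth_U (h : L.IsEquivTransf J I K T X U Θ) {r : E} (hr : r ∈ L.range) :
    SmoothOnBox J I K U :=
  contDiff_snd.comp_contDiffOn (contDiff_snd.comp_contDiffOn (h.smooth_fst hr))

theorem IsEquivTransf.regularAt (h : L.IsEquivTransf J I K T X U Θ) {r : E} (hr : r ∈ L.range)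
    (hro : IsOpen L.range) (hJ : IsOpen J) (hI : IsOpen I) (hK : IsOpen K) {t x u : ℝ}
    (ht : t ∈ J) (hx : x ∈ I) (hu : u ∈ K) : RegularAt T X U t x u := by
  intro w₁ w₂ w₃
  have hmem : (((t, x, u), r) : (ℝ × ℝ × ℝ) × E) ∈ (J ×ˢ I ×ˢ K) ×ˢ L.range :=
    ⟨⟨ht, hx, hu⟩, hr⟩
  obtain ⟨⟨⟨v₁, v₂, v₃⟩, e⟩, hv⟩ := (h.regular _ hmem).2 ((w₁, w₂, w₃), 0)
  have hd : HasFDerivAt (totalMap T X U Θ) (fderiv ℝ (totalMap T X U Θ) ((t, x, u), r))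
      ((t, x, u), r) :=
    ((h.smooth.differentiableOn (by simp)).differentiableAt
      (((hJ.prod (hI.prod hK)).prod hro).mem_nhds hmem)).hasFDerivAt
  have hT := (h.smooth_T hr)
  have hX := (h.smooth_X hr)
  have hU := (h.smooth_U hr)
  have h1 : HasFDerivAt (fun p : (ℝ × ℝ × ℝ) × E => (totalMap T X U Θ p).1)
      ((ContinuousLinearMap.fst ℝ _ _).comp (fderiv ℝ (totalMap T X U Θ) ((t, x, u), r)))
      ((t, x, u), r) := hd.fst
  have h2 : HasFDerivAt (fun p : (ℝ × ℝ × ℝ) × E => (totalMap T X U Θ p).1)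
      ((((fderiv ℝ (fun p : ℝ × ℝ × ℝ => T p.1 p.2.1 p.2.2) (t, x, u)).prod
        ((fderiv ℝ (fun p : ℝ × ℝ × ℝ => X p.1 p.2.1 p.2.2) (t, x, u)).prod
        (fderiv ℝ (fun p : ℝ × ℝ × ℝ => U p.1 p.2.1 p.2.2) (t, x, u))))).comp
        (ContinuousLinearMap.fst ℝ _ _)) ((t, x, u), r) :=
    HasFDerivAt.comp (g := fun p : ℝ × ℝ × ℝ =>
      (T p.1 p.2.1 p.2.2, X p.1 p.2.1 p.2.2, U p.1 p.2.1 p.2.2)) (f := Prod.fst)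
      ((t, x, u), r)
      ((hT.hasFDerivAt hJ hI hK ht hx hu).prodMk ((hX.hasFDerivAt hJ hI hK ht hx hu).prodMk
        (hU.hasFDerivAt hJ hI hK ht hx hu))) hasFDerivAt_fst
  have h3 := DFunLike.congr_fun (h1.unique h2) ((v₁, v₂, v₃), e)
  simp only [ContinuousLinearMap.comp_apply, hv, ContinuousLinearMap.coe_fst',
    ContinuousLinearMap.prod_apply, hT.fderiv_eq hJ hI hK ht hx hu,
    hX.fderiv_eq hJ hI hK ht hx hu, hU.fderiv_eq hJ hI hK ht hx hu, Prod.mk.injEq] at h3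
  exact ⟨v₁, v₂, v₃, h3.1.symm, h3.2.1.symm, h3.2.2.symm⟩

/-- The coefficients of an admissible equation are smooth. -/
theorem Rich.smooth_coeff (hL : L.Rich ε mk) {I : Set ℝ} {θ : ℝ → E} (hθ : L.Adm I θ) :
    ContDiffOn ℝ ∞ (fun x => L.diffusion (θ x)) I ∧ ContDiffOn ℝ ∞ (fun x => L.drift (θ x)) I :=
  ⟨hL.smooth_diffusion.comp_contDiffOn hθ.1, hL.smooth_drift.comp_contDiffOn hθ.1⟩

/-- The components of equivalence transformations for `t` and `x`. -/
theorem IsEquivTransf.projectable (hL : L.Rich ε mk) (h : L.IsEquivTransf J I K T X U Θ)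
    (hJ : IsOpen J) (hI : IsOpen I) (hK : IsOpen K) :
    EqOnBox J I K (px T) (fun _ _ _ => 0) ∧ EqOnBox J I K (pu T) (fun _ _ _ => 0) ∧
      EqOnBox J I K (pu X) (fun _ _ _ => 0) := by
  have hθ := hL.adm_mk I (fun _ => 0) contDiffOn_const
  obtain ⟨θ', hθ', -, hm⟩ := h.preserves _ hθ
  have main : ∀ t ∈ J, ∀ x ∈ I, ∀ u ∈ K, px T t x u = 0 ∧ pu T t x u = 0 := by
    intro t ht x hx u hu
    have hr := h.regularAt (hθ.2 x hx) hL.isOpen_range hJ hI hK ht hx hu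
    exact MapsFP.time_projectable (A := fun x => L.diffusion (mk (fun _ => 0) x)) hm ht hx hu
      (hL.diffusion_ne _ (hθ.2 x hx))
      (hL.diffusion_ne _ (hθ'.2 _ ⟨t, ht, x, hx, u, hu, rfl⟩)) hr
  have h1 : EqOnBox J I K (px T) (fun _ _ _ => 0) := fun t ht x hx u hu => (main t ht x hx u hu).1
  have h2 : EqOnBox J I K (pu T) (fun _ _ _ => 0) := fun t ht x hx u hu => (main t ht x hx u hu).2
  refine ⟨h1, h2, fun t ht x hx u hu => ?_⟩
  have hr := h.regularAt (hθ.2 x hx) hL.isOpen_range hJ hI hK ht hx hu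
  exact (MapsFP.space_projectable (A := fun x => L.diffusion (mk (fun _ => 0) x)) hm ht hx hu
    (hL.diffusion_ne _ (hθ.2 x hx)) hI hK h1 h2
    (hr.pt_time_ne_zero (h1 t ht x hx u hu) (h2 t ht x hx u hu)) hr).1

/-- Normal form of equivalence transformations: `x' = χ(x)`, `t' = a t + const`, and the action on
the coefficients. -/
theorem IsEquivTransf.normal_form (hL : L.Rich ε mk)
    (h : L.IsEquivTransf J I K T X U Θ)
    (hJ : IsOpenInterval J) (hI : IsOpenInterval I) (hK : IsOpenInterval K)
    (hY : IsOpen (imageX J I K X)) :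
    ∃ (a : ℝ) (χ : ℝ → ℝ), a ≠ 0 ∧ ContDiffOn ℝ ∞ χ I ∧ (∀ x ∈ I, deriv χ x ≠ 0) ∧
      (∀ t ∈ J, ∀ x ∈ I, ∀ u ∈ K, X t x u = χ x) ∧
      ∀ θ θ', L.Adm I θ → MapsElement J I K X Θ θ θ' → ∀ x ∈ I,
        a * L.diffusion (θ' (χ x)) = L.diffusion (θ x) * deriv χ x ^ 2 ∧
        a * L.drift (θ' (χ x))
          = L.drift (θ x) * deriv χ x - L.diffusion (θ x) * deriv (deriv χ) x := by
  obtain ⟨t₀, ht₀⟩ := hJ.nonempty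
  obtain ⟨x₀, hx₀⟩ := hI.nonempty
  obtain ⟨u₀, hu₀⟩ := hK.nonempty
  have hJo := hJ.isOpen
  have hIo := hI.isOpen
  have hKo := hK.isOpen
  obtain ⟨hTx, hTu, hXu⟩ := h.projectable hL hJo hIo hKo
  have hr₀ : mk (fun _ => 0) x₀ ∈ L.range := (hL.adm_mk I _ contDiffOn_const).2 x₀ hx₀
  have sT := h.smooth_T hr₀
  have sX := h.smooth_X hr₀
  have sU := h.smooth_U hr₀
  have hreg : ∀ t ∈ J, ∀ x ∈ I, ∀ u ∈ K, RegularAt T X U t x u := fun t ht x hx u hu =>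
    h.regularAt hr₀ hL.isOpen_range hJo hIo hKo ht hx hu
  have hTt : ∀ t ∈ J, ∀ x ∈ I, ∀ u ∈ K, pt T t x u ≠ 0 := fun t ht x hx u hu =>
    (hreg t ht x hx u hu).pt_time_ne_zero (hTx t ht x hx u hu) (hTu t ht x hx u hu)
  have hUu : ∀ t ∈ J, ∀ x ∈ I, ∀ u ∈ K, pu U t x u ≠ 0 := fun t ht x hx u hu =>
    (hreg t ht x hx u hu).pu_ne_zero (hTu t ht x hx u hu) (hXu t ht x hx u hu)
  have hsp : ∀ θ θ' : ℝ → E, L.Adm I θ → L.MapsEquation J I K T X U θ θ' →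
      ∀ t ∈ J, ∀ x ∈ I, ∀ u ∈ K, px X t x u ≠ 0 ∧
        pt T t x u * L.diffusion (θ' (X t x u)) = L.diffusion (θ x) * px X t x u ^ 2 := by
    intro θ θ' hθ hm t ht x hx u hu
    exact (MapsFP.space_projectable (A := fun x => L.diffusion (θ x))
      (A' := fun x => L.diffusion (θ' x)) hm ht hx hu
      (hL.diffusion_ne _ (hθ.2 x hx)) hIo hKo hTx hTu (hTt t ht x hx u hu)
      (hreg t ht x hx u hu)).2
  have hsplit := fun (θ θ' : ℝ → E) (hθ : L.Adm I θ) (hm : L.MapsEquation J I K T X U θ θ')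
      t (ht : t ∈ J) x (hx : x ∈ I) u (hu : u ∈ K) =>
    MapsFP.split (A := fun x => L.diffusion (θ x)) (B := fun x => L.drift (θ x))
      (A' := fun x => L.diffusion (θ' x)) (B' := fun x => L.drift (θ' x)) hm ht hx hu
      (hL.diffusion_ne _ (hθ.2 x hx)) hIo hKo hTx hTu (hTt t ht x hx u hu) hXu
      (hsp θ θ' hθ hm t ht x hx u hu).1 (hsp θ θ' hθ hm t ht x hx u hu).2
  -- the equations with the drifts `0`, `1` and `x`
  have a0 := hL.adm_mk I (fun _ => 0) contDiffOn_const
  have a1 := hL.adm_mk I (fun _ => 1) contDiffOn_const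
  have a2 := hL.adm_mk I (fun x => x) contDiffOn_id
  obtain ⟨θ₀, b0, -, m0⟩ := h.preserves _ a0
  obtain ⟨θ₁, b1, -, m1⟩ := h.preserves _ a1
  obtain ⟨θ₂, b2, -, m2⟩ := h.preserves _ a2
  have hXx : ∀ t ∈ J, ∀ x ∈ I, ∀ u ∈ K, px X t x u ≠ 0 := fun t ht x hx u hu =>
    (hsp _ _ a0 m0 t ht x hx u hu).1
  have hD : ∀ θ' b, L.Adm I (mk b) → L.MapsEquation J I K T X U (mk b) θ' →
      ∀ y ∈ imageX J I K X, L.diffusion (θ' y) = L.diffusion (θ₀ y) := by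
    rintro θ' b hb hm y ⟨t, ht, x, hx, u, hu, rfl⟩
    have e1 := (hsp _ _ hb hm t ht x hx u hu).2
    have e2 := (hsp _ _ a0 m0 t ht x hx u hu).2
    rw [hL.diffusion_mk] at e1 e2
    exact mul_left_cancel₀ (hTt t ht x hx u hu) (e1.trans e2.symm)
  have hD1 : ∀ θ' b, L.Adm I (mk b) → L.MapsEquation J I K T X U (mk b) θ' →
      ∀ y ∈ imageX J I K X, deriv (fun y => L.diffusion (θ' y)) y
        = deriv (fun y => L.diffusion (θ₀ y)) y := by
    intro θ' b hb hm y hy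
    apply Filter.EventuallyEq.deriv_eq
    filter_upwards [hY.mem_nhds hy] with z hz using hD θ' b hb hm z hz
  have hD2 : ∀ θ' b, L.Adm I (mk b) → L.MapsEquation J I K T X U (mk b) θ' →
      ∀ y ∈ imageX J I K X, deriv (deriv (fun y => L.diffusion (θ' y))) y
        = deriv (deriv (fun y => L.diffusion (θ₀ y))) y := by
    intro θ' b hb hm y hy
    apply Filter.EventuallyEq.deriv_eq
    filter_upwards [hY.mem_nhds hy] with z hz using hD1 θ' b hb hm z hz
  have hmem : ∀ t ∈ J, ∀ x ∈ I, ∀ u ∈ K, X t x u ∈ imageX J I K X :=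
    fun t ht x hx u hu => ⟨t, ht, x, hx, u, hu, rfl⟩
  set G₁ : ℝ → ℝ := fun y => L.drift (θ₁ y) - L.drift (θ₀ y) with hG₁
  set G₂ : ℝ → ℝ := fun y => L.drift (θ₂ y) - L.drift (θ₀ y)
  have sG₁ : ContDiffOn ℝ ∞ G₁ (imageX J I K X) :=
    (hL.smooth_coeff b1).2.sub (hL.smooth_coeff b0).2
  have sG₂ : ContDiffOn ℝ ∞ G₂ (imageX J I K X) :=
    (hL.smooth_coeff b2).2.sub (hL.smooth_coeff b0).2
  have k : ∀ θ' b, L.Adm I (mk b) → L.MapsEquation J I K T X U (mk b) θ' →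
      ∀ t ∈ J, ∀ x ∈ I, ∀ u ∈ K,
        pt T t x u * (L.drift (θ' (X t x u)) - L.drift (θ₀ (X t x u))) = b x * px X t x u := by
    intro θ' b hb hm t ht x hx u hu
    have e0 := (hsplit _ _ a0 m0 t ht x hx u hu).1
    have e1 := (hsplit _ _ hb hm t ht x hx u hu).1
    simp only [hL.diffusion_mk, hL.drift_mk, deriv_const', mul_zero, zero_add,
      hD1 _ _ hb hm _ (hmem t ht x hx u hu)] at e0 e1
    have hx' := hXx t ht x hx u hu
    refine mul_right_cancel₀ (hUu t ht x hx u hu) ?_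
    field_simp at e0 e1
    linear_combination e0 - e1
  have k1 : ∀ t ∈ J, ∀ x ∈ I, ∀ u ∈ K, pt T t x u * G₁ (X t x u) = px X t x u :=
    fun t ht x hx u hu => (k _ _ a1 m1 t ht x hx u hu).trans (one_mul _)
  have k2 : ∀ t ∈ J, ∀ x ∈ I, ∀ u ∈ K, pt T t x u * G₂ (X t x u) = x * px X t x u := k _ _ a2 m2
  have hG₁ne : ∀ t ∈ J, ∀ x ∈ I, ∀ u ∈ K, G₁ (X t x u) ≠ 0 := fun t ht x hx u hu h0 =>
    hXx t ht x hx u hu (by rw [← k1 t ht x hx u hu, h0, mul_zero])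
  have hG : ∀ t ∈ J, ∀ x ∈ I, ∀ u ∈ K, G₂ (X t x u) / G₁ (X t x u) = x := by
    intro t ht x hx u hu
    rw [div_eq_iff (hG₁ne t ht x hx u hu)]
    refine mul_left_cancel₀ (hTt t ht x hx u hu) ?_
    linear_combination k2 t ht x hx u hu - x * k1 t ht x hx u hu
  have hXt : ∀ t ∈ J, ∀ x ∈ I, ∀ u ∈ K, pt X t x u = 0 := by
    intro t ht x hx u hu
    have hy := hmem t ht x hx u hu
    obtain ⟨g, hg⟩ : ∃ g, HasDerivAt (fun y => G₂ y / G₁ y) g (X t x u) :=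
      ⟨_, (hasDerivAt_on sG₂ hY hy).div
        (hasDerivAt_on sG₁ hY hy) (hG₁ne t ht x hx u hu)⟩
    have d1 := hg.comp x (sX.hasDerivAt_x hJo hIo hKo ht hx hu)
    have d2 := hg.comp t (sX.hasDerivAt_t hJo hIo hKo ht hx hu)
    have d1' : HasDerivAt (fun y : ℝ => y) (g * px X t x u) x :=
      d1.congr_on hIo (fun y hy => (hG t ht y hy u hu).symm) hx
    have d2' : HasDerivAt (fun _ : ℝ => x) (g * pt X t x u) t :=
      d2.congr_on hJo (fun s hs => (hG s hs x hx u hu).symm) ht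
    have e1 := d1'.unique (hasDerivAt_id' x)
    have e2 := d2'.unique (hasDerivAt_const t x)
    rcases mul_eq_zero.mp e2 with h0 | h0
    · rw [h0, zero_mul] at e1; exact absurd e1 zero_ne_one
    · exact h0
  set χ : ℝ → ℝ := fun x => X t₀ x u₀ with hχ
  have hXχ : ∀ t ∈ J, ∀ x ∈ I, ∀ u ∈ K, X t x u = χ x := by
    intro t ht x hx u hu
    have e1 : X t x u = X t₀ x u := hJ.eq_of_hasDerivAt_zero (f := fun s => X s x u)
      (fun s hs => by rw [← hXt s hs x hx u hu]; exact sX.hasDerivAt_t hJo hIo hKo hs hx hu) ht ht₀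
    have e2 : X t₀ x u = X t₀ x u₀ := hK.eq_of_hasDerivAt_zero (f := fun w => X t₀ x w)
      (fun w hw => by
        rw [← show pu X t₀ x w = 0 from hXu t₀ ht₀ x hx w hw]
        exact sX.hasDerivAt_u hJo hIo hKo ht₀ hx hw) hu hu₀
    exact e1.trans e2
  have sχ : ContDiffOn ℝ ∞ χ I := sX.slice_x ht₀ hu₀
  have eX : EqOnBox J I K X (fun _ y _ => χ y) := hXχ
  have eX1 : ∀ t ∈ J, ∀ x ∈ I, ∀ u ∈ K, px X t x u = deriv χ x := eX.px hIo
  have eX2 : ∀ t ∈ J, ∀ x ∈ I, ∀ u ∈ K, px (px X) t x u = deriv (deriv χ) x :=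
    (eX.px hIo).px hIo
  have hχne : ∀ x ∈ I, deriv χ x ≠ 0 := fun x hx => by
    rw [← eX1 t₀ ht₀ x hx u₀ hu₀]; exact hXx t₀ ht₀ x hx u₀ hu₀
  have hχY : ∀ x ∈ I, χ x ∈ imageX J I K X := fun x hx => hmem t₀ ht₀ x hx u₀ hu₀
  set a := pt T t₀ x₀ u₀ with ha
  have hTa : ∀ t ∈ J, ∀ x ∈ I, ∀ u ∈ K, pt T t x u = a := by
    intro t ht x hx u hu
    have e1 : pt T t x u = pt T t₀ x u₀ := by
      have f1 := k1 t ht x hx u hu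
      have f2 := k1 t₀ ht₀ x hx u₀ hu₀
      rw [eX1 t ht x hx u hu, hXχ t ht x hx u hu] at f1
      rw [eX1 t₀ ht₀ x hx u₀ hu₀, hXχ t₀ ht₀ x hx u₀ hu₀] at f2
      exact mul_right_cancel₀ (hG₁ne t₀ ht₀ x hx u₀ hu₀) (f1.trans f2.symm)
    have e2 : EqOnBox J I K T (fun s _ w => T s x₀ w) := fun s hs y hy w hw =>
      hI.eq_of_hasDerivAt_zero (f := fun y => T s y w)
        (fun z hz => by
          rw [← show px T s z w = 0 from hTx s hs z hz w hw]
          exact sT.hasDerivAt_x hJo hIo hKo hs hz hw) hy hx₀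
    exact e1.trans (e2.pt hJo t₀ ht₀ x hx u₀ hu₀)
  have hane : a ≠ 0 := hTt t₀ ht₀ x₀ hx₀ u₀ hu₀
  have hUx : ∀ t ∈ J, ∀ x ∈ I, ∀ u ∈ K, px U t x u * deriv χ x + U t x u * deriv (deriv χ) x = 0 := by
    intro t ht x hx u hu
    have e0 := (hsplit _ _ a0 m0 t ht x hx u hu).2
    have e1 := (hsplit _ _ a1 m1 t ht x hx u hu).2
    simp only [hL.diffusion_mk, hL.drift_mk, deriv_const', zero_mul, add_zero,
      hD1 _ _ a1 m1 _ (hχY x hx), hD2 _ _ a1 m1 _ (hχY x hx),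
      hTa t ht x hx u hu, eX1 t ht x hx u hu, hXχ t ht x hx u hu] at e0 e1
    have f1 : a * G₁ (χ x) = deriv χ x := by
      have := k1 t ht x hx u hu
      rwa [hTa t ht x hx u hu, eX1 t ht x hx u hu, hXχ t ht x hx u hu] at this
    have d0 := hasDerivAt_on (hL.smooth_coeff b0).2 hY (hχY x hx)
    have d1 := hasDerivAt_on (hL.smooth_coeff b1).2 hY (hχY x hx)
    have dχ := hasDerivAt_on sχ hIo hx
    have dG : HasDerivAt (fun y => a * G₁ (χ y)) (a * ((deriv (fun x => L.drift (θ₁ x)) (χ x)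
        - deriv (fun x => L.drift (θ₀ x)) (χ x)) * deriv χ x)) x :=
      ((d1.sub d0).comp x dχ).const_mul a
    have dG' : HasDerivAt (deriv χ) (a * ((deriv (fun x => L.drift (θ₁ x)) (χ x)
        - deriv (fun x => L.drift (θ₀ x)) (χ x)) * deriv χ x)) x :=
      dG.congr_on hIo (fun y hy => by
        have := k1 t ht y hy u hu
        rw [hTa t ht y hy u hu, eX1 t ht y hy u hu, hXχ t ht y hy u hu] at this
        exact this.symm) hx
    have f2 := dG'.deriv
    have hne := hχne x hx
    have e2 : a * (L.drift (θ₁ (χ x)) - L.drift (θ₀ (χ x))) * px U t x u / deriv χ x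
        + a * (deriv (fun x => L.drift (θ₁ x)) (χ x)
        - deriv (fun x => L.drift (θ₀ x)) (χ x)) * U t x u = 0 := by
      linear_combination e0 - e1
    simp only [hG₁] at f1
    rw [f1, mul_div_assoc, mul_comm, div_mul_cancel₀ _ hne] at e2
    rw [f2]
    linear_combination deriv χ x * e2
  have hUxu : ∀ t ∈ J, ∀ x ∈ I, ∀ u ∈ K,
      px (pu U) t x u * deriv χ x = - (pu U t x u * deriv (deriv χ) x) := by
    intro t ht x hx u hu
    have c1 : EqOnBox J I K (fun t x u => U t x u * deriv χ x)
        (fun t _ u => U t x₀ u * deriv χ x₀) := fun s hs y hy w hw =>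
      hI.eq_of_hasDerivAt_zero (f := fun y => U s y w * deriv χ y)
        (fun z hz => by
          rw [← hUx s hs z hz w hw]
          exact (sU.hasDerivAt_x hJo hIo hKo hs hz hw).mul
            (hasDerivAt_on (deriv_smooth sχ hIo) hIo hz)) hy hx₀
    have c2 : ∀ y ∈ I, pu U t y u = pu U t x₀ u * deriv χ x₀ / deriv χ y := by
      intro y hy
      rw [eq_div_iff (hχne y hy)]
      have d1 := (sU.hasDerivAt_u hJo hIo hKo ht hy hu).mul_const (deriv χ y)
      have d2 := (sU.hasDerivAt_u hJo hIo hKo ht hx₀ hu).mul_const (deriv χ x₀)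
      exact d1.unique (d2.congr_on hKo (fun w hw => c1 t ht y hy w hw) hu)
    have c3 : HasDerivAt (fun y => pu U t y u)
        (-(pu U t x₀ u * deriv χ x₀ * deriv (deriv χ) x) / deriv χ x ^ 2) x := by
      have := (hasDerivAt_const x (pu U t x₀ u * deriv χ x₀)).div
        (hasDerivAt_on (deriv_smooth sχ hIo) hIo hx) (hχne x hx)
      refine (this.congr_on hIo c2 hx).congr_deriv ?_
      simp
    have c4 : px (pu U) t x u = _ := c3.deriv
    rw [c4, c2 x hx]
    have := hχne x hx
    field_simp
  refine ⟨a, χ, hane, sχ, hχne, hXχ, fun θ θ' hθ hmap x hx => ?_⟩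
  obtain ⟨η, hη, hmap', hm⟩ := h.preserves θ hθ
  have heq : θ' (χ x) = η (χ x) := by
    rw [← hXχ t₀ ht₀ x hx u₀ hu₀, hmap t₀ ht₀ x hx u₀ hu₀, hmap' t₀ ht₀ x hx u₀ hu₀]
  have g1 : ∀ y ∈ I, a * L.diffusion (η (χ y)) = L.diffusion (θ y) * deriv χ y ^ 2 := by
    intro y hy
    have := (hsp θ η hθ hm t₀ ht₀ y hy u₀ hu₀).2
    rwa [hTa t₀ ht₀ y hy u₀ hu₀, eX1 t₀ ht₀ y hy u₀ hu₀, hXχ t₀ ht₀ y hy u₀ hu₀] at this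
  rw [heq]
  refine ⟨g1 x hx, ?_⟩
  have g2 := (hsplit θ η hθ hm t₀ ht₀ x hx u₀ hu₀).1
  simp only [hTa t₀ ht₀ x hx u₀ hu₀, eX1 t₀ ht₀ x hx u₀ hu₀, eX2 t₀ ht₀ x hx u₀ hu₀,
    hXχ t₀ ht₀ x hx u₀ hu₀, hXt t₀ ht₀ x hx u₀ hu₀, zero_div, sub_zero] at g2
  have hne := hχne x hx
  have dη := hasDerivAt_on (hL.smooth_coeff hη).1 hY (hχY x hx)
  have dθ := hasDerivAt_on (hL.smooth_coeff hθ).1 hIo hx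
  have dχ := hasDerivAt_on sχ hIo hx
  have dχ1 := hasDerivAt_on (deriv_smooth sχ hIo) hIo hx
  have g3 := ((dη.comp x dχ).const_mul a).unique ((dθ.mul (dχ1.pow 2)).congr_on hIo g1 hx)
  have g4 := hUxu t₀ ht₀ x hx u₀ hu₀
  have hu := hUu t₀ ht₀ x hx u₀ hu₀
  simp only [Nat.cast_ofNat, Nat.reduceSub, pow_one, Pi.pow_apply] at g3
  refine mul_left_cancel₀ hne (mul_left_cancel₀ hu ?_)
  field_simp at g2
  linear_combination (-1 : ℝ) * deriv χ x * g2 - 2 * pu U t₀ x u₀ * g3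
    - 2 * L.diffusion (θ x) * deriv χ x * g4

end Equiv

end FPClass

/-! ### Equivalence transformations: construction -/

section Inverse

variable {I : Set ℝ} {χ : ℝ → ℝ}

theorem IsOpenInterval.injOn_of_deriv_ne_zero (hI : IsOpenInterval I) (hχ : ContDiffOn ℝ ∞ χ I)
    (hne : ∀ x ∈ I, deriv χ x ≠ 0) : Set.InjOn χ I := by
  have key : ∀ x ∈ I, ∀ y ∈ I, x < y → χ x ≠ χ y := by
    intro x hx y hy hxy he
    have hsub : Set.Icc x y ⊆ I := hI.2.1.out hx hy
    obtain ⟨c, hc, h0⟩ := exists_deriv_eq_zero hxy (hχ.continuousOn.mono hsub) he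
    exact hne c (hsub (Set.Ioo_subset_Icc_self hc)) h0
  intro x hx y hy he
  rcases lt_trichotomy x y with h | h | h
  · exact absurd he (key x hx y hy h)
  · exact h
  · exact absurd he.symm (key y hy x hx h)

theorem IsOpenInterval.exists_smooth_inverse (hI : IsOpenInterval I) (hχ : ContDiffOn ℝ ∞ χ I)
    (hne : ∀ x ∈ I, deriv χ x ≠ 0) :
    ∃ ψ : ℝ → ℝ, ContDiffOn ℝ ∞ ψ (χ '' I) ∧ ∀ x ∈ I, ψ (χ x) = x := by
  have hinj := hI.injOn_of_deriv_ne_zero hχ hne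
  have hleft : ∀ x ∈ I, Function.invFunOn χ I (χ x) = x := fun x hx =>
    hinj (Function.invFunOn_apply_mem hx) hx (Function.invFunOn_apply_eq hx)
  refine ⟨Function.invFunOn χ I, ?_, hleft⟩
  rintro _ ⟨x, hx, rfl⟩
  have hat : ContDiffAt ℝ ∞ χ x := hχ.contDiffAt (hI.isOpen.mem_nhds hx)
  have hd := (hasDerivAt_on hχ hI.isOpen hx).hasFDerivAt_equiv (hne x hx)
  have hs := hat.hasStrictFDerivAt' hd (by simp)
  have hg := hat.to_localInverse hd (by simp)
  have hgx : hs.localInverse χ _ x (χ x) = x := hs.localInverse_apply_image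
  have h1 := hs.eventually_right_inverse
  have h2 : ∀ᶠ y in 𝓝 (χ x), hs.localInverse χ _ x y ∈ I := by
    apply hs.localInverse_continuousAt.eventually_mem
    rw [hgx]; exact hI.isOpen.mem_nhds hx
  refine (hg.congr_of_eventuallyEq ?_).contDiffWithinAt
  filter_upwards [h1, h2] with y hy1 hy2
  have := hleft _ hy2
  rw [hy1] at this
  exact this

theorem isOpen_image_of_deriv_ne_zero (hI : IsOpen I) (hχ : ContDiffOn ℝ ∞ χ I)
    (hne : ∀ x ∈ I, deriv χ x ≠ 0) : IsOpen (χ '' I) := by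
  rw [isOpen_iff_mem_nhds]
  rintro _ ⟨x, hx, rfl⟩
  have hat : ContDiffAt ℝ ∞ χ x := hχ.contDiffAt (hI.mem_nhds hx)
  have hs := hat.hasStrictDerivAt (by simp)
  rw [← hs.map_nhds_eq (hne x hx)]
  exact Filter.image_mem_map (hI.mem_nhds hx)

theorem IsOpenInterval.image_of_deriv_ne_zero (hI : IsOpenInterval I) (hχ : ContDiffOn ℝ ∞ χ I)
    (hne : ∀ x ∈ I, deriv χ x ≠ 0) : IsOpenInterval (χ '' I) :=
  ⟨isOpen_image_of_deriv_ne_zero hI.isOpen hχ hne,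
    (hI.isPreconnected.image χ hχ.continuousOn).ordConnected, hI.nonempty.image χ⟩

end Inverse

theorem mapsFP_of_coeff {I : Set ℝ} {χ A B A' B' : ℝ → ℝ} {s : ℝ} (hI : IsOpen I)
    (hχ : ContDiffOn ℝ ∞ χ I) (hne : ∀ x ∈ I, deriv χ x ≠ 0) (hs : s ≠ 0)
    (hA : ContDiffOn ℝ ∞ A I) (hB : ContDiffOn ℝ ∞ B I)
    (hA' : ContDiffOn ℝ ∞ A' (χ '' I)) (hB' : ContDiffOn ℝ ∞ B' (χ '' I))
    (h1 : ∀ x ∈ I, s * A' (χ x) = A x * deriv χ x ^ 2)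
    (h2 : ∀ x ∈ I, s * B' (χ x) = B x * deriv χ x - A x * deriv (deriv χ) x) {J K : Set ℝ} :
    MapsFP J I K (fun t _ _ => s * t) (fun _ x _ => χ x) (fun _ x u => u / deriv χ x) A B A' B' := by
  intro j j' _ hx _ hsat hp
  have hY := isOpen_image_of_deriv_ne_zero hI hχ hne
  have hχ1 := deriv_smooth hχ hI
  have hχ2 := deriv_smooth hχ1 hI
  have c0 := hasDerivAt_on hχ hI hx
  have c1 := fun x (hx : x ∈ I) => hasDerivAt_on hχ1 hI hx
  have c2 := hasDerivAt_on hχ2 hI hx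
  have n := hne j.x hx
  have hy : χ j.x ∈ χ '' I := ⟨_, hx, rfl⟩
  -- the derivatives of the new coefficients
  have e1 : ∀ x ∈ I, s * deriv A' (χ x) = deriv A x * deriv χ x + 2 * A x * deriv (deriv χ) x := by
    intro x hx
    have d := (((hasDerivAt_on hA' hY ⟨x, hx, rfl⟩).comp x
      (hasDerivAt_on hχ hI hx)).const_mul s).unique
      (((hasDerivAt_on hA hI hx).mul ((c1 x hx).pow 2)).congr_on hI h1 hx)
    simp only [Nat.cast_ofNat, Nat.reduceSub, pow_one, Pi.pow_apply] at d
    exact mul_right_cancel₀ (hne x hx) (by linear_combination d)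
  have e2 : s * deriv (deriv A') (χ j.x) * deriv χ j.x = deriv (deriv A) j.x * deriv χ j.x
      + 3 * deriv A j.x * deriv (deriv χ) j.x + 2 * A j.x * deriv (deriv (deriv χ)) j.x := by
    have d := (((hasDerivAt_on (deriv_smooth hA' hY) hY hy).comp j.x
      c0).const_mul s).unique
      ((((hasDerivAt_on (deriv_smooth hA hI) hI hx).mul
        (c1 _ hx)).add (((hasDerivAt_on hA hI hx).const_mul 2).mul
          c2)).congr_on hI e1 hx)
    linear_combination d
  have e3 : s * deriv B' (χ j.x) * deriv χ j.x = deriv B j.x * deriv χ j.x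
      + B j.x * deriv (deriv χ) j.x - deriv A j.x * deriv (deriv χ) j.x
      - A j.x * deriv (deriv (deriv χ)) j.x := by
    have d := (((hasDerivAt_on hB' hY hy).comp j.x c0).const_mul s).unique
      ((((hasDerivAt_on hB hI hx).mul (c1 _ hx)).sub
        ((hasDerivAt_on hA hI hx).mul c2)).congr_on hI h2 hx)
    linear_combination d
  -- the prolongation
  have u1 : ∀ u, ∀ x ∈ I, deriv (fun y => u / deriv χ y) x
      = -u * deriv (deriv χ) x / deriv χ x ^ 2 := fun u x hx => by
    have := ((hasDerivAt_const x u).div (c1 x hx) (hne x hx)).deriv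
    rw [show (fun y => u / deriv χ y) = (fun _ => u) / deriv χ from rfl, this]
    simp
  have u2 : deriv (fun y => deriv (fun z => j.u / deriv χ z) y) j.x
      = -j.u * (deriv (deriv (deriv χ)) j.x * deriv χ j.x - 2 * deriv (deriv χ) j.x ^ 2)
        / deriv χ j.x ^ 3 := by
    have d := (c2.const_mul (-j.u)).div ((c1 j.x hx).pow 2) (pow_ne_zero 2 n)
    rw [(d.congr_on hI (fun y hy => by rw [u1 _ y hy]; rfl) hx).deriv]
    simp only [Nat.cast_ofNat, Nat.reduceSub, pow_one, Pi.pow_apply]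
    field_simp
    ring
  have w1 : ∀ y u, deriv (fun w : ℝ => w / deriv χ y) u = 1 / deriv χ y := fun y u => by simp
  have w2 := u1 1 j.x hx
  have f1 := hp.dt_eq
  have f2 := hp.dx_eq
  have f3 := hp.dxx_eq
  have f4 := hp.x_eq
  have f5 := hp.u_eq
  have sT : ∀ t, deriv (fun r : ℝ => s * r) t = s := fun t => by simp
  simp only [Dt, Dx, Dxx, at₀, px, pt, pu, deriv_const', w1, w2, u2, u1 _ _ hx, sT, mul_zero,
    add_zero, zero_add, zero_mul, ne_eq, OfNat.ofNat_ne_zero, not_false_eq_true, zero_pow]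
    at f1 f2 f3 f4 f5
  simp only [SatFP, fpRhs] at hsat ⊢
  have h10 := h1 _ hx
  have h20 := h2 _ hx
  have h11 := e1 _ hx
  rw [f4, f5]
  generalize deriv (deriv (deriv χ)) j.x = r at *
  generalize deriv (deriv χ) j.x = q at *
  generalize deriv χ j.x = p at *
  have v1 : j'.ut = j.ut / (p * s) := by field_simp at f1 ⊢; linear_combination -f1
  have v2 : j'.ux = (-j.u * q / p ^ 2 + j.ux * (1 / p))
      / p := by rw [eq_div_iff n]; linear_combination -f2
  have v3 : j'.uxx = (-j.u * (r * p
      - 2 * q ^ 2) / p ^ 3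
      + 2 * j.ux * (-1 * q / p ^ 2) + j.uxx * (1 / p)
      - j'.ux * q) / p ^ 2 := by
    rw [eq_div_iff (pow_ne_zero 2 n)]; linear_combination -f3
  have a0 : A' (χ j.x) = A j.x * p ^ 2 / s := by rw [eq_div_iff hs, ← h10, mul_comm]
  have a1 : deriv A' (χ j.x) = (deriv A j.x * p + 2 * A j.x * q) / s := by
    rw [eq_div_iff hs, ← h11, mul_comm]
  have a2 : deriv (deriv A') (χ j.x) = (deriv (deriv A) j.x * p
      + 3 * deriv A j.x * q + 2 * A j.x * r)
      / (s * p) := by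
    rw [eq_div_iff (mul_ne_zero hs n)]; linear_combination e2
  have b0 : B' (χ j.x) = (B j.x * p - A j.x * q) / s := by
    rw [eq_div_iff hs]; linear_combination h20
  have b1 : deriv B' (χ j.x) = (deriv B j.x * p
      + B j.x * q - deriv A j.x * q
      - A j.x * r) / (s * p) := by
    rw [eq_div_iff (mul_ne_zero hs n)]; linear_combination e3
  rw [v3, v2, v1, a0, a1, a2, b0, b1, hsat]
  field_simp
  ring

/-- A family of diffeomorphisms of the range that is compatible with a change of `x` gives
an equivalence. -/
theorem equivalent_of_coeff {E : Type} [NormedAddCommGroup E] [NormedSpace ℝ E]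
    [FiniteDimensional ℝ E] {L : FPClass E} {ε : ℝ} {mk : (ℝ → ℝ) → ℝ → E} (hL : L.Rich ε mk)
    {I : Set ℝ} (hI : IsOpenInterval I) {χ : ℝ → ℝ} (hχ : ContDiffOn ℝ ∞ χ I)
    (hne : ∀ x ∈ I, deriv χ x ≠ 0) {s : ℝ} (hs : s ≠ 0) {Φ Λ : ℝ → E → E}
    (hΦ : ContDiffOn ℝ ∞ (fun p : ℝ × E => Φ p.1 p.2) (I ×ˢ L.range))
    (hΛ : ContDiffOn ℝ ∞ (fun p : ℝ × E => Λ p.1 p.2) (I ×ˢ L.range))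
    (hmaps : ∀ x ∈ I, ∀ r ∈ L.range, Φ x r ∈ L.range)
    (hleft : ∀ x ∈ I, ∀ r ∈ L.range, Λ x (Φ x r) = r)
    (h1 : ∀ x ∈ I, ∀ r ∈ L.range, s * L.diffusion (Φ x r) = L.diffusion r * deriv χ x ^ 2)
    (h2 : ∀ x ∈ I, ∀ r ∈ L.range,
      s * L.drift (Φ x r) = L.drift r * deriv χ x - L.diffusion r * deriv (deriv χ) x)
    {θ θ' : ℝ → E} (hθ' : ∀ x ∈ I, θ' (χ x) = Φ x (θ x)) :
    L.Equivalent I θ (χ '' I) θ' := by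
  have hIo := hI.isOpen
  have hχ1 := deriv_smooth hχ hIo
  obtain ⟨ψ, hψ, hψχ⟩ := hI.exists_smooth_inverse hχ hne
  have hYo := isOpen_image_of_deriv_ne_zero hIo hχ hne
  have himg : imageX Set.univ I Set.univ (fun _ x _ => χ x) = χ '' I := by
    ext y; simp [imageX]
  have hψI : ∀ y ∈ χ '' I, ψ y ∈ I := by rintro _ ⟨x, hx, rfl⟩; rw [hψχ x hx]; exact hx
  set T : ℝ → ℝ → ℝ → ℝ := fun t _ _ => s * t with hT
  set X : ℝ → ℝ → ℝ → ℝ := fun _ x _ => χ x with hX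
  set U : ℝ → ℝ → ℝ → ℝ := fun _ x u => u / deriv χ x with hU
  set Θ : ℝ → ℝ → ℝ → E → E := fun _ x _ r => Φ x r with hΘ
  set D : Set ((ℝ × ℝ × ℝ) × E) := (Set.univ ×ˢ I ×ˢ Set.univ) ×ˢ L.range with hD
  have hDo : IsOpen D := (isOpen_univ.prod (hIo.prod isOpen_univ)).prod hL.isOpen_range
  have hsm : ContDiffOn ℝ ∞ (totalMap T X U Θ) D := by
    have p1 : ContDiffOn ℝ ∞ (fun p => χ p.1.2.1) D :=
      hχ.comp (by fun_prop) (fun p hp => hp.1.2.1)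
    have p2 : ContDiffOn ℝ ∞ (fun p => deriv χ p.1.2.1) D :=
      hχ1.comp (by fun_prop) (fun p hp => hp.1.2.1)
    have p3 : ContDiffOn ℝ ∞ (fun p => p.1.2.2 / deriv χ p.1.2.1) D :=
      ContDiffOn.div (by fun_prop) p2 (fun p hp => hne _ hp.1.2.1)
    have p4 : ContDiffOn ℝ ∞ (fun p => Φ p.1.2.1 p.2) D :=
      hΦ.comp (f := fun p : (ℝ × ℝ × ℝ) × E => (p.1.2.1, p.2)) (by fun_prop)
        (fun p hp => ⟨hp.1.2.1, hp.2⟩)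
    exact ((ContDiffOn.prodMk (by fun_prop) (p1.prodMk p3))).prodMk p4
  -- a left inverse
  set G : (ℝ × ℝ × ℝ) × E → (ℝ × ℝ × ℝ) × E := fun p =>
    ((p.1.1 / s, ψ p.1.2.1, p.1.2.2 * deriv χ (ψ p.1.2.1)), Λ (ψ p.1.2.1) p.2) with hG
  have hGF : ∀ p ∈ D, G (totalMap T X U Θ p) = p := by
    rintro ⟨⟨t, x, u⟩, r⟩ ⟨⟨-, hx, -⟩, hr⟩
    simp only [hG, totalMap, hT, hX, hU, hΘ, hψχ x hx, hleft x hx r hr,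
      mul_div_cancel_left₀ t hs, div_mul_cancel₀ u (hne x hx)]
  set D' : Set ((ℝ × ℝ × ℝ) × E) := (Set.univ ×ˢ (χ '' I) ×ˢ Set.univ) ×ˢ L.range
  have hD' : IsOpen D' := (isOpen_univ.prod (hYo.prod isOpen_univ)).prod hL.isOpen_range
  have hGsm : ContDiffOn ℝ ∞ G D' := by
    have p1 : ContDiffOn ℝ ∞ (fun p => ψ p.1.2.1) D' :=
      hψ.comp (by fun_prop) (fun p hp => hp.1.2.1)
    have p2 : ContDiffOn ℝ ∞ (fun p => deriv χ (ψ p.1.2.1)) D' :=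
      hχ1.comp p1 (fun p hp => hψI _ hp.1.2.1)
    have p3 : ContDiffOn ℝ ∞ (fun p => p.1.2.2 * deriv χ (ψ p.1.2.1)) D' :=
      ContDiffOn.mul (by fun_prop) p2
    have p4 : ContDiffOn ℝ ∞ (fun p => Λ (ψ p.1.2.1) p.2) D' :=
      hΛ.comp (f := fun p : (ℝ × ℝ × ℝ) × E => (ψ p.1.2.1, p.2))
        (p1.prodMk (by fun_prop)) (fun p hp => ⟨hψI _ hp.1.2.1, hp.2⟩)
    exact ((ContDiffOn.prodMk (by fun_prop) (p1.prodMk p3))).prodMk p4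
  refine ⟨Set.univ, Set.univ, isOpenInterval_univ, isOpenInterval_univ, T, X, U, Θ,
    ⟨hsm, ?_, ?_, ?_⟩, himg, fun t _ x hx u _ => hθ' x hx⟩
  · intro p hp q hq he
    rw [← hGF p hp, ← hGF q hq, he]
  · intro p hp
    have hFp : totalMap T X U Θ p ∈ D' :=
      ⟨⟨trivial, ⟨_, hp.1.2.1, rfl⟩, trivial⟩, hmaps _ hp.1.2.1 _ hp.2⟩
    have dG := ((hGsm.differentiableOn (by simp)).differentiableAt
      (hD'.mem_nhds hFp)).hasFDerivAt
    have dF := ((hsm.differentiableOn (by simp)).differentiableAt (hDo.mem_nhds hp)).hasFDerivAt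
    have dGF := dG.comp p dF
    have did : HasFDerivAt (G ∘ totalMap T X U Θ) (ContinuousLinearMap.id ℝ _) p := by
      refine (hasFDerivAt_id p).congr_of_eventuallyEq ?_
      filter_upwards [hDo.mem_nhds hp] with q hq using hGF q hq
    have hcomp := dGF.unique did
    have hinj : Function.Injective (fderiv ℝ (totalMap T X U Θ) p) := by
      intro v w hvw
      have e1 := DFunLike.congr_fun hcomp v
      have e2 := DFunLike.congr_fun hcomp w
      simp only [ContinuousLinearMap.comp_apply, ContinuousLinearMap.id_apply] at e1 e2
      rw [← e1, ← e2, hvw]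
    exact ⟨hinj, LinearMap.surjective_of_injective
      (f := (fderiv ℝ (totalMap T X U Θ) p).toLinearMap) hinj⟩
  · intro η hη
    have hη' : L.Adm (χ '' I) (fun y => Φ (ψ y) (η (ψ y))) :=
      ⟨hΦ.comp (f := fun y => (ψ y, η (ψ y))) (hψ.prodMk (hη.1.comp hψ hψI))
        (fun y hy => ⟨hψI y hy, hη.2 _ (hψI y hy)⟩),
        fun y hy => hmaps _ (hψI y hy) _ (hη.2 _ (hψI y hy))⟩
    refine ⟨fun y => Φ (ψ y) (η (ψ y)), by rw [himg]; exact hη', fun t _ x hx u _ => ?_, ?_⟩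
    · simp only [hX, hψχ x hx, hΘ]
    · exact mapsFP_of_coeff hIo hχ hne hs (hL.smooth_coeff hη).1 (hL.smooth_coeff hη).2
        (hL.smooth_coeff hη').1 (hL.smooth_coeff hη').2
        (fun x hx => by rw [hψχ x hx]; exact h1 x hx _ (hη.2 x hx))
        (fun x hx => by rw [hψχ x hx]; exact h2 x hx _ (hη.2 x hx))

theorem hasDerivAt_affine (k c x : ℝ) : HasDerivAt (fun x => k * x + c) k x := by
  simpa using ((hasDerivAt_id' x).const_mul k).add_const c

theorem deriv_affine (k c : ℝ) : deriv (fun x => k * x + c) = fun _ => k :=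
  funext fun x => (hasDerivAt_affine k c x).deriv

theorem equivalent_reduced {ε : ℝ} (hε : ε ≠ 0) {I : Set ℝ} (hI : IsOpenInterval I) {k c : ℝ}
    (hk : k ≠ 0) {B B' : ℝ → ℝ} (h : ∀ x ∈ I, B' (k * x + c) = B x / k) :
    (reducedFP ε).Equivalent I B ((fun x => k * x + c) '' I) B' := by
  refine equivalent_of_coeff (rich_reduced hε) hI (χ := fun x => k * x + c) (s := k ^ 2)
    (Φ := fun _ r => r / k) (Λ := fun _ r => r * k) (by fun_prop) ?_ (pow_ne_zero 2 hk)
    (by fun_prop) (by fun_prop) ?_ ?_ ?_ ?_ h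
  · simp [hk]
  · exact fun _ _ _ _ => trivial
  · intro x _ r _; exact div_mul_cancel₀ r hk
  · intro x _ r _; simp only [reducedFP, deriv_affine]; ring
  · intro x _ r _; simp only [reducedFP, deriv_affine, deriv_const']; field_simp; ring

theorem equivalent_full {I : Set ℝ} (hI : IsOpenInterval I) {χ : ℝ → ℝ}
    (hχ : ContDiffOn ℝ ∞ χ I) (hne : ∀ x ∈ I, deriv χ x ≠ 0) {s : ℝ} (hs : s ≠ 0)
    {θ θ' : ℝ → ℝ × ℝ}
    (h : ∀ x ∈ I, θ' (χ x) = ((θ x).1 * deriv χ x ^ 2 / s,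
      ((θ x).2 * deriv χ x - (θ x).1 * deriv (deriv χ) x) / s)) :
    fullFP.Equivalent I θ (χ '' I) θ' := by
  have c1 : ContDiffOn ℝ ∞ (fun p : ℝ × (ℝ × ℝ) => deriv χ p.1) (I ×ˢ fullFP.range) :=
    (deriv_smooth hχ hI.isOpen).comp (by fun_prop) (fun p hp => hp.1)
  have c2 : ContDiffOn ℝ ∞ (fun p : ℝ × (ℝ × ℝ) => deriv (deriv χ) p.1) (I ×ˢ fullFP.range) :=
    (deriv_smooth (deriv_smooth hχ hI.isOpen) hI.isOpen).comp
      (by fun_prop) (fun p hp => hp.1)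
  have hn : ∀ p ∈ I ×ˢ fullFP.range, deriv χ p.1 ≠ 0 := fun p hp => hne p.1 hp.1
  refine equivalent_of_coeff (rich_full one_ne_zero) hI (s := s) hχ hne hs
    (Φ := fun x r => (r.1 * deriv χ x ^ 2 / s,
      (r.2 * deriv χ x - r.1 * deriv (deriv χ) x) / s))
    (Λ := fun x r => (s * r.1 / deriv χ x ^ 2,
      (s * r.2 + s * r.1 / deriv χ x ^ 2 * deriv (deriv χ) x) / deriv χ x)) ?_ ?_ ?_ ?_ ?_ ?_ h
  · refine ContDiffOn.prodMk ?_ ?_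
    · exact ((ContDiffOn.mul (by fun_prop) (c1.pow 2))).div_const s
    · exact ((ContDiffOn.mul (by fun_prop) c1).sub (ContDiffOn.mul (by fun_prop) c2)).div_const s
  · have q : ContDiffOn ℝ ∞ (fun p : ℝ × (ℝ × ℝ) => s * p.2.1 / deriv χ p.1 ^ 2)
        (I ×ˢ fullFP.range) :=
      ContDiffOn.div (by fun_prop) (c1.pow 2) (fun p hp => pow_ne_zero 2 (hn p hp))
    exact q.prodMk (((ContDiffOn.add (by fun_prop) (q.mul c2))).div c1 hn)
  · intro x hx r hr
    have := hne x hx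
    have hr' : r.1 ≠ 0 := hr
    exact div_ne_zero (mul_ne_zero hr' (pow_ne_zero 2 this)) hs
  · intro x hx r hr
    have := hne x hx
    refine Prod.ext ?_ ?_
    · simp only; field_simp
    · simp only; field_simp; ring
  · intro x hx r hr
    simp only [fullFP]; field_simp
  · intro x hx r hr
    simp only [fullFP]; field_simp

/-! ### Confluent hypergeometric functions -/

section Series

open Complex Metric

/-- The reciprocal Gamma function decays factorially, locally uniformly. -/
theorem exists_inv_Gamma_bound (R : ℝ) (hR : 0 ≤ R) :
    ∃ C K : ℝ, 0 ≤ C ∧ 1 ≤ K ∧ ∀ b : ℂ, ‖b‖ ≤ R → ∀ n : ℕ,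
      ‖(Gamma (b + n))⁻¹‖ * (n.factorial : ℝ) ≤ C * K ^ n := by
  have hcont : ∀ n : ℕ, Continuous fun b : ℂ => (Gamma (b + n))⁻¹ := fun n =>
    differentiable_one_div_Gamma.continuous.comp (by fun_prop)
  have hex : ∀ n : ℕ, ∃ C : ℝ, ∀ b ∈ closedBall (0 : ℂ) R, ‖(Gamma (b + n))⁻¹‖ ≤ C := fun n =>
    (isCompact_closedBall (0 : ℂ) R).exists_bound_of_continuousOn (hcont n).continuousOn
  choose C hC using hex
  have hC0 : ∀ n, 0 ≤ C n := fun n =>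
    (norm_nonneg _).trans (hC n 0 (by simpa using hR))
  set n₀ := ⌈R⌉₊ + 1 with hn₀
  set C' := ∑ k ∈ Finset.range (n₀ + 1), C k * (k.factorial : ℝ) with hC'
  have hC'0 : 0 ≤ C' := Finset.sum_nonneg fun k _ => mul_nonneg (hC0 k) (Nat.cast_nonneg _)
  refine ⟨C', R + 2, hC'0, by linarith, fun b hb n => ?_⟩
  have hb' : b ∈ closedBall (0 : ℂ) R := by simpa using hb
  have hK : 1 ≤ R + 2 := by linarith
  have small : ∀ n ≤ n₀, ‖(Gamma (b + n))⁻¹‖ * (n.factorial : ℝ) ≤ C' * (R + 2) ^ n := by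
    intro n hn
    calc ‖(Gamma (b + n))⁻¹‖ * (n.factorial : ℝ) ≤ C n * (n.factorial : ℝ) := by
          gcongr; exact hC n b hb'
      _ ≤ C' := Finset.single_le_sum (f := fun k => C k * (k.factorial : ℝ))
          (fun k _ => mul_nonneg (hC0 k) (Nat.cast_nonneg _)) (Finset.mem_range.2 (by omega))
      _ ≤ C' * (R + 2) ^ n := le_mul_of_one_le_right hC'0 (one_le_pow₀ hK)
  rcases le_total n n₀ with h | h
  · exact small n h
  · induction n, h using Nat.le_induction with
    | base => exact small n₀ le_rfl
    | succ n hn ih =>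
      have hnR : (1 : ℝ) ≤ n - R := by
        have h1 : R ≤ ⌈R⌉₊ := Nat.le_ceil R
        have h2 : (n₀ : ℝ) ≤ n := by exact_mod_cast hn
        rw [hn₀] at h2; push_cast at h2; linarith
      have hbn : (n : ℝ) - R ≤ ‖b + n‖ := by
        have h1 : ‖(n : ℂ)‖ ≤ ‖b + n‖ + ‖b‖ := by
          calc ‖(n : ℂ)‖ = ‖(b + n) - b‖ := by ring_nf
            _ ≤ _ := norm_sub_le _ _
        rw [Complex.norm_natCast] at h1; linarith
      have hrec : (Gamma (b + n))⁻¹ = (b + n) * (Gamma (b + (n + 1 : ℕ)))⁻¹ := by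
        rw [one_div_Gamma_eq_self_mul_one_div_Gamma_add_one]
        push_cast; ring_nf
      have hle : ‖(Gamma (b + (n + 1 : ℕ)))⁻¹‖ * (n + 1) ≤ (R + 2) * ‖(Gamma (b + n))⁻¹‖ := by
        rw [hrec, norm_mul]
        have : (n : ℝ) + 1 ≤ (R + 2) * ‖b + n‖ := by nlinarith
        nlinarith [norm_nonneg (Gamma (b + (n + 1 : ℕ)))⁻¹]
      rw [Nat.factorial_succ]
      push_cast at hle ⊢
      calc ‖(Gamma (b + (n + 1)))⁻¹‖ * ((n + 1) * (n.factorial : ℝ))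
          = (‖(Gamma (b + (n + 1)))⁻¹‖ * (n + 1)) * (n.factorial : ℝ) := by ring
        _ ≤ ((R + 2) * ‖(Gamma (b + n))⁻¹‖) * (n.factorial : ℝ) := by gcongr
        _ = (R + 2) * (‖(Gamma (b + n))⁻¹‖ * (n.factorial : ℝ)) := by ring
        _ ≤ (R + 2) * (C' * (R + 2) ^ n) := by gcongr
        _ = C' * (R + 2) ^ (n + 1) := by ring

theorem norm_ascPochhammer_le {R : ℝ} (hR : 0 ≤ R) {a : ℂ} (ha : ‖a‖ ≤ R) (n : ℕ) :
    ‖(ascPochhammer ℂ n).eval a‖ ≤ (n.factorial : ℝ) * (R + 1) ^ n := by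
  induction n with
  | zero => simp
  | succ n ih =>
    rw [ascPochhammer_succ_eval, norm_mul, Nat.factorial_succ]
    have h1 : ‖a + n‖ ≤ (n + 1) * (R + 1) := by
      calc ‖a + n‖ ≤ ‖a‖ + ‖(n : ℂ)‖ := norm_add_le _ _
        _ ≤ R + n := by rw [Complex.norm_natCast]; linarith
        _ ≤ (n + 1) * (R + 1) := by nlinarith [(Nat.cast_nonneg n : (0 : ℝ) ≤ n)]
    push_cast
    calc ‖(ascPochhammer ℂ n).eval a‖ * ‖a + n‖
        ≤ ((n.factorial : ℝ) * (R + 1) ^ n) * ((n + 1) * (R + 1)) := by gcongr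
      _ = (n + 1) * (n.factorial : ℝ) * (R + 1) ^ (n + 1) := by ring

/-- A power series in `z` whose coefficients depend on parameters, with factorially decaying
coefficients, locally uniformly. -/
structure EntireFamily {P : Type*} [NormedAddCommGroup P] [NormedSpace ℂ P] (c : P → ℕ → ℂ) :
    Prop where
  differentiable : ∀ n, Differentiable ℂ fun p => c p n
  bound : ∀ R : ℝ, 0 ≤ R → ∃ C K : ℝ, 0 ≤ C ∧ 0 ≤ K ∧ ∀ p, ‖p‖ ≤ R → ∀ n : ℕ,
    ‖c p n‖ ≤ C * (K ^ n / (n.factorial : ℝ))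

namespace EntireFamily

variable {P : Type*} [NormedAddCommGroup P] [NormedSpace ℂ P] {c : P → ℕ → ℂ}

theorem exists_summable_bound (h : EntireFamily c) (R : ℝ) (hR : 0 ≤ R) :
    ∃ u : ℕ → ℝ, Summable u ∧ ∀ p, ‖p‖ ≤ R → ∀ z : ℂ, ‖z‖ ≤ R → ∀ n, ‖c p n * z ^ n‖ ≤ u n := by
  obtain ⟨C, K, hC, hK, hb⟩ := h.bound R hR
  refine ⟨fun n => C * ((K * R) ^ n / (n.factorial : ℝ)),
    (Real.summable_pow_div_factorial (K * R)).mul_left C, fun p hp z hz n => ?_⟩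
  rw [norm_mul, norm_pow]
  calc ‖c p n‖ * ‖z‖ ^ n ≤ (C * (K ^ n / (n.factorial : ℝ))) * R ^ n := by
        gcongr; exact hb p hp n
    _ = C * ((K * R) ^ n / (n.factorial : ℝ)) := by rw [mul_pow]; ring

theorem summable (h : EntireFamily c) (p : P) (z : ℂ) : Summable fun n => c p n * z ^ n := by
  obtain ⟨u, hu, hb⟩ := h.exists_summable_bound (max ‖p‖ ‖z‖) (le_max_of_le_left (norm_nonneg _))
  exact Summable.of_norm_bounded hu (hb p (le_max_left _ _) z (le_max_right _ _))

theorem continuous_tsum (h : EntireFamily c) :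
    Continuous fun q : P × ℂ => ∑' n, c q.1 n * q.2 ^ n := by
  rw [continuous_iff_continuousAt]
  intro q₀
  obtain ⟨u, hu, hb⟩ := h.exists_summable_bound (‖q₀‖ + 1) (by positivity)
  have hc : ContinuousOn (fun q : P × ℂ => ∑' n, c q.1 n * q.2 ^ n) (ball 0 (‖q₀‖ + 1)) := by
    refine continuousOn_tsum (fun n => ?_) hu (fun n q hq => ?_)
    · exact (((h.differentiable n).continuous.comp continuous_fst).mul
        (continuous_snd.pow n)).continuousOn
    · have hq' : ‖q‖ < ‖q₀‖ + 1 := by simpa using hq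
      exact hb _ ((norm_fst_le q).trans hq'.le) _ ((norm_snd_le q).trans hq'.le) n
  exact hc.continuousAt (isOpen_ball.mem_nhds (by simp))

theorem hasDerivAt_tsum (h : EntireFamily c) (p : P) (z : ℂ) :
    HasDerivAt (fun z => ∑' n, c p n * z ^ n) (∑' n, (n + 1) * c p (n + 1) * z ^ n) z := by
  obtain ⟨u, hu, hb⟩ := h.exists_summable_bound (max ‖p‖ (‖z‖ + 1)) (by positivity)
  have hmem : z ∈ ball (0 : ℂ) (‖z‖ + 1) := by simp
  have hbd : ∀ (n : ℕ) (w : ℂ), w ∈ ball (0 : ℂ) (‖z‖ + 1) → ‖c p n * w ^ n‖ ≤ u n :=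
    fun n w hw => hb p (le_max_left _ _) w (le_max_of_le_right (mem_ball_zero_iff.1 hw).le) n
  have hdiff : ∀ n : ℕ, DifferentiableOn ℂ (fun w : ℂ => c p n * w ^ n)
      (ball 0 (‖z‖ + 1)) := fun n => by fun_prop
  have hd := differentiableOn_tsum_of_summable_norm hu hdiff isOpen_ball hbd
  have hs := hasSum_deriv_of_summable_norm hu hdiff isOpen_ball hbd hmem
  have hda := (hd.differentiableAt (isOpen_ball.mem_nhds hmem)).hasDerivAt
  refine hda.congr_deriv ?_
  have hterm : ∀ n : ℕ, deriv (fun w : ℂ => c p n * w ^ n) z = c p n * (n * z ^ (n - 1)) := by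
    intro n; simp
  have hs' := hs
  rw [← hasSum_nat_add_iff' 1] at hs'
  simp only [hterm, Finset.range_one, Finset.sum_singleton, Nat.cast_zero, zero_mul, mul_zero,
    sub_zero, Nat.add_sub_cancel, Nat.cast_add, Nat.cast_one] at hs'
  rw [← hs'.tsum_eq]
  exact tsum_congr fun n => by ring

theorem differentiable_param (h : EntireFamily c) {g : ℂ → P} (hg : Differentiable ℂ g) (z : ℂ) :
    Differentiable ℂ fun m => ∑' n, c (g m) n * z ^ n := by
  intro m₀
  set R := max (‖g m₀‖ + 1) ‖z‖ with hR
  have hR0 : 0 ≤ R := le_max_of_le_right (norm_nonneg _)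
  obtain ⟨u, hu, hb⟩ := h.exists_summable_bound R hR0
  set V := g ⁻¹' ball 0 (‖g m₀‖ + 1) with hV
  have hVo : IsOpen V := isOpen_ball.preimage hg.continuous
  have hm : m₀ ∈ V := by simp [hV]
  refine (differentiableOn_tsum_of_summable_norm (F := fun n m => c (g m) n * z ^ n) hu
    (fun n => (((h.differentiable n).comp hg).mul_const _).differentiableOn) hVo
    (fun n w hw => hb _ ?_ z (le_max_right _ _) n)).differentiableAt (hVo.mem_nhds hm)
  have : ‖g w‖ < ‖g m₀‖ + 1 := by simpa [hV] using hw
  exact this.le.trans (le_max_left _ _)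

end EntireFamily

/-- The coefficients of the entire function `₀F₁(b; z) / Γ(b)`. -/
def coeffE (b : ℂ) (n : ℕ) : ℂ := (Gamma (b + n))⁻¹ / (n.factorial : ℂ)

/-- The coefficients of the entire function `₁F₁(a; b; z) / Γ(b)`. -/
def coeffM (p : ℂ × ℂ) (n : ℕ) : ℂ := (ascPochhammer ℂ n).eval p.1 * coeffE p.2 n

/-- The function `₀F₁(b; z) / Γ(b)`. -/
def hgE (b z : ℂ) : ℂ := regularizedHGFun 0 {b} z

/-- The function `₁F₁(a; b; z) / Γ(b)`. -/
def hgM (a b z : ℂ) : ℂ := regularizedHGFun {a} {b} z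

theorem hgE_eq (b z : ℂ) : hgE b z = ∑' n, coeffE b n * z ^ n := by
  simp only [hgE, regularizedHGFun, FormalMultilinearSeries.sum, regularizedHGFunSeries,
    FormalMultilinearSeries.ofScalars_apply_eq]
  refine tsum_congr fun n => ?_
  simp [regularizedHGFunCoeff, coeffE, div_eq_mul_inv]

theorem hgM_eq (a b z : ℂ) : hgM a b z = ∑' n, coeffM (a, b) n * z ^ n := by
  simp only [hgM, regularizedHGFun, FormalMultilinearSeries.sum, regularizedHGFunSeries,
    FormalMultilinearSeries.ofScalars_apply_eq]
  refine tsum_congr fun n => ?_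
  simp only [regularizedHGFunCoeff, coeffM, coeffE, smul_eq_mul, Multiset.map_singleton,
    Multiset.prod_singleton, div_eq_mul_inv, mul_inv]
  ring

theorem entireFamily_coeffE : EntireFamily coeffE where
  differentiable n := by
    simp only [coeffE]
    exact (differentiable_one_div_Gamma.comp (differentiable_id.add_const _)).div_const _
  bound R hR := by
    obtain ⟨C, K, hC, hK, h⟩ := exists_inv_Gamma_bound R hR
    refine ⟨C, K, hC, by linarith, fun b hb n => ?_⟩
    have h1 := h b hb n
    have hf : (1 : ℝ) ≤ n.factorial := by exact_mod_cast Nat.one_le_iff_ne_zero.2 (Nat.factorial_ne_zero n)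
    rw [coeffE, norm_div, Complex.norm_natCast, mul_div_assoc']
    gcongr
    nlinarith [norm_nonneg (Gamma (b + n))⁻¹]

theorem entireFamily_coeffM : EntireFamily coeffM where
  differentiable n := by
    refine Differentiable.mul ?_ ((entireFamily_coeffE.differentiable n).comp differentiable_snd)
    exact (Polynomial.differentiable (ascPochhammer ℂ n)).comp
      (differentiable_fst (𝕜 := ℂ) (E := ℂ) (F := ℂ))
  bound R hR := by
    obtain ⟨C, K, hC, hK, h⟩ := exists_inv_Gamma_bound R hR
    refine ⟨C, (R + 1) * K, hC, by positivity, fun p hp n => ?_⟩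
    have h1 := h p.2 ((norm_snd_le p).trans hp) n
    have h2 := norm_ascPochhammer_le hR ((norm_fst_le p).trans hp) n
    have hf : (0 : ℝ) < n.factorial := by exact_mod_cast Nat.factorial_pos n
    rw [coeffM, coeffE, norm_mul, norm_div, Complex.norm_natCast, mul_div_assoc', mul_div_assoc']
    refine div_le_div_of_nonneg_right ?_ hf.le
    calc ‖(ascPochhammer ℂ n).eval p.1‖ * ‖(Gamma (p.2 + n))⁻¹‖
        ≤ ((n.factorial : ℝ) * (R + 1) ^ n) * ‖(Gamma (p.2 + n))⁻¹‖ := by gcongr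
      _ = (R + 1) ^ n * (‖(Gamma (p.2 + n))⁻¹‖ * (n.factorial : ℝ)) := by ring
      _ ≤ (R + 1) ^ n * (C * K ^ n) := by gcongr
      _ = C * ((R + 1) * K) ^ n := by rw [mul_pow]; ring

theorem inv_Gamma_rec (s : ℂ) : (Gamma s)⁻¹ = s * (Gamma (s + 1))⁻¹ :=
  one_div_Gamma_eq_self_mul_one_div_Gamma_add_one s

theorem coeffE_succ (b : ℂ) (n : ℕ) : (n + 1) * coeffE b (n + 1) = coeffE (b + 1) n := by
  have : (n + 1 : ℂ) ≠ 0 := by exact_mod_cast n.succ_ne_zero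
  rw [coeffE, coeffE, Nat.factorial_succ]
  push_cast
  rw [show b + (n + 1) = b + 1 + n by ring]
  have hf : (n.factorial : ℂ) ≠ 0 := by exact_mod_cast n.factorial_ne_zero
  field_simp

theorem coeffE_rec (b : ℂ) (n : ℕ) : coeffE b n = (b + n) * coeffE (b + 1) n := by
  rw [coeffE, coeffE, inv_Gamma_rec, show b + n + 1 = b + 1 + n by ring]; ring

theorem coeffM_succ (a b : ℂ) (n : ℕ) :
    (n + 1) * coeffM (a, b) (n + 1) = a * coeffM (a + 1, b + 1) n := by
  simp only [coeffM]
  rw [← coeffE_succ, ascPochhammer_succ_left]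
  simp only [Polynomial.eval_mul, Polynomial.eval_X, Polynomial.eval_comp, Polynomial.eval_add,
    Polynomial.eval_one]
  ring

theorem hasDerivAt_hgE (b z : ℂ) : HasDerivAt (hgE b) (hgE (b + 1) z) z := by
  have := entireFamily_coeffE.hasDerivAt_tsum b z
  rw [show hgE b = fun z => ∑' n, coeffE b n * z ^ n from funext (hgE_eq b), hgE_eq]
  simpa only [coeffE_succ] using this

theorem hasDerivAt_hgM (a b z : ℂ) : HasDerivAt (hgM a b) (a * hgM (a + 1) (b + 1) z) z := by
  have := entireFamily_coeffM.hasDerivAt_tsum (a, b) z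
  rw [show hgM a b = fun z => ∑' n, coeffM (a, b) n * z ^ n from funext (hgM_eq a b), hgM_eq,
    ← tsum_mul_left]
  simpa only [coeffM_succ, mul_assoc] using this

/-- The differential equation of `₀F₁`. -/
theorem hgE_ode (b z : ℂ) : z * hgE (b + 2) z + b * hgE (b + 1) z = hgE b z := by
  have hs := entireFamily_coeffE.summable
  rw [hgE_eq, hgE_eq, hgE_eq, (hs b z).tsum_eq_zero_add, (hs (b + 1) z).tsum_eq_zero_add,
    mul_add, ← tsum_mul_left, ← tsum_mul_left]
  have s1 : Summable fun n => z * (coeffE (b + 2) n * z ^ n) := (hs _ _).mul_left z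
  have s2 : Summable fun n => b * (coeffE (b + 1) (n + 1) * z ^ (n + 1)) :=
    ((summable_nat_add_iff 1).2 (hs (b + 1) z)).mul_left b
  have e0 : b * (coeffE (b + 1) 0 * z ^ 0) = coeffE b 0 * z ^ 0 := by
    rw [coeffE_rec b 0]; simp
  rw [e0, ← add_assoc, add_comm _ (coeffE b 0 * z ^ 0), add_assoc, ← s1.tsum_add s2]
  congr 1
  refine tsum_congr fun n => ?_
  have h1 := coeffE_succ (b + 1) n
  have h2 := coeffE_rec b (n + 1)
  rw [show b + 1 + 1 = b + 2 by ring] at h1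
  rw [h2, ← h1]; push_cast; ring

/-- The differential equation of `₁F₁`. -/
theorem hgM_ode (a b z : ℂ) :
    z * ((a + 1) * hgM (a + 2) (b + 2) z) + (b - z) * hgM (a + 1) (b + 1) z = hgM a b z := by
  have hs := fun a b => entireFamily_coeffM.summable (a, b)
  rw [hgM_eq, hgM_eq, hgM_eq, (hs a b z).tsum_eq_zero_add, sub_mul,
    (hs (a + 1) (b + 1) z).tsum_eq_zero_add, mul_add, mul_add, ← tsum_mul_left, ← tsum_mul_left,
    ← tsum_mul_left, ← tsum_mul_left]
  have s1 : Summable fun n => z * ((a + 1) * (coeffM (a + 2, b + 2) n * z ^ n)) :=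
    ((hs _ _ _).mul_left _).mul_left z
  have s2 : Summable fun n => b * (coeffM (a + 1, b + 1) (n + 1) * z ^ (n + 1)) :=
    ((summable_nat_add_iff 1).2 (hs (a + 1) (b + 1) z)).mul_left b
  have s3 : Summable fun n => z * (coeffM (a + 1, b + 1) (n + 1) * z ^ (n + 1)) :=
    ((summable_nat_add_iff 1).2 (hs (a + 1) (b + 1) z)).mul_left z
  have s4 : Summable fun n => z * (coeffM (a + 1, b + 1) n * z ^ n) := (hs _ _ _).mul_left z
  have e0 : b * (coeffM (a + 1, b + 1) 0 * z ^ 0) = coeffM (a, b) 0 * z ^ 0 := by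
    simp [coeffM, coeffE_rec b 0]
  have e1 : z * (coeffM (a + 1, b + 1) 0 * z ^ 0)
      + ∑' n, z * (coeffM (a + 1, b + 1) (n + 1) * z ^ (n + 1))
      = ∑' n, z * (coeffM (a + 1, b + 1) n * z ^ n) := by
    rw [s4.tsum_eq_zero_add]
  rw [e0, e1]
  have : ∑' n, z * ((a + 1) * (coeffM (a + 2, b + 2) n * z ^ n))
      + ∑' n, b * (coeffM (a + 1, b + 1) (n + 1) * z ^ (n + 1))
      - ∑' n, z * (coeffM (a + 1, b + 1) n * z ^ n)
      = ∑' n, coeffM (a, b) (n + 1) * z ^ (n + 1) := by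
    rw [← s1.tsum_add s2, ← (s1.add s2).tsum_sub s4]
    refine tsum_congr fun n => ?_
    have h1 := coeffM_succ (a + 1) (b + 1) n
    rw [show a + 1 + 1 = a + 2 by ring, show b + 1 + 1 = b + 2 by ring] at h1
    have h2 : coeffM (a, b) (n + 1) = (b + n + 1) * coeffM (a + 1, b + 1) (n + 1)
        - coeffM (a + 1, b + 1) n := by
      have e1 : (ascPochhammer ℂ (n + 1)).eval a = a * (ascPochhammer ℂ n).eval (a + 1) := by
        rw [ascPochhammer_succ_left]; simp
      have e2 := ascPochhammer_succ_eval n (a + 1)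
      have e3 := coeffE_rec b (n + 1)
      have e4 := coeffE_succ (b + 1) n
      have e5 := coeffE_rec (b + 1) n
      push_cast at e3
      simp only [coeffM]
      rw [e1, e2, e3, e5, ← e4]
      ring
    rw [h2]
    linear_combination (-z ^ (n + 1)) * h1
  rw [← this]; ring

theorem continuous_hgE : Continuous fun q : ℂ × ℂ => hgE q.1 q.2 := by
  simpa only [hgE_eq] using entireFamily_coeffE.continuous_tsum

theorem continuous_hgM : Continuous fun q : (ℂ × ℂ) × ℂ => hgM q.1.1 q.1.2 q.2 := by
  simpa only [hgM_eq] using entireFamily_coeffM.continuous_tsum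

theorem differentiable_hgE_param {b : ℂ → ℂ} (hb : Differentiable ℂ b) (z : ℂ) :
    Differentiable ℂ fun m => hgE (b m) z := by
  simpa only [hgE_eq] using entireFamily_coeffE.differentiable_param hb z

theorem differentiable_hgM_param {a b : ℂ → ℂ} (ha : Differentiable ℂ a) (hb : Differentiable ℂ b)
    (z : ℂ) : Differentiable ℂ fun m => hgM (a m) (b m) z := by
  simpa only [hgM_eq] using entireFamily_coeffM.differentiable_param (ha.prodMk hb) z

theorem hgE_zero (b : ℂ) : hgE b 0 = (Gamma b)⁻¹ := by
  rw [hgE_eq, tsum_eq_single 0 (fun n hn => by simp [hn])]; simp [coeffE]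

theorem hgM_zero (a b : ℂ) : hgM a b 0 = (Gamma b)⁻¹ := by
  rw [hgM_eq, tsum_eq_single 0 (fun n hn => by simp [hn])]; simp [coeffM, coeffE]

theorem inv_Gamma_neg_nat (n : ℕ) : (Gamma (-n))⁻¹ = 0 := by
  rw [inv_eq_zero, Gamma_eq_zero_iff]; exact ⟨n, rfl⟩

theorem coeffE_one_sub {n k : ℕ} (h : k < n) : coeffE (1 - n) k = 0 := by
  obtain ⟨d, rfl⟩ := Nat.exists_eq_add_of_lt h
  rw [coeffE, show (1 : ℂ) - (k + d + 1 : ℕ) + k = -(d : ℕ) by push_cast; ring,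
    inv_Gamma_neg_nat, zero_div]

theorem coeffE_one_sub_add (n k : ℕ) : coeffE (1 - n) (k + n) = coeffE (1 + n) k := by
  simp only [coeffE]
  rw [show (1 : ℂ) - n + (k + n : ℕ) = (k : ℂ) + 1 by push_cast; ring,
    show (1 : ℂ) + n + k = ((k + n : ℕ) : ℂ) + 1 by push_cast; ring, Gamma_nat_eq_factorial,
    Gamma_nat_eq_factorial]
  have h1 : (k.factorial : ℂ) ≠ 0 := by exact_mod_cast k.factorial_ne_zero
  have h2 : ((k + n).factorial : ℂ) ≠ 0 := by exact_mod_cast (k + n).factorial_ne_zero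
  field_simp

theorem hgE_one_sub (n : ℕ) (z : ℂ) : hgE (1 - n) z = z ^ n * hgE (1 + n) z := by
  rw [hgE_eq, hgE_eq, ← (entireFamily_coeffE.summable (1 - n) z).sum_add_tsum_nat_add n,
    Finset.sum_eq_zero (fun k hk => by rw [coeffE_one_sub (Finset.mem_range.1 hk), zero_mul]),
    zero_add, ← tsum_mul_left]
  refine tsum_congr fun k => ?_
  rw [coeffE_one_sub_add]; ring

theorem ascPochhammer_eval_add (a : ℂ) (n k : ℕ) : (ascPochhammer ℂ (n + k)).eval a
    = (ascPochhammer ℂ n).eval a * (ascPochhammer ℂ k).eval (a + n) := by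
  induction k with
  | zero => simp
  | succ k ih =>
    rw [← add_assoc, ascPochhammer_succ_eval, ih, ascPochhammer_succ_eval]; push_cast; ring

theorem hgM_sub_one_sub (n : ℕ) (a z : ℂ) :
    hgM (a - n) (1 - n) z = (ascPochhammer ℂ n).eval (a - n) * z ^ n * hgM a (1 + n) z := by
  rw [hgM_eq, hgM_eq, ← (entireFamily_coeffM.summable (a - n, 1 - n) z).sum_add_tsum_nat_add n,
    Finset.sum_eq_zero (fun k hk => by
      rw [coeffM]; simp only; rw [coeffE_one_sub (Finset.mem_range.1 hk), mul_zero, zero_mul]),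
    zero_add, ← tsum_mul_left]
  refine tsum_congr fun k => ?_
  simp only [coeffM]
  rw [coeffE_one_sub_add, add_comm k n, ascPochhammer_eval_add, sub_add_cancel]; ring

theorem inv_Gamma_sub_nat (n : ℕ) (a : ℂ) :
    (Gamma (a - n))⁻¹ = (ascPochhammer ℂ n).eval (a - n) * (Gamma a)⁻¹ := by
  induction n generalizing a with
  | zero => simp
  | succ n ih =>
    have h := ih (a - 1)
    rw [show a - 1 - n = a - (n + 1 : ℕ) by push_cast; ring] at h
    rw [h, inv_Gamma_rec (a - 1), ascPochhammer_succ_eval, sub_add_cancel]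
    push_cast; ring

end Series

/-! ### Frobenius families of solutions -/

section Frobenius

open Complex Metric

/-- The power `x ^ s` for `x > 0`. -/
def pw (s : ℂ) (x : ℝ) : ℂ := exp (s * (Real.log x : ℂ))

theorem pw_eq {s : ℂ} {x : ℝ} (hx : 0 < x) : pw s x = (x : ℂ) ^ s := by
  rw [pw, cpow_def_of_ne_zero (by exact_mod_cast hx.ne'), ← ofReal_log hx.le, mul_comm]

theorem pw_add (s s' : ℂ) (x : ℝ) : pw (s + s') x = pw s x * pw s' x := by
  rw [pw, pw, pw, ← exp_add, add_mul]

theorem pw_natCast (n : ℕ) {x : ℝ} (hx : 0 < x) : pw n x = (x : ℂ) ^ n := by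
  rw [pw_eq hx, cpow_natCast]

theorem pw_one {x : ℝ} (hx : 0 < x) : pw 1 x = x := by
  rw [pw_eq hx, cpow_one]

theorem hasDerivAt_pw (s : ℂ) {x : ℝ} (hx : 0 < x) : HasDerivAt (pw s) (s / x * pw s x) x := by
  have h1 : HasDerivAt (fun x : ℝ => (Real.log x : ℂ)) ((x⁻¹ : ℝ) : ℂ) x :=
    (Real.hasDerivAt_log hx.ne').ofReal_comp
  refine ((h1.const_mul s).cexp).congr_deriv ?_
  rw [pw]; push_cast; ring

theorem continuousOn_pw : ContinuousOn (fun q : ℂ × ℝ => pw q.1 q.2) (Set.univ ×ˢ Set.Ioi 0) := by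
  refine Complex.continuous_exp.comp_continuousOn (continuousOn_fst.mul
    (continuous_ofReal.comp_continuousOn (continuousOn_snd.log ?_)))
  rintro ⟨s, x⟩ ⟨-, hx⟩
  exact (Set.mem_Ioi.1 hx).ne'

theorem differentiable_pw (x : ℝ) : Differentiable ℂ fun s => pw s x := by
  unfold pw; fun_prop

/-- The functions `x ^ (1/2 + ν) h(ν, x²)` solve
`f'' = ((ν² - 1/4) / x² + p + r x²) f`. -/
structure IsFrobenius (p r : ℂ) (h h₁ h₂ : ℂ → ℂ → ℂ) : Prop where
  deriv₀ : ∀ ν w, HasDerivAt (h ν) (h₁ ν w) w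
  deriv₁ : ∀ ν w, HasDerivAt (h₁ ν) (h₂ ν w) w
  ode : ∀ ν w, 4 * w * h₂ ν w + (4 + 4 * ν) * h₁ ν w = (p + r * w) * h ν w
  cont₀ : Continuous fun q : ℂ × ℂ => h q.1 q.2
  cont₁ : Continuous fun q : ℂ × ℂ => h₁ q.1 q.2
  diff₀ : ∀ w, Differentiable ℂ fun ν => h ν w
  diff₁ : ∀ w, Differentiable ℂ fun ν => h₁ ν w

/-- The potential `(ν² - 1/4) / x² + p + r x²`. -/
def frobPot (p r ν : ℂ) (x : ℝ) : ℂ := (ν ^ 2 - 1 / 4) / (x : ℂ) ^ 2 + p + r * (x : ℂ) ^ 2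

def frob (h : ℂ → ℂ → ℂ) (ν : ℂ) (x : ℝ) : ℂ := pw (1 / 2 + ν) x * h ν ((x : ℂ) ^ 2)

def frob₁ (h h₁ : ℂ → ℂ → ℂ) (ν : ℂ) (x : ℝ) : ℂ :=
  pw (1 / 2 + ν) x * ((1 / 2 + ν) / x * h ν ((x : ℂ) ^ 2) + 2 * x * h₁ ν ((x : ℂ) ^ 2))

variable {p r : ℂ} {h h₁ h₂ : ℂ → ℂ → ℂ}

theorem _root_.HasDerivAt.comp_ofReal_sq {f : ℂ → ℂ} {f' : ℂ} {x : ℝ}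
    (hf : HasDerivAt f f' ((x : ℂ) ^ 2)) :
    HasDerivAt (fun x : ℝ => f ((x : ℂ) ^ 2)) (f' * (2 * x)) x := by
  have h1 : HasDerivAt (fun z : ℂ => z ^ 2) (2 * (x : ℂ)) (x : ℂ) := by
    simpa using hasDerivAt_pow 2 (x : ℂ)
  exact (hf.comp (x : ℂ) h1).comp_ofReal

theorem IsFrobenius.isSol (H : IsFrobenius p r h h₁ h₂) (ν : ℂ) :
    IsSol (frobPot p r ν) (Set.Ioi 0) (frob h ν) (frob₁ h h₁ ν) := by
  intro x hx
  have hx' : (x : ℂ) ≠ 0 := by exact_mod_cast (Set.mem_Ioi.1 hx).ne'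
  have d0 := hasDerivAt_pw (1 / 2 + ν) hx
  have d1 := (H.deriv₀ ν ((x : ℂ) ^ 2)).comp_ofReal_sq
  have d2 := (H.deriv₁ ν ((x : ℂ) ^ 2)).comp_ofReal_sq
  have dx : HasDerivAt (fun x : ℝ => (x : ℂ)) 1 x := (hasDerivAt_id x).ofReal_comp
  constructor
  · refine (d0.fun_mul d1).congr_deriv ?_
    rw [frob₁]; ring
  · have d3 := ((hasDerivAt_const x (1 / 2 + ν)).fun_div dx hx').fun_mul d1
    have d4 := (dx.const_mul 2).fun_mul d2
    refine (d0.fun_mul (d3.fun_add d4)).congr_deriv ?_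
    have e := H.ode ν ((x : ℂ) ^ 2)
    rw [frobPot, frob]
    generalize pw (1 / 2 + ν) x = P
    field_simp
    linear_combination 16 * P * (x : ℂ) ^ 2 * e

/-- The Wronskian of the two members of orders `ν` and `-ν` of a Frobenius family. -/
theorem IsFrobenius.wronskian (H : IsFrobenius p r h h₁ h₂) (ν : ℂ) {x : ℝ} (hx : 0 < x) :
    frob h ν x * frob₁ h h₁ (-ν) x - frob₁ h h₁ ν x * frob h (-ν) x
      = -2 * ν * h ν 0 * h (-ν) 0 := by
  set Ω : ℂ → ℂ := fun w => -2 * ν * h ν w * h (-ν) w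
    + 2 * w * (h ν w * h₁ (-ν) w - h₁ ν w * h (-ν) w) with hΩ
  have key : ∀ x : ℝ, 0 < x →
      frob h ν x * frob₁ h h₁ (-ν) x - frob₁ h h₁ ν x * frob h (-ν) x = Ω ((x : ℂ) ^ 2) := by
    intro x hx
    have hx' : (x : ℂ) ≠ 0 := by exact_mod_cast hx.ne'
    have e : pw (1 / 2 + ν) x * pw (1 / 2 + -ν) x = x := by
      rw [← pw_add, ← pw_one hx]; ring_nf
    simp only [frob, frob₁, hΩ]
    calc _ = (pw (1 / 2 + ν) x * pw (1 / 2 + -ν) x) *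
        (h ν ((x : ℂ) ^ 2) * ((1 / 2 + -ν) / x * h (-ν) ((x : ℂ) ^ 2) + 2 * x * h₁ (-ν) ((x : ℂ) ^ 2))
        - ((1 / 2 + ν) / x * h ν ((x : ℂ) ^ 2) + 2 * x * h₁ ν ((x : ℂ) ^ 2))
          * h (-ν) ((x : ℂ) ^ 2)) := by ring
      _ = _ := by rw [e]; field_simp; ring
  have hcont : Continuous Ω := by
    have c0 : ∀ μ, Continuous (h μ) := fun μ => H.cont₀.comp (by fun_prop : Continuous fun w => (μ, w))
    have c1 : ∀ μ, Continuous (h₁ μ) := fun μ =>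
      H.cont₁.comp (by fun_prop : Continuous fun w => (μ, w))
    have := c0 ν; have := c0 (-ν); have := c1 ν; have := c1 (-ν)
    fun_prop
  have hI : IsOpenInterval (Set.Ioi (0 : ℝ)) := ⟨isOpen_Ioi, Set.ordConnected_Ioi, ⟨1, by simp⟩⟩
  have hconst : ∀ y : ℝ, 0 < y → Ω ((y : ℂ) ^ 2)
      = frob h ν x * frob₁ h h₁ (-ν) x - frob₁ h h₁ ν x * frob h (-ν) x := by
    intro y hy
    rw [← key y hy]
    exact (H.isSol ν).wronskian_const hI ((H.isSol (-ν)).congr_coeff fun z _ => by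
      rw [frobPot, frobPot, neg_sq]) hy hx
  have t1 : Filter.Tendsto (fun y : ℝ => Ω ((y : ℂ) ^ 2)) (𝓝[>] 0) (𝓝 (Ω 0)) := by
    have : Continuous fun y : ℝ => Ω ((y : ℂ) ^ 2) := hcont.comp (by fun_prop)
    have h2 := (this.tendsto 0).mono_left (nhdsWithin_le_nhds (s := Set.Ioi 0))
    simpa using h2
  have t2 : Filter.Tendsto (fun y : ℝ => Ω ((y : ℂ) ^ 2)) (𝓝[>] 0)
      (𝓝 (frob h ν x * frob₁ h h₁ (-ν) x - frob₁ h h₁ ν x * frob h (-ν) x)) := by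
    refine tendsto_const_nhds.congr' ?_
    filter_upwards [self_mem_nhdsWithin] with y hy using (hconst y hy).symm
  rw [tendsto_nhds_unique t2 t1]
  simp [hΩ]

theorem IsFrobenius.continuousOn_frob (H : IsFrobenius p r h h₁ h₂) :
    ContinuousOn (fun q : ℂ × ℝ => frob h q.1 q.2) (Set.univ ×ˢ Set.Ioi 0) := by
  refine ContinuousOn.mul ?_ (H.cont₀.comp
    (by fun_prop : Continuous fun q : ℂ × ℝ => (q.1, (q.2 : ℂ) ^ 2))).continuousOn
  exact continuousOn_pw.comp (f := fun q : ℂ × ℝ => (1 / 2 + q.1, q.2)) (by fun_prop)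
    (fun q hq => ⟨trivial, hq.2⟩)

theorem IsFrobenius.continuousOn_frob₁ (H : IsFrobenius p r h h₁ h₂) :
    ContinuousOn (fun q : ℂ × ℝ => frob₁ h h₁ q.1 q.2) (Set.univ ×ˢ Set.Ioi 0) := by
  have c0 : Continuous fun q : ℂ × ℝ => h q.1 ((q.2 : ℂ) ^ 2) := H.cont₀.comp
    (by fun_prop : Continuous fun q : ℂ × ℝ => (q.1, (q.2 : ℂ) ^ 2))
  have c1 : Continuous fun q : ℂ × ℝ => h₁ q.1 ((q.2 : ℂ) ^ 2) := H.cont₁.comp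
    (by fun_prop : Continuous fun q : ℂ × ℝ => (q.1, (q.2 : ℂ) ^ 2))
  refine ContinuousOn.mul (continuousOn_pw.comp (f := fun q : ℂ × ℝ => (1 / 2 + q.1, q.2))
    (by fun_prop) (fun q hq => ⟨trivial, hq.2⟩)) (ContinuousOn.add (ContinuousOn.mul ?_
      c0.continuousOn) (Continuous.continuousOn (Continuous.mul (by fun_prop) c1)))
  refine ContinuousOn.div (by fun_prop) (by fun_prop) ?_
  rintro ⟨s, x⟩ ⟨-, hx⟩
  exact_mod_cast (Set.mem_Ioi.1 hx).ne'

theorem IsFrobenius.differentiable_frob (H : IsFrobenius p r h h₁ h₂) (x : ℝ) :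
    Differentiable ℂ fun ν => frob h ν x :=
  ((differentiable_pw x).comp (by fun_prop : Differentiable ℂ fun ν : ℂ => 1 / 2 + ν)).mul
    (H.diff₀ _)

theorem IsFrobenius.differentiable_frob₁ (H : IsFrobenius p r h h₁ h₂) (x : ℝ) :
    Differentiable ℂ fun ν => frob₁ h h₁ ν x := by
  refine ((differentiable_pw x).comp (by fun_prop : Differentiable ℂ fun ν : ℂ => 1 / 2 + ν)).mul ?_
  have d0 := H.diff₀ ((x : ℂ) ^ 2)
  have d1 := H.diff₁ ((x : ℂ) ^ 2)
  fun_prop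

end Frobenius

/-! ### Removable singularities with respect to the order -/

section Limit

open Complex Metric
open scoped Real

theorem hasDerivAt_circleAverage {F F₁ : ℂ → ℝ → ℂ} {c : ℂ} {R : ℝ} {V : Set ℝ} (hV : IsOpen V)
    {x₀ : ℝ} (hx₀ : x₀ ∈ V)
    (hd : ∀ m ∈ sphere c |R|, ∀ x ∈ V, HasDerivAt (F m) (F₁ m x) x)
    (hF : ContinuousOn (fun q : ℂ × ℝ => F q.1 q.2) (sphere c |R| ×ˢ V))
    (hF₁ : ContinuousOn (fun q : ℂ × ℝ => F₁ q.1 q.2) (sphere c |R| ×ˢ V)) :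
    HasDerivAt (fun x => Real.circleAverage (fun m => F m x) c R)
      (Real.circleAverage (fun m => F₁ m x₀) c R) x₀ := by
  obtain ⟨δ, hδ, hsub⟩ := isOpen_iff.1 hV x₀ hx₀
  have hsub' : closedBall x₀ (δ / 2) ⊆ V :=
    (closedBall_subset_ball (by linarith)).trans hsub
  obtain ⟨M, hM⟩ := ((isCompact_sphere c |R|).prod
    (isCompact_closedBall x₀ (δ / 2))).exists_bound_of_continuousOn
      (hF₁.mono (Set.prod_mono le_rfl hsub'))
  have hmem : ∀ θ, circleMap c R θ ∈ sphere c |R| := circleMap_mem_sphere' c R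
  have cF : ∀ x ∈ V, Continuous fun θ => F (circleMap c R θ) x := fun x hx =>
    continuousOn_univ.1 (hF.comp (f := fun θ => (circleMap c R θ, x))
      ((continuous_circleMap c R).prodMk continuous_const).continuousOn
      (fun θ _ => ⟨hmem θ, hx⟩))
  have cF₁ : ∀ x ∈ V, Continuous fun θ => F₁ (circleMap c R θ) x := fun x hx =>
    continuousOn_univ.1 (hF₁.comp (f := fun θ => (circleMap c R θ, x))
      ((continuous_circleMap c R).prodMk continuous_const).continuousOn
      (fun θ _ => ⟨hmem θ, hx⟩))
  simp only [Real.circleAverage_def]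
  apply HasDerivAt.const_smul
  refine (intervalIntegral.hasDerivAt_integral_of_dominated_loc_of_deriv_le
    (F := fun x θ => F (circleMap c R θ) x) (F' := fun x θ => F₁ (circleMap c R θ) x)
    (bound := fun _ => M) (s := ball x₀ (δ / 2)) (ball_mem_nhds _ (by linarith))
    ?_ ?_ ?_ ?_ ?_ ?_).2
  · filter_upwards [hV.mem_nhds hx₀] with x hx using (cF x hx).aestronglyMeasurable
  · exact (cF x₀ hx₀).intervalIntegrable _ _
  · exact (cF₁ x₀ hx₀).aestronglyMeasurable
  · exact Filter.Eventually.of_forall fun θ _ x hx =>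
      hM (circleMap c R θ, x) ⟨hmem θ, ball_subset_closedBall hx⟩
  · exact intervalIntegrable_const
  · exact Filter.Eventually.of_forall fun θ _ x hx =>
      hd _ (hmem θ) x (hsub' (ball_subset_closedBall hx))

open Classical in
/-- The filter along which a quotient with the denominator `sin (ν π)` is evaluated at `ν₀`. -/
def ordFilter (ν₀ : ℂ) : Filter ℂ := if sin (ν₀ * π) ≠ 0 then pure ν₀ else 𝓝[≠] ν₀

theorem ordFilter_of_ne {ν₀ : ℂ} (h : sin (ν₀ * π) ≠ 0) : ordFilter ν₀ = pure ν₀ := if_pos h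

theorem ordFilter_of_eq {ν₀ : ℂ} (h : sin (ν₀ * π) = 0) : ordFilter ν₀ = 𝓝[≠] ν₀ :=
  if_neg (not_not.2 h)

instance ordFilter_neBot (ν₀ : ℂ) : (ordFilter ν₀).NeBot := by
  by_cases h : sin (ν₀ * π) = 0
  · rw [ordFilter_of_eq h]; infer_instance
  · rw [ordFilter_of_ne h]; infer_instance

theorem ordFilter_le (ν₀ : ℂ) : ordFilter ν₀ ≤ 𝓝 ν₀ := by
  by_cases h : sin (ν₀ * π) = 0
  · rw [ordFilter_of_eq h]; exact nhdsWithin_le_nhds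
  · rw [ordFilter_of_ne h]; exact pure_le_nhds _

theorem sin_mul_pi_eq_zero_iff {ν : ℂ} : sin (ν * π) = 0 ↔ ∃ k : ℤ, ν = k := by
  have hpi : (π : ℂ) ≠ 0 := by exact_mod_cast Real.pi_ne_zero
  rw [sin_eq_zero_iff]
  constructor
  · rintro ⟨k, hk⟩; exact ⟨k, mul_right_cancel₀ hpi hk⟩
  · rintro ⟨k, rfl⟩; exact ⟨k, rfl⟩

theorem sin_mul_pi_ne_zero_of_mem {k : ℤ} {ν : ℂ} (hν : ν ∈ closedBall (k : ℂ) (1 / 2))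
    (hne : ν ≠ k) : sin (ν * π) ≠ 0 := by
  rw [Ne, sin_mul_pi_eq_zero_iff]
  rintro ⟨l, rfl⟩
  rw [mem_closedBall_iff_norm, ← Int.cast_sub, Complex.norm_intCast] at hν
  have h1 : l - k ≠ 0 := fun h0 => hne (by rw [sub_eq_zero.1 h0])
  have h2 : (1 : ℤ) ≤ |l - k| := Int.one_le_abs h1
  have h3 : (1 : ℝ) ≤ |((l - k : ℤ) : ℝ)| := by exact_mod_cast h2
  linarith

theorem eventually_sin_ne_zero (ν₀ : ℂ) : ∀ᶠ ν in ordFilter ν₀, sin (ν * π) ≠ 0 := by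
  by_cases h : sin (ν₀ * π) = 0
  · rw [ordFilter_of_eq h]
    obtain ⟨k, rfl⟩ := sin_mul_pi_eq_zero_iff.1 h
    have : ∀ᶠ ν in 𝓝[≠] (k : ℂ), ν ∈ closedBall (k : ℂ) (1 / 2) :=
      nhdsWithin_le_nhds (closedBall_mem_nhds _ (by norm_num))
    filter_upwards [this, self_mem_nhdsWithin] with ν h1 h2
    exact sin_mul_pi_ne_zero_of_mem h1 h2
  · rw [ordFilter_of_ne h]; exact h

theorem valueOrLimit_eq {F : ℂ → ℂ} {ν₀ y : ℂ} (h : Filter.Tendsto F (ordFilter ν₀) (𝓝 y)) :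
    valueOrLimit (fun ν => sin (ν * π)) F ν₀ = y := by
  rw [valueOrLimit]
  by_cases h0 : sin (ν₀ * π) = 0
  · rw [if_neg (by simpa using h0)]
    rw [ordFilter_of_eq h0] at h
    exact h.limUnder_eq
  · rw [if_pos h0]
    rw [ordFilter_of_ne h0] at h
    exact tendsto_nhds_unique (tendsto_pure_nhds F ν₀) h

variable {N N₁ Q : ℂ → ℝ → ℂ}

/-- Quotients by `sin (ν π)` of an analytic family of solutions are continued analytically to integer
orders where the family vanishes; the continuation consists of solutions. -/
theorem exists_limit_sol (hsol : ∀ ν, IsSol (Q ν) (Set.Ioi 0) (N ν) (N₁ ν))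
    (hQ : ∀ x, Continuous fun ν => Q ν x)
    (hQd : ∀ x, Differentiable ℂ fun ν => Q ν x)
    (hN : ∀ x, Differentiable ℂ fun ν => N ν x) (hN₁ : ∀ x, Differentiable ℂ fun ν => N₁ ν x)
    (cN : ContinuousOn (fun q : ℂ × ℝ => N q.1 q.2) (Set.univ ×ˢ Set.Ioi 0))
    (cN₁ : ContinuousOn (fun q : ℂ × ℝ => N₁ q.1 q.2) (Set.univ ×ˢ Set.Ioi 0))
    (cQ : ContinuousOn (fun q : ℂ × ℝ => Q q.1 q.2) (Set.univ ×ˢ Set.Ioi 0))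
    (hzero : ∀ n : ℕ, ∀ x : ℝ, 0 < x → N n x = 0) {ν₀ : ℂ}
    (hν₀ : sin (ν₀ * π) = 0 → ∃ n : ℕ, ν₀ = n) :
    ∃ y y₁ : ℝ → ℂ, IsSol (Q ν₀) (Set.Ioi 0) y y₁ ∧ ∀ x : ℝ, 0 < x →
      Filter.Tendsto (fun ν => N ν x / sin (ν * π)) (ordFilter ν₀) (𝓝 (y x)) ∧
      Filter.Tendsto (fun ν => N₁ ν x / sin (ν * π)) (ordFilter ν₀) (𝓝 (y₁ x)) := by
  by_cases h0 : sin (ν₀ * π) = 0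
  swap
  · refine ⟨fun x => N ν₀ x / sin (ν₀ * π), fun x => N₁ ν₀ x / sin (ν₀ * π),
      fun x hx => ⟨((hsol ν₀ x hx).1.div_const _), ?_⟩, fun x hx => ?_⟩
    · exact ((hsol ν₀ x hx).2.div_const _).congr_deriv (by ring)
    · rw [ordFilter_of_ne h0]
      exact ⟨tendsto_pure_nhds _ _, tendsto_pure_nhds _ _⟩
  obtain ⟨n, rfl⟩ := hν₀ h0
  rw [ordFilter_of_eq h0]
  set d : ℂ → ℂ := fun ν => sin (ν * π) with hd
  have hdd : Differentiable ℂ d := by simp only [hd]; fun_prop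
  have hdz : d n = 0 := h0
  have hball : ∀ ν ∈ closedBall (n : ℂ) (1 / 2), ν ≠ n → d ν ≠ 0 := fun ν h1 h2 => by
    exact sin_mul_pi_ne_zero_of_mem (k := (n : ℤ)) (by simpa using h1) (by simpa using h2)
  have hdn : dslope d (n : ℂ) n ≠ 0 := by
    rw [dslope_same]
    have : HasDerivAt d (cos (n * π) * π) n := by
      have := (((hasDerivAt_id (n : ℂ)).mul_const (π : ℂ)).csin)
      simpa using this
    rw [this.deriv]
    refine mul_ne_zero ?_ (by exact_mod_cast Real.pi_ne_zero)
    intro hc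
    have := sin_sq_add_cos_sq ((n : ℂ) * π)
    rw [hc, show sin ((n : ℂ) * π) = 0 from h0] at this
    simp at this
  have hds : ∀ ν ∈ closedBall (n : ℂ) (1 / 2), dslope d (n : ℂ) ν ≠ 0 := by
    intro ν hν
    rcases eq_or_ne ν (n : ℂ) with hne | hne
    · rw [hne]; exact hdn
    · rw [dslope_of_ne _ hne, slope_def_field, hdz, sub_zero]
      exact div_ne_zero (hball ν hν hne) (sub_ne_zero.2 hne)
  set G : (ℂ → ℂ) → ℂ → ℂ := fun f ν => dslope f (n : ℂ) ν / dslope d (n : ℂ) ν with hG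
  have hGeq : ∀ f : ℂ → ℂ, f n = 0 → ∀ ν : ℂ, ν ≠ n → G f ν = f ν / d ν := by
    intro f hf ν hne
    simp only [hG]
    rw [dslope_of_ne _ hne, dslope_of_ne _ hne, slope_def_field, slope_def_field, hdz, hf, sub_zero,
      sub_zero, div_div_div_cancel_right₀ (sub_ne_zero.2 hne)]
  have hGdiff : ∀ f : ℂ → ℂ, Differentiable ℂ f →
      DifferentiableOn ℂ (G f) (closedBall (n : ℂ) (1 / 2)) := by
    intro f hf
    have e : ∀ g : ℂ → ℂ, Differentiable ℂ g → DifferentiableOn ℂ (dslope g (n : ℂ)) Set.univ :=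
      fun g hg => (differentiableOn_dslope Filter.univ_mem).2 hg.differentiableOn
    exact ((e f hf).mono (Set.subset_univ _)).div ((e d hdd).mono (Set.subset_univ _)) hds
  have hGlim : ∀ f : ℂ → ℂ, Differentiable ℂ f → f n = 0 →
      Filter.Tendsto (fun ν => f ν / d ν) (𝓝[≠] (n : ℂ)) (𝓝 (G f n)) := by
    intro f hf hf0
    have hc := ((hGdiff f hf).continuousOn.continuousAt
      (closedBall_mem_nhds _ (by norm_num))).tendsto.mono_left
      (nhdsWithin_le_nhds (s := {(n : ℂ)}ᶜ))
    refine hc.congr' ?_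
    filter_upwards [self_mem_nhdsWithin] with ν hν using hGeq f hf0 ν hν
  have hGav : ∀ f : ℂ → ℂ, Differentiable ℂ f → f n = 0 →
      Real.circleAverage (fun ν => f ν / d ν) n (1 / 2) = G f n := by
    intro f hf hf0
    have h1 : DiffContOnCl ℂ (G f) (ball (n : ℂ) |(1 / 2 : ℝ)|) := by
      rw [abs_of_pos (by norm_num : (0 : ℝ) < 1 / 2)]
      refine DifferentiableOn.diffContOnCl ?_
      rw [closure_ball _ (by norm_num)]
      exact hGdiff f hf
    rw [← h1.circleAverage]
    refine Real.circleAverage_congr_sphere fun ν hν => (hGeq f hf0 ν ?_).symm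
    rintro rfl
    simp at hν
  have zN := hzero n
  have zN₁ : ∀ x : ℝ, 0 < x → N₁ n x = 0 := fun x hx =>
    (hsol n x hx).1.unique ((hasDerivAt_const x (0 : ℂ)).congr_on isOpen_Ioi zN hx)
  have cdiv : ∀ K : ℂ → ℝ → ℂ,
      ContinuousOn (fun q : ℂ × ℝ => K q.1 q.2) (Set.univ ×ˢ Set.Ioi 0) →
      ContinuousOn (fun q : ℂ × ℝ => K q.1 q.2 / d q.1)
        (sphere (n : ℂ) |(1 / 2 : ℝ)| ×ˢ Set.Ioi 0) := by
    intro K hK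
    refine (hK.mono (Set.prod_mono (Set.subset_univ _) le_rfl)).div
      (hdd.continuous.comp continuous_fst).continuousOn ?_
    rintro ⟨ν, x⟩ ⟨hν, -⟩
    rw [abs_of_pos (by norm_num : (0 : ℝ) < 1 / 2)] at hν
    refine hball ν (sphere_subset_closedBall hν) ?_
    rintro rfl
    simp at hν
  refine ⟨fun x => G (fun ν => N ν x) n, fun x => G (fun ν => N₁ ν x) n, fun x hx => ⟨?_, ?_⟩,
    fun x hx => ⟨hGlim _ (hN x) (zN x hx), hGlim _ (hN₁ x) (zN₁ x hx)⟩⟩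
  · have hda := hasDerivAt_circleAverage (F := fun ν x => N ν x / d ν)
      (F₁ := fun ν x => N₁ ν x / d ν) (c := n) (R := 1 / 2) isOpen_Ioi hx
      (fun m _ x hx => (hsol m x hx).1.div_const _) (cdiv N cN) (cdiv N₁ cN₁)
    rw [hGav _ (hN₁ x) (zN₁ x hx)] at hda
    exact hda.congr_on isOpen_Ioi (fun z hz => (hGav _ (hN z) (zN z hz)).symm) hx
  · have hda := hasDerivAt_circleAverage (F := fun ν x => N₁ ν x / d ν)
      (F₁ := fun ν x => Q ν x * N ν x / d ν) (c := n) (R := 1 / 2) isOpen_Ioi hx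
      (fun m _ x hx => (hsol m x hx).2.div_const _) (cdiv N₁ cN₁)
      (cdiv (fun ν x => Q ν x * N ν x) (cQ.mul cN))
    have hq0 : Q n x * N n x = 0 := by rw [zN x hx, mul_zero]
    rw [hGav (fun ν => Q ν x * N ν x) ((hQd x).mul (hN x)) hq0] at hda
    have e : G (fun ν => Q ν x * N ν x) n = Q n x * G (fun ν => N ν x) n := by
      refine tendsto_nhds_unique (hGlim _ ((hQd x).mul (hN x)) hq0) ?_
      have := (((hQ x).tendsto n).mono_left (nhdsWithin_le_nhds (s := {(n : ℂ)}ᶜ))).mul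
        (hGlim _ (hN x) (zN x hx))
      refine this.congr fun ν => ?_
      ring
    rw [e] at hda
    exact hda.congr_on isOpen_Ioi (fun z hz => (hGav _ (hN₁ z) (zN₁ z hz)).symm) hx

end Limit

section Fundamental

variable {q : ℝ → ℂ} {I : Set ℝ} {f g : ℝ → ℂ}

/-- `f`, `g` is a fundamental system of solutions of `y'' = q y` on `I`. -/
def IsFund (q : ℝ → ℂ) (I : Set ℝ) (f g : ℝ → ℂ) : Prop :=
  ∃ f₁ g₁, IsSol q I f f₁ ∧ IsSol q I g g₁ ∧ ∀ x ∈ I, f x * g₁ x - f₁ x * g x ≠ 0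

theorem IsFund.mono {I' : Set ℝ} (h : IsFund q I f g) (hI : I' ⊆ I) : IsFund q I' f g := by
  obtain ⟨f₁, g₁, hf, hg, hw⟩ := h
  exact ⟨f₁, g₁, hf.mono hI, hg.mono hI, fun x hx => hw x (hI hx)⟩

theorem IsFund.congr (h : IsFund q I f g) (hI : IsOpen I) {q' : ℝ → ℂ} {f' g' : ℝ → ℂ}
    (hq : ∀ x ∈ I, q x = q' x) (hf' : ∀ x ∈ I, f' x = f x) (hg' : ∀ x ∈ I, g' x = g x) :
    IsFund q' I f' g' := by
  obtain ⟨f₁, g₁, hf, hg, hw⟩ := h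
  exact ⟨f₁, g₁, (hf.congr hI hf').congr_coeff hq, (hg.congr hI hg').congr_coeff hq,
    fun x hx => by rw [hf' x hx, hg' x hx]; exact hw x hx⟩

theorem IsFund.comb (h : IsFund q I f g) {a b c d : ℂ} (hd : a * d - b * c ≠ 0) :
    IsFund q I (fun x => a * f x + b * g x) (fun x => c * f x + d * g x) := by
  obtain ⟨f₁, g₁, hf, hg, hw⟩ := h
  refine ⟨_, _, hf.comb hg a b, hf.comb hg c d, fun x hx => ?_⟩
  have := mul_ne_zero hd (hw x hx)
  intro h0
  exact this (by linear_combination h0)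

theorem IsFund.exists_comb (h : IsFund q I f g) (hI : IsOpenInterval I) {y y₁ : ℝ → ℂ}
    (hy : IsSol q I y y₁) : ∃ A B : ℂ, ∀ x ∈ I, y x = A * f x + B * g x := by
  obtain ⟨f₁, g₁, hf, hg, hw⟩ := h
  obtain ⟨x₀, hx₀⟩ := hI.nonempty
  obtain ⟨A, B, hAB⟩ := hf.exists_comb hI hg hy hx₀ (hw x₀ hx₀)
  exact ⟨A, B, fun x hx => (hAB x hx).1⟩

theorem IsFund.exists_comb_real (h : IsFund q I f g) (hI : IsOpenInterval I) {y : ℝ → ℝ}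
    {y₁ : ℝ → ℂ} (hy : IsSol q I (fun x => y x) y₁) (hf : ∀ x ∈ I, (f x).im = 0)
    (hg : ∀ x ∈ I, (g x).im = 0) :
    ∃ A B : ℝ, ∀ x ∈ I, (y x : ℂ) = A * f x + B * g x := by
  obtain ⟨A, B, hAB⟩ := h.exists_comb hI hy
  refine ⟨A.re, B.re, fun x hx => ?_⟩
  have e := hAB x hx
  apply Complex.ext
  · have := congrArg Complex.re e
    simpa [hf x hx, hg x hx] using this
  · simp [hf x hx, hg x hx]

theorem IsFund.comb_unique (h : IsFund q I f g) (hI : IsOpenInterval I) {A B A' B' : ℂ}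
    (he : ∀ x ∈ I, A * f x + B * g x = A' * f x + B' * g x) : A = A' ∧ B = B' := by
  obtain ⟨f₁, g₁, hf, hg, hw⟩ := h
  obtain ⟨x₀, hx₀⟩ := hI.nonempty
  exact hf.comb_unique hI.isOpen hg hx₀ (hw x₀ hx₀) he

theorem IsSol.abs {f₁ : ℝ → ℂ} (hq : ∀ x, q (-x) = q x) (hf : IsSol q (Set.Ioi 0) f f₁) :
    IsSol q {0}ᶜ (fun x => f |x|) (fun x => if 0 < x then f₁ x else -f₁ (-x)) := by
  intro x hx
  rcases lt_or_gt_of_ne (show x ≠ 0 from hx) with h | h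
  · have hx' : (-x) ∈ Set.Ioi (0 : ℝ) := by simpa using h
    have e1 : ∀ y ∈ Set.Iio (0 : ℝ), f |y| = f (-y) := fun y hy => by rw [abs_of_neg hy]
    have e2 : ∀ y ∈ Set.Iio (0 : ℝ), (if 0 < y then f₁ y else -f₁ (-y)) = -f₁ (-y) :=
      fun y hy => if_neg (not_lt.2 (le_of_lt hy))
    constructor
    · refine (((hf _ hx').1.scomp x (hasDerivAt_neg x)).congr_on isOpen_Iio e1 h).congr_deriv ?_
      simp only [e2 x h]; simp
    · refine (((hf _ hx').2.scomp x (hasDerivAt_neg x)).neg.congr_on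
        isOpen_Iio e2 h).congr_deriv ?_
      simp [hq, abs_of_neg h]
  · have e1 : ∀ y ∈ Set.Ioi (0 : ℝ), f |y| = f y := fun y hy => by rw [abs_of_pos hy]
    have e2 : ∀ y ∈ Set.Ioi (0 : ℝ), (if 0 < y then f₁ y else -f₁ (-y)) = f₁ y :=
      fun y hy => if_pos hy
    constructor
    · refine ((hf _ h).1.congr_on isOpen_Ioi e1 h).congr_deriv ?_
      simp only [e2 x h]
    · exact ((hf _ h).2.congr_on isOpen_Ioi e2 h).congr_deriv (by simp [abs_of_pos h])

theorem IsFund.abs (h : IsFund q (Set.Ioi 0) f g) (hq : ∀ x, q (-x) = q x) :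
    IsFund q {0}ᶜ (fun x => f |x|) (fun x => g |x|) := by
  obtain ⟨f₁, g₁, hf, hg, hw⟩ := h
  refine ⟨_, _, hf.abs hq, hg.abs hq, fun x hx => ?_⟩
  have hx' : x ≠ 0 := hx
  have := hw |x| (abs_pos.2 hx')
  rcases lt_or_gt_of_ne hx' with h | h
  · simp only [if_neg (not_lt.2 h.le)]
    rw [abs_of_neg h] at this ⊢
    intro h0
    exact this (by linear_combination -h0)
  · simp only [if_pos h]
    rwa [abs_of_pos h] at this ⊢

end Fundamental

section SecondSolution

open Complex
open scoped Real

variable {p r : ℂ} {h h₁ h₂ : ℂ → ℂ → ℂ} {α β α' β' : ℂ → ℂ} {ν₀ c₀ : ℂ}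

/-- `y` is the limit at `ν₀` of the solutions
`(α(ν) f_ν + β(ν) f_{-ν}) / sin (ν π)`, and `y₁` the limit of their derivatives. -/
def IsFrobLimit (h h₁ : ℂ → ℂ → ℂ) (α β : ℂ → ℂ) (ν₀ : ℂ) (y y₁ : ℝ → ℂ) : Prop :=
  ∀ x : ℝ, 0 < x →
    Filter.Tendsto (fun ν => (α ν * frob h ν x + β ν * frob h (-ν) x) / sin (ν * π))
      (ordFilter ν₀) (𝓝 (y x)) ∧
    Filter.Tendsto (fun ν => (α ν * frob₁ h h₁ ν x + β ν * frob₁ h h₁ (-ν) x)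
      / sin (ν * π)) (ordFilter ν₀) (𝓝 (y₁ x))

theorem IsFrobenius.exists_second (H : IsFrobenius p r h h₁ h₂) (hα : Differentiable ℂ α)
    (hβ : Differentiable ℂ β)
    (hzero : ∀ n : ℕ, ∀ x : ℝ, 0 < x → α n * frob h n x + β n * frob h (-n) x = 0)
    (hν₀ : sin (ν₀ * π) = 0 → ∃ n : ℕ, ν₀ = n) :
    ∃ y y₁ : ℝ → ℂ, IsSol (frobPot p r ν₀) (Set.Ioi 0) y y₁ ∧ IsFrobLimit h h₁ α β ν₀ y y₁ := by
  have hneg : ∀ {K : ℂ → ℝ → ℂ}, ContinuousOn (fun q : ℂ × ℝ => K q.1 q.2) (Set.univ ×ˢ Set.Ioi 0) →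
      ContinuousOn (fun q : ℂ × ℝ => K (-q.1) q.2) (Set.univ ×ˢ Set.Ioi 0) := fun {K} hK =>
    hK.comp (f := fun q : ℂ × ℝ => (-q.1, q.2)) (by fun_prop) (fun q hq => ⟨trivial, hq.2⟩)
  have ca : ContinuousOn (fun q : ℂ × ℝ => α q.1) (Set.univ ×ˢ Set.Ioi 0) :=
    (hα.continuous.comp continuous_fst).continuousOn
  have cb : ContinuousOn (fun q : ℂ × ℝ => β q.1) (Set.univ ×ˢ Set.Ioi 0) :=
    (hβ.continuous.comp continuous_fst).continuousOn
  have dneg : ∀ {g : ℂ → ℂ}, Differentiable ℂ g → Differentiable ℂ fun ν => g (-ν) := fun hg =>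
    hg.comp (by fun_prop : Differentiable ℂ fun ν : ℂ => -ν)
  have hpot : ∀ x : ℝ, Differentiable ℂ fun ν => frobPot p r ν x := fun x => by
    unfold frobPot; fun_prop
  refine exists_limit_sol (N := fun ν x => α ν * frob h ν x + β ν * frob h (-ν) x)
    (N₁ := fun ν x => α ν * frob₁ h h₁ ν x + β ν * frob₁ h h₁ (-ν) x) (Q := frobPot p r)
    (fun ν => ?_) (fun x => (hpot x).continuous) hpot (fun x => ?_) (fun x => ?_) ?_ ?_ ?_ hzero hν₀
  · exact (H.isSol ν).comb ((H.isSol (-ν)).congr_coeff fun z _ => by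
      rw [frobPot, frobPot, neg_sq]) _ _
  · exact (hα.mul (H.differentiable_frob x)).add (hβ.mul (dneg (H.differentiable_frob x)))
  · exact (hα.mul (H.differentiable_frob₁ x)).add (hβ.mul (dneg (H.differentiable_frob₁ x)))
  · exact (ca.mul H.continuousOn_frob).add (cb.mul (hneg H.continuousOn_frob))
  · exact (ca.mul H.continuousOn_frob₁).add (cb.mul (hneg H.continuousOn_frob₁))
  · unfold frobPot
    refine ContinuousOn.add (ContinuousOn.add (ContinuousOn.div (by fun_prop) (by fun_prop) ?_)
      (by fun_prop)) (by fun_prop)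
    rintro ⟨s, x⟩ ⟨-, hx⟩
    have : (x : ℂ) ≠ 0 := by exact_mod_cast (Set.mem_Ioi.1 hx).ne'
    exact pow_ne_zero 2 this

theorem IsFrobenius.wronskian_limit (H : IsFrobenius p r h h₁ h₂)
    (hc : ∀ ν, -2 * ν * h ν 0 * h (-ν) 0 = c₀ * sin (ν * π)) (hβ : Differentiable ℂ β)
    {y y₁ : ℝ → ℂ} (hy : IsFrobLimit h h₁ α β ν₀ y y₁) {x : ℝ} (hx : 0 < x) :
    frob h ν₀ x * y₁ x - frob₁ h h₁ ν₀ x * y x = c₀ * β ν₀ := by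
  have t0 := (((H.differentiable_frob x).continuous.tendsto ν₀).mono_left (ordFilter_le ν₀))
  have t1 := (((H.differentiable_frob₁ x).continuous.tendsto ν₀).mono_left (ordFilter_le ν₀))
  have tb := ((hβ.continuous.tendsto ν₀).mono_left (ordFilter_le ν₀)).const_mul c₀
  refine tendsto_nhds_unique ((t0.mul (hy x hx).2).sub (t1.mul (hy x hx).1)) (tb.congr' ?_)
  filter_upwards [eventually_sin_ne_zero ν₀] with ν hs
  have e := H.wronskian ν hx
  rw [hc ν] at e
  field_simp
  linear_combination (-β ν) * e

theorem IsFrobenius.wronskian_limits (H : IsFrobenius p r h h₁ h₂)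
    (hc : ∀ ν, -2 * ν * h ν 0 * h (-ν) 0 = c₀ * sin (ν * π))
    {y y₁ z z₁ : ℝ → ℂ} (hy : IsFrobLimit h h₁ α β ν₀ y y₁) (hz : IsFrobLimit h h₁ α' β' ν₀ z z₁)
    {c₁ : ℂ} (hc₁ : ∀ ν, α ν * β' ν - β ν * α' ν = c₁ * sin (ν * π)) {x : ℝ} (hx : 0 < x) :
    y x * z₁ x - y₁ x * z x = c₀ * c₁ := by
  refine tendsto_nhds_unique (((hy x hx).1.mul (hz x hx).2).sub ((hy x hx).2.mul (hz x hx).1))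
    (tendsto_const_nhds.congr' ?_)
  filter_upwards [eventually_sin_ne_zero ν₀] with ν hs
  have e := H.wronskian ν hx
  rw [hc ν] at e
  field_simp
  linear_combination (-(c₀ * sin (ν * π))) * hc₁ ν - (α ν * β' ν - β ν * α' ν) * e

theorem mul_inv_Gamma (ν : ℂ) :
    ν * (Gamma (1 + ν))⁻¹ * (Gamma (1 - ν))⁻¹ = sin (ν * π) / π := by
  have e := Gamma_mul_Gamma_one_sub ν
  have e2 := inv_Gamma_rec ν
  rw [add_comm 1 ν, ← e2, ← mul_inv, e, inv_div, mul_comm (π : ℂ) ν]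

end SecondSolution

section Conj

open Complex ComplexConjugate
open scoped Real

theorem conj_coeffE (b : ℂ) (n : ℕ) : conj (coeffE b n) = coeffE (conj b) n := by
  rw [coeffE, coeffE, map_div₀, map_inv₀, ← Gamma_conj, map_add, map_natCast, map_natCast]

theorem conj_coeffM (a b : ℂ) (n : ℕ) : conj (coeffM (a, b) n) = coeffM (conj a, conj b) n := by
  have : conj ((ascPochhammer ℂ n).eval a) = (ascPochhammer ℂ n).eval (conj a) := by
    induction n with
    | zero => simp
    | succ n ih => rw [ascPochhammer_succ_eval, ascPochhammer_succ_eval, map_mul, ih]; simp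
  simp only [coeffM, map_mul, this, conj_coeffE]

theorem conj_hgE (b z : ℂ) : conj (hgE b z) = hgE (conj b) (conj z) := by
  rw [hgE_eq, hgE_eq, Complex.conj_tsum]
  exact tsum_congr fun n => by rw [map_mul, map_pow, conj_coeffE]

theorem conj_hgM (a b z : ℂ) : conj (hgM a b z) = hgM (conj a) (conj b) (conj z) := by
  rw [hgM_eq, hgM_eq, Complex.conj_tsum]
  exact tsum_congr fun n => by rw [map_mul, map_pow, conj_coeffM]

theorem conj_pw (s : ℂ) (x : ℝ) : conj (pw s x) = pw (conj s) x := by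
  rw [pw, pw, ← exp_conj, map_mul, conj_ofReal]

theorem conj_sin_mul_pi (ν : ℂ) : conj (sin (ν * π)) = sin (conj ν * π) := by
  rw [← sin_conj, map_mul, conj_ofReal]

theorem tendsto_conj_ordFilter (ν₀ : ℂ) :
    Filter.Tendsto conj (ordFilter ν₀) (ordFilter (conj ν₀)) := by
  by_cases h0 : sin (ν₀ * π) = 0
  · have h0' : sin (conj ν₀ * π) = 0 := by rw [← conj_sin_mul_pi, h0, map_zero]
    rw [ordFilter_of_eq h0, ordFilter_of_eq h0']
    refine tendsto_nhdsWithin_iff.2 ⟨(continuous_conj.tendsto ν₀).mono_left nhdsWithin_le_nhds, ?_⟩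
    filter_upwards [self_mem_nhdsWithin] with ν hν
    exact fun h => hν ((starRingEnd ℂ).injective h)
  · have h0' : sin (conj ν₀ * π) ≠ 0 := by
      rw [← conj_sin_mul_pi]; simpa using h0
    rw [ordFilter_of_ne h0, ordFilter_of_ne h0']
    simp

/-- Limits of families that commute with conjugation commute with conjugation. -/
theorem conj_limit {F G : ℂ → ℂ} {ν₀ y z : ℂ} (hy : Filter.Tendsto F (ordFilter ν₀) (𝓝 y))
    (hz : Filter.Tendsto G (ordFilter (conj ν₀)) (𝓝 z)) (h : ∀ ν, conj (F ν) = G (conj ν)) :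
    conj y = z := by
  have t1 := (continuous_conj.tendsto y).comp hy
  have t2 := hz.comp (tendsto_conj_ordFilter ν₀)
  exact tendsto_nhds_unique (t1.congr h) t2

end Conj

/-! ### Bessel functions -/

section Bessel

open Complex ComplexConjugate
open scoped Real

theorem sqrt_eq_pw {x : ℝ} (hx : 0 < x) : ((√x : ℝ) : ℂ) = pw (1 / 2) x := by
  rw [pw_eq hx, Real.sqrt_eq_rpow, ofReal_cpow hx.le]; norm_num

/-- The entire factors of the functions `√x J_ν(x)` (for `σ = -1`) and `√x I_ν(x)`
(for `σ = 1`). -/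
def besselFactor (σ ν w : ℂ) : ℂ := exp (-ν * Real.log 2) * hgE (ν + 1) (σ / 4 * w)

def besselFactor₁ (σ ν w : ℂ) : ℂ := exp (-ν * Real.log 2) * (σ / 4 * hgE (ν + 2) (σ / 4 * w))

def besselFactor₂ (σ ν w : ℂ) : ℂ :=
  exp (-ν * Real.log 2) * ((σ / 4) ^ 2 * hgE (ν + 3) (σ / 4 * w))

theorem hasDerivAt_hgE_linear (b c w : ℂ) :
    HasDerivAt (fun w : ℂ => hgE b (c * w)) (c * hgE (b + 1) (c * w)) w := by
  have h1 : HasDerivAt (fun w : ℂ => c * w) c w := by simpa using (hasDerivAt_id w).const_mul c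
  have h2 := HasDerivAt.comp (h₂ := hgE b) (h := fun w : ℂ => c * w) w
    (hasDerivAt_hgE b (c * w)) h1
  rw [mul_comm c]
  exact h2

theorem continuous_hgE_linear (b c : ℂ) :
    Continuous fun q : ℂ × ℂ => hgE (q.1 + b) (c * q.2) := by
  have hf : Continuous fun q : ℂ × ℂ => ((q.1 + b, c * q.2) : ℂ × ℂ) :=
    (continuous_fst.add continuous_const).prodMk (continuous_const.mul continuous_snd)
  generalize hF : (fun q : ℂ × ℂ => hgE q.1 q.2) = F
  have h := (hF ▸ continuous_hgE : Continuous F).comp hf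
  subst hF
  exact h

theorem isFrobenius_bessel (σ : ℂ) :
    IsFrobenius σ 0 (besselFactor σ) (besselFactor₁ σ) (besselFactor₂ σ) := by
  refine ⟨fun ν w => ?_, fun ν w => ?_, fun ν w => ?_, ?_, ?_, fun w => ?_, fun w => ?_⟩
  · have := (hasDerivAt_hgE_linear (ν + 1) (σ / 4) w).const_mul (exp (-ν * Real.log 2))
    rwa [show ν + 1 + 1 = ν + 2 by ring] at this
  · have := ((hasDerivAt_hgE_linear (ν + 2) (σ / 4) w).const_mul (σ / 4)).const_mul
      (exp (-ν * Real.log 2))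
    rwa [show ν + 2 + 1 = ν + 3 by ring, ← mul_assoc (σ / 4), ← sq] at this
  · have e := hgE_ode (ν + 1) (σ / 4 * w)
    rw [show ν + 1 + 2 = ν + 3 by ring, show ν + 1 + 1 = ν + 2 by ring] at e
    simp only [besselFactor, besselFactor₁, besselFactor₂]
    generalize hgE (ν + 1) (σ / 4 * w) = e1 at *
    generalize hgE (ν + 2) (σ / 4 * w) = e2 at *
    generalize hgE (ν + 3) (σ / 4 * w) = e3 at *
    linear_combination exp (-ν * Real.log 2) * σ * e
  · exact Continuous.mul (by fun_prop) (continuous_hgE_linear 1 (σ / 4))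
  · exact Continuous.mul (by fun_prop) (continuous_const.mul (continuous_hgE_linear 2 (σ / 4)))
  · exact Differentiable.mul (by fun_prop)
      (differentiable_hgE_param (b := fun ν => ν + 1) (by fun_prop) _)
  · exact Differentiable.mul (by fun_prop)
      ((differentiable_hgE_param (b := fun ν => ν + 2) (by fun_prop) _).const_mul _)

theorem besselFactor_zero (σ ν : ℂ) : -2 * ν * besselFactor σ ν 0 * besselFactor σ (-ν) 0
    = -2 / π * sin (ν * π) := by
  have e : exp (-ν * Real.log 2) * exp (- -ν * Real.log 2) = 1 := by
    rw [← exp_add]; ring_nf; exact exp_zero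
  have e2 := mul_inv_Gamma ν
  simp only [besselFactor, mul_zero, hgE_zero]
  rw [show ν + 1 = 1 + ν by ring, show -ν + 1 = 1 - ν by ring]
  linear_combination (-2 * ν * (Gamma (1 + ν))⁻¹ * (Gamma (1 - ν))⁻¹) * e - 2 * e2

theorem pw_half_mul (ν : ℂ) {x : ℝ} (hx : 0 < x) :
    pw (1 / 2) x * ((x / 2 : ℝ) : ℂ) ^ ν = pw (1 / 2 + ν) x * exp (-ν * Real.log 2) := by
  rw [← pw_eq (by positivity : 0 < x / 2), pw_add, mul_assoc]
  congr 1
  rw [pw, pw, Real.log_div hx.ne' two_ne_zero, ← exp_add]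
  push_cast; ring_nf

theorem frob_besselJ (ν : ℂ) {x : ℝ} (hx : 0 < x) :
    frob (besselFactor (-1)) ν x = (√x : ℝ) * besselJ ν x := by
  rw [frob, besselFactor, sqrt_eq_pw hx, besselJ, ← mul_assoc, ← mul_assoc, pw_half_mul ν hx, hgE]
  ring_nf

theorem frob_besselI (ν : ℂ) {x : ℝ} (hx : 0 < x) :
    frob (besselFactor 1) ν x = (√x : ℝ) * besselI ν x := by
  rw [frob, besselFactor, sqrt_eq_pw hx, besselI, ← mul_assoc, ← mul_assoc, pw_half_mul ν hx, hgE]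
  ring_nf

theorem frob_bessel_neg_nat (σ : ℂ) (n : ℕ) {x : ℝ} (hx : 0 < x) :
    frob (besselFactor σ) (-n) x = σ ^ n * frob (besselFactor σ) n x := by
  rw [frob, frob, besselFactor, besselFactor, show -(n : ℂ) + 1 = 1 - n by ring, hgE_one_sub,
    show (1 : ℂ) + n = n + 1 by ring]
  have e1 : pw (1 / 2 + n) x = pw (1 / 2 + -n) x * ((x : ℂ) ^ 2) ^ n := by
    rw [← pow_mul, ← pw_natCast (2 * n) hx, ← pw_add]; push_cast; ring_nf
  have e2 : exp (- -(n : ℂ) * Real.log 2) = exp (-n * Real.log 2) * 4 ^ n := by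
    have : (4 : ℂ) ^ n = exp (2 * n * Real.log 2) := by
      rw [show (2 : ℂ) * n * Real.log 2 = n * (2 * Real.log 2) by ring, exp_nat_mul, two_mul,
        exp_add, ← ofReal_exp, Real.exp_log two_pos]
      norm_num
    rw [this, ← exp_add]; ring_nf
  rw [e1, e2, mul_pow, div_pow]
  field_simp

theorem sol_limit_eq {h h₁ : ℂ → ℂ → ℂ} {α β : ℂ → ℂ} {ν₀ : ℂ} {y y₁ : ℝ → ℂ}
    (hy : IsFrobLimit h h₁ α β ν₀ y y₁) {F : ℂ → ℝ → ℂ}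
    (hF : ∀ ν, ∀ x : ℝ, 0 < x → (α ν * frob h ν x + β ν * frob h (-ν) x)
      = (√x : ℝ) * F ν x) {x : ℝ} (hx : 0 < x) :
    (√x : ℝ) * valueOrLimit (fun ν => sin (ν * π))
      (fun ν => F ν x / sin (ν * π)) ν₀ = y x := by
  have hs : ((√x : ℝ) : ℂ) ≠ 0 := by exact_mod_cast (Real.sqrt_pos.2 hx).ne'
  have t := (hy x hx).1.const_mul ((√x : ℝ) : ℂ)⁻¹
  rw [valueOrLimit_eq (y := ((√x : ℝ) : ℂ)⁻¹ * y x) (t.congr fun ν => by rw [hF ν x hx]; field_simp)]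
  field_simp

theorem cos_nat_mul_pi (n : ℕ) : cos ((n : ℂ) * π) = (-1) ^ n := by
  have h : Real.cos (n * π) = (-1) ^ n := Real.cos_nat_mul_pi n
  have h2 := congrArg ((↑) : ℝ → ℂ) h
  push_cast at h2
  exact h2

theorem conj_besselJ (ν : ℂ) {x : ℝ} (hx : 0 < x) : conj (besselJ ν x) = besselJ (conj ν) x := by
  have hx2 : 0 < x / 2 := by positivity
  simp only [besselJ]
  rw [← pw_eq hx2, ← pw_eq hx2, map_mul, conj_pw]
  congr 1
  have := conj_hgE (ν + 1) (-(x : ℂ) ^ 2 / 4)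
  rw [hgE, hgE] at this
  rw [this]
  simp [map_ofNat]

theorem conj_besselI (ν : ℂ) {x : ℝ} (hx : 0 < x) : conj (besselI ν x) = besselI (conj ν) x := by
  have hx2 : 0 < x / 2 := by positivity
  simp only [besselI]
  rw [← pw_eq hx2, ← pw_eq hx2, map_mul, conj_pw]
  congr 1
  have := conj_hgE (ν + 1) ((x : ℂ) ^ 2 / 4)
  rw [hgE, hgE] at this
  rw [this]
  simp [map_ofNat]

theorem conj_frob_limit {h h₁ : ℂ → ℂ → ℂ} {α β : ℂ → ℂ} {ν₀ : ℂ} {y y₁ : ℝ → ℂ}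
    (hy : IsFrobLimit h h₁ α β ν₀ y y₁) (hα : ∀ ν, conj (α ν) = α (conj ν))
    (hβ : ∀ ν, conj (β ν) = β (conj ν))
    (hh : ∀ ν, ∀ x : ℝ, 0 < x → conj (frob h ν x) = frob h (conj ν) x)
    (h0 : conj ν₀ = ν₀) {x : ℝ} (hx : 0 < x) : conj (y x) = y x := by
  refine conj_limit (hy x hx).1 (h0.symm ▸ (hy x hx).1) fun ν => ?_
  simp only [map_div₀, map_add, map_mul, hα, hβ, hh _ x hx, conj_sin_mul_pi, map_neg]

theorem bessel_fundamental {ν₀ : ℂ} (hν₀ : sin (ν₀ * π) = 0 → ∃ n : ℕ, ν₀ = n) :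
    IsFund (frobPot (-1) 0 ν₀) (Set.Ioi 0) (fun x => (√x : ℝ) * besselJ ν₀ x)
      (fun x => (√x : ℝ) * besselY ν₀ x) ∧
    (conj ν₀ = ν₀ → ∀ x : ℝ, 0 < x → conj ((√x : ℝ) * besselY ν₀ x) = (√x : ℝ) * besselY ν₀ x) := by
  have H := isFrobenius_bessel (-1)
  obtain ⟨y, y₁, hs, hl⟩ := H.exists_second (α := fun ν => cos (ν * π)) (β := fun _ => -1)
    (by fun_prop) (by fun_prop) (fun n x hx => by
      rw [frob_bessel_neg_nat (-1) n hx, cos_nat_mul_pi]; ring) hν₀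
  have hY : ∀ x : ℝ, 0 < x → (√x : ℝ) * besselY ν₀ x = y x := fun x hx => by
    rw [besselY]
    exact sol_limit_eq hl (F := fun μ x => besselJ μ x * cos (μ * π) - besselJ (-μ) x)
      (fun ν x hx => by rw [frob_besselJ _ hx, frob_besselJ _ hx]; ring) hx
  refine ⟨⟨frob₁ (besselFactor (-1)) (besselFactor₁ (-1)) ν₀, y₁,
    (H.isSol ν₀).congr isOpen_Ioi fun x hx => (frob_besselJ ν₀ hx).symm,
    hs.congr isOpen_Ioi hY, fun x hx => ?_⟩, fun h0 x hx => ?_⟩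
  · beta_reduce
    rw [hY x hx, ← frob_besselJ ν₀ hx,
      H.wronskian_limit (besselFactor_zero (-1)) (by fun_prop) hl hx]
    simp [Real.pi_ne_zero]
  · rw [hY x hx]
    refine conj_frob_limit hl (fun ν => ?_) (fun ν => by simp) (fun ν x hx => ?_) h0 hx
    · rw [← cos_conj, map_mul, conj_ofReal]
    · rw [frob_besselJ _ hx, frob_besselJ _ hx, map_mul, conj_besselJ _ hx, conj_ofReal]

theorem modBessel_fundamental {ν₀ : ℂ} (hν₀ : sin (ν₀ * π) = 0 → ∃ n : ℕ, ν₀ = n) :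
    IsFund (frobPot 1 0 ν₀) (Set.Ioi 0) (fun x => (√x : ℝ) * besselI ν₀ x)
      (fun x => (√x : ℝ) * besselK ν₀ x) ∧
    (conj ν₀ = ν₀ → ∀ x : ℝ, 0 < x → conj ((√x : ℝ) * besselK ν₀ x) = (√x : ℝ) * besselK ν₀ x) := by
  have H := isFrobenius_bessel 1
  obtain ⟨y, y₁, hs, hl⟩ := H.exists_second (α := fun _ => -(π : ℂ) / 2)
    (β := fun _ => (π : ℂ) / 2)
    (by fun_prop) (by fun_prop) (fun n x hx => by
      rw [frob_bessel_neg_nat 1 n hx]; ring) hν₀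
  have hY : ∀ x : ℝ, 0 < x → (√x : ℝ) * besselK ν₀ x = y x := fun x hx => by
    rw [besselK]
    exact sol_limit_eq hl (F := fun μ x => π / 2 * (besselI (-μ) x - besselI μ x))
      (fun ν x hx => by rw [frob_besselI _ hx, frob_besselI _ hx]; ring) hx
  refine ⟨⟨frob₁ (besselFactor 1) (besselFactor₁ 1) ν₀, y₁,
    (H.isSol ν₀).congr isOpen_Ioi fun x hx => (frob_besselI ν₀ hx).symm,
    hs.congr isOpen_Ioi hY, fun x hx => ?_⟩, fun h0 x hx => ?_⟩
  · beta_reduce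
    rw [hY x hx, ← frob_besselI ν₀ hx,
      H.wronskian_limit (besselFactor_zero 1) (by fun_prop) hl hx]
    simp [Real.pi_ne_zero]
  · rw [hY x hx]
    refine conj_frob_limit hl (fun ν => by simp [map_ofNat]) (fun ν => by simp [map_ofNat])
      (fun ν x hx => ?_) h0 hx
    rw [frob_besselI _ hx, frob_besselI _ hx, map_mul, conj_besselI _ hx, conj_ofReal]

end Bessel

section ImaginaryOrder

open Complex ComplexConjugate
open scoped Real

variable {γ : ℝ}

theorem sin_I_mul_pi (γ : ℝ) : sin (I * γ * π) = Real.sinh (γ * π) * I := by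
  rw [show I * (γ : ℂ) * π = ((γ * π : ℝ) : ℂ) * I by push_cast; ring, sin_mul_I,
    ofReal_sinh]

theorem cos_I_mul_pi (γ : ℝ) : cos (I * γ * π) = Real.cosh (γ * π) := by
  rw [show I * (γ : ℂ) * π = ((γ * π : ℝ) : ℂ) * I by push_cast; ring, cos_mul_I,
    ofReal_cosh]

theorem sinh_mul_pi_pos (hγ : 0 < γ) : 0 < Real.sinh (γ * π) :=
  Real.sinh_pos_iff.2 (mul_pos hγ Real.pi_pos)

theorem sin_I_mul_pi_ne_zero (hγ : 0 < γ) : sin (I * γ * π) ≠ 0 := by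
  rw [sin_I_mul_pi]
  exact mul_ne_zero (by exact_mod_cast (sinh_mul_pi_pos hγ).ne') I_ne_zero

theorem conj_I_mul (γ : ℝ) : conj (I * (γ : ℂ)) = -(I * γ) := by simp

theorem valueOrLimit_of_ne {d F : ℂ → ℂ} {m : ℂ} (h : d m ≠ 0) : valueOrLimit d F m = F m :=
  if_pos h

theorem besselY_I (hγ : 0 < γ) (x : ℝ) : besselY (I * γ) x =
    (besselJ (I * γ) x * Real.cosh (γ * π) - besselJ (-(I * γ)) x)
      / (Real.sinh (γ * π) * I) := by
  rw [besselY, valueOrLimit_of_ne (d := fun μ => sin (μ * π)) (sin_I_mul_pi_ne_zero hγ), sin_I_mul_pi, cos_I_mul_pi]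

theorem besselK_I (hγ : 0 < γ) (x : ℝ) : besselK (I * γ) x =
    π / 2 * (besselI (-(I * γ)) x - besselI (I * γ) x) / (Real.sinh (γ * π) * I) := by
  rw [besselK, valueOrLimit_of_ne (d := fun μ => sin (μ * π)) (sin_I_mul_pi_ne_zero hγ), sin_I_mul_pi]

theorem exists_exp_half (hγ : 0 < γ) : ∃ E F : ℝ, Real.exp (-(γ * π) / 2) = E ∧
    Real.exp (γ * π / 2) = F ∧ E * F = 1 ∧ 0 < E ∧ E < F ∧
    Real.cosh (γ * π) = (F ^ 2 + E ^ 2) / 2 ∧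
    Real.sinh (γ * π) = (F ^ 2 - E ^ 2) / 2 := by
  refine ⟨_, _, rfl, rfl, ?_, Real.exp_pos _, ?_, ?_, ?_⟩
  · rw [← Real.exp_add]; simp [← add_div]
  · have := mul_pos hγ Real.pi_pos
    exact Real.exp_lt_exp.2 (by linarith)
  all_goals
    rw [← Real.exp_nat_mul, ← Real.exp_nat_mul]
    first | rw [Real.cosh_eq] | rw [Real.sinh_eq]
    congr 3 <;> push_cast <;> ring_nf

theorem hankelMod₁_eq (hγ : 0 < γ) (x : ℝ) : hankelMod₁ γ x =
    (besselJ (I * γ) x + besselJ (-(I * γ)) x)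
      / (Real.exp (-(γ * π) / 2) + Real.exp (γ * π / 2) : ℝ) := by
  obtain ⟨E, F, hE, hF, h1, h0, hlt, hc, hs⟩ := exists_exp_half hγ
  rw [hankelMod₁, hankel₁, hankel₂, besselY_I hγ, hE, hF, hc, hs]
  have hsum : (E : ℂ) + F ≠ 0 := by exact_mod_cast (by linarith : E + F ≠ 0)
  have hdif : (F : ℂ) - E ≠ 0 := by exact_mod_cast (sub_pos.2 hlt).ne'
  have hsq : (F : ℂ) ^ 2 - E ^ 2 ≠ 0 := by
    rw [sq_sub_sq]; exact mul_ne_zero (by rwa [add_comm]) hdif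
  have h1' : (E : ℂ) * F = 1 := by exact_mod_cast h1
  push_cast
  field_simp
  linear_combination (-2 * besselJ (I * γ) x * (E ^ 2 - F ^ 2)) * h1'

theorem hankelMod₂_eq (hγ : 0 < γ) (x : ℝ) : hankelMod₂ γ x =
    I * (besselJ (-(I * γ)) x - besselJ (I * γ) x)
      / (Real.exp (γ * π / 2) - Real.exp (-(γ * π) / 2) : ℝ) := by
  obtain ⟨E, F, hE, hF, h1, h0, hlt, hc, hs⟩ := exists_exp_half hγ
  rw [hankelMod₂, hankel₁, hankel₂, besselY_I hγ, hE, hF, hc, hs]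
  have hsum : (E : ℂ) + F ≠ 0 := by exact_mod_cast (by linarith : E + F ≠ 0)
  have hdif : (F : ℂ) - E ≠ 0 := by exact_mod_cast (sub_pos.2 hlt).ne'
  have hsq : (F : ℂ) ^ 2 - E ^ 2 ≠ 0 := by
    rw [sq_sub_sq]; exact mul_ne_zero (by rwa [add_comm]) hdif
  have h1' : (E : ℂ) * F = 1 := by exact_mod_cast h1
  push_cast
  field_simp
  rw [I_sq]
  linear_combination (-2 * besselJ (I * γ) x * (E ^ 2 - F ^ 2)) * h1'

theorem besselImag_fundamental (hγ : 0 < γ) :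
    IsFund (frobPot (-1) 0 (I * γ)) (Set.Ioi 0) (fun x => (√x : ℝ) * hankelMod₁ γ x)
      (fun x => (√x : ℝ) * hankelMod₂ γ x) ∧
    ∀ x : ℝ, 0 < x → conj ((√x : ℝ) * hankelMod₁ γ x) = (√x : ℝ) * hankelMod₁ γ x ∧
      conj ((√x : ℝ) * hankelMod₂ γ x) = (√x : ℝ) * hankelMod₂ γ x := by
  refine ⟨?_, fun x hx => ?_⟩
  · have H := (bessel_fundamental (ν₀ := I * γ)
      fun h => absurd h (sin_I_mul_pi_ne_zero hγ)).1
    obtain ⟨E, F, hE, hF, h1, -⟩ := exists_exp_half hγ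
    have h1' : (E : ℂ) * F = 1 := by exact_mod_cast h1
    refine (H.comb (a := (E + F) / 2) (b := I * (E - F) / 2) (c := (E - F) / (2 * I))
      (d := (E + F) / 2) ?_).congr isOpen_Ioi (fun _ _ => rfl) (fun x _ => ?_) fun x _ => ?_
    · rw [show ((E : ℂ) + F) / 2 * ((E + F) / 2) - I * (E - F) / 2 * ((E - F) / (2 * I)) = E * F by
        field_simp; ring, h1']
      exact one_ne_zero
    · rw [hankelMod₁, hankel₁, hankel₂, hE, hF]; ring
    · rw [hankelMod₂, hankel₁, hankel₂, hE, hF]; field_simp; ring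
  · rw [hankelMod₁_eq hγ, hankelMod₂_eq hγ]
    simp only [map_mul, map_div₀, map_add, map_sub, conj_ofReal, conj_besselJ _ hx, map_neg, conj_I]
    constructor <;> ring_nf

theorem modBesselImag_fundamental (hγ : 0 < γ) :
    IsFund (frobPot 1 0 (I * γ)) (Set.Ioi 0) (fun x => (√x : ℝ) * besselIMod γ x)
      (fun x => (√x : ℝ) * besselK (I * γ) x) ∧
    ∀ x : ℝ, 0 < x → conj ((√x : ℝ) * besselIMod γ x) = (√x : ℝ) * besselIMod γ x ∧
      conj ((√x : ℝ) * besselK (I * γ) x) = (√x : ℝ) * besselK (I * γ) x := by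
  have hs : ((Real.sinh (γ * π) : ℝ) : ℂ) ≠ 0 := by
    exact_mod_cast (sinh_mul_pi_pos hγ).ne'
  have hpi : (π : ℂ) ≠ 0 := by exact_mod_cast Real.pi_ne_zero
  refine ⟨?_, fun x hx => ?_⟩
  · have H := (modBessel_fundamental (ν₀ := I * γ)
      fun h => absurd h (sin_I_mul_pi_ne_zero hγ)).1
    refine (H.comb (a := π / Real.sinh (γ * π)) (b := I) (c := 0)
      (d := 1) ?_).congr isOpen_Ioi (fun _ _ => rfl) (fun x _ => ?_) fun x _ => ?_
    · rw [mul_one, mul_zero, sub_zero]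
      exact div_ne_zero hpi hs
    · rw [besselIMod, sin_I_mul_pi, besselK_I hγ]
      field_simp
      ring
    · ring
  · rw [besselIMod, sin_I_mul_pi, besselK_I hγ]
    simp only [map_mul, map_div₀, map_add, map_sub, conj_ofReal, conj_besselI _ hx, map_neg,
      conj_I, map_ofNat]
    constructor
    · field_simp
      ring
    · field_simp; ring

end ImaginaryOrder

section Kummer

open Complex

theorem eq_zero_of_kummer_ode {D D₁ D₂ : ℂ → ℂ} {a b : ℂ} (h₀ : ∀ z, HasDerivAt D (D₁ z) z)
    (h₁ : ∀ z, HasDerivAt D₁ (D₂ z) z) (ode : ∀ z, z * D₂ z + (b - z) * D₁ z - a * D z = 0)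
    (h0 : D 0 = 0) (hb : ∀ n : ℕ, b + n ≠ 0) (z : ℂ) : D z = 0 := by
  have hD : Differentiable ℂ D := fun z => (h₀ z).differentiableAt
  have hd : ∀ n z, HasDerivAt (iteratedDeriv n D) (iteratedDeriv (n + 1) D z) z := fun n z => by
    rw [iteratedDeriv_succ]
    exact ((hD.contDiff (n := (n + 1 : ℕ))).differentiable_iteratedDeriv n (by
      exact_mod_cast Nat.lt_succ_self n) z).hasDerivAt
  have e₁ : D₁ = iteratedDeriv 1 D := by
    rw [iteratedDeriv_one]; exact funext fun z => (h₀ z).deriv.symm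
  have e₂ : D₂ = iteratedDeriv 2 D := by
    rw [iteratedDeriv_succ, ← e₁]; exact funext fun z => (h₁ z).deriv.symm
  have key : ∀ (n : ℕ) z, z * iteratedDeriv (n + 2) D z + (n + b - z) * iteratedDeriv (n + 1) D z
      - (n + a) * iteratedDeriv n D z = 0 := by
    intro n
    induction n with
    | zero => intro z; simpa [e₁, e₂] using ode z
    | succ n ih =>
      intro z
      have d := (((hasDerivAt_id z).fun_mul (hd (n + 2) z)).add
        (((hasDerivAt_id z).const_sub (n + b)).fun_mul (hd (n + 1) z))).sub
        ((hd n z).const_mul (n + a))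
      have := (d.congr_deriv rfl).unique ((hasDerivAt_const z (0 : ℂ)).congr_of_eventuallyEq
        (Filter.Eventually.of_forall ih))
      simp only [id] at this
      push_cast
      linear_combination this
  have hz : ∀ n, iteratedDeriv n D 0 = 0 := by
    intro n
    induction n with
    | zero => simpa using h0
    | succ n ih =>
      have := key n 0
      rw [ih] at this
      simp only [zero_mul, mul_zero, sub_zero, zero_add] at this
      exact (mul_eq_zero.1 this).resolve_left (by rw [add_comm]; exact hb n)
  have t := hasSum_taylorSeries_of_entire hD 0 z
  simp only [hz, smul_zero] at t
  exact t.unique hasSum_zero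

theorem kummer_of_ne {a b : ℂ} (hb : ∀ n : ℕ, b + n ≠ 0) (z : ℂ) :
    hgM a b z = exp z * hgM (b - a) b (-z) := by
  have hd : ∀ a b z : ℂ, HasDerivAt (fun z => hgM a b (-z)) (-(a * hgM (a + 1) (b + 1) (-z))) z :=
    fun a b z => by
      have := HasDerivAt.comp (h₂ := hgM a b) (h := fun z : ℂ => -z) z
        (hasDerivAt_hgM a b (-z)) (hasDerivAt_neg z)
      exact this.congr_deriv (by ring)
  rw [← sub_eq_zero]
  refine eq_zero_of_kummer_ode (a := a) (b := b)
    (D := fun z => hgM a b z - exp z * hgM (b - a) b (-z))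
    (fun z => (hasDerivAt_hgM a b z).sub ((hasDerivAt_exp z).fun_mul (hd (b - a) b z)))
    (fun z => ((hasDerivAt_hgM (a + 1) (b + 1) z).const_mul a).sub
      (((hasDerivAt_exp z).fun_mul (hd (b - a) b z)).add
        ((hasDerivAt_exp z).fun_mul
          ((hd (b - a + 1) (b + 1) z).const_mul (b - a)).neg))) (fun z => ?_) ?_ hb z
  · have e1 := hgM_ode a b z
    have e2 := hgM_ode (b - a) b (-z)
    rw [show a + 1 + 1 = a + 2 by ring, show b + 1 + 1 = b + 2 by ring,
      show b - a + 1 + 1 = b - a + 2 by ring]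
    linear_combination a * e1 + (b - a) * exp z * e2
  · simp [hgM_zero]

theorem kummer (a b z : ℂ) : hgM a b z = exp z * hgM (b - a) b (-z) := by
  have t1 := ((differentiable_hgM_param (a := fun _ => a) (b := fun b => b) (by fun_prop)
    (by fun_prop) z).continuous.tendsto b).mono_left (ordFilter_le b)
  have t2 := (((differentiable_hgM_param (a := fun b => b - a) (b := fun b => b) (by fun_prop)
    (by fun_prop) (-z)).continuous.tendsto b).mono_left (ordFilter_le b)).const_mul (exp z)
  refine tendsto_nhds_unique (t1.congr' ?_) t2
  filter_upwards [eventually_sin_ne_zero b] with b hb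
  refine kummer_of_ne (fun n hn => hb (sin_mul_pi_eq_zero_iff.2 ⟨-n, ?_⟩)) z
  push_cast
  linear_combination hn

end Kummer

section Whittaker

open Complex ComplexConjugate
open scoped Real

variable (k ζ L : ℂ)

/-- The entire factor of the Whittaker function `M_{k, ν/2}(ζ x²)`, where `L = log ζ`. -/
def whitFactor (ν w : ℂ) : ℂ :=
  exp (L * ((1 + ν) / 2)) * exp (-(ζ * w) / 2) * hgM (1 / 2 + ν / 2 - k) (1 + ν) (ζ * w)

def whitFactor₁ (ν w : ℂ) : ℂ :=
  exp (L * ((1 + ν) / 2)) * exp (-(ζ * w) / 2) *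
    (-(ζ / 2) * hgM (1 / 2 + ν / 2 - k) (1 + ν) (ζ * w) +
      ζ * (1 / 2 + ν / 2 - k) * hgM (3 / 2 + ν / 2 - k) (2 + ν) (ζ * w))

def whitFactor₂ (ν w : ℂ) : ℂ :=
  exp (L * ((1 + ν) / 2)) * exp (-(ζ * w) / 2) *
    (ζ ^ 2 / 4 * hgM (1 / 2 + ν / 2 - k) (1 + ν) (ζ * w) -
      ζ ^ 2 * (1 / 2 + ν / 2 - k) * hgM (3 / 2 + ν / 2 - k) (2 + ν) (ζ * w) +
      ζ ^ 2 * (1 / 2 + ν / 2 - k) * (3 / 2 + ν / 2 - k) *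
        hgM (5 / 2 + ν / 2 - k) (3 + ν) (ζ * w))

theorem hasDerivAt_hgM_linear (a b c w : ℂ) :
    HasDerivAt (fun w : ℂ => hgM a b (c * w)) (c * (a * hgM (a + 1) (b + 1) (c * w))) w := by
  have h1 : HasDerivAt (fun w : ℂ => c * w) c w := by simpa using (hasDerivAt_id w).const_mul c
  have h2 := HasDerivAt.comp (h₂ := hgM a b) (h := fun w : ℂ => c * w) w
    (hasDerivAt_hgM a b (c * w)) h1
  rw [mul_comm c]
  exact h2

theorem continuous_hgM_linear (s b c : ℂ) :
    Continuous fun q : ℂ × ℂ => hgM (s + q.1 / 2 - k) (b + q.1) (c * q.2) := by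
  have hf : Continuous fun q : ℂ × ℂ =>
      (((s + q.1 / 2 - k, b + q.1), c * q.2) : (ℂ × ℂ) × ℂ) := by fun_prop
  generalize hF : (fun q : (ℂ × ℂ) × ℂ => hgM q.1.1 q.1.2 q.2) = F
  have h := (hF ▸ continuous_hgM : Continuous F).comp hf
  subst hF
  exact h

theorem isFrobenius_whittaker : IsFrobenius (-4 * k * ζ) (ζ ^ 2) (whitFactor k ζ L)
    (whitFactor₁ k ζ L) (whitFactor₂ k ζ L) := by
  have hexp : ∀ w : ℂ, HasDerivAt (fun w => exp (-(ζ * w) / 2)) (exp (-(ζ * w) / 2) * (-(ζ / 2))) w :=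
    fun w => by
      have : HasDerivAt (fun w : ℂ => -(ζ * w) / 2) (-(ζ / 2)) w := by
        simpa [neg_div] using (((hasDerivAt_id w).const_mul ζ).neg).div_const 2
      exact this.cexp
  have hM : ∀ s s' b b' ν w : ℂ, s' = s + 1 → b' = b + 1 →
      HasDerivAt (fun w : ℂ => hgM (s + ν / 2 - k) (b + ν) (ζ * w))
        (ζ * ((s + ν / 2 - k) * hgM (s' + ν / 2 - k) (b' + ν) (ζ * w))) w := by
    rintro s _ b _ ν w rfl rfl
    have := hasDerivAt_hgM_linear (s + ν / 2 - k) (b + ν) ζ w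
    rwa [show s + ν / 2 - k + 1 = s + 1 + ν / 2 - k by ring,
      show b + ν + 1 = b + 1 + ν by ring] at this
  have hM₀ := fun ν w => hM (1 / 2) (3 / 2) 1 2 ν w (by norm_num) (by norm_num)
  have hM₁ := fun ν w => hM (3 / 2) (5 / 2) 2 3 ν w (by norm_num) (by norm_num)
  refine ⟨fun ν w => ?_, fun ν w => ?_, fun ν w => ?_, ?_, ?_, fun w => ?_, fun w => ?_⟩
  · refine (((hexp w).const_mul _).fun_mul (hM₀ ν w)).congr_deriv ?_
    simp only [whitFactor₁]; ring
  · refine (((hexp w).const_mul _).fun_mul (((hM₀ ν w).const_mul (-(ζ / 2))).fun_add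
      ((hM₁ ν w).const_mul (ζ * (1 / 2 + ν / 2 - k))))).congr_deriv ?_
    simp only [whitFactor₂]; ring
  · have e := hgM_ode (1 / 2 + ν / 2 - k) (1 + ν) (ζ * w)
    rw [show 1 / 2 + ν / 2 - k + 2 = 5 / 2 + ν / 2 - k by ring,
      show 1 / 2 + ν / 2 - k + 1 = 3 / 2 + ν / 2 - k by ring,
      show 1 + ν + 2 = 3 + ν by ring, show 1 + ν + 1 = 2 + ν by ring] at e
    simp only [whitFactor, whitFactor₁, whitFactor₂]
    linear_combination (4 * ζ * (1 / 2 + ν / 2 - k) *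
      exp (L * ((1 + ν) / 2)) * exp (-(ζ * w) / 2)) * e
  · exact Continuous.mul (by fun_prop) (continuous_hgM_linear k (1 / 2) 1 ζ)
  · exact Continuous.mul (by fun_prop) ((continuous_const.mul
      (continuous_hgM_linear k (1 / 2) 1 ζ)).add
      (Continuous.mul (by fun_prop) (continuous_hgM_linear k (3 / 2) 2 ζ)))
  · exact Differentiable.mul (by fun_prop) (differentiable_hgM_param
      (a := fun ν => 1 / 2 + ν / 2 - k) (b := fun ν => 1 + ν) (by fun_prop) (by fun_prop) _)
  · exact Differentiable.mul (by fun_prop) (((differentiable_hgM_param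
      (a := fun ν => 1 / 2 + ν / 2 - k) (b := fun ν => 1 + ν) (by fun_prop)
      (by fun_prop) _).const_mul _).add (Differentiable.mul (by fun_prop) (differentiable_hgM_param
      (a := fun ν => 3 / 2 + ν / 2 - k) (b := fun ν => 2 + ν) (by fun_prop) (by fun_prop) _)))

theorem whitFactor_zero (ν : ℂ) : -2 * ν * whitFactor k ζ L ν 0 * whitFactor k ζ L (-ν) 0
    = -2 * exp L / π * sin (ν * π) := by
  have e : exp (L * ((1 + ν) / 2)) * exp (L * ((1 + -ν) / 2)) = exp L := by
    rw [← exp_add]; ring_nf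
  have e2 := mul_inv_Gamma ν
  simp only [whitFactor, mul_zero, hgM_zero, neg_zero, zero_div, exp_zero, mul_one]
  rw [← sub_eq_add_neg] at e ⊢
  linear_combination (-2 * ν * (Gamma (1 + ν))⁻¹ * (Gamma (1 - ν))⁻¹) * e - 2 * exp L * e2

def whitα (ν : ℂ) : ℂ := -π * (Gamma (1 / 2 - ν / 2 - k))⁻¹

def whitβ (ν : ℂ) : ℂ := π * (Gamma (1 / 2 + ν / 2 - k))⁻¹

theorem whitα_neg (ν : ℂ) : whitα k (-ν) = -whitβ k ν := by
  rw [whitα, whitβ, neg_div, sub_neg_eq_add]; ring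

theorem whitβ_neg (ν : ℂ) : whitβ k (-ν) = -whitα k ν := by
  rw [whitα, whitβ, neg_div, ← sub_eq_add_neg]; ring

theorem differentiable_whitα : Differentiable ℂ (whitα k) :=
  (differentiable_one_div_Gamma.comp
    (by fun_prop : Differentiable ℂ fun ν : ℂ => 1 / 2 - ν / 2 - k)).const_mul _

theorem differentiable_whitβ : Differentiable ℂ (whitβ k) :=
  (differentiable_one_div_Gamma.comp
    (by fun_prop : Differentiable ℂ fun ν : ℂ => 1 / 2 + ν / 2 - k)).const_mul _

theorem whit_vanish (hL : exp L = ζ) (n : ℕ) {x : ℝ} (hx : 0 < x) :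
    whitα k n * frob (whitFactor k ζ L) n x + whitβ k n * frob (whitFactor k ζ L) (-n) x = 0 := by
  have e1 := inv_Gamma_sub_nat n (1 / 2 + n / 2 - k)
  have e2 := hgM_sub_one_sub n (1 / 2 + n / 2 - k) (ζ * (x : ℂ) ^ 2)
  have e3 : pw (1 / 2 + n) x = pw (1 / 2 + -n) x * ((x : ℂ) ^ 2) ^ n := by
    rw [← pow_mul, ← pw_natCast (2 * n) hx, ← pw_add]; push_cast; ring_nf
  have e4 : exp (L * ((1 + n) / 2)) = exp (L * ((1 + -n) / 2)) * ζ ^ n := by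
    rw [← hL, ← exp_nat_mul, ← exp_add]; ring_nf
  rw [show 1 / 2 + (n : ℂ) / 2 - k - n = 1 / 2 - n / 2 - k by ring] at e1 e2
  simp only [whitα, whitβ, frob, whitFactor]
  rw [e1, e3, e4, show 1 / 2 + -(n : ℂ) / 2 - k = 1 / 2 - n / 2 - k by ring,
    show (1 : ℂ) + -n = 1 - n by ring, e2, mul_pow]
  ring

theorem frob_whittakerM (hlog : ∀ x : ℝ, 0 < x → log (ζ * (x : ℂ) ^ 2) = L + 2 * Real.log x)
    (hζ : ζ ≠ 0) (ν : ℂ) {x : ℝ} (hx : 0 < x) :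
    (x ^ (-1 / 2 : ℝ) : ℝ) * whittakerM k (ν / 2) (ζ * (x : ℂ) ^ 2)
      = Gamma (1 + ν) * frob (whitFactor k ζ L) ν x := by
  have hx' : (x : ℂ) ≠ 0 := by exact_mod_cast hx.ne'
  have h1 : ((x ^ (-1 / 2 : ℝ) : ℝ) : ℂ) * (ζ * (x : ℂ) ^ 2) ^ (1 / 2 + ν / 2)
      = pw (1 / 2 + ν) x * exp (L * ((1 + ν) / 2)) := by
    rw [cpow_def_of_ne_zero (mul_ne_zero hζ (pow_ne_zero 2 hx')), hlog x hx,
      Real.rpow_def_of_pos hx, ofReal_exp, pw, ← exp_add, ← exp_add]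
    push_cast; ring_nf
  rw [whittakerM, show 2 * (ν / 2) = ν by ring]
  simp only [frob, whitFactor, hgM]
  linear_combination (exp (-(ζ * (x : ℂ) ^ 2) / 2) * Gamma (1 + ν) *
    regularizedHGFun {1 / 2 + ν / 2 - k} {1 + ν} (ζ * (x : ℂ) ^ 2)) * h1

theorem valueOrLimit_half {F : ℂ → ℂ} {ν₀ y : ℂ}
    (h : Filter.Tendsto (fun ν => F (ν / 2)) (ordFilter ν₀) (𝓝 y)) :
    valueOrLimit (fun n => sin (2 * n * π)) F (ν₀ / 2) = y := by
  have e : 2 * (ν₀ / 2) = ν₀ := by ring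
  rw [valueOrLimit]
  by_cases h0 : sin (ν₀ * π) = 0
  · rw [if_neg (by simpa [e] using h0)]
    rw [ordFilter_of_eq h0] at h
    refine Filter.Tendsto.limUnder_eq ?_
    have t : Filter.Tendsto (fun n : ℂ => 2 * n) (𝓝[≠] (ν₀ / 2)) (𝓝[≠] ν₀) := by
      refine tendsto_nhdsWithin_iff.2 ⟨?_, ?_⟩
      · have := ((continuous_const_mul (2 : ℂ)).tendsto (ν₀ / 2)).mono_left
          (nhdsWithin_le_nhds (s := {ν₀ / 2}ᶜ))
        rwa [e] at this
      · filter_upwards [self_mem_nhdsWithin] with n hn h2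
        exact hn (by rw [Set.mem_singleton_iff] at *; linear_combination h2 / 2)
    exact (h.comp t).congr fun n => by simp
  · rw [if_pos (by simpa [e] using h0)]
    rw [ordFilter_of_ne h0] at h
    exact tendsto_nhds_unique (tendsto_pure_nhds (fun ν => F (ν / 2)) ν₀) h

theorem exists_whittakerW (hL : exp L = ζ)
    (hlog : ∀ x : ℝ, 0 < x → log (ζ * (x : ℂ) ^ 2) = L + 2 * Real.log x)
    {ν₀ : ℂ} (hν₀ : sin (ν₀ * π) = 0 → ∃ n : ℕ, ν₀ = n) :
    ∃ y y₁ : ℝ → ℂ, IsSol (frobPot (-4 * k * ζ) (ζ ^ 2) ν₀) (Set.Ioi 0) y y₁ ∧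
      IsFrobLimit (whitFactor k ζ L) (whitFactor₁ k ζ L) (whitα k) (whitβ k) ν₀ y y₁ ∧
      ∀ x : ℝ, 0 < x →
        (x ^ (-1 / 2 : ℝ) : ℝ) * whittakerW k (ν₀ / 2) (ζ * (x : ℂ) ^ 2) = y x := by
  have hζ : ζ ≠ 0 := hL ▸ exp_ne_zero L
  obtain ⟨y, y₁, hs, hl⟩ := (isFrobenius_whittaker k ζ L).exists_second (differentiable_whitα k)
    (differentiable_whitβ k) (fun n x hx => whit_vanish k ζ L hL n hx) hν₀
  refine ⟨y, y₁, hs, hl, fun x hx => ?_⟩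
  have hxs : ((x ^ (-1 / 2 : ℝ) : ℝ) : ℂ) ≠ 0 := by exact_mod_cast (Real.rpow_pos_of_pos hx _).ne'
  rw [whittakerW, valueOrLimit_half (y := ((x ^ (-1 / 2 : ℝ) : ℝ) : ℂ)⁻¹ * y x),
    mul_inv_cancel_left₀ hxs]
  refine ((hl x hx).1.const_mul ((x ^ (-1 / 2 : ℝ) : ℝ) : ℂ)⁻¹).congr' ?_
  filter_upwards [eventually_sin_ne_zero ν₀] with ν hs
  have m1 := frob_whittakerM k ζ L hlog hζ ν hx
  have m2 := frob_whittakerM k ζ L hlog hζ (-ν) hx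
  rw [← sub_eq_add_neg, neg_div (2 : ℂ) ν] at m2
  have g1 := Gamma_mul_Gamma_one_sub ν
  have g2 := Gamma_mul_Gamma_one_sub (-ν)
  rw [sub_neg_eq_add, mul_neg, sin_neg, mul_comm (π : ℂ)] at g2
  rw [mul_comm (π : ℂ)] at g1
  rw [inv_mul_eq_iff_eq_mul₀ hxs, show -2 * (ν / 2) = -ν by ring, show 2 * (ν / 2) = ν by ring]
  have n1 : -(π : ℂ) / sin (ν * π) = Gamma (-ν) * Gamma (1 + ν) := by
    rw [g2, div_neg, neg_div]
  rw [whitα, whitβ, div_eq_mul_inv (Gamma (-ν)), div_eq_mul_inv (Gamma ν)]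
  linear_combination (-Gamma (-ν) * (Gamma (1 / 2 - ν / 2 - k))⁻¹) * m1
    - Gamma ν * (Gamma (1 / 2 + ν / 2 - k))⁻¹ * m2
    + (Gamma (1 / 2 - ν / 2 - k))⁻¹ * frob (whitFactor k ζ L) ν x * n1
    - (Gamma (1 / 2 + ν / 2 - k))⁻¹ * frob (whitFactor k ζ L) (-ν) x * g1

end Whittaker

section WhittakerPair

open Complex ComplexConjugate
open scoped Real

variable {k ζ L σ ν₀ : ℂ}

theorem whitFactor_kummer (k ζ L σ ν w : ℂ) :
    whitFactor (-k) (-ζ) (L + σ * π * I) ν w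
      = exp (σ * π * I * ((1 + ν) / 2)) * whitFactor k ζ L ν w := by
  have e := kummer (1 / 2 + ν / 2 - -k) (1 + ν) (-ζ * w)
  rw [show 1 + ν - (1 / 2 + ν / 2 - -k) = 1 / 2 + ν / 2 - k by ring,
    show -(-ζ * w) = ζ * w by ring] at e
  have e1 : exp ((L + σ * π * I) * ((1 + ν) / 2))
      = exp (σ * π * I * ((1 + ν) / 2)) * exp (L * ((1 + ν) / 2)) := by
    rw [← exp_add]; ring_nf
  have e2 : exp (-(-ζ * w) / 2) * exp (-ζ * w) = exp (-(ζ * w) / 2) := by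
    rw [← exp_add]; ring_nf
  rw [whitFactor, whitFactor, e, e1]
  linear_combination (exp (σ * π * I * ((1 + ν) / 2)) * exp (L * ((1 + ν) / 2)) *
    hgM (1 / 2 + ν / 2 - k) (1 + ν) (ζ * w)) * e2

theorem inv_Gamma_mul_half (u : ℂ) :
    (Gamma (1 / 2 + u))⁻¹ * (Gamma (1 / 2 - u))⁻¹ = cos (π * u) / π := by
  have e := Gamma_mul_Gamma_one_sub (1 / 2 + u)
  rw [show 1 - (1 / 2 + u) = 1 / 2 - u by ring,
    show (π : ℂ) * (1 / 2 + u) = π * u + π / 2 by ring, sin_add_pi_div_two] at e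
  rw [← mul_inv, e, inv_div]

theorem whit_det (hσ : σ = 1 ∨ σ = -1) (ν : ℂ) :
    whitα k ν * (exp (σ * π * I * ((1 + -ν) / 2)) * whitβ (-k) ν)
      - whitβ k ν * (exp (σ * π * I * ((1 + ν) / 2)) * whitα (-k) ν)
      = -π * exp (-(σ * π * I * k)) * sin (ν * π) := by
  have hpi : (π : ℂ) ≠ 0 := by exact_mod_cast Real.pi_ne_zero
  have g1 := inv_Gamma_mul_half (ν / 2 + k)
  have g2 := inv_Gamma_mul_half (ν / 2 - k)
  have hs : exp (σ * π * I / 2) = σ * I := by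
    rcases hσ with rfl | rfl
    · rw [one_mul, one_mul, mul_div_right_comm, exp_pi_div_two_mul_I]
    · rw [show -1 * (π : ℂ) * I / 2 = -π / 2 * I by ring, exp_neg_pi_div_two_mul_I]
      ring
  have hss : σ * σ = 1 := by rcases hσ with rfl | rfl <;> norm_num
  obtain ⟨A, hA⟩ : ∃ A, exp (σ * π * I * (ν / 2)) = A := ⟨_, rfl⟩
  obtain ⟨K, hK⟩ : ∃ K, exp (σ * π * I * k) = K := ⟨_, rfl⟩
  have hA0 : A ≠ 0 := hA ▸ exp_ne_zero _
  have hK0 : K ≠ 0 := hK ▸ exp_ne_zero _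
  have hcos : ∀ u : ℂ, cos (π * u)
      = (exp (σ * π * I * u) + exp (-(σ * π * I * u))) / 2 := fun u => by
    rcases hσ with rfl | rfl
    · rw [cos]; ring_nf
    · rw [cos]; ring_nf
  have hsin : sin (ν * π) = σ * (A⁻¹ ^ 2 - A ^ 2) * I / 2 := by
    rw [← hA, ← exp_neg, ← exp_nat_mul, ← exp_nat_mul]
    rcases hσ with rfl | rfl
    · rw [sin]; push_cast; ring_nf
    · rw [sin]; push_cast; ring_nf
  have c1 : cos (π * (ν / 2 + k)) = (A * K + A⁻¹ * K⁻¹) / 2 := by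
    rw [hcos, ← hA, ← hK, ← exp_neg, ← exp_neg, ← exp_add, ← exp_add]; ring_nf
  have c2 : cos (π * (ν / 2 - k)) = (A * K⁻¹ + A⁻¹ * K) / 2 := by
    rw [hcos, ← hA, ← hK, ← exp_neg, ← exp_neg, ← exp_add, ← exp_add]; ring_nf
  have x1 : exp (σ * π * I * ((1 + -ν) / 2)) = σ * I * A⁻¹ := by
    rw [← hs, ← hA, ← exp_neg, ← exp_add]; ring_nf
  have x2 : exp (σ * π * I * ((1 + ν) / 2)) = σ * I * A := by
    rw [← hs, ← hA, ← exp_add]; ring_nf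
  rw [exp_neg, hK, hsin, x1, x2, whitα, whitβ, whitα, whitβ,
    show 1 / 2 - ν / 2 - k = 1 / 2 - (ν / 2 + k) by ring,
    show 1 / 2 + ν / 2 - -k = 1 / 2 + (ν / 2 + k) by ring,
    show 1 / 2 + ν / 2 - k = 1 / 2 + (ν / 2 - k) by ring,
    show 1 / 2 - ν / 2 - -k = 1 / 2 - (ν / 2 - k) by ring]
  rw [c1] at g1
  rw [c2] at g2
  have e : -(π : ℂ) ^ 2 * (σ * I) * (A⁻¹ * ((A * K + A⁻¹ * K⁻¹) / 2 / π)
      - A * ((A * K⁻¹ + A⁻¹ * K) / 2 / π))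
      = -π * K⁻¹ * (σ * (A⁻¹ ^ 2 - A ^ 2) * I / 2) := by
    field_simp
    ring
  rw [← e, ← g1, ← g2]
  ring

theorem whittaker_fundamental (hσ : σ = 1 ∨ σ = -1) (hL : exp L = ζ)
    (hlog : ∀ x : ℝ, 0 < x → log (ζ * (x : ℂ) ^ 2) = L + 2 * Real.log x)
    (hlog' : ∀ x : ℝ, 0 < x → log (-ζ * (x : ℂ) ^ 2) = L + σ * π * I + 2 * Real.log x)
    (hν₀ : sin (ν₀ * π) = 0 → ∃ n : ℕ, ν₀ = n) (k : ℂ) :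
    IsFund (frobPot (-4 * k * ζ) (ζ ^ 2) ν₀) (Set.Ioi 0)
      (fun x => (x ^ (-1 / 2 : ℝ) : ℝ) * whittakerW k (ν₀ / 2) (ζ * (x : ℂ) ^ 2))
      (fun x => (x ^ (-1 / 2 : ℝ) : ℝ) * whittakerW (-k) (ν₀ / 2) (-ζ * (x : ℂ) ^ 2)) := by
  have hL' : exp (L + σ * π * I) = -ζ := by
    rw [exp_add, hL]
    rcases hσ with rfl | rfl
    · rw [one_mul, exp_pi_mul_I]; ring
    · rw [show -1 * (π : ℂ) * I = -(π * I) by ring, exp_neg_pi_mul_I]; ring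
  have H := isFrobenius_whittaker k ζ L
  have H' := isFrobenius_whittaker (-k) (-ζ) (L + σ * π * I)
  obtain ⟨y, y₁, hy, hl, hW⟩ := exists_whittakerW k ζ L hL hlog hν₀
  obtain ⟨z, z₁, hz, hl', hW'⟩ := exists_whittakerW (-k) (-ζ) _ hL' hlog' hν₀
  have hk : ∀ ν x, frob (whitFactor (-k) (-ζ) (L + σ * π * I)) ν x
      = exp (σ * π * I * ((1 + ν) / 2)) * frob (whitFactor k ζ L) ν x := fun ν x => by
    rw [frob, frob, whitFactor_kummer]; ring
  have hk₁ : ∀ ν x, 0 < x → frob₁ (whitFactor (-k) (-ζ) (L + σ * π * I))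
      (whitFactor₁ (-k) (-ζ) (L + σ * π * I)) ν x
      = exp (σ * π * I * ((1 + ν) / 2)) * frob₁ (whitFactor k ζ L) (whitFactor₁ k ζ L) ν x :=
    fun ν x hx => (H'.isSol ν x hx).1.unique
      (((H.isSol ν x hx).1.const_mul _).congr_on isOpen_Ioi (fun u _ => hk ν u) hx)
  have hl'' : IsFrobLimit (whitFactor k ζ L) (whitFactor₁ k ζ L)
      (fun ν => exp (σ * π * I * ((1 + ν) / 2)) * whitα (-k) ν)
      (fun ν => exp (σ * π * I * ((1 + -ν) / 2)) * whitβ (-k) ν) ν₀ z z₁ := fun x hx =>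
    ⟨(hl' x hx).1.congr fun ν => by rw [hk, hk]; ring,
      (hl' x hx).2.congr fun ν => by rw [hk₁ _ _ hx, hk₁ _ _ hx]; ring⟩
  refine ⟨y₁, z₁, hy.congr isOpen_Ioi hW, (hz.congr isOpen_Ioi hW').congr_coeff fun x _ => ?_,
    fun x hx => ?_⟩
  · simp only [frobPot]; ring
  · beta_reduce
    rw [hW x hx, hW' x hx, H.wronskian_limits (whitFactor_zero k ζ L) hl hl'' (whit_det hσ) hx, hL]
    have hζ : ζ ≠ 0 := hL ▸ exp_ne_zero L
    have := exp_ne_zero (-(σ * π * I * k))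
    simp [Real.pi_ne_zero, hζ]

theorem log_mul_sq {ζ L : ℂ} (hL : log ζ = L) (hζ : ζ ≠ 0) {x : ℝ} (hx : 0 < x) :
    log (ζ * (x : ℂ) ^ 2) = L + 2 * Real.log x := by
  have := log_mul_ofReal (x ^ 2) (by positivity) ζ hζ
  rw [Real.log_pow] at this
  push_cast at this
  rw [this, hL]; ring

theorem expW_fundamental (hν₀ : sin (ν₀ * π) = 0 → ∃ n : ℕ, ν₀ = n) (κ : ℝ) :
    IsFund (frobPot (-κ) 1 ν₀) (Set.Ioi 0)
      (fun x => (x ^ (-1 / 2 : ℝ) : ℝ) * whittakerW (κ / 4) (ν₀ / 2) ((x : ℂ) ^ 2))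
      (fun x => (x ^ (-1 / 2 : ℝ) : ℝ) * whittakerW (-(κ / 4)) (ν₀ / 2) (-(x : ℂ) ^ 2)) := by
  refine (whittaker_fundamental (σ := 1) (ζ := 1) (L := 0) (Or.inl rfl) exp_zero
    (fun x hx => log_mul_sq log_one one_ne_zero hx) (fun x hx => log_mul_sq ?_ (by norm_num) hx)
    hν₀ (κ / 4)).congr isOpen_Ioi (fun x _ => ?_) (fun x _ => ?_) (fun x _ => ?_)
  · rw [log_neg_one]; ring
  · simp only [frobPot]; ring
  · rw [one_mul]
  · rw [neg_one_mul]

theorem whitLimit_neg (k ζ L ν : ℂ) (x : ℝ) :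
    (whitα k (-ν) * frob (whitFactor k ζ L) (-ν) x + whitβ k (-ν) * frob (whitFactor k ζ L) (- -ν) x)
      / sin (-ν * π) = (whitα k ν * frob (whitFactor k ζ L) ν x
        + whitβ k ν * frob (whitFactor k ζ L) (-ν) x) / sin (ν * π) := by
  rw [whitα_neg, whitβ_neg, neg_neg, neg_mul ν, sin_neg, div_neg, ← neg_div]; ring

theorem conj_whitFactor (k ζ L ν w : ℂ) : conj (whitFactor k ζ L ν w)
    = whitFactor (conj k) (conj ζ) (conj L) (conj ν) (conj w) := by
  simp [whitFactor, ← exp_conj, conj_hgM, map_ofNat]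

theorem conj_whitα (k ν : ℂ) : conj (whitα k ν) = whitα (conj k) (conj ν) := by
  simp [whitα, ← Gamma_conj, map_ofNat]

theorem conj_whitβ (k ν : ℂ) : conj (whitβ k ν) = whitβ (conj k) (conj ν) := by
  simp [whitβ, ← Gamma_conj, map_ofNat]

theorem conj_whittakerW (hν₀ : sin (ν₀ * π) = 0 → ∃ n : ℕ, ν₀ = n)
    (hc : conj ν₀ = ν₀ ∨ conj ν₀ = -ν₀ ∧ sin (ν₀ * π) ≠ 0) {k : ℂ} (hk : conj k = -k)
    {x : ℝ} (hx : 0 < x) :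
    conj ((x ^ (-1 / 2 : ℝ) : ℝ) * whittakerW k (ν₀ / 2) (I * (x : ℂ) ^ 2))
      = (x ^ (-1 / 2 : ℝ) : ℝ) * whittakerW (-k) (ν₀ / 2) (-I * (x : ℂ) ^ 2) := by
  have hnI : log (-I) = conj (π / 2 * I) := by rw [log_neg_I]; simp [map_ofNat]
  obtain ⟨y, y₁, -, hl, hW⟩ := exists_whittakerW k I (π / 2 * I) exp_pi_div_two_mul_I
    (fun x hx => log_mul_sq log_I I_ne_zero hx) hν₀
  obtain ⟨z, z₁, -, hl', hW'⟩ := exists_whittakerW (-k) (-I) (conj (π / 2 * I))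
    (by rw [← hnI, exp_log (neg_ne_zero.2 I_ne_zero)])
    (fun x hx => log_mul_sq hnI (neg_ne_zero.2 I_ne_zero) hx) hν₀
  rw [hW x hx, hW' x hx]
  have ht : Filter.Tendsto (fun ν => (whitα (-k) ν * frob (whitFactor (-k) (-I)
      (conj (π / 2 * I))) ν x + whitβ (-k) ν * frob (whitFactor (-k) (-I)
      (conj (π / 2 * I))) (-ν) x) / sin (ν * π)) (ordFilter (conj ν₀)) (𝓝 (z x)) := by
    rcases hc with hc | ⟨hc, hs⟩
    · rw [hc]; exact (hl' x hx).1
    · have h1 := (hl' x hx).1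
      rw [ordFilter_of_ne hs] at h1
      rw [hc, ordFilter_of_ne (by rw [neg_mul, sin_neg]; exact neg_ne_zero.2 hs),
        ← tendsto_nhds_unique (tendsto_pure_nhds _ ν₀) h1, ← whitLimit_neg]
      exact tendsto_pure_nhds _ (-ν₀)
  refine conj_limit (hl x hx).1 ht fun ν => ?_
  have hf : ∀ ν, conj (frob (whitFactor k I (π / 2 * I)) ν x)
      = frob (whitFactor (-k) (-I) (conj (π / 2 * I))) (conj ν) x := fun ν => by
    rw [frob, frob, map_mul, conj_pw, conj_whitFactor, hk, conj_I]
    simp [map_ofNat]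
  rw [map_div₀, map_add, map_mul, map_mul, conj_whitα, conj_whitβ, hf, hf, hk, conj_sin_mul_pi,
    map_neg]

theorem oscW_fundamental (hν₀ : sin (ν₀ * π) = 0 → ∃ n : ℕ, ν₀ = n)
    (hc : conj ν₀ = ν₀ ∨ conj ν₀ = -ν₀ ∧ sin (ν₀ * π) ≠ 0) (κ : ℝ) :
    IsFund (frobPot (-κ) (-1) ν₀) (Set.Ioi 0)
      (fun x => ((x ^ (-1 / 2 : ℝ) *
        (whittakerW (-(κ / 4) * I) (ν₀ / 2) (I * (x : ℂ) ^ 2)).re : ℝ) : ℂ))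
      (fun x => ((x ^ (-1 / 2 : ℝ) *
        (whittakerW (-(κ / 4) * I) (ν₀ / 2) (I * (x : ℂ) ^ 2)).im : ℝ) : ℂ)) := by
  have hk : conj (-((κ : ℂ) / 4) * I) = -(-(κ / 4) * I) := by simp [map_ofNat]
  have H := whittaker_fundamental (σ := -1) (ζ := I) (L := π / 2 * I) (Or.inr rfl)
    exp_pi_div_two_mul_I (fun x hx => log_mul_sq log_I I_ne_zero hx)
    (fun x hx => log_mul_sq (by rw [log_neg_I]; ring) (neg_ne_zero.2 I_ne_zero) hx) hν₀
    (-(κ / 4) * I)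
  have hcw : ∀ x : ℝ, 0 < x → ((x ^ (-1 / 2 : ℝ) : ℝ) : ℂ) *
      whittakerW (-(-(κ / 4) * I)) (ν₀ / 2) (-I * (x : ℂ) ^ 2) = (x ^ (-1 / 2 : ℝ) : ℝ) *
        conj (whittakerW (-(κ / 4) * I) (ν₀ / 2) (I * (x : ℂ) ^ 2)) := fun x hx => by
    rw [← conj_whittakerW hν₀ hc hk hx, map_mul, conj_ofReal]
  refine (H.comb (a := 1 / 2) (b := 1 / 2) (c := -I / 2) (d := I / 2) ?_).congr isOpen_Ioi
    (fun x _ => ?_) (fun x hx => ?_) (fun x hx => ?_)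
  · intro h0
    exact I_ne_zero (by linear_combination 2 * h0)
  · simp only [frobPot, I_sq]
    linear_combination (κ : ℂ) * I_sq
  · rw [hcw x hx, ofReal_mul, re_eq_add_conj]; ring
  · rw [hcw x hx, ofReal_mul, im_eq_sub_conj]; field_simp; rw [I_sq]; ring

end WhittakerPair

section Analytic

open Complex Metric

variable {Q : ℂ → ℂ} {c : ℂ} {r M : ℝ}

theorem exists_double_primitive (hr : 0 < r) {g : ℂ → ℂ} (hg : DifferentiableOn ℂ g (ball c r)) :
    ∃ G G₁ : ℂ → ℂ, (∀ z ∈ ball c r, HasDerivAt G (G₁ z) z ∧ HasDerivAt G₁ (g z) z) ∧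
      G c = 0 ∧ G₁ c = 0 ∧ ∀ K, (∀ z ∈ ball c r, ‖g z‖ ≤ K) →
        ∀ z ∈ ball c r, ‖G z‖ ≤ K * r * r ∧ ‖G₁ z‖ ≤ K * r := by
  have hc : c ∈ ball c r := mem_ball_self hr
  obtain ⟨G₁, hG₁c, hG₁⟩ := hg.isExactOn_ball.with_val_at c 0
  have hd : DifferentiableOn ℂ G₁ (ball c r) := fun z hz =>
    (hG₁ z hz).differentiableAt.differentiableWithinAt
  obtain ⟨G, hGc, hG⟩ := hd.isExactOn_ball.with_val_at c 0
  have bound : ∀ {P p : ℂ → ℂ} {K : ℝ}, (∀ z ∈ ball c r, HasDerivAt P (p z) z) → P c = 0 →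
      (∀ z ∈ ball c r, ‖p z‖ ≤ K) → ∀ z ∈ ball c r, ‖P z‖ ≤ K * r := by
    intro P p K hP hPc hK z hz
    have := (convex_ball c r).norm_image_sub_le_of_norm_hasDerivWithin_le
      (fun w hw => (hP w hw).hasDerivWithinAt) hK hc hz
    rw [hPc, sub_zero] at this
    refine this.trans (mul_le_mul_of_nonneg_left ?_ ((norm_nonneg _).trans (hK c hc)))
    rw [← dist_eq_norm]; exact (mem_ball.1 hz).le
  refine ⟨G, G₁, fun z hz => ⟨hG z hz, hG₁ z hz⟩, hGc, hG₁c, fun K hK z hz => ?_⟩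
  have b₁ := bound hG₁ hG₁c hK
  exact ⟨bound hG hGc b₁ z hz, b₁ z hz⟩

theorem exists_holomorphic_sol (hr : 0 < r) (hQ : DifferentiableOn ℂ Q (ball c r))
    (hM : ∀ z ∈ ball c r, ‖Q z‖ ≤ M) (hrM : M * r * r ≤ 1 / 2) (A B : ℂ) :
    ∃ Y Y₁ : ℂ → ℂ, (∀ z ∈ ball c r, HasDerivAt Y (Y₁ z) z ∧ HasDerivAt Y₁ (Q z * Y z) z) ∧
      Y c = A ∧ Y₁ c = B := by
  have hc : c ∈ ball c r := mem_ball_self hr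
  have hM0 : 0 ≤ M := (norm_nonneg _).trans (hM c hc)
  have := fun g => exists_double_primitive (c := c) (g := g) hr
  choose! G G₁ hG hGc hG₁c hb using this
  let y : ℕ → ℂ → ℂ := fun n => Nat.rec (fun z => A + B * (z - c)) (fun _ f => G (fun z => Q z * f z)) n
  have hy0 : ∀ z, HasDerivAt (y 0) B z := fun z => by
    exact ((((hasDerivAt_id z).sub_const c).const_mul B).const_add A).congr_deriv (mul_one B)
  have hys : ∀ n, y (n + 1) = G (fun z => Q z * y n z) := fun n => rfl
  set K := ‖A‖ + ‖B‖ * r with hK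
  have hK0 : 0 ≤ K := by positivity
  have main : ∀ n, DifferentiableOn ℂ (y n) (ball c r) ∧ ∀ z ∈ ball c r, ‖y n z‖ ≤ K * (1 / 2) ^ n := by
    intro n
    induction n with
    | zero =>
      refine ⟨fun z _ => (hy0 z).differentiableAt.differentiableWithinAt, fun z hz => ?_⟩
      rw [pow_zero, mul_one]
      refine (norm_add_le _ _).trans (add_le_add_right ?_ _)
      rw [norm_mul]
      refine mul_le_mul_of_nonneg_left ?_ (norm_nonneg _)
      rw [← dist_eq_norm]; exact (mem_ball.1 hz).le
    | succ n ih =>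
      have hd := hQ.fun_mul ih.1
      refine ⟨fun z hz => ((hG _ hd z hz).1).differentiableAt.differentiableWithinAt,
        fun z hz => ?_⟩
      refine ((hb _ hd (M * (K * (1 / 2) ^ n)) (fun w hw => ?_) z hz).1).trans ?_
      · rw [norm_mul]
        exact mul_le_mul (hM w hw) (ih.2 w hw) (norm_nonneg _) hM0
      · have : 0 ≤ K * (1 / 2) ^ n := by positivity
        calc M * (K * (1 / 2) ^ n) * r * r = (M * r * r) * (K * (1 / 2) ^ n) := by ring
          _ ≤ 1 / 2 * (K * (1 / 2) ^ n) := mul_le_mul_of_nonneg_right hrM this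
          _ = K * (1 / 2) ^ (n + 1) := by ring
  have hprod : ∀ n, DifferentiableOn ℂ (fun z => Q z * y n z) (ball c r) := fun n =>
    hQ.fun_mul (main n).1
  have hd1 : ∀ n, ∀ z ∈ ball c r, deriv (y (n + 1)) z = G₁ (fun z => Q z * y n z) z := fun n z hz =>
    (hG _ (hprod n) z hz).1.deriv
  have hd2 : ∀ n, ∀ z ∈ ball c r, deriv (deriv (y (n + 1))) z = Q z * y n z := fun n z hz =>
    (((hG _ (hprod n) z hz).2).congr_of_eventuallyEq
      (Filter.eventuallyEq_of_mem (isOpen_ball.mem_nhds hz) (hd1 n))).deriv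
  have hsum : Summable fun n : ℕ => K * (1 / 2 : ℝ) ^ n :=
    (summable_geometric_of_lt_one (by norm_num) (by norm_num)).mul_left K
  have hbd : ∀ n, ∀ z ∈ ball c r, ‖y n z‖ ≤ K * (1 / 2) ^ n := fun n => (main n).2
  have hdiff : ∀ n, DifferentiableOn ℂ (y n) (ball c r) := fun n => (main n).1
  have hY := differentiableOn_tsum_of_summable_norm hsum hdiff isOpen_ball hbd
  have hYd := fun z hz => hasSum_deriv_of_summable_norm hsum hdiff isOpen_ball hbd (z := z) hz
  let u : ℕ → ℝ := fun n => ‖B‖ * (1 / 2) ^ n + M * K * r * 2 * (1 / 2) ^ n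
  have husum : Summable u :=
    ((summable_geometric_of_lt_one (by norm_num) (by norm_num)).mul_left _).add
      ((summable_geometric_of_lt_one (by norm_num) (by norm_num)).mul_left _)
  have hbd₁ : ∀ n, ∀ z ∈ ball c r, ‖deriv (y n) z‖ ≤ u n := by
    intro n z hz
    rcases n with _ | n
    · have h0 : 0 ≤ M * K * r * 2 := by positivity
      rw [(hy0 z).deriv]
      simpa [u] using h0
    · rw [hd1 n z hz]
      refine ((hb _ (hprod n) (M * (K * (1 / 2) ^ n)) (fun w hw => ?_) z hz).2).trans ?_
      · rw [norm_mul]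
        exact mul_le_mul (hM w hw) (hbd n w hw) (norm_nonneg _) hM0
      · have h0 : 0 ≤ ‖B‖ * (1 / 2) ^ (n + 1) := by positivity
        calc M * (K * (1 / 2) ^ n) * r = M * K * r * 2 * (1 / 2) ^ (n + 1) := by ring
          _ ≤ u (n + 1) := le_add_of_nonneg_left h0
  have hYd2 := fun z hz => hasSum_deriv_of_summable_norm husum
    (fun n => (hdiff n).deriv isOpen_ball) isOpen_ball hbd₁ (z := z) hz
  have hv : ∀ n, y (n + 1) c = 0 := fun n => hGc _ (hprod n)
  refine ⟨fun z => ∑' n, y n z, deriv fun z => ∑' n, y n z, fun z hz =>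
    ⟨(hY.differentiableAt (isOpen_ball.mem_nhds hz)).hasDerivAt, ?_⟩, ?_, ?_⟩
  · have h1 := ((hY.deriv isOpen_ball).differentiableAt (isOpen_ball.mem_nhds hz)).hasDerivAt
    refine h1.congr_deriv ?_
    have e : (fun w => ∑' n, deriv (y n) w) =ᶠ[𝓝 z] deriv fun z => ∑' n, y n z :=
      Filter.eventuallyEq_of_mem (isOpen_ball.mem_nhds hz) fun w hw => (hYd w hw).tsum_eq
    have h2 := hYd2 z hz
    rw [e.deriv_eq] at h2
    rw [← h2.tsum_eq, h2.summable.tsum_eq_zero_add, ← tsum_mul_left]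
    have h00 : deriv (deriv (y 0)) z = 0 := by
      rw [show deriv (y 0) = fun _ => B from funext fun w => (hy0 w).deriv, deriv_const]
    rw [h00, zero_add]
    exact tsum_congr fun n => hd2 n z hz
  · beta_reduce
    rw [tsum_eq_single 0 fun n hn => by
      obtain ⟨m, rfl⟩ := Nat.exists_eq_succ_of_ne_zero hn
      exact hv m]
    simp [y]
  · rw [← (hYd c hc).tsum_eq, tsum_eq_single 0 fun n hn => by
      obtain ⟨m, rfl⟩ := Nat.exists_eq_succ_of_ne_zero hn
      rw [hd1 m c hc]
      exact hG₁c _ (hprod m)]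
    exact (hy0 c).deriv

theorem IsSol.analyticAt {q : ℝ → ℂ} {I : Set ℝ} (hI : IsOpen I) {x₀ : ℝ} (hx₀ : x₀ ∈ I)
    (hQ : ∀ᶠ z in 𝓝 (x₀ : ℂ), DifferentiableAt ℂ Q z) (hq : ∀ x ∈ I, q x = Q x) {y y₁ : ℝ → ℂ}
    (hy : IsSol q I y y₁) : AnalyticAt ℝ y x₀ := by
  set M := ‖Q x₀‖ + 1 with hMdef
  have hM0 : 0 < M := by positivity
  have hcont : ∀ᶠ z in 𝓝 (x₀ : ℂ), ‖Q z‖ ≤ M := by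
    have := hQ.self_of_nhds.continuousAt.norm
    exact (Filter.Tendsto.eventually_lt_const (lt_add_one _) this).mono fun z hz => le_of_lt hz
  obtain ⟨r₁, hr₁, h₁⟩ := Metric.eventually_nhds_iff_ball.1 (hQ.and hcont)
  obtain ⟨r₂, hr₂, h₂⟩ := Metric.isOpen_iff.1 hI x₀ hx₀
  obtain ⟨r, hr, hrr₁, hrr₂, hr1, hrM⟩ : ∃ r : ℝ, 0 < r ∧ r ≤ r₁ ∧ r ≤ r₂ ∧ r ≤ 1 ∧ M * r ≤ 1 / 2 := by
    refine ⟨min (min r₁ r₂) (min 1 (1 / (2 * M))), by positivity,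
      (min_le_left _ _).trans (min_le_left _ _), (min_le_left _ _).trans (min_le_right _ _),
      (min_le_right _ _).trans (min_le_left _ _), ?_⟩
    calc M * min (min r₁ r₂) (min 1 (1 / (2 * M))) ≤ M * (1 / (2 * M)) :=
          mul_le_mul_of_nonneg_left ((min_le_right _ _).trans (min_le_right _ _)) hM0.le
      _ = 1 / 2 := by field_simp
  have hsub : ball (x₀ : ℂ) r ⊆ ball (x₀ : ℂ) r₁ := ball_subset_ball hrr₁
  have hd : DifferentiableOn ℂ Q (ball (x₀ : ℂ) r) := fun z hz =>
    (h₁ z (hsub hz)).1.differentiableWithinAt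
  have hb : ∀ z ∈ ball (x₀ : ℂ) r, ‖Q z‖ ≤ M := fun z hz => (h₁ z (hsub hz)).2
  have hrr : M * r * r ≤ 1 / 2 := by nlinarith
  obtain ⟨F, F₁, hF, hF0, hF₁0⟩ := exists_holomorphic_sol hr hd hb hrr 1 0
  obtain ⟨G, G₁, hG, hG0, hG₁0⟩ := exists_holomorphic_sol hr hd hb hrr 0 1
  have hmem : ∀ x ∈ ball x₀ r, (x : ℂ) ∈ ball (x₀ : ℂ) r := fun x hx => by
    rw [mem_ball, dist_eq_norm] at *
    rwa [← ofReal_sub, norm_real]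
  have hqr : ∀ x ∈ ball x₀ r, q x = Q x := fun x hx => hq x (h₂ (ball_subset_ball hrr₂ hx))
  have hJ : IsOpenInterval (ball x₀ r) :=
    ⟨isOpen_ball, (convex_ball x₀ r).ordConnected, ⟨x₀, mem_ball_self hr⟩⟩
  have sol : ∀ {Y Y₁ : ℂ → ℂ}, (∀ z ∈ ball (x₀ : ℂ) r, HasDerivAt Y (Y₁ z) z ∧
      HasDerivAt Y₁ (Q z * Y z) z) → IsSol q (ball x₀ r) (fun x => Y x) (fun x => Y₁ x) :=
    fun h x hx => ⟨(h x (hmem x hx)).1.comp_ofReal, by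
      rw [hqr x hx]; exact (h x (hmem x hx)).2.comp_ofReal⟩
  obtain ⟨A, B, hAB⟩ := (sol hF).exists_comb hJ (sol hG)
    (hy.mono fun x hx => h₂ (ball_subset_ball hrr₂ hx)) (mem_ball_self hr)
    (by simp [hF0, hF₁0, hG0, hG₁0])
  have an : ∀ {Y Y₁ : ℂ → ℂ}, (∀ z ∈ ball (x₀ : ℂ) r, HasDerivAt Y (Y₁ z) z ∧
      HasDerivAt Y₁ (Q z * Y z) z) → AnalyticAt ℝ (fun x : ℝ => Y x) x₀ := by
    intro Y Y₁ h
    have h1 : AnalyticAt ℂ Y x₀ := DifferentiableOn.analyticAt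
      (fun z hz => (h z hz).1.differentiableAt.differentiableWithinAt) (ball_mem_nhds _ hr)
    exact h1.restrictScalars (𝕜 := ℝ) |>.comp (ofRealCLM.analyticAt x₀)
  refine ((analyticAt_const.mul (an hF)).add (analyticAt_const.mul (an hG))).congr
    (f := fun x : ℝ => A * F x + B * G x) ?_
  filter_upwards [isOpen_ball.mem_nhds (mem_ball_self hr)] with x hx
  exact (hAB x hx).1.symm

end Analytic

section Elementary

open Complex ComplexConjugate

theorem airy_fundamental : IsFund (fun x => (x : ℂ)) Set.univ airyAi airyBi ∧
    ∀ x, conj (airyAi x) = airyAi x ∧ conj (airyBi x) = airyBi x := by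
  have hd : ∀ (b b' : ℂ) (x : ℝ), b' = b + 1 → HasDerivAt (fun x : ℝ => hgE b ((x : ℂ) ^ 3 / 9))
      ((x : ℂ) ^ 2 / 3 * hgE b' ((x : ℂ) ^ 3 / 9)) x := by
    rintro b _ x rfl
    have h1 : HasDerivAt (fun z : ℂ => z ^ 3 / 9) ((x : ℂ) ^ 2 / 3) (x : ℂ) := by
      refine ((hasDerivAt_pow 3 (x : ℂ)).div_const 9).congr_deriv ?_
      push_cast; ring
    have h2 := HasDerivAt.comp (h₂ := hgE b) (h := fun z : ℂ => z ^ 3 / 9) (x : ℂ)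
      (hasDerivAt_hgE b ((x : ℂ) ^ 3 / 9)) h1
    exact h2.comp_ofReal.congr_deriv (by ring)
  have hx : ∀ x : ℝ, HasDerivAt (fun x : ℝ => (x : ℂ)) 1 x := fun x => ofRealCLM.hasDerivAt
  have hx2 : ∀ x : ℝ, HasDerivAt (fun x : ℝ => (x : ℂ) ^ 2) (2 * x) x := fun x => by
    simpa using (hx x).fun_pow 2
  have hf : IsSol (fun x => (x : ℂ)) Set.univ (fun x : ℝ => hgE (2 / 3) ((x : ℂ) ^ 3 / 9))
      (fun x : ℝ => (x : ℂ) ^ 2 / 3 * hgE (5 / 3) ((x : ℂ) ^ 3 / 9)) := fun x _ => by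
    refine ⟨hd _ _ x (by norm_num), ((((hx2 x).div_const 3).fun_mul
      (hd (5 / 3) (8 / 3) x (by norm_num)))).congr_deriv ?_⟩
    have e := hgE_ode (2 / 3) ((x : ℂ) ^ 3 / 9)
    rw [show (2 / 3 : ℂ) + 2 = 8 / 3 by norm_num, show (2 / 3 : ℂ) + 1 = 5 / 3 by norm_num] at e
    linear_combination (x : ℂ) * e
  have hg : IsSol (fun x => (x : ℂ)) Set.univ (fun x : ℝ => (x : ℂ) * hgE (4 / 3) ((x : ℂ) ^ 3 / 9))
      (fun x : ℝ => 1 * hgE (4 / 3) ((x : ℂ) ^ 3 / 9)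
        + x * ((x : ℂ) ^ 2 / 3 * hgE (7 / 3) ((x : ℂ) ^ 3 / 9))) := fun x _ => by
    refine ⟨(hx x).fun_mul (hd _ _ x (by norm_num)),
      (((hd (4 / 3) (7 / 3) x (by norm_num)).const_mul 1).fun_add ((hx x).fun_mul
        (((hx2 x).div_const 3).fun_mul (hd (7 / 3) (10 / 3) x (by norm_num))))).congr_deriv ?_⟩
    have e := hgE_ode (4 / 3) ((x : ℂ) ^ 3 / 9)
    rw [show (4 / 3 : ℂ) + 2 = 10 / 3 by norm_num, show (4 / 3 : ℂ) + 1 = 7 / 3 by norm_num] at e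
    linear_combination (x : ℂ) ^ 2 * e
  have H : IsFund (fun x => (x : ℂ)) Set.univ (fun x : ℝ => hgE (2 / 3) ((x : ℂ) ^ 3 / 9))
      (fun x : ℝ => (x : ℂ) * hgE (4 / 3) ((x : ℂ) ^ 3 / 9)) := by
    refine ⟨_, _, hf, hg, fun x _ => ?_⟩
    rw [hf.wronskian_const isOpenInterval_univ hg (Set.mem_univ x) (Set.mem_univ 0)]
    have g : ∀ s : ℂ, 0 < s.re → (Gamma s)⁻¹ ≠ 0 := fun s hs =>
      inv_ne_zero (Gamma_ne_zero_of_re_pos hs)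
    simpa [hgE_zero] using mul_ne_zero (g (2 / 3) (by norm_num)) (g (4 / 3) (by norm_num))
  refine ⟨(H.comb (a := ((3 : ℝ) ^ (-2 / 3 : ℝ) : ℝ)) (b := -((3 : ℝ) ^ (-4 / 3 : ℝ) : ℝ))
    (c := ((3 : ℝ) ^ (-1 / 6 : ℝ) : ℝ)) (d := ((3 : ℝ) ^ (-5 / 6 : ℝ) : ℝ)) ?_).congr isOpen_univ
    (fun _ _ => rfl) (fun x _ => ?_) (fun x _ => ?_), fun x => ?_⟩
  · rw [neg_mul, sub_neg_eq_add]
    have : (0 : ℝ) < (3 : ℝ) ^ (-2 / 3 : ℝ) * (3 : ℝ) ^ (-5 / 6 : ℝ)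
      + (3 : ℝ) ^ (-4 / 3 : ℝ) * (3 : ℝ) ^ (-1 / 6 : ℝ) := by positivity
    exact_mod_cast this.ne'
  · rw [airyAi, hgE, hgE]; ring
  · rw [airyBi, hgE, hgE]; ring
  · have hc : ∀ b : ℂ, conj b = b → conj (hgE b ((x : ℂ) ^ 3 / 9)) = hgE b ((x : ℂ) ^ 3 / 9) :=
      fun b hb => by rw [conj_hgE, hb]; simp [map_ofNat]
    have h1 := hc (2 / 3) (by simp [map_ofNat])
    have h2 := hc (4 / 3) (by simp [map_ofNat])
    simp only [hgE] at h1 h2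
    simp only [airyAi, airyBi, map_sub, map_add, map_mul, conj_ofReal, h1, h2, and_self]

variable {l : ℝ} {φ ψ φ₁ ψ₁ : ℝ → ℝ}

/-- A fundamental system of real functions, as complex-valued functions. -/
theorem isFund_ofReal {q : ℝ → ℝ} {I : Set ℝ} (hφ : IsSol q I φ φ₁) (hψ : IsSol q I ψ ψ₁)
    (hw : ∀ x ∈ I, φ x * ψ₁ x - φ₁ x * ψ x ≠ 0) :
    IsFund (fun x => (q x : ℂ)) I (fun x => (φ x : ℂ)) (fun x => (ψ x : ℂ)) :=
  ⟨fun x => φ₁ x, fun x => ψ₁ x,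
    fun x hx => ⟨(hφ x hx).1.ofReal_comp, by
      simpa using (hφ x hx).2.ofReal_comp⟩,
    fun x hx => ⟨(hψ x hx).1.ofReal_comp, by
      simpa using (hψ x hx).2.ofReal_comp⟩,
    fun x hx => by beta_reduce; exact_mod_cast hw x hx⟩

/-- If `φ'' = l φ`, then `√x φ(log x)` solves `f'' = (l - 1/4) / x² f`. -/
theorem isSol_sqrt_log (hφ : IsSol (fun _ => l) Set.univ φ φ₁) :
    IsSol (fun x => (l - 1 / 4) / x ^ 2) (Set.Ioi 0) (fun x => √x * φ (Real.log x))
      (fun x => 1 / √x * (φ (Real.log x) / 2 + φ₁ (Real.log x))) := by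
  intro x hx
  have hx0 : (0 : ℝ) < x := hx
  have hs := Real.hasDerivAt_sqrt hx0.ne'
  have hss := Real.mul_self_sqrt hx0.le
  have hsp := Real.sqrt_pos.2 hx0
  have d0 := (hφ (Real.log x) trivial).1.comp x (Real.hasDerivAt_log hx0.ne')
  have d1 := (hφ (Real.log x) trivial).2.comp x (Real.hasDerivAt_log hx0.ne')
  constructor
  · refine (hs.fun_mul d0).congr_deriv ?_
    simp only [Function.comp_apply]
    field_simp
    rw [pow_two, hss]; ring
  · refine (((hasDerivAt_const x (1 : ℝ)).fun_div hs hsp.ne').fun_mul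
      ((d0.div_const 2).fun_add d1)).congr_deriv ?_
    simp only [Function.comp_apply]
    have h2 : √x ^ 2 = x := by rw [pow_two, hss]
    have h4 : √x ^ 4 = x ^ 2 := by rw [show 4 = 2 * 2 from rfl, pow_mul, h2]
    field_simp
    simp only [h2, h4]
    ring

theorem isFund_sqrt_log (hφ : IsSol (fun _ => l) Set.univ φ φ₁)
    (hψ : IsSol (fun _ => l) Set.univ ψ ψ₁) (hw : ∀ x, φ x * ψ₁ x - φ₁ x * ψ x ≠ 0) :
    IsFund (fun x : ℝ => ((l - 1 / 4) / x ^ 2 : ℝ)) {0}ᶜ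
      (fun x => (√|x| * φ (Real.log |x|) : ℝ)) (fun x => (√|x| * ψ (Real.log |x|) : ℝ)) := by
  refine IsFund.abs (f := fun x => ((√x * φ (Real.log x) : ℝ) : ℂ))
    (g := fun x => ((√x * ψ (Real.log x) : ℝ) : ℂ))
    (isFund_ofReal (isSol_sqrt_log hφ) (isSol_sqrt_log hψ) fun x hx => ?_) fun x => by rw [neg_sq]
  have hsp := Real.sqrt_pos.2 (Set.mem_Ioi.1 hx)
  rw [show √x * φ (Real.log x) * (1 / √x * (ψ (Real.log x) / 2 + ψ₁ (Real.log x)))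
    - 1 / √x * (φ (Real.log x) / 2 + φ₁ (Real.log x)) * (√x * ψ (Real.log x))
    = φ (Real.log x) * ψ₁ (Real.log x) - φ₁ (Real.log x) * ψ (Real.log x) by field_simp; ring]
  exact hw _

theorem isSol_one : IsSol (fun _ => (0 : ℝ)) Set.univ (fun _ => 1) (fun _ => 0) := fun x _ =>
  ⟨hasDerivAt_const x 1, by simpa using hasDerivAt_const x (0 : ℝ)⟩

theorem isSol_ident : IsSol (fun _ => (0 : ℝ)) Set.univ (fun x => x) (fun _ => 1) := fun x _ =>
  ⟨hasDerivAt_id x, by simpa using hasDerivAt_const x (1 : ℝ)⟩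

theorem isSol_cos (a : ℝ) : IsSol (fun _ => -a ^ 2) Set.univ (fun x => Real.cos (a * x))
    (fun x => -a * Real.sin (a * x)) := fun x _ => by
  have h : HasDerivAt (fun x : ℝ => a * x) a x := by simpa using (hasDerivAt_id x).const_mul a
  exact ⟨h.cos.congr_deriv (by ring), (h.sin.const_mul (-a)).congr_deriv (by ring)⟩

theorem isSol_sin (a : ℝ) : IsSol (fun _ => -a ^ 2) Set.univ (fun x => Real.sin (a * x))
    (fun x => a * Real.cos (a * x)) := fun x _ => by
  have h : HasDerivAt (fun x : ℝ => a * x) a x := by simpa using (hasDerivAt_id x).const_mul a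
  exact ⟨h.sin.congr_deriv (by ring), (h.cos.const_mul a).congr_deriv (by ring)⟩

theorem isSol_exp (a : ℝ) : IsSol (fun _ => a ^ 2) Set.univ (fun x => Real.exp (a * x))
    (fun x => a * Real.exp (a * x)) := fun x _ => by
  have h : HasDerivAt (fun x : ℝ => a * x) a x := by simpa using (hasDerivAt_id x).const_mul a
  exact ⟨h.exp.congr_deriv (by ring), (h.exp.const_mul a).congr_deriv (by ring)⟩

end Elementary

section Table

open Complex ComplexConjugate

namespace TableCase

/-- The coefficients of the potential `c₀ + c₁ x + c₂ x² + μ / x²` of a case. -/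
def c₀ : TableCase → ℝ
  | bessel _ _ _ | besselImag _ _ _ | cosine => -1
  | modBessel _ _ _ | modBesselImag _ _ _ | expo | hypCos | hypSin => 1
  | whittakerOsc κ _ _ _ | whittakerExp κ _ _ _ | quarterOsc κ _ _ | quarterExp κ _ _ => -κ
  | _ => 0

def c₁ : TableCase → ℝ
  | airy _ _ => 1
  | _ => 0

def c₂ : TableCase → ℝ
  | whittakerOsc _ _ _ _ | quarterOsc _ _ _ => -1
  | whittakerExp _ _ _ _ | quarterExp _ _ _ => 1
  | _ => 0

def μ : TableCase → ℝ
  | cosLog α => -α ^ 2 - 1 / 4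
  | sqrtAbs | sqrtLog => -1 / 4
  | power α _ _ => α ^ 2 - 1 / 4
  | bessel β _ _ | modBessel β _ _ => β ^ 2 - 1 / 4
  | besselImag γ _ _ | modBesselImag γ _ _ => -γ ^ 2 - 1 / 4
  | whittakerOsc _ ν _ _ | whittakerExp _ ν _ _ => (ν ^ 2).re - 1 / 4
  | _ => 0

def pot (p : TableCase) (x : ℝ) : ℝ := p.c₀ + p.c₁ * x + p.c₂ * x ^ 2 + p.μ / x ^ 2

/-- A fundamental system of the equation `y'' = pot y`. -/
def fund : TableCase → (ℝ → ℂ) × (ℝ → ℂ)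
  | cosLog α => (fun x => (√|x| * Real.cos (α * Real.log |x|) : ℝ),
      fun x => (√|x| * Real.sin (α * Real.log |x|) : ℝ))
  | sqrtAbs | sqrtLog => (fun x => (√|x| * 1 : ℝ), fun x => (√|x| * Real.log |x| : ℝ))
  | power α _ _ => (fun x => (√|x| * Real.exp (α * Real.log |x|) : ℝ),
      fun x => (√|x| * Real.exp (-α * Real.log |x|) : ℝ))
  | bessel β _ _ => (fun x => (√|x| : ℝ) * besselJ β |x|, fun x => (√|x| : ℝ) * besselY β |x|)
  | besselImag γ _ _ => (fun x => (√|x| : ℝ) * hankelMod₁ γ |x|,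
      fun x => (√|x| : ℝ) * hankelMod₂ γ |x|)
  | modBessel β _ _ => (fun x => (√|x| : ℝ) * besselI β |x|, fun x => (√|x| : ℝ) * besselK β |x|)
  | modBesselImag γ _ _ => (fun x => (√|x| : ℝ) * besselIMod γ |x|,
      fun x => (√|x| : ℝ) * besselK (I * γ) |x|)
  | whittakerOsc κ ν _ _ => (fun x => oscW κ ν 1 0 x, fun x => oscW κ ν 0 1 x)
  | whittakerExp κ ν _ _ => (expW κ ν 1 0, expW κ ν 0 1)
  | one | ident => (fun _ => (1 : ℝ), fun x => x)
  | cosine => (fun x => Real.cos (1 * x), fun x => Real.sin (1 * x))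
  | expo | hypCos | hypSin => (fun x => Real.exp (1 * x), fun x => Real.exp (-1 * x))
  | quarterOsc κ _ _ => (fun x => oscW κ (1 / 2) 1 0 x, fun x => oscW κ (1 / 2) 0 1 x)
  | quarterExp κ _ _ => (expW κ (1 / 2) 1 0, expW κ (1 / 2) 0 1)
  | airy _ _ => (airyAi, airyBi)

def coef : TableCase → ℂ × ℂ
  | power _ a b | bessel _ a b | besselImag _ a b | modBessel _ a b | modBesselImag _ a b
  | whittakerOsc _ _ a b | quarterOsc _ a b | airy a b => (a, b)
  | whittakerExp _ _ a b | quarterExp _ a b => (a, b)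
  | sqrtLog | ident => (0, 1)
  | hypCos => (1 / 2, 1 / 2)
  | hypSin => (1 / 2, -1 / 2)
  | _ => (1, 0)

/-- Where the formulas for `W` apply. -/
def dom (p : TableCase) : Set ℝ := {x | p.IsSingular ∨ p.IsQuarter → x ≠ 0}

theorem mem_dom_of_ne (p : TableCase) {x : ℝ} (hx : x ≠ 0) : x ∈ p.dom := fun _ => hx

theorem dom_of_singular {p : TableCase} (h : p.IsSingular ∨ p.IsQuarter) : p.dom = {0}ᶜ := by
  ext x; simp [dom, h]

theorem W_eq (p : TableCase) {x : ℝ} (hx : x ∈ p.dom) :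
    p.W x = p.coef.1 * p.fund.1 x + p.coef.2 * p.fund.2 x := by
  cases p with
  | power α a b =>
    have : x ≠ 0 := hx (Or.inl trivial)
    have hpos : 0 < |x| := abs_pos.2 this
    simp only [W, coef, fund, Real.rpow_def_of_pos hpos]
    push_cast
    ring_nf
  | whittakerOsc κ ν a b => simp [W, coef, fund, oscW]; ring
  | quarterOsc κ a b => simp [W, coef, fund, oscW]; ring
  | whittakerExp κ ν a b => simp [W, coef, fund, expW]; ring
  | quarterExp κ a b => simp [W, coef, fund, expW]; ring
  | hypCos => simp [W, coef, fund, Complex.cosh]; ring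
  | hypSin => simp [W, coef, fund, Complex.sinh]; ring
  | _ => simp [W, coef, fund] <;> ring

end TableCase

/-- `ν ≥ 0` or `ν ∈ i ℝ_{>0}`. -/
def IsOrder (ν : ℂ) : Prop := (∃ r : ℝ, 0 ≤ r ∧ ν = r) ∨ ∃ r : ℝ, 0 < r ∧ ν = I * r

variable {ν : ℂ}

theorem IsOrder.sq (h : IsOrder ν) : ν ^ 2 = ((ν ^ 2).re : ℂ) := by
  rcases h with ⟨r, -, rfl⟩ | ⟨r, -, rfl⟩
  · rw [← ofReal_pow, ofReal_re]
  · rw [mul_pow, I_sq, ← ofReal_pow, neg_one_mul, ← ofReal_neg, ofReal_re]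

theorem exists_nat_of_sin {r : ℝ} (h0 : 0 ≤ r) (h : sin ((r : ℂ) * Real.pi) = 0) :
    ∃ n : ℕ, (r : ℂ) = n := by
  obtain ⟨k, hk⟩ := sin_mul_pi_eq_zero_iff.1 h
  have hk' : r = k := by exact_mod_cast hk
  have : (0 : ℤ) ≤ k := by rw [hk'] at h0; exact_mod_cast h0
  obtain ⟨n, rfl⟩ := Int.eq_ofNat_of_zero_le this
  exact ⟨n, by rw [hk]; simp⟩

theorem IsOrder.nat_of_sin (h : IsOrder ν) (hs : sin (ν * Real.pi) = 0) : ∃ n : ℕ, ν = n := by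
  rcases h with ⟨r, h0, rfl⟩ | ⟨r, h0, rfl⟩
  · exact exists_nat_of_sin h0 hs
  · exact absurd hs (sin_I_mul_pi_ne_zero h0)

theorem IsOrder.conj (h : IsOrder ν) :
    conj ν = ν ∨ conj ν = -ν ∧ sin (ν * Real.pi) ≠ 0 := by
  rcases h with ⟨r, -, rfl⟩ | ⟨r, h0, rfl⟩
  · exact Or.inl (conj_ofReal r)
  · exact Or.inr ⟨conj_I_mul r, sin_I_mul_pi_ne_zero h0⟩

theorem isOrder_half : IsOrder (1 / 2) := Or.inl ⟨1 / 2, by norm_num, by push_cast; rfl⟩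

theorem frobPot_neg (p r ν : ℂ) (x : ℝ) : frobPot p r ν (-x) = frobPot p r ν x := by
  simp [frobPot]

theorem oscW_fund (h : IsOrder ν) (κ : ℝ) :
    IsFund (fun x : ℝ => ((-κ + 0 * x + (-1) * x ^ 2 + ((ν ^ 2).re - 1 / 4) / x ^ 2 : ℝ) : ℂ)) {0}ᶜ
      (fun x => oscW κ ν 1 0 x) (fun x => oscW κ ν 0 1 x) := by
  refine ((oscW_fundamental h.nat_of_sin h.conj κ).abs (frobPot_neg _ _ _)).congr
    isOpen_compl_singleton (fun x _ => ?_) (fun x _ => ?_) (fun x _ => ?_)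
  · have e := h.sq
    generalize (ν ^ 2).re = s at e ⊢
    rw [frobPot, e]; push_cast; ring
  all_goals simp [oscW]; norm_cast; rw [sq_abs]; exact Or.inl rfl

theorem expW_fund (h : IsOrder ν) (κ : ℝ) :
    IsFund (fun x : ℝ => ((-κ + 0 * x + 1 * x ^ 2 + ((ν ^ 2).re - 1 / 4) / x ^ 2 : ℝ) : ℂ)) {0}ᶜ
      (expW κ ν 1 0) (expW κ ν 0 1) := by
  refine ((expW_fundamental h.nat_of_sin κ).abs (frobPot_neg _ _ _)).congr
    isOpen_compl_singleton (fun x _ => ?_) (fun x _ => ?_) (fun x _ => ?_)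
  · have e := h.sq
    generalize (ν ^ 2).re = s at e ⊢
    rw [frobPot, e]; push_cast; ring
  all_goals simp [expW]; norm_cast; rw [sq_abs]; exact Or.inl rfl

theorem isFund_of_frobPot {p r ν : ℂ} {f g : ℝ → ℂ} (h : IsFund (frobPot p r ν) (Set.Ioi 0) f g)
    {q : ℝ → ℝ} (hq : ∀ x, frobPot p r ν x = q x) :
    IsFund (fun x => (q x : ℂ)) {0}ᶜ (fun x => f |x|) (fun x => g |x|) :=
  (h.abs (frobPot_neg p r ν)).congr isOpen_compl_singleton (fun x _ => hq x) (fun _ _ => rfl)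
    fun _ _ => rfl

theorem TableCase.isFund {p : TableCase} (hp : p.Admissible) :
    IsFund (fun x => (p.pot x : ℂ)) p.dom p.fund.1 p.fund.2 := by
  have hsing : p.IsSingular ∨ p.IsQuarter → p.dom = {0}ᶜ := dom_of_singular
  have huniv : ¬ (p.IsSingular ∨ p.IsQuarter) → p.dom = Set.univ := fun h => by
    ext x; simp [dom, h]
  cases p with
  | cosLog α =>
    have h0 : α ≠ 0 := ne_of_gt hp
    rw [hsing (Or.inl trivial)]
    refine (isFund_sqrt_log (isSol_cos α) (isSol_sin α) fun x => ?_).congr isOpen_compl_singleton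
      (fun x _ => ?_) (fun _ _ => rfl) fun _ _ => rfl
    · have := Real.sin_sq_add_cos_sq (α * x)
      rw [show Real.cos (α * x) * (α * Real.cos (α * x)) - -α * Real.sin (α * x) * Real.sin (α * x)
        = α by linear_combination α * this]
      exact h0
    · simp [pot, c₀, c₁, c₂, μ]
  | sqrtAbs | sqrtLog =>
    rw [hsing (Or.inl trivial)]
    refine (isFund_sqrt_log isSol_one isSol_ident fun x => by simp).congr isOpen_compl_singleton
      (fun x _ => ?_) (fun _ _ => rfl) fun _ _ => rfl
    simp [pot, c₀, c₁, c₂, μ]; norm_num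
  | power α a b =>
    have h0 : α ≠ 0 := ne_of_gt hp.1
    rw [hsing (Or.inl trivial)]
    have h2 := isSol_exp (-α)
    rw [neg_sq] at h2
    refine (isFund_sqrt_log (isSol_exp α) h2 fun x => ?_).congr isOpen_compl_singleton
      (fun x _ => ?_) (fun _ _ => rfl) fun _ _ => rfl
    · have e : Real.exp (α * x) * Real.exp (-α * x) = 1 := by rw [← Real.exp_add]; simp
      rw [show Real.exp (α * x) * (-α * Real.exp (-α * x)) - α * Real.exp (α * x) *
        Real.exp (-α * x) = -2 * α by linear_combination -2 * α * e]
      simpa using h0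
    · simp [pot, c₀, c₁, c₂, μ]
  | bessel β a b =>
    rw [hsing (Or.inl trivial)]
    exact isFund_of_frobPot (bessel_fundamental (exists_nat_of_sin hp.1)).1 fun x => by
      simp [frobPot, pot, c₀, c₁, c₂, μ]; ring
  | besselImag γ a b =>
    rw [hsing (Or.inl trivial)]
    exact isFund_of_frobPot (besselImag_fundamental hp.1).1 fun x => by
      simp [frobPot, pot, c₀, c₁, c₂, μ, mul_pow]; ring
  | modBessel β a b =>
    rw [hsing (Or.inl trivial)]
    exact isFund_of_frobPot (modBessel_fundamental (exists_nat_of_sin hp.1)).1 fun x => by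
      simp [frobPot, pot, c₀, c₁, c₂, μ]; ring
  | modBesselImag γ a b =>
    rw [hsing (Or.inl trivial)]
    exact isFund_of_frobPot (modBesselImag_fundamental hp.1).1 fun x => by
      simp [frobPot, pot, c₀, c₁, c₂, μ, mul_pow]; ring
  | whittakerOsc κ ν a b =>
    rw [hsing (Or.inl trivial)]
    exact oscW_fund hp.1.1 κ
  | whittakerExp κ ν a b =>
    rw [hsing (Or.inl trivial)]
    exact expW_fund hp.1.1 κ
  | one | ident =>
    rw [huniv (by simp [IsSingular, IsQuarter])]
    exact (isFund_ofReal isSol_one isSol_ident fun x => by simp).congr isOpen_univ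
      (fun x _ => by simp [pot, c₀, c₁, c₂, μ]) (fun _ _ => rfl) fun _ _ => rfl
  | cosine =>
    rw [huniv (by simp [IsSingular, IsQuarter])]
    refine (isFund_ofReal (isSol_cos 1) (isSol_sin 1) fun x _ => ?_).congr isOpen_univ
      (fun x _ => by simp [pot, c₀, c₁, c₂, μ]) (fun _ _ => rfl) fun _ _ => rfl
    have := Real.sin_sq_add_cos_sq (1 * x)
    intro h
    linarith [h]
  | expo | hypCos | hypSin =>
    rw [huniv (by simp [IsSingular, IsQuarter])]
    have h2 := isSol_exp (-1)
    rw [neg_sq] at h2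
    refine (isFund_ofReal (isSol_exp 1) h2 fun x _ => ?_).congr isOpen_univ
      (fun x _ => by simp [pot, c₀, c₁, c₂, μ]) (fun _ _ => rfl) fun _ _ => rfl
    have e : Real.exp (1 * x) * Real.exp (-1 * x) = 1 := by rw [← Real.exp_add]; simp
    intro h
    linarith [h]
  | quarterOsc κ a b =>
    rw [hsing (Or.inr trivial)]
    refine (oscW_fund isOrder_half κ).congr isOpen_compl_singleton (fun x _ => ?_)
      (fun _ _ => rfl) fun _ _ => rfl
    simp [pot, c₀, c₁, c₂, μ]; norm_num
  | quarterExp κ a b =>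
    rw [hsing (Or.inr trivial)]
    refine (expW_fund isOrder_half κ).congr isOpen_compl_singleton (fun x _ => ?_)
      (fun _ _ => rfl) fun _ _ => rfl
    simp [pot, c₀, c₁, c₂, μ]; norm_num
  | airy a b =>
    rw [huniv (by simp [IsSingular, IsQuarter])]
    exact airy_fundamental.1.congr isOpen_univ (fun x _ => by simp [pot, c₀, c₁, c₂, μ])
      (fun _ _ => rfl) fun _ _ => rfl

theorem TableCase.μ_ne_zero {p : TableCase} (hp : p.Admissible) (hs : p.IsSingular) : p.μ ≠ 0 := by
  have hsq : ∀ r : ℝ, 0 ≤ r → r ≠ 1 / 2 → r ^ 2 - 1 / 4 ≠ 0 := fun r h0 h1 h => h1 (by nlinarith)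
  have hν : ∀ ν : ℂ, AdmOrder ν → (ν ^ 2).re - 1 / 4 ≠ 0 := by
    rintro ν ⟨⟨r, h0, rfl⟩ | ⟨r, h0, rfl⟩, h1⟩
    · rw [← ofReal_pow, ofReal_re]
      exact hsq r h0 fun h => h1 (by rw [h]; push_cast; rfl)
    · rw [mul_pow, I_sq, ← ofReal_pow, neg_one_mul, ← ofReal_neg, ofReal_re]
      nlinarith
  cases p with
  | cosLog α | besselImag α a b | modBesselImag α a b => simp only [μ]; nlinarith [sq_nonneg α]
  | sqrtAbs | sqrtLog => simp [μ]
  | power α a b => exact hsq α (le_of_lt hp.1) hp.2.1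
  | bessel β a b | modBessel β a b => exact hsq β hp.1 hp.2.1
  | whittakerOsc κ ν a b | whittakerExp κ ν a b => exact hν ν hp.1
  | _ => exact absurd hs (by simp [IsSingular])

theorem TableCase.μ_eq_zero {p : TableCase} (hs : ¬ p.IsSingular) : p.μ = 0 := by
  cases p <;> first | rfl | exact absurd trivial hs

end Table

section TableDrift

open TableCase

theorem IsSol.ofReal {q f f₁ : ℝ → ℝ} {I : Set ℝ} (h : IsSol q I f f₁) :
    IsSol (fun x => (q x : ℂ)) I (fun x => (f x : ℂ)) (fun x => (f₁ x : ℂ)) := fun x hx =>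
  ⟨(h x hx).1.ofReal_comp, by simpa using (h x hx).2.ofReal_comp⟩

variable {p : TableCase} {I J : Set ℝ} {W B : ℝ → ℝ} {ε : ℝ}

theorem Realizes.isSol (hI : IsOpenInterval I) (hp : p.Admissible) (h : Realizes p I W) :
    IsSol p.pot I W (deriv W) := by
  obtain ⟨hW, -, hs, hq, hn⟩ := h
  have d1 : ∀ x ∈ I, HasDerivAt W (deriv W x) x := fun x hx =>
    (hW x hx).differentiableAt.hasDerivAt
  have d2 : ∀ x ∈ I, HasDerivAt (deriv W) (deriv (deriv W) x) x := fun x hx =>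
    (hW x hx).deriv.differentiableAt.hasDerivAt
  have key : ∀ D ⊆ I, IsOpen D → D ⊆ p.dom → (∀ x ∈ D, (W x : ℂ) = p.W x) →
      ∀ x ∈ D, deriv (deriv W) x = p.pot x * W x := by
    intro D hDI hD hdom hWD x hx
    obtain ⟨f₁, g₁, hf, hg, -⟩ := p.isFund hp
    have hc := ((hf.mono hdom).comb (hg.mono hdom) p.coef.1 p.coef.2).congr hD
      (fun x hx => by rw [hWD x hx, p.W_eq (hdom hx)] : ∀ x ∈ D, (W x : ℂ) = _)
    have e1 : ∀ z ∈ D, ((deriv W z : ℝ) : ℂ) = p.coef.1 * f₁ z + p.coef.2 * g₁ z := fun z hz =>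
      (d1 z (hDI hz)).ofReal_comp.unique (hc z hz).1
    have e2 := (d2 x (hDI hx)).ofReal_comp.unique ((hc x hx).2.congr_on hD e1 hx)
    beta_reduce at e2
    exact_mod_cast e2
  suffices hsuff : ∀ x ∈ I, deriv (deriv W) x = p.pot x * W x from fun x hx =>
    ⟨d1 x hx, (d2 x hx).congr_deriv (hsuff x hx)⟩
  by_cases h0 : p.IsQuarter ∧ (0 : ℝ) ∈ I
  · have hμ : p.μ = 0 := μ_eq_zero fun h => hs h h0.2
    have hpos := key (I ∩ Set.Ioi 0) Set.inter_subset_left (hI.isOpen.inter isOpen_Ioi)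
      (fun x hx => p.mem_dom_of_ne (ne_of_gt hx.2)) fun x hx => hq h0 x hx.1 hx.2
    obtain ⟨r, hr, hball⟩ := Metric.isOpen_iff.1 hI.isOpen 0 h0.2
    have hz : r / 2 ∈ I ∩ Set.Ioi 0 := by
      refine ⟨hball ?_, half_pos hr⟩
      rw [Metric.mem_ball, dist_zero_right, Real.norm_of_nonneg (half_pos hr).le]
      exact half_lt_self hr
    have hE : AnalyticOnNhd ℝ (fun x => deriv (deriv W) x - (p.c₀ + p.c₁ * x + p.c₂ * x ^ 2) * W x)
        I := fun x hx => by
      have := (hW x hx).deriv.deriv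
      have h' := hW x hx
      fun_prop
    have hpot : ∀ x, p.pot x = p.c₀ + p.c₁ * x + p.c₂ * x ^ 2 := fun x => by
      rw [pot, hμ, zero_div, add_zero]
    have := hE.eqOn_zero_of_preconnected_of_eventuallyEq_zero hI.isPreconnected hz.1
      (Filter.eventuallyEq_of_mem ((hI.isOpen.inter isOpen_Ioi).mem_nhds hz) fun x hx => by
        simp only [hpos x hx, hpot, sub_self, Pi.zero_apply])
    intro x hx
    rw [hpot]
    exact sub_eq_zero.1 (this hx)
  · refine key I subset_rfl hI.isOpen (fun x hx h' => ?_) (hn h0)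
    rintro rfl
    rcases h' with h' | h'
    · exact hs h' hx
    · exact h0 ⟨h', hx⟩

theorem redPot_of_sol (hε : ε * ε = 1) (hI : IsOpen I) {q W₁ : ℝ → ℝ} (hW : IsSol q I W W₁)
    (h0 : ∀ x ∈ I, W x ≠ 0) (hB : ∀ x ∈ I, B x = -2 * ε * W₁ x / W x) {x : ℝ} (hx : x ∈ I) :
    redPot ε B x = q x := by
  have d := ((((hW x hx).2.const_mul (-2 * ε)).fun_div (hW x hx).1 (h0 x hx)).congr_on hI
    hB hx).deriv
  have hne := h0 x hx
  rw [redPot, d, hB x hx]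
  field_simp
  linear_combination (4 * W x ^ 2 * q x) * hε

theorem IsTableDrift.exists_sol (h : IsTableDrift ε p I B) :
    ∃ W : ℝ → ℝ, Realizes p I W ∧ IsSol p.pot I W (deriv W) ∧ (∀ x ∈ I, W x ≠ 0) ∧
      ∀ x ∈ I, B x = -2 * ε * deriv W x / W x := by
  obtain ⟨hI, hp, W, hR, hB⟩ := h
  exact ⟨W, hR, hR.isSol hI hp, hR.2.1, hB⟩

theorem IsTableDrift.redPot_eq (h : IsTableDrift ε p I B) (hε : ε * ε = 1) {x : ℝ} (hx : x ∈ I) :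
    redPot ε B x = p.pot x := by
  obtain ⟨W, -, hs, h0, hB⟩ := h.exists_sol
  exact redPot_of_sol hε h.1.isOpen hs h0 hB hx

theorem IsTableDrift.contDiffOn (h : IsTableDrift ε p I B) : ContDiffOn ℝ ∞ B I := by
  obtain ⟨W, hR, -, h0, hB⟩ := h.exists_sol
  have a1 : AnalyticOnNhd ℝ (fun x => -2 * ε * deriv W x / W x) I := fun x hx => by
    have h1 := (hR.1 x hx).deriv
    exact (analyticAt_const.mul h1).div (hR.1 x hx) (h0 x hx)
  exact (a1.contDiffOn h.1.isOpen.uniqueDiffOn).congr hB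

theorem IsTableDrift.isBasisOn (h : IsTableDrift ε p I B) (hε : ε * ε = 1) (hJ : IsOpenInterval J)
    {S : Set VField} (hS : ∀ v, v ∈ S ↔ (IsLieSymmetry (fun _ => ε) B J I v ∧ IsEssential J I v)) :
    IsBasisOn J I S (fieldT :: fieldU :: p.basis ε B) := by
  have hI := h.1
  have hp := h.2.1
  have hB := h.contDiffOn
  have hQ := fun x (hx : x ∈ I) => h.redPot_eq hε hx
  have h0 : p.IsSingular → (0 : ℝ) ∉ I := by
    obtain ⟨W, hR, -⟩ := h.exists_sol
    exact hR.2.2.1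
  have hsing : ∀ {κ c : ℝ} {f₁ f₂ : ℝ → ℝ}, p.IsSingular → p.c₀ = -κ → p.c₁ = 0 → p.c₂ = c →
      TimePair (16 * c) f₁ f₂ → IsBasisOn J I S [fieldT, fieldU, fieldD ε B κ f₁, fieldD ε B κ f₂] :=
    fun hs h₀ h₁ h₂ hf => isBasisOn_singular hε hJ hI hB (p.μ_ne_zero hp hs) (h0 hs)
      (fun x hx => by rw [hQ x hx, pot, h₀, h₁, h₂]; ring) hf hS
  have hreg : ∀ {κ c : ℝ} {f₁ f₂ g₁ g₂ : ℝ → ℝ}, ¬ p.IsSingular → p.c₀ = -κ → p.c₁ = 0 → p.c₂ = c →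
      TimePair (16 * c) f₁ f₂ → SpacePair (4 * c) g₁ g₂ → IsBasisOn J I S
        [fieldT, fieldU, fieldP ε B g₁, fieldP ε B g₂, fieldD ε B κ f₁, fieldD ε B κ f₂] :=
    fun hs h₀ h₁ h₂ hf hg => isBasisOn_regular hε hJ hI hB
      (fun x hx => by rw [hQ x hx, pot, h₀, h₁, h₂, μ_eq_zero hs]; ring) hf hg hS
  cases p with
  | cosLog _ | sqrtAbs | sqrtLog | power _ _ _ | bessel _ _ _ | besselImag _ _ _ | modBessel _ _ _
  | modBesselImag _ _ _ => exact hsing trivial (by simp [c₀]) rfl rfl timePair_poly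
  | whittakerOsc _ _ _ _ => exact hsing trivial rfl rfl rfl timePair_trig
  | whittakerExp _ _ _ _ => exact hsing trivial rfl rfl rfl timePair_exp
  | one | ident | cosine | expo | hypCos | hypSin =>
    exact hreg (fun h => h) (by simp [c₀]) rfl rfl timePair_poly spacePair_poly
  | quarterOsc _ _ _ => exact hreg (fun h => h) rfl rfl rfl timePair_trig spacePair_trig
  | quarterExp _ _ _ => exact hreg (fun h => h) rfl rfl rfl timePair_exp spacePair_exp
  | airy a b =>
    exact isBasisOn_airy hε hJ hI hB (fun x hx => by
      rw [hQ x hx]; simp [pot, c₀, c₁, c₂, μ]) hS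

end TableDrift

section Reaches

open Complex ComplexConjugate

variable {I : Set ℝ} {W W₁ q : ℝ → ℝ} {k c : ℝ}

theorem IsSol.affine (hk : k ≠ 0) (h : IsSol q I W W₁) :
    IsSol (fun y => q ((y - c) / k) / k ^ 2) ((fun x => k * x + c) '' I)
      (fun y => W ((y - c) / k)) (fun y => W₁ ((y - c) / k) / k) := by
  rintro _ ⟨x, hx, rfl⟩
  have e : (k * x + c - c) / k = x := by field_simp; ring
  have hd : HasDerivAt (fun y => (y - c) / k) (1 / k) (k * x + c) :=
    ((hasDerivAt_id _).sub_const c).div_const k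
  have d1 := (h x hx).1.comp_of_eq (k * x + c) hd e.symm
  have d2 := ((h x hx).2.comp_of_eq (k * x + c) hd e.symm).div_const k
  beta_reduce
  rw [e]
  exact ⟨d1.congr_deriv (by ring), d2.congr_deriv (by field_simp)⟩

/-- Up to an affine change of `x` and a constant factor, `W` is a function of the list. -/
def Reaches (I : Set ℝ) (W : ℝ → ℝ) : Prop :=
  ∃ (p : TableCase) (k c C : ℝ) (V : ℝ → ℝ), k ≠ 0 ∧ C ≠ 0 ∧ p.Admissible ∧
    Realizes p ((fun x => k * x + c) '' I) V ∧ ∀ x ∈ I, V (k * x + c) = C * W x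

theorem affine_image_image (k c k' c' : ℝ) (I : Set ℝ) :
    (fun x => k' * x + c') '' ((fun x => k * x + c) '' I)
      = (fun x => k' * k * x + (k' * c + c')) '' I := by
  rw [Set.image_image]
  exact Set.image_congr fun x _ => by ring

theorem Reaches.of_affine (hk : k ≠ 0)
    (h : Reaches ((fun x => k * x + c) '' I) (fun y => W ((y - c) / k))) : Reaches I W := by
  obtain ⟨p, k', c', C, V, hk', hC, hp, hR, hV⟩ := h
  refine ⟨p, k' * k, k' * c + c', C, V, mul_ne_zero hk' hk, hC, hp, ?_, fun x hx => ?_⟩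
  · rwa [← affine_image_image]
  · have := hV _ (Set.mem_image_of_mem (fun x => k * x + c) hx)
    beta_reduce at this
    rw [show (k * x + c - c) / k = x by field_simp; ring] at this
    rw [← this]; ring_nf

theorem isOpenInterval_affine (hI : IsOpenInterval I) (hk : k ≠ 0) (c : ℝ) :
    IsOpenInterval ((fun x => k * x + c) '' I) :=
  hI.image_of_deriv_ne_zero (by fun_prop) fun x _ => by rw [deriv_affine]; exact hk

theorem TableCase.analyticOnNhd (p : TableCase) (hI : IsOpenInterval I) (hs : p.IsSingular → (0 : ℝ) ∉ I)
    (hW : IsSol p.pot I W W₁) : AnalyticOnNhd ℝ W I := by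
  intro x hx
  have hQ : ∀ᶠ z in 𝓝 (x : ℂ), DifferentiableAt ℂ (fun z : ℂ =>
      (p.c₀ + p.c₁ * z + p.c₂ * z ^ 2 + p.μ / z ^ 2 : ℂ)) z := by
    by_cases h : p.IsSingular
    · have hx0 : (x : ℂ) ≠ 0 := by
        rintro h0
        have : x = 0 := by exact_mod_cast h0
        exact hs h (this ▸ hx)
      filter_upwards [isOpen_ne.mem_nhds hx0] with z hz
      have hz2 : z ^ 2 ≠ 0 := pow_ne_zero 2 hz
      fun_prop (disch := assumption)
    · filter_upwards with z
      simp only [μ_eq_zero h, ofReal_zero, zero_div]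
      fun_prop
  have := IsSol.analyticAt (q := fun x => (p.pot x : ℂ)) hI.isOpen hx hQ
    (fun x _ => by simp [pot]) hW.ofReal
  exact (reCLM.analyticAt _).comp this

theorem reaches_of_table {p : TableCase} (hI : IsOpenInterval I) (hp : p.Admissible)
    (hs : p.IsSingular → (0 : ℝ) ∉ I) (hW : IsSol p.pot I W W₁) (h0 : ∀ x ∈ I, W x ≠ 0) {C : ℝ}
    (hC : C ≠ 0) (hq : ∀ x ∈ I, (p.IsQuarter ∧ (0 : ℝ) ∈ I → 0 < x) → (C * W x : ℂ) = p.W x) :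
    Reaches I W := by
  have hid : (fun x : ℝ => 1 * x + 0) '' I = I := by simp
  refine ⟨p, 1, 0, C, fun x => C * W x, one_ne_zero, hC, hp, ?_, fun x _ => by simp⟩
  rw [hid]
  exact ⟨analyticOnNhd_const.mul (p.analyticOnNhd hI hs hW), fun x hx => mul_ne_zero hC (h0 x hx),
    hs, fun h x hx hpos => by push_cast; exact hq x hx fun _ => hpos,
    fun h x hx => by push_cast; exact hq x hx fun h' => absurd h' h⟩

/-- The part of `I` where the formula for `W` applies, as an interval. -/
theorem exists_sub_interval (p : TableCase) (hI : IsOpenInterval I)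
    (hs : p.IsSingular → (0 : ℝ) ∉ I) : ∃ D ⊆ I, IsOpenInterval D ∧ D ⊆ p.dom ∧
      ∀ x ∈ I, x ∈ D ↔ (p.IsQuarter ∧ (0 : ℝ) ∈ I → 0 < x) := by
  by_cases h0 : p.IsQuarter ∧ (0 : ℝ) ∈ I
  · obtain ⟨r, hr, hball⟩ := Metric.isOpen_iff.1 hI.isOpen 0 h0.2
    refine ⟨I ∩ Set.Ioi 0, Set.inter_subset_left, ⟨hI.isOpen.inter isOpen_Ioi,
      hI.2.1.inter Set.ordConnected_Ioi, r / 2, hball ?_, half_pos hr⟩,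
      fun x hx => p.mem_dom_of_ne (ne_of_gt hx.2), fun x hx =>
        ⟨fun h _ => h.2, fun h => ⟨hx, h h0⟩⟩⟩
    rw [Metric.mem_ball, dist_zero_right, Real.norm_of_nonneg (half_pos hr).le]
    exact half_lt_self hr
  · refine ⟨I, subset_rfl, hI, fun x hx h' => ?_, fun x hx => ⟨fun _ h => absurd h h0, fun _ => hx⟩⟩
    rintro rfl
    rcases h' with h' | h'
    · exact hs h' hx
    · exact h0 ⟨h', hx⟩

end Reaches

section Normalization

open Complex ComplexConjugate TableCase

variable {I : Set ℝ} {W W₁ q : ℝ → ℝ}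

attribute [local simp] pot c₀ c₁ c₂ μ

theorem reaches_of_affine_table {p : TableCase} (hI : IsOpenInterval I) (hp : p.Admissible)
    (hW : IsSol q I W W₁) (h0 : ∀ x ∈ I, W x ≠ 0) {k c C : ℝ} (hk : k ≠ 0) (hC : C ≠ 0)
    (hs : p.IsSingular → ∀ x ∈ I, k * x + c ≠ 0)
    (hpot : ∀ x ∈ I, q x / k ^ 2 = p.pot (k * x + c))
    (hform : ∀ x ∈ I, (C * W x : ℂ) = p.W (k * x + c)) : Reaches I W := by
  have e : ∀ x, (k * x + c - c) / k = x := fun x => by field_simp; ring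
  refine Reaches.of_affine (k := k) (c := c) hk (reaches_of_table (p := p) (C := C)
    (W₁ := fun y => W₁ ((y - c) / k) / k) (isOpenInterval_affine hI hk c) hp ?_
    ((hW.affine hk).congr_coeff ?_) ?_ hC ?_)
  · rintro h ⟨x, hx, hx0⟩; exact hs h x hx hx0
  · rintro _ ⟨x, hx, rfl⟩; beta_reduce; rw [e, hpot x hx]
  · rintro _ ⟨x, hx, rfl⟩; beta_reduce; rw [e]; exact h0 x hx
  · rintro _ ⟨x, hx, rfl⟩ -; beta_reduce; rw [e, hform x hx]

/-- Cases that differ only in the coefficients `a₁`, `a₂`. -/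
structure IsFamily {𝕜 : Type} [Zero 𝕜] (ι : 𝕜 → ℂ) (P : 𝕜 → 𝕜 → TableCase) (p : TableCase) :
    Prop where
  zero : ι 0 = 0 := by rfl
  pot : ∀ a b, (P a b).pot = p.pot := by intros; rfl
  fund : ∀ a b, (P a b).fund = p.fund := by intros; rfl
  coef : ∀ a b, (P a b).coef = (ι a, ι b) := by intros; rfl
  sing : ∀ a b, (P a b).IsSingular = p.IsSingular := by intros; rfl
  quar : ∀ a b, (P a b).IsQuarter = p.IsQuarter := by intros; rfl
  adm : ∀ a b, (a, b) ≠ 0 → (P a b).Admissible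

theorem IsFamily.reaches {𝕜 : Type} [Zero 𝕜] {ι : 𝕜 → ℂ} {P : 𝕜 → 𝕜 → TableCase} {p : TableCase}
    (F : IsFamily ι P p) (hI : IsOpenInterval I) (hs : p.IsSingular → (0 : ℝ) ∉ I)
    (hW : IsSol q I W W₁) (hq : ∀ x ∈ I, q x = p.pot x) (h0 : ∀ x ∈ I, W x ≠ 0)
    (hex : ∀ D, IsOpenInterval D → D ⊆ p.dom →
      IsSol (fun x => (p.pot x : ℂ)) D (fun x => (W x : ℂ)) (fun x => (W₁ x : ℂ)) →
      ∃ a b, ∀ x ∈ D, (W x : ℂ) = ι a * p.fund.1 x + ι b * p.fund.2 x) : Reaches I W := by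
  replace hW := hW.congr_coeff hq
  obtain ⟨D, hDI, hD, hdom, hmem⟩ := exists_sub_interval p hI hs
  obtain ⟨a, b, hab⟩ := hex D hD hdom (hW.ofReal.mono hDI)
  have hne : (a, b) ≠ 0 := by
    rintro h
    obtain ⟨rfl, rfl⟩ := Prod.mk.inj h
    obtain ⟨x, hx⟩ := hD.nonempty
    exact h0 x (hDI hx) (by simpa [F.zero] using hab x hx)
  refine reaches_of_table (p := P a b) (C := 1) hI (F.adm a b hne)
    (by rwa [F.sing]) (W₁ := W₁) (by rwa [F.pot]) h0 one_ne_zero fun x hx h => ?_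
  rw [F.quar] at h
  have hx' := (hmem x hx).2 h
  rw [(P a b).W_eq (by rw [dom, F.sing, F.quar]; exact hdom hx'), F.coef, F.fund,
    ofReal_one, one_mul, hab x hx']

theorem IsFamily.reaches_real {P : ℝ → ℝ → TableCase} (F : IsFamily ofReal P (P 1 0))
    (hI : IsOpenInterval I) (hs : (P 1 0).IsSingular → (0 : ℝ) ∉ I)
    (hW : IsSol q I W W₁) (hq : ∀ x ∈ I, q x = (P 1 0).pot x) (h0 : ∀ x ∈ I, W x ≠ 0)
    (hr : ∀ x ∈ (P 1 0).dom, conj ((P 1 0).fund.1 x) = (P 1 0).fund.1 x ∧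
      conj ((P 1 0).fund.2 x) = (P 1 0).fund.2 x) : Reaches I W :=
  F.reaches hI hs hW hq h0 fun _ hD hdom hsol =>
    ((isFund (F.adm 1 0 (by simp))).mono hdom).exists_comb_real hD hsol
      (fun x hx => conj_eq_iff_im.1 (hr x (hdom hx)).1)
      (fun x hx => conj_eq_iff_im.1 (hr x (hdom hx)).2)

theorem IsFamily.reaches_complex {P : ℂ → ℂ → TableCase} (F : IsFamily (fun z => z) P (P 1 0))
    (hI : IsOpenInterval I) (hs : (P 1 0).IsSingular → (0 : ℝ) ∉ I)
    (hW : IsSol q I W W₁) (hq : ∀ x ∈ I, q x = (P 1 0).pot x) (h0 : ∀ x ∈ I, W x ≠ 0) :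
    Reaches I W :=
  F.reaches hI hs hW hq h0 fun _ hD hdom hsol =>
    ((isFund (F.adm 1 0 (by simp))).mono hdom).exists_comb hD hsol

theorem exists_order (m : ℝ) : ∃ ν : ℂ, IsOrder ν ∧ (ν ^ 2).re = m := by
  rcases le_or_gt 0 m with h | h
  · refine ⟨√m, Or.inl ⟨√m, Real.sqrt_nonneg m, rfl⟩, ?_⟩
    rw [← ofReal_pow, ofReal_re, Real.sq_sqrt h]
  · refine ⟨I * √(-m), Or.inr ⟨√(-m), Real.sqrt_pos.2 (by linarith), rfl⟩, ?_⟩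
    rw [mul_pow, I_sq, ← ofReal_pow, Real.sq_sqrt (by linarith)]
    simp

theorem reaches_whittaker (hI : IsOpenInterval I) (hW : IsSol q I W W₁) (h0 : ∀ x ∈ I, W x ≠ 0)
    {c s m : ℝ} (hs : s = 1 ∨ s = -1) (hm : m = 0 ∨ (0 : ℝ) ∉ I)
    (hq : ∀ x ∈ I, q x = c + s * x ^ 2 + m / x ^ 2) : Reaches I W := by
  obtain ⟨ν, hν, hν2⟩ := exists_order (m + 1 / 4)
  by_cases hm0 : m = 0
  · rcases hs with rfl | rfl
    · have F : IsFamily (fun z => z) (.quarterExp (-c)) (.quarterExp (-c) 1 0) :=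
        { adm := fun _ _ h => h }
      refine F.reaches_complex hI False.elim hW (fun x hx => ?_) h0
      rw [hq x hx, hm0]
      simp
    · have F : IsFamily ofReal (.quarterOsc (-c)) (.quarterOsc (-c) 1 0) :=
        { adm := fun _ _ h => h }
      refine F.reaches_real hI False.elim hW (fun x hx => ?_) h0 fun x _ =>
        ⟨conj_ofReal _, conj_ofReal _⟩
      rw [hq x hx, hm0]
      simp
  · have hν' : AdmOrder ν := ⟨hν, fun h => hm0 (by
      have : (ν ^ 2).re = 1 / 4 := by rw [h]; norm_num
      linarith)⟩
    have hm1 := hm.resolve_left hm0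
    rcases hs with rfl | rfl
    · have F : IsFamily (fun z => z) (.whittakerExp (-c) ν) (.whittakerExp (-c) ν 1 0) :=
        { adm := fun _ _ h => ⟨hν', h⟩ }
      refine F.reaches_complex hI (fun _ => hm1) hW (fun x hx => ?_) h0
      rw [hq x hx]
      simp [hν2]
    · have F : IsFamily ofReal (.whittakerOsc (-c) ν) (.whittakerOsc (-c) ν 1 0) :=
        { adm := fun _ _ h => ⟨hν', h⟩ }
      refine F.reaches_real hI (fun _ => hm1) hW (fun x hx => ?_) h0 fun x _ =>
        ⟨conj_ofReal _, conj_ofReal _⟩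
      rw [hq x hx]
      simp [hν2]

theorem reaches_bessel (hI : IsOpenInterval I) (hW : IsSol q I W W₁) (h0 : ∀ x ∈ I, W x ≠ 0)
    {s m : ℝ} (hs : s = 1 ∨ s = -1) (hm0 : m ≠ 0) (hm : (0 : ℝ) ∉ I)
    (hq : ∀ x ∈ I, q x = s + m / x ^ 2) : Reaches I W := by
  have hne : ∀ x : ℝ, x ∈ {x : ℝ | True ∨ False → x ≠ 0} → 0 < |x| := fun x hx =>
    abs_pos.2 (hx (Or.inl trivial))
  rcases le_or_gt 0 (m + 1 / 4) with h | h
  · have hβ : 0 ≤ √(m + 1 / 4) := Real.sqrt_nonneg _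
    have hsq := Real.sq_sqrt h
    have hβ' : √(m + 1 / 4) ≠ 1 / 2 := fun h' => hm0 (by rw [h'] at hsq; linarith)
    generalize √(m + 1 / 4) = β at *
    have hm' : m = β ^ 2 - 1 / 4 := by linarith
    rcases hs with rfl | rfl
    · have F : IsFamily ofReal (.modBessel β) (.modBessel β 1 0) :=
        { adm := fun _ _ h => ⟨hβ, hβ', h⟩ }
      refine F.reaches_real hI (fun _ => hm) hW (fun x hx => ?_) h0 fun x hx => ⟨?_, ?_⟩
      · rw [hq x hx, hm']; simp
      · simp only [fund, map_mul, conj_ofReal, conj_besselI _ (hne x hx)]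
      · exact (modBessel_fundamental (exists_nat_of_sin hβ)).2 (conj_ofReal β) _ (hne x hx)
    · have F : IsFamily ofReal (.bessel β) (.bessel β 1 0) :=
        { adm := fun _ _ h => ⟨hβ, hβ', h⟩ }
      refine F.reaches_real hI (fun _ => hm) hW (fun x hx => ?_) h0 fun x hx => ⟨?_, ?_⟩
      · rw [hq x hx, hm']; simp
      · simp only [fund, map_mul, conj_ofReal, conj_besselJ _ (hne x hx)]
      · exact (bessel_fundamental (exists_nat_of_sin hβ)).2 (conj_ofReal β) _ (hne x hx)
  · have hγ : 0 < √(-(m + 1 / 4)) := Real.sqrt_pos.2 (by linarith)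
    have hsq := Real.sq_sqrt (by linarith : 0 ≤ -(m + 1 / 4))
    generalize √(-(m + 1 / 4)) = γ at *
    have hm' : m = -γ ^ 2 - 1 / 4 := by linarith
    rcases hs with rfl | rfl
    · have F : IsFamily ofReal (.modBesselImag γ) (.modBesselImag γ 1 0) :=
        { adm := fun _ _ h => ⟨hγ, h⟩ }
      refine F.reaches_real hI (fun _ => hm) hW (fun x hx => ?_) h0 fun x hx =>
        (modBesselImag_fundamental hγ).2 _ (hne x hx)
      rw [hq x hx, hm']; simp
    · have F : IsFamily ofReal (.besselImag γ) (.besselImag γ 1 0) :=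
        { adm := fun _ _ h => ⟨hγ, h⟩ }
      refine F.reaches_real hI (fun _ => hm) hW (fun x hx => ?_) h0 fun x hx =>
        (besselImag_fundamental hγ).2 _ (hne x hx)
      rw [hq x hx, hm']; simp

theorem reaches_airy (hI : IsOpenInterval I) (hW : IsSol q I W W₁) (h0 : ∀ x ∈ I, W x ≠ 0)
    (hq : ∀ x ∈ I, q x = x) : Reaches I W := by
  have F : IsFamily ofReal .airy (.airy 1 0) :=
        { adm := fun _ _ h => h }
  refine F.reaches_real hI False.elim hW (fun x hx => ?_) h0 fun x _ => airy_fundamental.2 x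
  rw [hq x hx]; simp

/-- Real coefficients of a solution with respect to a real fundamental system of the list. -/
theorem TableCase.exists_real_comb {p : TableCase} (hp : p.Admissible) (hI : IsOpenInterval I)
    (hdom : I ⊆ p.dom) (hW : IsSol q I W W₁) (hq : ∀ x ∈ I, q x = p.pot x) {f g : ℝ → ℝ}
    (hf : p.fund.1 = fun x => (f x : ℂ)) (hg : p.fund.2 = fun x => (g x : ℂ)) :
    ∃ A B : ℝ, ∀ x ∈ I, W x = A * f x + B * g x := by
  have F := (p.isFund hp).mono hdom
  rw [hf, hg] at F
  obtain ⟨A, B, h⟩ := F.exists_comb_real hI (hW.congr_coeff hq).ofReal (fun _ _ => ofReal_im _)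
    fun _ _ => ofReal_im _
  exact ⟨A, B, fun x hx => by exact_mod_cast h x hx⟩

theorem exists_polar {A B : ℝ} (h : A ≠ 0 ∨ B ≠ 0) :
    ∃ R φ : ℝ, R ≠ 0 ∧ A = R * Real.cos φ ∧ B = R * Real.sin φ := by
  refine ⟨‖(⟨A, B⟩ : ℂ)‖, arg ⟨A, B⟩, ?_, (norm_mul_cos_arg (⟨A, B⟩ : ℂ)).symm,
    (norm_mul_sin_arg (⟨A, B⟩ : ℂ)).symm⟩
  rw [norm_ne_zero_iff]
  intro h0
  rw [Complex.ext_iff] at h0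
  exact h.elim (fun h => h h0.1) fun h => h h0.2

theorem sqrt_abs_mul {k : ℝ} (hk : 0 < k) (x : ℝ) : √|k * x + 0| = √k * √|x| := by
  rw [add_zero, abs_mul, abs_of_pos hk, Real.sqrt_mul hk.le]

theorem log_abs_mul {k x : ℝ} (hk : 0 < k) (hx : x ≠ 0) :
    Real.log |k * x + 0| = Real.log k + Real.log |x| := by
  rw [add_zero, abs_mul, abs_of_pos hk, Real.log_mul hk.ne' (abs_ne_zero.2 hx)]

theorem reaches_inverse_square (hI : IsOpenInterval I) (hW : IsSol q I W W₁)
    (h0 : ∀ x ∈ I, W x ≠ 0) {m : ℝ} (hm0 : m ≠ 0) (hm : (0 : ℝ) ∉ I)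
    (hq : ∀ x ∈ I, q x = m / x ^ 2) : Reaches I W := by
  have hx0 : ∀ x ∈ I, x ≠ 0 := fun x hx h => hm (h ▸ hx)
  obtain ⟨z, hz⟩ := hI.nonempty
  have key : ∀ (p : TableCase) (k C : ℝ), p.Admissible → p.c₀ = 0 → p.c₁ = 0 → p.c₂ = 0 → p.μ = m →
      0 < k → C ≠ 0 → (∀ x ∈ I, (C * W x : ℂ) = p.W (k * x + 0)) → Reaches I W := by
    intro p k C hp h₀ h₁ h₂ hμ hk hC hform
    refine reaches_of_affine_table hI hp hW h0 hk.ne' hC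
      (fun _ x hx => by simpa using ⟨hk.ne', hx0 x hx⟩) (fun x hx => ?_) hform
    have := hx0 x hx
    rw [hq x hx, pot, h₀, h₁, h₂, hμ]
    field_simp
    ring
  rcases lt_trichotomy (m + 1 / 4) 0 with h | h | h
  · have hα : 0 < √(-(m + 1 / 4)) := Real.sqrt_pos.2 (by linarith)
    have hsq := Real.sq_sqrt (by linarith : 0 ≤ -(m + 1 / 4))
    generalize √(-(m + 1 / 4)) = α at *
    have hm' : -α ^ 2 - 1 / 4 = m := by linarith
    obtain ⟨A, B, hAB⟩ := exists_real_comb (p := .cosLog α) hα hI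
      (fun x hx _ => hx0 x hx) hW (fun x hx => by
        rw [hq x hx, ← hm']; simp) rfl rfl
    obtain ⟨R, φ, hR, rfl, rfl⟩ := exists_polar (A := A) (B := B) (by
      by_contra! hc; exact h0 z hz (by rw [hAB z hz, hc.1, hc.2]; ring))
    have hk := Real.exp_pos (-φ / α)
    have hsk := Real.sqrt_pos.2 hk
    refine key (.cosLog α) (Real.exp (-φ / α)) (√(Real.exp (-φ / α)) / R) hα rfl rfl rfl hm' hk
      (div_ne_zero hsk.ne' hR) fun x hx => ?_
    rw [TableCase.W, sqrt_abs_mul hk, log_abs_mul hk (hx0 x hx), Real.log_exp, hAB x hx,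
      show α * (-φ / α + Real.log |x|) = α * Real.log |x| - φ by field_simp; ring, Real.cos_sub,
      ← ofReal_mul]
    congr 1
    field_simp
  · have hm' : -1 / 4 = m := by linarith
    obtain ⟨A, B, hAB⟩ := exists_real_comb (p := .sqrtAbs) trivial hI
      (fun x hx _ => hx0 x hx) hW (fun x hx => by
        rw [hq x hx, ← hm']; simp) rfl rfl
    by_cases hB : B = 0
    · have hA : A ≠ 0 := fun hA => h0 z hz (by rw [hAB z hz, hA, hB]; ring)
      refine key .sqrtAbs 1 A⁻¹ trivial rfl rfl rfl hm' one_pos (inv_ne_zero hA) fun x hx => ?_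
      rw [TableCase.W, ← ofReal_mul, hAB x hx, hB, add_zero, one_mul]
      congr 1
      field_simp
      ring
    · have hk := Real.exp_pos (A / B)
      have hsk := Real.sqrt_pos.2 hk
      refine key .sqrtLog (Real.exp (A / B)) (√(Real.exp (A / B)) / B) trivial rfl rfl rfl hm' hk
        (div_ne_zero hsk.ne' hB) fun x hx => ?_
      rw [TableCase.W, sqrt_abs_mul hk, log_abs_mul hk (hx0 x hx), Real.log_exp, hAB x hx,
        ← ofReal_mul]
      congr 1
      field_simp
  · have hα : 0 < √(m + 1 / 4) := Real.sqrt_pos.2 h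
    have hsq := Real.sq_sqrt h.le
    have hα' : √(m + 1 / 4) ≠ 1 / 2 := fun h' => hm0 (by rw [h'] at hsq; linarith)
    generalize √(m + 1 / 4) = α at *
    have F : IsFamily ofReal (.power α) (.power α 1 0) :=
        { adm := fun _ _ h => ⟨hα, hα', h⟩ }
    refine F.reaches_real hI (fun _ => hm) hW (fun x hx => ?_) h0 fun x _ =>
      ⟨conj_ofReal _, conj_ofReal _⟩
    rw [hq x hx, show m = α ^ 2 - 1 / 4 by linarith]
    simp

end Normalization

section ConstantPotential

open Complex TableCase

variable {I : Set ℝ} {W W₁ q : ℝ → ℝ}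

theorem reaches_const (hI : IsOpenInterval I) (hW : IsSol q I W W₁) (h0 : ∀ x ∈ I, W x ≠ 0) {s : ℝ}
    (hs : s = 0 ∨ s = 1 ∨ s = -1) (hq : ∀ x ∈ I, q x = s) : Reaches I W := by
  obtain ⟨z, hz⟩ := hI.nonempty
  have key : ∀ (p : TableCase) (k c C : ℝ), p.Admissible → ¬ p.IsSingular → (∀ x, p.pot x = s) →
      k ^ 2 = 1 → C ≠ 0 → (∀ x ∈ I, (C * W x : ℂ) = p.W (k * x + c)) → Reaches I W := by
    intro p k c C hp hns hpot hk hC hform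
    refine reaches_of_affine_table hI hp hW h0 (by rintro rfl; norm_num at hk) hC
      (fun h => absurd h hns) (fun x hx => ?_) hform
    rw [hq x hx, hpot, hk, div_one]
  rcases hs with rfl | rfl | rfl
  · have hpot : ∀ x, one.pot x = 0 := fun x => by
      simp [pot, c₀, c₁, c₂, μ]
    obtain ⟨A, B, hAB⟩ := exists_real_comb (p := .one) trivial hI
      (fun _ _ h => absurd h (by simp [IsSingular, IsQuarter])) hW
      (fun x hx => by rw [hq x hx, hpot]) rfl rfl
    by_cases hB : B = 0
    · have hA : A ≠ 0 := fun hA => h0 z hz (by rw [hAB z hz, hA, hB]; ring)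
      refine key .one 1 0 A⁻¹ trivial id hpot (one_pow 2) (inv_ne_zero hA) fun x hx => ?_
      rw [TableCase.W, ← ofReal_mul, hAB x hx, hB, ← ofReal_one]
      congr 1
      field_simp
      ring
    · refine key .ident 1 (A / B) B⁻¹ trivial id hpot (one_pow 2) (inv_ne_zero hB)
        fun x hx => ?_
      rw [TableCase.W, ← ofReal_mul, hAB x hx]
      congr 1
      field_simp
      ring
  · have hpot : ∀ x, expo.pot x = 1 := fun x => by
      simp [pot, c₀, c₁, c₂, μ]
    obtain ⟨A, B, hAB⟩ := exists_real_comb (p := .expo) trivial hI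
      (fun _ _ h => absurd h (by simp [IsSingular, IsQuarter])) hW
      (fun x hx => by rw [hq x hx, hpot]) rfl rfl
    have hE : ∀ {r : ℝ}, 0 < r → Real.exp (Real.log r / 2) ^ 2 = r := fun hr => by
      rw [← Real.exp_nat_mul, Nat.cast_ofNat, mul_div_cancel₀ _ two_ne_zero, Real.exp_log hr]
    by_cases hB : B = 0
    · have hA : A ≠ 0 := fun hA => h0 z hz (by rw [hAB z hz, hA, hB]; ring)
      refine key .expo 1 0 A⁻¹ trivial id hpot (one_pow 2) (inv_ne_zero hA) fun x hx => ?_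
      rw [TableCase.W, ← ofReal_mul, hAB x hx, hB, add_zero (1 * x)]
      congr 1
      field_simp
      ring
    by_cases hA : A = 0
    · refine key .expo (-1) 0 B⁻¹ trivial id hpot (by norm_num) (inv_ne_zero hB)
        fun x hx => ?_
      rw [TableCase.W, ← ofReal_mul, hAB x hx, hA, add_zero (-1 * x)]
      congr 1
      field_simp
      ring
    have hexp : ∀ s x : ℝ, Real.exp (1 * x + s) = Real.exp s * Real.exp (1 * x) ∧
        Real.exp (-(1 * x + s)) = (Real.exp s)⁻¹ * Real.exp (-1 * x) := fun s x => by
      rw [← Real.exp_neg, ← Real.exp_add, ← Real.exp_add]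
      constructor <;> ring_nf
    rcases lt_or_gt_of_ne (div_ne_zero hA hB) with h | h
    · have hr : 0 < -(A / B) := by linarith
      have h2 := hE hr
      have hS := Real.exp_pos (Real.log (-(A / B)) / 2)
      refine key .hypSin 1 (Real.log (-(A / B)) / 2) (Real.exp (Real.log (-(A / B)) / 2) / (2 * A))
        trivial id hpot (one_pow 2) (div_ne_zero hS.ne' (by simpa using hA)) fun x hx => ?_
      rw [TableCase.W, ← ofReal_mul, hAB x hx, Real.sinh_eq, (hexp _ x).1, (hexp _ x).2]
      congr 1
      generalize Real.exp (Real.log (-(A / B)) / 2) = S at *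
      have hb : B * S ^ 2 = -A := by rw [h2]; field_simp
      field_simp
      linear_combination (Real.exp (-x)) * hb
    · have h2 := hE h
      have hS := Real.exp_pos (Real.log (A / B) / 2)
      refine key .hypCos 1 (Real.log (A / B) / 2) (Real.exp (Real.log (A / B) / 2) / (2 * A))
        trivial id hpot (one_pow 2) (div_ne_zero hS.ne' (by simpa using hA)) fun x hx => ?_
      rw [TableCase.W, ← ofReal_mul, hAB x hx, Real.cosh_eq, (hexp _ x).1, (hexp _ x).2]
      congr 1
      generalize Real.exp (Real.log (A / B) / 2) = S at *
      have hb : B * S ^ 2 = A := by rw [h2]; field_simp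
      field_simp
      linear_combination (Real.exp (-x)) * hb
  · have hpot : ∀ x, cosine.pot x = -1 := fun x => by
      simp [pot, c₀, c₁, c₂, μ]
    obtain ⟨A, B, hAB⟩ := exists_real_comb (p := .cosine) trivial hI
      (fun _ _ h => absurd h (by simp [IsSingular, IsQuarter])) hW
      (fun x hx => by rw [hq x hx, hpot]) rfl rfl
    obtain ⟨R, φ, hR, rfl, rfl⟩ := exists_polar (A := A) (B := B) (by
      by_contra! hc; exact h0 z hz (by rw [hAB z hz, hc.1, hc.2]; ring))
    refine key .cosine 1 (-φ) R⁻¹ trivial id hpot (one_pow 2) (inv_ne_zero hR)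
      fun x hx => ?_
    rw [TableCase.W, ← ofReal_mul, hAB x hx, ← sub_eq_add_neg, Real.cos_sub]
    congr 1
    field_simp

theorem exists_cube_root (a : ℝ) : ∃ k : ℝ, k ^ 3 = a := by
  have h : ∀ b : ℝ, 0 ≤ b → (b ^ ((3 : ℕ) : ℝ)⁻¹) ^ 3 = b := fun b hb =>
    Real.rpow_inv_natCast_pow hb three_ne_zero
  rcases le_total 0 a with ha | ha
  · exact ⟨_, h a ha⟩
  · exact ⟨-(-a) ^ ((3 : ℕ) : ℝ)⁻¹, by rw [Odd.neg_pow (by decide), h _ (by linarith), neg_neg]⟩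

theorem exists_sq_root {a : ℝ} (ha : a ≠ 0) : ∃ k s : ℝ, 0 < k ∧ (s = 1 ∨ s = -1) ∧ a = s * k ^ 2 := by
  rcases lt_or_gt_of_ne ha with h | h
  · exact ⟨√(-a), -1, Real.sqrt_pos.2 (by linarith), Or.inr rfl, by
      rw [Real.sq_sqrt (by linarith)]; ring⟩
  · exact ⟨√a, 1, Real.sqrt_pos.2 h, Or.inl rfl, by rw [Real.sq_sqrt h.le]; ring⟩

theorem reaches_of_pot (hI : IsOpenInterval I) (hW : IsSol q I W W₁) (h0 : ∀ x ∈ I, W x ≠ 0)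
    (hq : PotForm I (fun x => x) q) : Reaches I W := by
  obtain ⟨c₀, c₁, c₂, μ, x₀, hc, hq⟩ := hq
  have norm : ∀ k c : ℝ, k ≠ 0 → (∀ {V V₁ r : ℝ → ℝ}, IsOpenInterval ((fun x => k * x + c) '' I) →
      IsSol r ((fun x => k * x + c) '' I) V V₁ → (∀ y ∈ (fun x => k * x + c) '' I, V y ≠ 0) →
      (∀ x ∈ I, r (k * x + c) = q x / k ^ 2) → Reaches ((fun x => k * x + c) '' I) V) →
      Reaches I W := by
    intro k c hk h
    have e : ∀ x, (k * x + c - c) / k = x := fun x => by field_simp; ring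
    refine Reaches.of_affine hk (h (isOpenInterval_affine hI hk c) (hW.affine hk) ?_ fun x _ => ?_)
    · rintro _ ⟨x, hx, rfl⟩; beta_reduce; rw [e]; exact h0 x hx
    · rw [e]
  have quad : ∀ d m y₀ : ℝ, c₂ ≠ 0 → (m = 0 ∨ ∀ x ∈ I, x ≠ y₀) →
      (∀ x ∈ I, q x = d + c₂ * (x - y₀) ^ 2 + m / (x - y₀) ^ 2) → Reaches I W := by
    intro d m y₀ h2 hm hq
    obtain ⟨l, s, hl, hs, hls⟩ := exists_sq_root h2
    have hk : 0 < √l := Real.sqrt_pos.2 hl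
    have hsq := Real.sq_sqrt hl.le
    generalize √l = k at *
    refine norm k (-k * y₀) hk.ne' fun hI' hV hV0 hr => reaches_whittaker (c := d / k ^ 2) (m := m)
      hI' hV hV0 hs (hm.imp id fun h => ?_) ?_
    · rintro ⟨x, hx, hx0⟩
      have : k * (x - y₀) = 0 := by linear_combination hx0
      exact h x hx (sub_eq_zero.1 ((mul_eq_zero.1 this).resolve_left hk.ne'))
    · rintro _ ⟨x, hx, rfl⟩
      beta_reduce
      rw [hr x hx, hq x hx, hls, ← hsq, show k * x + -k * y₀ = k * (x - y₀) by ring]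
      rcases hm with rfl | hm
      · field_simp
      · have := sub_ne_zero.2 (hm x hx)
        field_simp
  by_cases h2 : c₂ = 0
  swap
  · by_cases hμ : μ = 0
    · refine quad (c₀ - c₁ ^ 2 / (4 * c₂)) 0 (x₀ - c₁ / (2 * c₂)) h2 (Or.inl rfl) fun x hx => ?_
      rw [hq x hx, hμ, zero_div, zero_div]
      field_simp
      ring
    · obtain ⟨rfl, hne⟩ := hc.resolve_left hμ
      exact quad c₀ μ x₀ h2 (Or.inr hne) fun x hx => by rw [hq x hx]; ring
  subst h2
  by_cases hμ : μ = 0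
  · subst hμ
    by_cases h1 : c₁ = 0
    · subst h1
      by_cases hc0 : c₀ = 0
      · exact reaches_const hI hW h0 (Or.inl rfl) fun x hx => by rw [hq x hx, hc0]; ring
      · obtain ⟨k, s, hk, hs, rfl⟩ := exists_sq_root hc0
        refine norm k 0 hk.ne' fun hI' hV hV0 hr => reaches_const hI' hV hV0 (Or.inr hs) ?_
        rintro _ ⟨x, hx, rfl⟩
        beta_reduce
        rw [hr x hx, hq x hx]
        field_simp
        ring
    · obtain ⟨k, rfl⟩ := exists_cube_root c₁
      have hk : k ≠ 0 := by rintro rfl; simp at h1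
      refine norm k ((c₀ - k ^ 3 * x₀) / k ^ 2) hk fun hI' hV hV0 hr => reaches_airy hI' hV hV0 ?_
      rintro _ ⟨x, hx, rfl⟩
      beta_reduce
      rw [hr x hx, hq x hx]
      field_simp
      ring
  · obtain ⟨rfl, hne⟩ := hc.resolve_left hμ
    have hne' : ∀ k : ℝ, 0 < k → (0 : ℝ) ∉ (fun x => k * x + -k * x₀) '' I := by
      rintro k hk ⟨x, hx, hx0⟩
      have : k * (x - x₀) = 0 := by linear_combination hx0
      exact hne x hx (sub_eq_zero.1 ((mul_eq_zero.1 this).resolve_left hk.ne'))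
    have hform : ∀ {k s : ℝ}, 0 < k → c₀ = s * k ^ 2 → ∀ x ∈ I,
        q x / k ^ 2 = s + μ / (k * x + -k * x₀) ^ 2 := by
      intro k s hk hs x hx
      have := sub_ne_zero.2 (hne x hx)
      rw [hq x hx, hs, show k * x + -k * x₀ = k * (x - x₀) by ring]
      field_simp
      ring
    by_cases hc0 : c₀ = 0
    · refine norm 1 (-1 * x₀) one_ne_zero fun hI' hV hV0 hr => reaches_inverse_square hI' hV hV0
        hμ (hne' 1 one_pos) ?_
      rintro _ ⟨x, hx, rfl⟩
      beta_reduce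
      rw [hr x hx, hform (s := 0) one_pos (by rw [hc0]; ring) x hx]; ring
    · obtain ⟨k, s, hk, hs, hks⟩ := exists_sq_root hc0
      refine norm k (-k * x₀) hk.ne' fun hI' hV hV0 hr => reaches_bessel hI' hV hV0 hs hμ
        (hne' k hk) ?_
      rintro _ ⟨x, hx, rfl⟩
      beta_reduce
      rw [hr x hx, hform hk hks x hx]

end ConstantPotential

/-! ### Completeness of the list -/

theorem exists_straightening {I : Set ℝ} (hI : IsOpenInterval I) {A B : ℝ → ℝ}
    (hA : ContDiffOn ℝ ∞ A I) (hB : ContDiffOn ℝ ∞ B I) (h0 : ∀ x ∈ I, A x ≠ 0) :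
    ∃ (ε : ℝ) (a X b : ℝ → ℝ), Straightening ε I A B a X b := by
  obtain ⟨ε, hε, hs⟩ : ∃ ε : ℝ, ε * ε = 1 ∧ ∀ x ∈ I, 0 < ε * A x := by
    rcases hI.isPreconnected.eq_or_eq_neg_of_sq_eq hA.continuousOn hA.continuousOn.abs
      (fun x _ => by simp) (fun hx => abs_ne_zero.2 (h0 _ hx)) with h | h
    · exact ⟨1, one_mul 1, fun x hx => by
        rw [one_mul, h hx]; exact abs_pos.2 (h0 x hx)⟩
    · exact ⟨-1, by norm_num, fun x hx => by
        rw [h hx, Pi.neg_apply, neg_one_mul, neg_neg]; exact abs_pos.2 (h0 x hx)⟩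
  have ha : ContDiffOn ℝ ∞ (fun x => √(ε * A x)) I :=
    (contDiffOn_const.mul hA).sqrt fun x hx => (hs x hx).ne'
  have hn : ∀ x ∈ I, √(ε * A x) ≠ 0 := fun x hx => (Real.sqrt_pos.2 (hs x hx)).ne'
  obtain ⟨X, hX⟩ := hI.exists_antideriv (f := fun x => 1 / √(ε * A x))
    (continuousOn_const.div ha.continuousOn hn)
  refine ⟨ε, fun x => √(ε * A x), X,
    fun x => (B x + ε * √(ε * A x) * deriv (fun x => √(ε * A x)) x) / √(ε * A x),
    hI.isOpen, hε, ha, ?_, hn, hX, fun x hx => ?_, fun x hx => ?_⟩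
  · exact (hB.add ((contDiffOn_const.mul ha).mul (deriv_smooth ha hI.isOpen))).div ha hn
  · rw [Real.sq_sqrt (hs x hx).le, ← mul_assoc, hε, one_mul]
  · have := hn x hx
    field_simp
    ring

theorem Straightening.exists_table {ε ε' : ℝ} {I : Set ℝ} {A B a X b : ℝ → ℝ}
    (s : Straightening ε' I A B a X b) (hI : IsOpenInterval I)
    (hP : PotForm I X (potential ε' a b)) :
    ∃ (p : TableCase) (k c : ℝ) (B' : ℝ → ℝ), k ≠ 0 ∧
      IsTableDrift ε p ((fun x => k * X x + c) '' I) B' ∧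
      ∀ x ∈ I, B' (k * X x + c) = ε * ε' * b x / k := by
  have hX := s.smooth_X
  have hXn : ∀ x ∈ I, deriv X x ≠ 0 := fun x hx => by
    rw [(s.deriv_X x hx).deriv]; exact one_div_ne_zero (s.ne_zero x hx)
  obtain ⟨ψ, hψ, hl⟩ := hI.exists_smooth_inverse hX hXn
  have hY := hI.image_of_deriv_ne_zero hX hXn
  have dψ : ∀ x ∈ I, HasDerivAt ψ (a x) (X x) := fun x hx => by
    have h1 := hasDerivAt_on hψ hY.isOpen ⟨x, hx, rfl⟩
    have h2 := (h1.comp x (s.deriv_X x hx)).unique ((hasDerivAt_id x).congr_on hI.isOpen hl hx)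
    have := s.ne_zero x hx
    field_simp at h2
    rwa [h2] at h1
  obtain ⟨Φ, hΦ⟩ := hI.exists_antideriv (f := fun x => b x / a x)
    (s.smooth_b.continuousOn.div s.smooth_a.continuousOn s.ne_zero)
  have dw : ∀ x ∈ I, HasDerivAt (fun y => Real.exp (-(ε' / 2) * Φ (ψ y)))
      (-(ε' / 2) * b x * Real.exp (-(ε' / 2) * Φ x)) (X x) := fun x hx => by
    have hΦ' : HasDerivAt Φ (b x / a x) (ψ (X x)) := by rw [hl x hx]; exact hΦ x hx
    have h : HasDerivAt (fun y => Φ (ψ y)) (b x) (X x) :=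
      (hΦ'.comp (X x) (dψ x hx)).congr_deriv (div_mul_cancel₀ _ (s.ne_zero x hx))
    refine (h.const_mul (-(ε' / 2))).exp.congr_deriv ?_
    rw [hl x hx]
    ring
  have hsol : IsSol (fun y => potential ε' a b (ψ y)) (X '' I)
      (fun y => Real.exp (-(ε' / 2) * Φ (ψ y)))
      (fun y => -(ε' / 2) * b (ψ y) * Real.exp (-(ε' / 2) * Φ (ψ y))) := by
    rintro _ ⟨x, hx, rfl⟩
    refine ⟨by simpa only [hl x hx] using dw x hx, ?_⟩
    have db : HasDerivAt b (deriv b x) (ψ (X x)) := by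
      rw [hl x hx]; exact hasDerivAt_on s.smooth_b s.isOpen hx
    refine (((db.comp (X x) (dψ x hx)).const_mul (-(ε' / 2))).fun_mul (dw x hx)).congr_deriv ?_
    simp only [Function.comp_apply, hl x hx, potential]
    linear_combination (b x ^ 2 / 4 * Real.exp (-(ε' / 2) * Φ x)) * s.sq
  have hP' : PotForm (X '' I) (fun y => y) (fun y => potential ε' a b (ψ y)) := by
    obtain ⟨c₀, c₁, c₂, μ, x₀, h, hQ⟩ := hP
    refine ⟨c₀, c₁, c₂, μ, x₀, h.imp id fun h => ⟨h.1, ?_⟩, ?_⟩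
    · rintro _ ⟨x, hx, rfl⟩; exact h.2 x hx
    · rintro _ ⟨x, hx, rfl⟩; simp only [hl x hx]; exact hQ x hx
  obtain ⟨p, k, c, C, V, hk, hC, hp, hR, hV⟩ :=
    reaches_of_pot hY hsol (fun _ _ => Real.exp_ne_zero _) hP'
  refine ⟨p, k, c, fun z => -2 * ε * deriv V z / V z, hk, ?_, fun x hx => ?_⟩
  · have := isOpenInterval_affine hY hk c
    rw [Set.image_image] at this hR
    exact ⟨this, hp, V, hR, fun _ _ => rfl⟩
  · have hm : X x ∈ X '' I := ⟨x, hx, rfl⟩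
    have hmV : k * X x + c ∈ (fun x => k * x + c) '' (X '' I) := ⟨_, hm, rfl⟩
    have d1 := (hR.1 _ hmV).differentiableAt.hasDerivAt.comp (X x) (hasDerivAt_affine k c (X x))
    have d2 := d1.unique (((dw x hx).const_mul C).congr_on hY.isOpen
      (fun y hy => by simpa using hV y hy) hm)
    have hv := hV _ hm
    beta_reduce at hv
    rw [hl x hx] at hv
    have hd : deriv V (k * X x + c) = C * (-(ε' / 2) * b x * Real.exp (-(ε' / 2) * Φ x)) / k := by
      rw [← d2]; field_simp
    beta_reduce
    rw [hd, hv]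
    field_simp

theorem TableCase.c₁_eq_zero {p : TableCase} (hs : p.IsSingular) : p.c₁ = 0 := by
  cases p <;> first | rfl | exact hs.elim

theorem IsTableDrift.zero_notMem {ε : ℝ} {p : TableCase} {I : Set ℝ} {B : ℝ → ℝ}
    (h : IsTableDrift ε p I B) (hs : p.μ ≠ 0) : p.IsSingular ∧ (0 : ℝ) ∉ I := by
  have : p.IsSingular := by
    by_contra hn
    exact hs (TableCase.μ_eq_zero hn)
  obtain ⟨-, -, W, hR, -⟩ := h
  exact ⟨this, hR.2.2.1 this⟩

/-- An equation whose coefficients are related to those of an equation of the list as in the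
normal form of equivalence transformations has additional essential symmetries. -/
theorem exists_extension_of_table {ε : ℝ} (hε : ε * ε = 1) {I J : Set ℝ} (hI : IsOpenInterval I)
    (hJ : IsOpenInterval J) {A B χ B' : ℝ → ℝ} {p : TableCase} {a : ℝ} (ha : a ≠ 0)
    (hχ : ContDiffOn ℝ ∞ χ I) (hne : ∀ x ∈ I, deriv χ x ≠ 0) (hT : IsTableDrift ε p (χ '' I) B')
    (hA : ∀ x ∈ I, a * ε = A x * deriv χ x ^ 2)
    (hB : ∀ x ∈ I, a * B' (χ x) = B x * deriv χ x - A x * deriv (deriv χ) x) :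
    ∃ v, (IsLieSymmetry A B J I v ∧ IsEssential J I v) ∧
      ¬ ∃ c₀ c₁ : ℝ, ∀ t ∈ J, ∀ x ∈ I, ∀ u, v t x u = (c₀, 0, c₁ * u) := by
  obtain ⟨l, σ, hl, hσ, hal⟩ := exists_sq_root ha
  replace hσ : σ * σ = 1 := by rcases hσ with rfl | rfl <;> norm_num
  have hl0 := hl.ne'
  have hχ' := deriv_smooth hχ hI.isOpen
  have dB' : ∀ x ∈ I, HasDerivAt (fun x => σ * l * B' (χ x)) (σ * l * (deriv B' (χ x) * deriv χ x)) x :=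
    fun x hx => ((hasDerivAt_on hT.contDiffOn hT.1.isOpen ⟨x, hx, rfl⟩).comp x
      (hasDerivAt_on hχ hI.isOpen hx)).const_mul _
  have s : Straightening (σ * ε) I A B (fun x => l / deriv χ x) (fun x => χ x / l)
      (fun x => σ * l * B' (χ x)) := by
    refine ⟨hI.isOpen, by linear_combination (ε * ε) * hσ + hε, contDiffOn_const.div hχ' hne,
      contDiffOn_const.mul (hT.contDiffOn.comp hχ fun x hx => ⟨x, hx, rfl⟩),
      fun x hx => div_ne_zero hl0 (hne x hx), fun x hx => ?_, fun x hx => ?_, fun x hx => ?_⟩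
    · refine ((hasDerivAt_on hχ hI.isOpen hx).div_const l).congr_deriv ?_
      rw [one_div_div]
    · have := hne x hx
      have := hA x hx
      field_simp
      rw [← this, hal]; ring
    · have d := ((hasDerivAt_const x l).fun_div (hasDerivAt_on hχ' hI.isOpen hx)
        (hne x hx)).deriv
      rw [d]
      have h0 := hne x hx
      have h1 := hA x hx
      have h2 := hB x hx
      rw [hal] at h1 h2
      field_simp
      linear_combination (-deriv χ x ^ 2) * h2 - deriv (deriv χ) x * h1
  refine s.exists_extension hJ hI ⟨l ^ 2 * p.c₀, l ^ 3 * p.c₁, l ^ 4 * p.c₂, p.μ, 0, ?_, ?_⟩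
  · by_cases hμ : p.μ = 0
    · exact Or.inl hμ
    · obtain ⟨hs, h0⟩ := hT.zero_notMem hμ
      refine Or.inr ⟨by rw [TableCase.c₁_eq_zero hs, mul_zero], fun x hx he => h0 ⟨x, hx, ?_⟩⟩
      simpa [hl0] using he
  · intro x hx
    have hr := hT.redPot_eq hε ⟨x, hx, rfl⟩
    rw [redPot] at hr
    have h0 := hne x hx
    have e : potential (σ * ε) (fun x => l / deriv χ x) (fun x => σ * l * B' (χ x)) x
        = l ^ 2 * p.pot (χ x) := by
      rw [potential, (dB' x hx).deriv, ← hr]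
      field_simp
      linear_combination (2 * B' (χ x) ^ 2 - 4 * ε * deriv B' (χ x)) * hσ
    rw [e, TableCase.pot, sub_zero]
    field_simp

theorem FPClass.Equivalent.normal_form {E : Type} [NormedAddCommGroup E] [NormedSpace ℝ E]
    {L : FPClass E} {ε : ℝ} {mk : (ℝ → ℝ) → ℝ → E} (hL : L.Rich ε mk)
    {I I' : Set ℝ} {θ θ' : ℝ → E} (hI : IsOpenInterval I) (hI' : IsOpen I') (hθ : L.Adm I θ)
    (h : L.Equivalent I θ I' θ') :
    ∃ (a : ℝ) (χ : ℝ → ℝ), a ≠ 0 ∧ ContDiffOn ℝ ∞ χ I ∧ (∀ x ∈ I, deriv χ x ≠ 0) ∧ I' = χ '' I ∧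
      ∀ x ∈ I, a * L.diffusion (θ' (χ x)) = L.diffusion (θ x) * deriv χ x ^ 2 ∧
        a * L.drift (θ' (χ x))
          = L.drift (θ x) * deriv χ x - L.diffusion (θ x) * deriv (deriv χ) x := by
  obtain ⟨J, K, hJ, hK, T, X, U, Θ, ht, rfl, hm⟩ := h
  obtain ⟨a, χ, ha, hχ, hne, hX, hc⟩ := ht.normal_form hL hJ hI hK hI'
  refine ⟨a, χ, ha, hχ, hne, ?_, hc θ θ' hθ hm⟩
  obtain ⟨t, ht⟩ := hJ.nonempty
  obtain ⟨u, hu⟩ := hK.nonempty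
  ext y
  constructor
  · rintro ⟨t, ht, x, hx, u, hu, rfl⟩
    exact ⟨x, hx, (hX t ht x hx u hu).symm⟩
  · rintro ⟨x, hx, rfl⟩
    exact ⟨t, ht, x, hx, u, hu, hX t ht x hx u hu⟩

section Completeness

variable {ε : ℝ} {I J : Set ℝ}

theorem isExtension_reduced_iff (hε : ε * ε = 1) (hJ : IsOpenInterval J) (hI : IsOpenInterval I)
    {B : ℝ → ℝ} (hB : (reducedFP ε).Adm I B) :
    (reducedFP ε).IsExtension J I B ↔ ∃ (p : TableCase) (I' : Set ℝ) (B' : ℝ → ℝ),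
      IsTableDrift ε p I' B' ∧ (reducedFP ε).Equivalent I B I' B' := by
  have hε0 : ε ≠ 0 := left_ne_zero_of_mul_eq_one hε
  constructor
  · rintro ⟨v, hv, hn⟩
    rw [mem_essKernel_reduced hε0 hJ hI] at hn
    have s := straightening_reduced hε hI.isOpen (adm_reduced_iff.1 hB)
    obtain ⟨p, k, c, B', hk, hT, h⟩ :=
      s.exists_table (ε := ε) hI (s.potForm_of_extension hJ hI hv hn)
    refine ⟨p, _, B', hT, equivalent_reduced hε0 hI hk fun x hx => ?_⟩
    rw [h x hx, hε, one_mul]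
  · rintro ⟨p, I', B', hT, he⟩
    obtain ⟨a, χ, ha, hχ, hne, rfl, hc⟩ :=
      he.normal_form (rich_reduced hε0) hI hT.1.isOpen hB
    obtain ⟨v, hv, hn⟩ := exists_extension_of_table hε hI hJ ha hχ hne hT
      (fun x hx => (hc x hx).1) (fun x hx => (hc x hx).2)
    exact ⟨v, hv, fun h => hn ((mem_essKernel_reduced hε0 hJ hI).1 h)⟩

theorem isExtension_full_iff (hε : ε * ε = 1) (hJ : IsOpenInterval J) (hI : IsOpenInterval I)
    {θ : ℝ → ℝ × ℝ} (hθ : fullFP.Adm I θ) :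
    fullFP.IsExtension J I θ ↔ ∃ (p : TableCase) (I' : Set ℝ) (B' : ℝ → ℝ),
      IsTableDrift ε p I' B' ∧ fullFP.Equivalent I θ I' (fun x => (ε, B' x)) := by
  have hε0 : ε ≠ 0 := left_ne_zero_of_mul_eq_one hε
  obtain ⟨hA, hB, h0⟩ := adm_full_iff.1 hθ
  constructor
  · rintro ⟨v, hv, hn⟩
    rw [mem_essKernel_full hJ hI] at hn
    obtain ⟨ε', a, X, b, s⟩ := exists_straightening hI hA hB h0
    obtain ⟨p, k, c, B', hk, hT, h⟩ :=
      s.exists_table (ε := ε) hI (s.potForm_of_extension hJ hI hv hn)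
    have d : ∀ x ∈ I, deriv (fun x => k * X x + c) x = k * (1 / a x) := fun x hx =>
      (((s.deriv_X x hx).const_mul k).add_const c).deriv
    have hk2 := s.sq
    have hε'0 : ε' ≠ 0 := left_ne_zero_of_mul_eq_one hk2
    refine ⟨p, _, B', hT, equivalent_full hI ((contDiffOn_const.mul s.smooth_X).add contDiffOn_const)
      (fun x hx => ?_) (s := ε * ε' * k ^ 2) (by positivity) fun x hx => ?_⟩
    · rw [d x hx]
      exact mul_ne_zero hk (one_div_ne_zero (s.ne_zero x hx))
    · have d2 := ((((hasDerivAt_const x (1 : ℝ)).fun_div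
        (hasDerivAt_on s.smooth_a s.isOpen hx) (s.ne_zero x hx)).const_mul
        k).congr_on hI.isOpen d hx).deriv
      have h1 := s.A_eq x hx
      have h2 := s.B_eq x hx
      have h3 := s.ne_zero x hx
      beta_reduce at h1 h2
      rw [h x hx, d2, d x hx, h1, h2]
      refine Prod.ext ?_ ?_
      · simp only
        field_simp
        linear_combination hε
      · simp only
        field_simp
        linear_combination b x * hε + (ε ^ 2 * b x) * hk2
  · rintro ⟨p, I', B', hT, he⟩
    obtain ⟨a, χ, ha, hχ, hne, rfl, hc⟩ :=
      he.normal_form (rich_full hε0) hI hT.1.isOpen hθ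
    obtain ⟨v, hv, hn⟩ := exists_extension_of_table hε hI hJ ha hχ hne hT
      (fun x hx => (hc x hx).1) (fun x hx => (hc x hx).2)
    exact ⟨v, hv, fun h => hn ((mem_essKernel_full hJ hI).1 h)⟩

/-- Equivalent equations of the list are related by an affine change of `x`. -/
theorem exists_affine_of_equivalent (hε : ε * ε = 1) {I' : Set ℝ} {B B' : ℝ → ℝ}
    (hI : IsOpenInterval I) (hI' : IsOpen I') (hB : ContDiffOn ℝ ∞ B I)
    (h : (reducedFP ε).Equivalent I B I' B' ∨
      fullFP.Equivalent I (fun x => (ε, B x)) I' (fun x => (ε, B' x))) :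
    ∃ k c : ℝ, k ≠ 0 ∧ I' = (fun x => k * x + c) '' I ∧ ∀ x ∈ I, B' (k * x + c) = B x / k := by
  have hε0 : ε ≠ 0 := left_ne_zero_of_mul_eq_one hε
  obtain ⟨a, χ, ha, hχ, hne, rfl, hc⟩ : ∃ (a : ℝ) (χ : ℝ → ℝ), a ≠ 0 ∧ ContDiffOn ℝ ∞ χ I ∧
      (∀ x ∈ I, deriv χ x ≠ 0) ∧ I' = χ '' I ∧ ∀ x ∈ I, a * ε = ε * deriv χ x ^ 2 ∧
        a * B' (χ x) = B x * deriv χ x - ε * deriv (deriv χ) x := by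
    rcases h with h | h
    · exact h.normal_form (rich_reduced hε0) hI hI' (adm_reduced_iff.2 hB)
    · exact h.normal_form (rich_full hε0) hI hI' (adm_full_const hε0 hB)
  have hχ' := deriv_smooth hχ hI.isOpen
  have hsq : ∀ x ∈ I, deriv χ x ^ 2 = a := fun x hx =>
    mul_left_cancel₀ hε0 ((hc x hx).1.symm.trans (mul_comm _ _))
  have d2 : ∀ x ∈ I, deriv (deriv χ) x = 0 := fun x hx => by
    have := ((hasDerivAt_on hχ' hI.isOpen hx).fun_pow 2).unique
      ((hasDerivAt_const x a).congr_on hI.isOpen hsq hx)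
    simpa [hne x hx] using this
  obtain ⟨x₀, hx₀⟩ := hI.nonempty
  have hk : ∀ x ∈ I, deriv χ x = deriv χ x₀ := fun x hx => hI.eq_of_hasDerivAt_zero
    (fun y hy => d2 y hy ▸ hasDerivAt_on hχ' hI.isOpen hy) hx hx₀
  have hχe : ∀ x ∈ I, χ x = deriv χ x₀ * x + (χ x₀ - deriv χ x₀ * x₀) := fun x hx => by
    have := hI.eq_of_hasDerivAt_zero (f := fun x => χ x - deriv χ x₀ * x) (fun y hy =>
      ((hasDerivAt_on hχ hI.isOpen hy).sub
        ((hasDerivAt_id y).const_mul _)).congr_deriv (by rw [hk y hy]; ring)) hx hx₀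
    linear_combination this
  refine ⟨deriv χ x₀, χ x₀ - deriv χ x₀ * x₀, hne x₀ hx₀, Set.image_congr hχe, fun x hx => ?_⟩
  have h1 := (hc x hx).2
  have h0 := hne x₀ hx₀
  rw [d2 x hx, hk x hx, ← hsq x₀ hx₀] at h1
  rw [← hχe x hx]
  field_simp
  apply mul_left_cancel₀ h0
  linear_combination h1

end Completeness

/-! ### Irredundance of the list -/

namespace TableCase

theorem coeff_cases (p : TableCase) : (p.c₁ = 1 ∧ p.c₂ = 0 ∧ p.c₀ = 0 ∧ p.μ = 0) ∨
    (p.c₁ = 0 ∧ (p.c₂ = 1 ∨ p.c₂ = -1)) ∨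
    (p.c₁ = 0 ∧ p.c₂ = 0 ∧ (p.c₀ = 0 ∨ p.c₀ = 1 ∨ p.c₀ = -1)) := by
  cases p <;> simp [c₀, c₁, c₂, μ]

theorem coeff_eq_of_affine {p p' : TableCase} {I : Set ℝ} (hI : I.Infinite) {k c : ℝ} (hk : k ≠ 0)
    (h : ∀ x ∈ I, p.pot x = k ^ 2 * p'.pot (k * x + c)) (h0 : p.μ ≠ 0 → ∀ x ∈ I, x ≠ 0)
    (h0' : p'.μ ≠ 0 → ∀ x ∈ I, k * x + c ≠ 0) :
    (p'.c₀ = p.c₀ ∧ p'.c₁ = p.c₁ ∧ p'.c₂ = p.c₂ ∧ p'.μ = p.μ) ∧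
      (p.c₁ ≠ 0 ∨ p.c₂ ≠ 0 ∨ p.μ ≠ 0 → c = 0) ∧ (p.c₀ ≠ 0 ∨ p.c₂ ≠ 0 → k = 1 ∨ k = -1) ∧
      (p.c₁ ≠ 0 → k = 1) := by
  have hx : ∀ {m x : ℝ}, (m ≠ 0 → x ≠ 0) → m / x ^ 2 * x ^ 2 = m := fun {m x} h => by
    by_cases hm : m = 0
    · simp [hm]
    · exact div_mul_cancel₀ _ (pow_ne_zero 2 (h hm))
  obtain ⟨e0, e1, e2, e3, e4, e5, e6⟩ := coeff_eq_zero_of_infinite hI (p₀ := p.μ * c ^ 2)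
    (p₁ := 2 * p.μ * k * c)
    (p₂ := p.μ * k ^ 2 + p.c₀ * c ^ 2
      - k ^ 2 * (p'.μ + p'.c₀ * c ^ 2 + p'.c₁ * c ^ 3 + p'.c₂ * c ^ 4))
    (p₃ := 2 * p.c₀ * k * c + p.c₁ * c ^ 2
      - k ^ 2 * (2 * p'.c₀ * c * k + 3 * p'.c₁ * c ^ 2 * k + 4 * p'.c₂ * c ^ 3 * k))
    (p₄ := p.c₀ * k ^ 2 + 2 * p.c₁ * k * c + p.c₂ * c ^ 2
      - k ^ 2 * (p'.c₀ * k ^ 2 + 3 * p'.c₁ * c * k ^ 2 + 6 * p'.c₂ * c ^ 2 * k ^ 2))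
    (p₅ := p.c₁ * k ^ 2 + 2 * p.c₂ * k * c - k ^ 2 * (p'.c₁ * k ^ 3 + 4 * p'.c₂ * c * k ^ 3))
    (p₆ := p.c₂ * k ^ 2 - k ^ 2 * p'.c₂ * k ^ 4) (fun x hxI => by
      have h1 := hx fun hm => h0 hm x hxI
      have h2 := hx fun hm => h0' hm x hxI
      have h3 := h x hxI
      rw [pot, pot] at h3
      linear_combination (x ^ 2 * (k * x + c) ^ 2) * h3 - (k * x + c) ^ 2 * h1 + k ^ 2 * x ^ 2 * h2)
  have hk2 : 0 < k ^ 2 := by positivity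
  have e6' : p.c₂ = p'.c₂ * k ^ 4 := mul_left_cancel₀ hk2.ne' (by linear_combination e6)
  have sq1 : k ^ 2 = 1 → k = 1 ∨ k = -1 := fun h => by
    have : (k - 1) * (k + 1) = 0 := by linear_combination h
    exact (mul_eq_zero.1 this).imp sub_eq_zero.1 eq_neg_of_add_eq_zero_left
  have hk4 : 0 < k ^ 4 := by positivity
  have hz : p.c₂ = 0 → p'.c₂ = 0 := fun h =>
    (mul_eq_zero.1 (e6'.symm.trans h)).resolve_right hk4.ne'
  rcases p.coeff_cases with ⟨a1, a2, a0, am⟩ | ⟨a1, a2⟩ | ⟨a1, a2, a0⟩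
  · have b2 := hz a2
    rw [a1, a2, b2] at e5
    rcases p'.coeff_cases with ⟨b1, -, b0, bm⟩ | ⟨b1, b2'⟩ | ⟨b1, -⟩
    · have k1 : k = 1 := by
        have : (k - 1) * ((k + 1 / 2) ^ 2 + 3 / 4) = 0 :=
          mul_left_cancel₀ hk2.ne' (by rw [b1] at e5; linear_combination -e5)
        exact sub_eq_zero.1 ((mul_eq_zero.1 this).resolve_right (by positivity))
      rw [a0, a1, a2, b0, b1, b2, k1] at e4
      have c0 : c = 0 := by linarith
      simp [a0, a1, a2, am, b0, b1, b2, bm, c0, k1]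
    · rw [b2] at b2'; norm_num at b2'
    · rw [b1] at e5
      exact absurd (by linear_combination e5) hk2.ne'
  · have b2 : p'.c₂ = p.c₂ ∧ k ^ 2 = 1 := by
      have aux : k ^ 4 = 1 → k ^ 2 = 1 := fun h =>
        (sq_eq_sq₀ hk2.le zero_le_one).1 (by linear_combination h)
      rcases p'.coeff_cases with ⟨-, b2, -⟩ | ⟨-, b2⟩ | ⟨-, b2, -⟩
      · rw [b2, zero_mul] at e6'; rw [e6'] at a2; norm_num at a2
      · rcases a2 with a2 | a2 <;> rcases b2 with b2 | b2 <;> rw [a2, b2] at e6' ⊢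
        · exact ⟨rfl, aux (by linarith)⟩
        · linarith
        · linarith
        · exact ⟨rfl, aux (by linarith)⟩
      · rw [b2, zero_mul] at e6'; rw [e6'] at a2; norm_num at a2
    obtain ⟨b2, hk1⟩ := b2
    have a2' : p.c₂ ≠ 0 := by rcases a2 with h | h <;> rw [h] <;> norm_num
    have b1 : p'.c₁ = 0 := by
      rcases p'.coeff_cases with ⟨-, h, -⟩ | ⟨h, -⟩ | ⟨h, -⟩
      · exact absurd (b2.symm.trans h) a2'
      · exact h
      · exact h
    have c0 : c = 0 := by
      have : p.c₂ * k * c = 0 := by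
        rw [a1, b1, b2] at e5
        linear_combination (-1 / 2) * e5 - 2 * p.c₂ * c * k * (k ^ 2 + 1) * hk1
      simpa [a2', hk] using this
    rw [c0, hk1] at e4 e2
    refine ⟨⟨by linarith, by rw [a1, b1], b2, by linarith⟩, fun _ => c0, fun _ => sq1 hk1,
      fun h => absurd a1 h⟩
  · have b2 := hz a2
    have b1 : p'.c₁ = 0 := by
      have : p'.c₁ * (k ^ 2 * k ^ 3) = 0 := by
        rw [a1, a2, b2] at e5
        linear_combination -e5
      exact (mul_eq_zero.1 this).resolve_right (by positivity)
    rw [a1, a2, b1, b2] at e4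
    rw [b1, b2] at e2
    have h04 : p.c₀ = k ^ 2 * p'.c₀ := mul_left_cancel₀ hk2.ne' (by linear_combination e4)
    have hm : p'.μ = p.μ := mul_left_cancel₀ hk2.ne' (by linear_combination c ^ 2 * h04 - e2)
    have b0 : p'.c₀ = 0 ∨ p'.c₀ = 1 ∨ p'.c₀ = -1 := by
      rcases p'.coeff_cases with ⟨h, -⟩ | ⟨-, h⟩ | ⟨-, -, h⟩
      · rw [b1] at h; norm_num at h
      · rw [b2] at h; norm_num at h
      · exact h
    have h0 : p'.c₀ = p.c₀ ∧ (p.c₀ ≠ 0 → k ^ 2 = 1) := by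
      rcases a0 with a0 | a0 | a0 <;> rcases b0 with b0 | b0 | b0 <;> rw [a0, b0] at h04 ⊢ <;>
        first
        | exact ⟨rfl, fun h => absurd rfl h⟩
        | exact ⟨rfl, fun _ => by linarith⟩
        | (exfalso; linarith)
    refine ⟨⟨h0.1, by rw [a1, b1], by rw [a2, b2], hm⟩, ?_, ?_, fun h => absurd a1 h⟩
    · rintro (h | h | h)
      · exact absurd a1 h
      · exact absurd a2 h
      · simpa [h, hk] using e1
    · rintro (h | h)
      · exact sq1 (h0.2 h)
      · exact absurd a2 h

end TableCase

section Relation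

variable {ε k c : ℝ} {p p' : TableCase} {I : Set ℝ} {B B' : ℝ → ℝ}

theorem IsTableDrift.pot_affine (hε : ε * ε = 1) (h : IsTableDrift ε p I B) (hk : k ≠ 0)
    (h' : IsTableDrift ε p' ((fun x => k * x + c) '' I) B')
    (hB : ∀ x ∈ I, B' (k * x + c) = B x / k) :
    ∀ x ∈ I, p.pot x = k ^ 2 * p'.pot (k * x + c) := fun x hx => by
  have d := ((((hasDerivAt_on h'.contDiffOn h'.1.isOpen ⟨x, hx, rfl⟩).comp x
    (hasDerivAt_affine k c x)).const_mul k).congr_on h.1.isOpen (f := B)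
      (fun y hy => by simp only [Function.comp_apply, hB y hy]; field_simp) hx).deriv
  rw [← h.redPot_eq hε hx, ← h'.redPot_eq hε ⟨x, hx, rfl⟩, redPot, redPot, d, hB x hx]
  field_simp

theorem IsTableDrift.exists_sol_affine (h : IsTableDrift ε p I B) (hε : ε * ε = 1) (hk : k ≠ 0)
    (h' : IsTableDrift ε p' ((fun x => k * x + c) '' I) B')
    (hB : ∀ x ∈ I, B' (k * x + c) = B x / k) :
    ∃ (W V : ℝ → ℝ) (C : ℝ), Realizes p I W ∧ Realizes p' ((fun x => k * x + c) '' I) V ∧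
      C ≠ 0 ∧ ∀ x ∈ I, V (k * x + c) = C * W x := by
  obtain ⟨W, hW, sW, W0, BW⟩ := h.exists_sol
  obtain ⟨V, hV, sV, V0, BV⟩ := h'.exists_sol
  have hε0 : ε ≠ 0 := left_ne_zero_of_mul_eq_one hε
  obtain ⟨x₀, hx₀⟩ := h.1.nonempty
  refine ⟨W, V, V (k * x₀ + c) / W x₀, hW, hV, div_ne_zero (V0 _ ⟨x₀, hx₀, rfl⟩) (W0 x₀ hx₀),
    fun x hx => ?_⟩
  rw [← h.1.eq_of_hasDerivAt_zero (f := fun x => V (k * x + c) / W x) (fun y hy => ?_) hx hx₀]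
  · exact (div_mul_cancel₀ _ (W0 x hx)).symm
  · have hm : k * y + c ∈ (fun x => k * x + c) '' I := ⟨y, hy, rfl⟩
    have e := hB y hy
    rw [BV _ hm, BW y hy] at e
    have w0 := W0 y hy
    have v0 := V0 _ hm
    refine (((sV _ hm).1.comp y (hasDerivAt_affine k c y)).div (sW y hy).1 w0).congr_deriv ?_
    field_simp at e
    simp only [Function.comp_apply]
    rw [show deriv V (k * y + c) * k * W y - V (k * y + c) * deriv W y = 0 by
      linear_combination -e, zero_div]

end Relation

open Complex

theorem IsOrder.eq_of_sq {ν ν' : ℂ} (h : IsOrder ν) (h' : IsOrder ν')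
    (he : (ν' ^ 2).re = (ν ^ 2).re) : ν' = ν := by
  have hs : ∀ {r s : ℝ}, 0 ≤ r → 0 ≤ s → s ^ 2 = r ^ 2 → s = r := fun h h' he =>
    (sq_eq_sq₀ h' h).1 he
  rcases h with ⟨r, hr, rfl⟩ | ⟨r, hr, rfl⟩ <;> rcases h' with ⟨s, hs', rfl⟩ | ⟨s, hs', rfl⟩ <;>
    simp only [mul_pow, I_sq, neg_one_mul, ← ofReal_pow, ← ofReal_neg,
      ofReal_re] at he
  · rw [hs hr hs' he]
  · nlinarith
  · nlinarith
  · rw [hs hr.le hs'.le (by linarith)]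

theorem TableCase.fund_neg {p : TableCase} (h : p.IsSingular ∨ p.IsQuarter) (x : ℝ) :
    p.fund.1 (-x) = p.fund.1 x ∧ p.fund.2 (-x) = p.fund.2 x := by
  cases p <;> first
    | exact (h.elim id id).elim
    | simp [fund, oscW, expW]

open TableCase in
theorem IsTableDrift.sameEntry_of_affine {ε k c : ℝ} {p p' : TableCase} {I : Set ℝ} {B B' : ℝ → ℝ}
    (h : IsTableDrift ε p I B) (hε : ε * ε = 1) (hk : k ≠ 0)
    (h' : IsTableDrift ε p' ((fun x => k * x + c) '' I) B')
    (hB : ∀ x ∈ I, B' (k * x + c) = B x / k) : SameEntry p p' I B B' := by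
  obtain ⟨⟨h0, h1, h2, hμ⟩, hc, hk1, hk2⟩ := coeff_eq_of_affine h.1.infinite hk
    (h.pot_affine hε hk h' hB) (fun hm x hx hx0 => (h.zero_notMem hm).2 (hx0 ▸ hx))
    (fun hm x hx hx0 => (h'.zero_notMem hm).2 ⟨x, hx, hx0⟩)
  have hp := h.2.1
  have hp' := h'.2.1
  have hs : p'.IsSingular ↔ p.IsSingular := by
    refine not_iff_not.1 ⟨fun h => fun hs => ?_, fun h => fun hs => ?_⟩
    · exact μ_ne_zero hp hs (hμ ▸ μ_eq_zero h)
    · exact μ_ne_zero hp' hs (hμ ▸ μ_eq_zero h)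
  have hμs : p.IsSingular → p.μ ≠ 0 := μ_ne_zero hp
  obtain ⟨W, V, C, hW, hV, hC, hWV⟩ := h.exists_sol_affine hε hk h' hB
  obtain ⟨D, hDI, hD, hdom, hmem⟩ := exists_sub_interval p h.1 hW.2.2.1
  have key : ∀ u₁ v₁ u₂ v₂ : ℂ, (∀ x ∈ I, (p.IsQuarter ∧ (0 : ℝ) ∈ I → 0 < x) → x ∈ p.dom →
      (p'.IsQuarter ∧ (0 : ℝ) ∈ (fun x => k * x + c) '' I → 0 < k * x + c) ∧ k * x + c ∈ p'.dom ∧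
      p'.fund.1 (k * x + c) = u₁ * p.fund.1 x + v₁ * p.fund.2 x ∧
      p'.fund.2 (k * x + c) = u₂ * p.fund.1 x + v₂ * p.fund.2 x) →
      p'.coef.1 * u₁ + p'.coef.2 * u₂ = C * p.coef.1 ∧
      p'.coef.1 * v₁ + p'.coef.2 * v₂ = C * p.coef.2 := by
    intro u₁ v₁ u₂ v₂ hd
    refine ((isFund hp).mono hdom).comb_unique hD fun x hx => ?_
    have hq := (hmem x (hDI hx)).1 hx
    obtain ⟨d1, d2, d3, d4⟩ := hd x (hDI hx) hq (hdom hx)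
    have hVx : (V (k * x + c) : ℂ) = p'.W (k * x + c) := by
      by_cases hq' : p'.IsQuarter ∧ (0 : ℝ) ∈ (fun x => k * x + c) '' I
      · exact hV.2.2.2.1 hq' _ ⟨x, hDI hx, rfl⟩ (d1 hq')
      · exact hV.2.2.2.2 hq' _ ⟨x, hDI hx, rfl⟩
    have hWx : (W x : ℂ) = p.W x := by
      by_cases hq' : p.IsQuarter ∧ (0 : ℝ) ∈ I
      · exact hW.2.2.2.1 hq' _ (hDI hx) (hq hq')
      · exact hW.2.2.2.2 hq' _ (hDI hx)
    have e := congrArg (ofReal) (hWV x (hDI hx))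
    rw [ofReal_mul, hVx, hWx, p'.W_eq d2, p.W_eq (hdom hx), d3, d4] at e
    linear_combination e
  have even : p'.fund = p.fund → (p'.IsQuarter ↔ p.IsQuarter) → c = 0 → k = 1 ∨ k = -1 →
      (k = -1 → (p.IsSingular ∨ p.IsQuarter) ∧ ¬ (p.IsQuarter ∧ (0 : ℝ) ∈ I)) →
      p'.coef.1 = C * p.coef.1 ∧ p'.coef.2 = C * p.coef.2 := by
    intro hf hq hc0 hk hev
    have := key 1 0 0 1 fun x hx hx0 hxd => ?_
    · simpa using this
    have hd : k * x + c ∈ p'.dom := fun hsq => by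
      have := hxd ((or_congr hs hq).1 hsq)
      rw [hc0, add_zero]
      exact mul_ne_zero ‹_› this
    refine ⟨?_, hd, ?_⟩
    · rintro ⟨hq', y, hy, hy0⟩
      rcases hk with rfl | rfl
      · simp only [hc0, one_mul, add_zero] at hy0 ⊢
        exact hx0 ⟨hq.1 hq', hy0 ▸ hy⟩
      · simp only [hc0, neg_one_mul, add_zero, neg_eq_zero] at hy0
        exact absurd ⟨hq.1 hq', hy0 ▸ hy⟩ (hev rfl).2
    · rw [hf, hc0, add_zero]
      rcases hk with rfl | rfl
      · simp
      · simpa using fund_neg (hev rfl).1 x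
  have sing : p'.fund = p.fund → p.IsSingular → ¬ p.IsQuarter → ¬ p'.IsQuarter →
      p.c₀ ≠ 0 ∨ p.c₂ ≠ 0 → p'.coef.1 = C * p.coef.1 ∧ p'.coef.2 = C * p.coef.2 :=
    fun hf hs hq hq' hcc => even hf (iff_of_false hq' hq) (hc (Or.inr (Or.inr (hμs hs))))
      (hk1 hcc) fun _ => ⟨Or.inl hs, fun h => hq h.1⟩
  have hyp : p.fund = expo.fund → p'.fund = expo.fund →
      ¬ (p'.IsSingular ∨ p'.IsQuarter) → p.c₀ ≠ 0 →
      p'.coef.1 * p'.coef.2 = C ^ 2 * (p.coef.1 * p.coef.2) := by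
    intro hf hf' hsq hcc
    have e : (Real.exp c : ℂ) * Real.exp (-c) = 1 := by
      rw [← ofReal_mul, ← Real.exp_add, add_neg_cancel, Real.exp_zero, ofReal_one]
    rcases hk1 (Or.inl hcc) with rfl | rfl
    · obtain ⟨e1, e2⟩ := key (Real.exp c) 0 0 (Real.exp (-c)) fun x _ _ _ =>
        ⟨fun h => (hsq (Or.inr h.1)).elim, fun h => (hsq h).elim, by
          rw [hf, hf']
          simp only [fund, ← ofReal_mul, ← Real.exp_add, zero_mul, add_zero, zero_add]
          constructor <;> ring_nf⟩
      linear_combination (-(p'.coef.1 * p'.coef.2)) * e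
        + p'.coef.2 * Real.exp (-c) * e1 + C * p.coef.1 * e2
    · obtain ⟨e1, e2⟩ := key 0 (Real.exp c) (Real.exp (-c)) 0 fun x _ _ _ =>
        ⟨fun h => (hsq (Or.inr h.1)).elim, fun h => (hsq h).elim, by
          rw [hf, hf']
          simp only [fund, ← ofReal_mul, ← Real.exp_add, zero_mul, add_zero, zero_add]
          constructor <;> ring_nf⟩
      linear_combination (-(p'.coef.1 * p'.coef.2)) * e
        + p'.coef.1 * Real.exp c * e1 + C * p.coef.1 * e2
  have real : ∀ {a b a' b' : ℝ}, (b : ℂ) = C * a ∧ (b' : ℂ) = C * a' →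
      ∃ r : ℝ, r ≠ 0 ∧ b = r * a ∧ b' = r * a' := fun h =>
    ⟨C, hC, by exact_mod_cast h.1, by exact_mod_cast h.2⟩
  cases p <;> cases p' <;>
    (try simp only [IsSingular, iff_true, iff_false, not_true] at hs) <;>
    (try (norm_num [c₁] at h1; done)) <;>
    (try (norm_num [c₂] at h2; done)) <;>
    (try (norm_num [c₀] at h0; done)) <;>
    (try exact Or.inl trivial)
  all_goals simp only [μ, Admissible] at hμ hp hp'
  case cosLog.cosLog => exact Or.inl ((sq_eq_sq₀ hp.le hp'.le).1 (by linarith))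
  case cosLog.sqrtAbs | cosLog.sqrtLog | cosLog.power => nlinarith [sq_pos_of_pos hp]
  case sqrtAbs.cosLog | sqrtLog.cosLog | power.cosLog => nlinarith [sq_pos_of_pos hp']
  case sqrtAbs.power | sqrtLog.power | bessel.besselImag | modBessel.modBesselImag =>
    nlinarith [sq_pos_of_pos hp'.1]
  case power.sqrtAbs | power.sqrtLog | besselImag.bessel | modBesselImag.modBessel =>
    nlinarith [sq_pos_of_pos hp.1]
  case bessel.bessel | modBessel.modBessel =>
    obtain rfl := (sq_eq_sq₀ hp.1 hp'.1).1 (by linarith)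
    exact Or.inl ⟨rfl, real (sing rfl trivial id id (by simp [c₀]))⟩
  case besselImag.besselImag | modBesselImag.modBesselImag =>
    obtain rfl := (sq_eq_sq₀ hp.1.le hp'.1.le).1 (by linarith)
    exact Or.inl ⟨rfl, real (sing rfl trivial id id (by simp [c₀]))⟩
  case whittakerOsc.whittakerOsc | whittakerExp.whittakerExp =>
    obtain rfl := IsOrder.eq_of_sq hp.1.1 hp'.1.1 (by linarith)
    obtain rfl := neg_injective h0
    have := sing rfl trivial id id (by simp [c₂])
    first | exact Or.inl ⟨rfl, rfl, real this⟩ | exact Or.inl ⟨rfl, rfl, C, hC, this⟩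
  case quarterOsc.quarterOsc | quarterExp.quarterExp =>
    obtain rfl := neg_injective h0
    have c0 := hc (by simp [c₂])
    by_cases hr : (0 : ℝ) ∈ I ∧ k = -1
    · refine Or.inr ⟨rfl, hr.1, fun x hx => ?_⟩
      simpa [hr.2, c0, div_neg] using hB x hx
    · have := even rfl Iff.rfl c0 (hk1 (by simp [c₂])) fun h =>
        ⟨Or.inr trivial, fun h' => hr ⟨h'.2, h⟩⟩
      first | exact Or.inl ⟨rfl, real this⟩ | exact Or.inl ⟨rfl, C, hC, this⟩
  case airy.airy =>
    have c0 := hc (by simp [c₁])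
    have hk' := hk2 (by simp [c₁])
    exact Or.inl (real (even rfl Iff.rfl c0 (Or.inl hk') fun h => by rw [hk'] at h; norm_num at h))
  case one.ident | ident.one =>
    have := key 1 0 c k fun x _ _ _ => ⟨fun h => h.1.elim, fun h => (h.elim id id).elim, by
      simp [fund], by simp [fund]; ring⟩
    simp [coef, hk, eq_comm, hC] at this
  case expo.hypCos | expo.hypSin | hypCos.expo | hypSin.expo =>
    have := hyp rfl rfl (fun h => h.elim id id) (by simp [c₀])
    simp [coef, hC] at this
  case hypCos.hypSin | hypSin.hypCos =>
    have := hyp rfl rfl (fun h => h.elim id id) (by simp [c₀])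
    simp only [coef] at this
    have e : ((C ^ 2 : ℝ) : ℂ) = ((-1 : ℝ) : ℂ) := by
      push_cast
      first | linear_combination 4 * this | linear_combination -4 * this
    nlinarith [sq_nonneg C, ofReal_injective e]
  all_goals
    obtain rfl : c = 0 := hc (Or.inr (Or.inr (hμs trivial)))
    simp only [add_zero] at key
    have hsq : ∀ x, √|k * x| = √|k| * √|x| := fun x => by rw [abs_mul, Real.sqrt_mul (abs_nonneg k)]
    have hlog : ∀ x, x ≠ 0 → Real.log |k * x| = Real.log |k| + Real.log |x| := fun x hx => by
      rw [abs_mul, Real.log_mul (abs_ne_zero.2 hk) (abs_ne_zero.2 hx)]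
  case power.power α a₁ a₂ α' b₁ b₂ =>
    obtain rfl := (sq_eq_sq₀ hp.1.le hp'.1.le).1 (by linarith)
    have := key (√|k| * Real.exp (α * Real.log |k|) : ℝ) 0 0
      (√|k| * Real.exp (-α * Real.log |k|) : ℝ) fun x _ _ hx => ⟨fun h => h.1.elim,
      fun _ => mul_ne_zero hk (hx (Or.inl trivial)), ?_⟩
    · have hk0 := abs_pos.2 hk
      have hr := (Real.sqrt_pos.2 hk0).ne'
      simp only [coef, mul_zero, add_zero, zero_add] at this
      norm_cast at this
      have hs : ∀ r : ℝ, |k|⁻¹ ^ r = (Real.exp (r * Real.log |k|))⁻¹ := fun r => by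
        rw [Real.rpow_def_of_pos (inv_pos.2 hk0), Real.log_inv, ← Real.exp_neg]; ring_nf
      refine Or.inl ⟨rfl, C / √|k|, |k|⁻¹, div_ne_zero hC hr, inv_pos.2 hk0, ?_, ?_⟩
      · rw [hs]
        field_simp
        linear_combination this.1
      · rw [hs]
        field_simp
        rw [← neg_mul]
        linear_combination this.2
    · have hx0 := hx (Or.inl trivial)
      simp only [fund, hsq, hlog x hx0, mul_add, Real.exp_add]
      push_cast
      constructor <;> ring
  case sqrtAbs.sqrtLog | sqrtLog.sqrtAbs =>
    have := (key √|k| 0 (√|k| * Real.log |k| : ℝ) √|k| fun x _ _ hx => ⟨fun h => h.1.elim,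
      fun _ => mul_ne_zero hk (hx (Or.inl trivial)), by
        simp only [fund, hsq, hlog x (hx (Or.inl trivial))]
        push_cast
        constructor <;> ring⟩).2
    exfalso
    first | simpa [coef, hk] using this | simpa [coef, hC] using this.symm

end FP

end

theorem mainTheorem2 (ε : ℝ) (hε : ε = 1 ∨ ε = -1) (J : Set ℝ) (hJ : IsOpenInterval J) :
    -- the kernel algebras and the essential kernel algebras of both classes
    (∀ I : Set ℝ, IsOpenInterval I →
      IsBasisOn J I ((reducedFP ε).kernel J I) [fieldT, fieldU] ∧
      IsBasisOn J I ((reducedFP ε).essKernel J I) [fieldT, fieldU] ∧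
      IsBasisOn J I (fullFP.kernel J I) [fieldT, fieldU] ∧
      IsBasisOn J I (fullFP.essKernel J I) [fieldT, fieldU]) ∧
    -- the essential Lie invariance algebras of the equations of the list
    (∀ (p : TableCase) (I : Set ℝ) (B : ℝ → ℝ), IsTableDrift ε p I B →
      (reducedFP ε).Adm I B ∧ fullFP.Adm I (fun x => (ε, B x)) ∧
      IsBasisOn J I ((reducedFP ε).essAlg J I B) (fieldT :: fieldU :: p.basis ε B) ∧
      IsBasisOn J I (fullFP.essAlg J I (fun x => (ε, B x))) (fieldT :: fieldU :: p.basis ε B)) ∧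
    -- completeness of the list for the reduced class
    (∀ (I : Set ℝ) (B : ℝ → ℝ), IsOpenInterval I → (reducedFP ε).Adm I B →
      ((reducedFP ε).IsExtension J I B ↔
        ∃ (p : TableCase) (I' : Set ℝ) (B' : ℝ → ℝ),
          IsTableDrift ε p I' B' ∧ (reducedFP ε).Equivalent I B I' B')) ∧
    -- completeness of the list for the full class
    (∀ (I : Set ℝ) (θ : ℝ → ℝ × ℝ), IsOpenInterval I → fullFP.Adm I θ →
      (fullFP.IsExtension J I θ ↔
        ∃ (p : TableCase) (I' : Set ℝ) (B' : ℝ → ℝ),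
          IsTableDrift ε p I' B' ∧ fullFP.Equivalent I θ I' (fun x => (ε, B' x)))) ∧
    -- inequivalence of the entries of the list, in both classes
    (∀ (p p' : TableCase) (I I' : Set ℝ) (B B' : ℝ → ℝ),
      IsTableDrift ε p I B → IsTableDrift ε p' I' B' →
      ((reducedFP ε).Equivalent I B I' B' ∨
        fullFP.Equivalent I (fun x => (ε, B x)) I' (fun x => (ε, B' x))) →
      SameEntry p p' I B B') := by
  have hε2 : ε * ε = 1 := by rcases hε with rfl | rfl <;> norm_num
  have hε0 : ε ≠ 0 := left_ne_zero_of_mul_eq_one hε2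
  refine ⟨fun I hI => ⟨?_, ?_, ?_, ?_⟩, fun p I B h => ⟨adm_reduced_iff.2 h.contDiffOn,
    adm_full_const hε0 h.contDiffOn, h.isBasisOn hε2 hJ fun v => Iff.rfl,
    h.isBasisOn hε2 hJ fun v => Iff.rfl⟩,
    fun I B hI hB => isExtension_reduced_iff hε2 hJ hI hB,
    fun I θ hI hθ => isExtension_full_iff hε2 hJ hI hθ, fun p p' I I' B B' h h' he => ?_⟩
  · exact isBasisOn_trivial hJ hI fun v => mem_kernel_reduced hε0 hJ hI
  · exact isBasisOn_trivial hJ hI fun v => mem_essKernel_reduced hε0 hJ hI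
  · exact isBasisOn_trivial hJ hI fun v => mem_kernel_full hJ hI
  · exact isBasisOn_trivial hJ hI fun v => mem_essKernel_full hJ hI
  · obtain ⟨k, c, hk, rfl, hB⟩ :=
      exists_affine_of_equivalent hε2 h.1 h'.1.isOpen h.contDiffOn he
    exact h.sameEntry_of_affine hε2 hk h' hB
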